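/- **Conventions.** Let $w$ be a non-empty word of length $N$. The size of a context-free grammar is the total length of the bodies of its productions, and $g$ is the least size of a context-free grammar generating exactly $\{w\}$ (so $1\le g\le N$). A letter $c$ is *represented* by a production $c\to u$ of cost $|u|$. **The algorithm.** The algorithm keeps a text $T$, initially $w$, and the productions of the letters introduced so far, initially none. While $|T|>1$ it performs a *phase*, in which all introduced letters are fresh: 1. *Block compression.* For each letter $a$ of $T$, every maximal block $a^\ell$ with $\ell>1$ is replaced by a letter $a_\ell$. If $1<\ell_1<\dots<\ell_k$ are the lengths $>1$ of the maximal blocks of $a$ in $T$, and $\ell_0=0$, these letters are represented as follows. For $1\le i\le\log_2\max_j(\ell_j-\ell_{j-1})$ there is a letter $b_i\to b_{i-1}b_{i-1}$, where $b_0=a$; for each $j$ there is a letter $d_j$ whose production is the concatenation of those $b_i$ for which $2^i$ occurs in the binary expansion of $\ell_j-\ell_{j-1}$; and $a_{\ell_1}\to d_1$, $a_{\ell_j}\to d_j\,a_{\ell_{j-1}}$ for $j>1$. 2. *Greedy partition.* In the text $T$ after step 1, consider the letters that occur in pairs of adjacent letters of $T$, in an arbitrary order, and build disjoint sets $\Sigma_\ell,\Sigma_r$,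 initially empty: put $a$ into $\Sigma_\ell$ if the number of occurrences in $T$ of pairs from $a\Sigma_r\cup\Sigma_r a$ is at least the number of occurrences of pairs from $a\Sigma_\ell\cup\Sigma_\ell a$, and into $\Sigma_r$ otherwise. At the end swap $\Sigma_\ell$ and $\Sigma_r$ if more occurrences of pairs in $T$ belong to $\Sigma_r\Sigma_\ell$ than to $\Sigma_\ell\Sigma_r$. 3. *Pair compression.* For each pair $ab\in\Sigma_\ell\Sigma_r$ that occurs in $T$, replace all its occurrences by a letter $c$, represented by $c\to ab$. Let $T_0=w,T_1,\dots,T_n$ be the texts before, between and after the phases ($|T_n|\le 1$). Let $G_i$ be the grammar made of the productions of the letters represented up to the moment when the text is $T_i$, together with the single rule $X\to T_i$ for a new start symbol $X$; its size is $|T_i|$ plus the cost of representing letters so far. The algorithm returns a $G_i$, $0\le i\le n$, of smallest size. **Theorem.** (1) There is an absolute constant $C$ such that, for every alphabet and every non-empty word $w$ over it, the algorithm has an output on $w$, and every possible output (whatever orders are used in step 2) generates exactly $\{w\}$ and has size at most $C\left(g+g\log_2(N/g)\right)$. (2) The algorithm runs in linear time when the input letters are integers in $\{1,\dots,N^c\}$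 for a constant $c$. That is, there is a program for the word RAM (finitely many registers and arrays, initially zero apart from the input, with indirect addressing; unit-cost arithmetic $+,-,\cdot,/,\bmod$ and comparisons of words) such that for every $c$ there is a constant $K$ with the following property. For every non-empty word $w$ of length $N$ over $\{1,\dots,N^c\}$, the program started on $w$ on the machine whose words are the integers smaller than $K N^K$ (that is, words of $O(\log N)$ bits) halts after at most $K N$ steps, with an output array that lists explicitly the productions of a possible output of the algorithm on $w$, up to the names of the nonterminals. -/

import Mathlib

/-! ## Size of a grammar and the smallest grammar of a word -/

/-- The size of a context-free grammar: the total length of the bodies of its productions. -/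
def ContextFreeGrammar.size {α : Type} (G : ContextFreeGrammar α) : ℕ :=
  ∑ r ∈ G.rules, r.output.length

/-- The size of a smallest context-free grammar that generates exactly the word `w`. -/
noncomputable def smallestGrammarSize {α : Type} (w : List α) : ℕ :=
  sInf {n : ℕ | ∃ G : ContextFreeGrammar α, G.language = {w} ∧ G.size = n}

/-! ## The algorithm -/

namespace Recompression

/-- The letters that may appear in the text: letters of the input alphabet `α`, and the letters
(nonterminals of the constructed grammar) introduced by the compression. The first argument `p` of
an introduced letter is the number of the phase that introduces it, so that it is always fresh. -/
inductive Letter (α : Type) : Type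
  /-- a letter of the input alphabet -/
  | input (a : α) : Letter α
  /-- the letter that replaces the pair `ab` -/
  | pair (p : ℕ) (a b : Letter α) : Letter α
  /-- the letter that replaces the maximal blocks `a ^ l` -/
  | block (p : ℕ) (a : Letter α) (l : ℕ) : Letter α
  /-- auxiliary letter that derives `a ^ (2 ^ i)` -/
  | power (p : ℕ) (a : Letter α) (i : ℕ) : Letter α
  /-- auxiliary letter that derives `a ^ (l - k)`, for consecutive block lengths `k < l` -/
  | diff (p : ℕ) (a : Letter α) (k l : ℕ) : Letter α
  deriving DecidableEq

/-- A letter as a symbol of the constructed grammar. The nonterminal `none` is kept for the start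
symbol `X`. -/
def Letter.toSymbol {α : Type} : Letter α → Symbol α (Option (Letter α))
  | .input a => .terminal a
  | x => .nonterminal (some x)

/-- A state of the algorithm: the current text and the productions (head, body) of the letters
represented so far. -/
structure State (α : Type) where
  text : List (Letter α)
  prods : Finset (Letter α × List (Letter α))

section

variable {α : Type} [DecidableEq α]

/-- The length of the text plus the cost of representing the letters so far. -/
def State.size (s : State α) : ℕ :=
  s.text.length + ∑ q ∈ s.prods, q.2.length

/-- The grammar made of the productions of the letters represented so far and of the single
rule `X → text`. -/
def State.grammar (s : State α) : ContextFreeGrammar α where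
  NT := Option (Letter α)
  initial := none
  rules := insert ⟨none, s.text.map Letter.toSymbol⟩
    (s.prods.image fun q => ⟨some q.1, q.2.map Letter.toSymbol⟩)

/-! ### Block compression -/

/-- The maximal blocks of a text, from left to right: `(a, l)` stands for a maximal block `a ^ l`. -/
def maximalBlocks : List (Letter α) → List (Letter α × ℕ)
  | [] => []
  | a :: t =>
    match maximalBlocks t with
    | [] => [(a, 1)]
    | (b, l) :: r => if a = b then (b, l + 1) :: r else (a, 1) :: (b, l) :: r

/-- Replace every maximal block `a ^ l` with `l > 1` by the letter `block p a l`. -/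
def compressBlocks (p : ℕ) (T : List (Letter α)) : List (Letter α) :=
  (maximalBlocks T).map fun q => if 1 < q.2 then .block p q.1 q.2 else q.1

/-- The increasing list `l₁ < l₂ < ⋯ < lₖ` of the lengths greater than `1` of the maximal blocks of
the letter `a` in `T`. -/
def blockLengths (T : List (Letter α)) (a : Letter α) : List ℕ :=
  (((maximalBlocks T).filter fun q => q.1 = a ∧ 1 < q.2).map Prod.snd).toFinset.sort (· ≤ ·)

/-- The letter that derives `a ^ (2 ^ i)`; for `i = 0` this is `a` itself. -/
def powerLetter (p : ℕ) (a : Letter α) (i : ℕ) : Letter α :=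
  if i = 0 then a else .power p a i

/-- The list of pairs `(lᵢ₋₁, lᵢ)` for `1 ≤ i ≤ k`, where `l₀ = 0`. -/
def consecutive (ls : List ℕ) : List (ℕ × ℕ) :=
  (0 :: ls).zip ls

/-- The representation of the letters that replace the blocks `a ^ l₁, …, a ^ lₖ`:
`power i → power (i - 1) power (i - 1)` for `1 ≤ i ≤ log₂ (max (lᵢ - lᵢ₋₁))`; each
`a ^ (lᵢ - lᵢ₋₁)` by the binary expansion of the exponent; and
`a ^ lᵢ` as the concatenation of `a ^ (lᵢ - lᵢ₋₁)` and `a ^ lᵢ₋₁` (the latter absent for `i = 1`). -/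
def blockProds (p : ℕ) (a : Letter α) (ls : List ℕ) : Finset (Letter α × List (Letter α)) :=
  ((Finset.Icc 1 (Nat.log 2 (((consecutive ls).map fun q => q.2 - q.1).foldr max 0))).image
      fun i => (.power p a i, [powerLetter p a (i - 1), powerLetter p a (i - 1)]))
    ∪ ((consecutive ls).map fun q =>
      (Letter.diff p a q.1 q.2, (Nat.bitIndices (q.2 - q.1)).map (powerLetter p a))).toFinset
    ∪ ((consecutive ls).map fun q =>
      (Letter.block p a q.2,
        Letter.diff p a q.1 q.2 :: if q.1 = 0 then [] else [Letter.block p a q.1])).toFinset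

/-- The productions introduced by the block compression of the text `T`. -/
def allBlockProds (p : ℕ) (T : List (Letter α)) : Finset (Letter α × List (Letter α)) :=
  T.toFinset.biUnion fun a => blockProds p a (blockLengths T a)

/-! ### Pair compression -/

/-- The occurrences of pairs in a text, from left to right. -/
def pairs (T : List (Letter α)) : List (Letter α × Letter α) :=
  T.zip T.tail

/-- The number of occurrences in `T` of pairs from `aS ∪ Sa`. -/
def count (T : List (Letter α)) (S : Finset (Letter α)) (a : Letter α) : ℕ :=
  (pairs T).countP fun q => (q.1 = a ∧ q.2 ∈ S) ∨ (q.1 ∈ S ∧ q.2 = a)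

/-- The number of occurrences in `T` of pairs from `AB`. -/
def cover (T : List (Letter α)) (A B : Finset (Letter α)) : ℕ :=
  (pairs T).countP fun q => q.1 ∈ A ∧ q.2 ∈ B

/-- The main loop of the greedy choice of a partition: the letters of the list are assigned one
after another, each to the part that covers more occurrences of pairs. -/
def greedyLoop (T : List (Letter α)) :
    List (Letter α) → Finset (Letter α) × Finset (Letter α) → Finset (Letter α) × Finset (Letter α)
  | [], S => S
  | a :: L, (Sl, Sr) =>
    if count T Sl a ≤ count T Sr a then greedyLoop T L (insert a Sl, Sr)
    else greedyLoop T L (Sl, insert a Sr)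

/-- The partition `(Σ_ℓ, Σ_r)` found when the letters are considered in the order `L`; the parts
are switched if this covers more occurrences. -/
def greedyPairs (T L : List (Letter α)) : Finset (Letter α) × Finset (Letter α) :=
  let S := greedyLoop T L (∅, ∅)
  if cover T S.1 S.2 < cover T S.2 S.1 then (S.2, S.1) else S

/-- Replace every occurrence of a pair `ab` with `a ∈ A`, `b ∈ B` by the letter `pair p a b`
(for disjoint `A` and `B` such occurrences do not overlap). -/
def compressPairs (p : ℕ) (A B : Finset (Letter α)) : List (Letter α) → List (Letter α)
  | [] => []
  | [a] => [a]
  | a :: b :: t =>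
    if a ∈ A ∧ b ∈ B then .pair p a b :: compressPairs p A B t
    else a :: compressPairs p A B (b :: t)

/-- The productions introduced by the compression of the pairs from `AB` that occur in `T`. -/
def pairProds (p : ℕ) (A B : Finset (Letter α)) (T : List (Letter α)) :
    Finset (Letter α × List (Letter α)) :=
  ((pairs T).toFinset.filter fun q => q.1 ∈ A ∧ q.2 ∈ B).image
    fun q => (.pair p q.1 q.2, [q.1, q.2])

/-! ### Phases, runs, output -/

/-- The state after phase number `p`, if the greedy choice considers the letters in the
order `L`. -/
def phase (p : ℕ) (L : List (Letter α)) (s : State α) : State α :=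
  let T := compressBlocks p s.text
  let S := greedyPairs T L
  { text := compressPairs p S.1 S.2 T
    prods := s.prods ∪ allBlockProds p s.text ∪ pairProds p S.1 S.2 T }

/-- `L` lists, without repetitions and in an arbitrary order, the letters used in the pairs that
occur in `T`. -/
def IsLetterList (T L : List (Letter α)) : Prop :=
  L.Nodup ∧ ∀ a, a ∈ L ↔ ∃ q ∈ pairs T, a = q.1 ∨ a = q.2

/-- `s 0, …, s n` are the states before, between and after the `n` phases of a run on the
input `w`: a phase is executed as long as the text has more than one letter. -/
def IsRun (w : List α) (n : ℕ) (s : ℕ → State α) : Prop :=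
  s 0 = ⟨w.map .input, ∅⟩ ∧
  (∀ i < n, 1 < (s i).text.length ∧
    ∃ L, IsLetterList (compressBlocks i (s i).text) L ∧ s (i + 1) = phase i L (s i)) ∧
  (s n).text.length ≤ 1

/-- `G` is a possible output of the improved algorithm on the input `w`: the grammar of a state of
smallest size in a run on `w`. -/
def IsOutput (w : List α) (G : ContextFreeGrammar α) : Prop :=
  ∃ (n : ℕ) (s : ℕ → State α), IsRun w n s ∧
    ∃ i ≤ n, G = (s i).grammar ∧ ∀ j ≤ n, (s i).size ≤ (s j).size

end

end Recompression

/-! ## The machine model: a word RAM with unit-cost operations -/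

namespace WordRAM

/-- Binary operations on words; comparisons give `1` (true) or `0` (false). -/
inductive BinOp : Type
  | add | sub | mul | div | mod | eq | lt

def BinOp.apply : BinOp → ℕ → ℕ → ℕ
  | .add, m, n => m + n
  | .sub, m, n => m - n
  | .mul, m, n => m * n
  | .div, m, n => m / n
  | .mod, m, n => m % n
  | .eq, m, n => if m = n then 1 else 0
  | .lt, m, n => if m < n then 1 else 0

/-- Expressions: constants, registers, cells of arrays (indirect addressing), operations. -/
inductive Expr : Type
  | const (k : ℕ)
  | reg (x : ℕ)
  | cell (A : ℕ) (i : Expr)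
  | op (o : BinOp) (e f : Expr)

/-- Programs. A program mentions only finitely many registers and arrays. -/
inductive Prog : Type
  | skip
  | assign (x : ℕ) (e : Expr)
  | write (A : ℕ) (i e : Expr)
  | seq (P Q : Prog)
  | ite (e : Expr) (P Q : Prog)
  | loop (e : Expr) (P : Prog)

/-- The contents of the registers and of the arrays. -/
structure Store : Type where
  reg : ℕ → ℕ
  cell : ℕ → ℕ → ℕ

def Store.setReg (σ : Store) (x v : ℕ) : Store :=
  { σ with reg := Function.update σ.reg x v }

def Store.setCell (σ : Store) (A i v : ℕ) : Store :=
  { σ with cell := Function.update σ.cell A (Function.update (σ.cell A) i v) }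

def Expr.val (σ : Store) : Expr → ℕ
  | .const k => k
  | .reg x => σ.reg x
  | .cell A i => σ.cell A (i.val σ)
  | .op o e f => o.apply (e.val σ) (f.val σ)

/-- The time for evaluating an expression: one step for each constant, register access, array
access and operation. -/
def Expr.time : Expr → ℕ
  | .const _ => 1
  | .reg _ => 1
  | .cell _ i => i.time + 1
  | .op _ e f => e.time + f.time + 1

/-- All values that are computed in the evaluation of the expression, addresses included, are words,
i.e. numbers smaller than `W`. -/
def Expr.Fits (W : ℕ) (σ : Store) : Expr → Prop
  | .const k => k < W
  | .reg x => σ.reg x < W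
  | .cell A i => i.Fits W σ ∧ σ.cell A (i.val σ) < W
  | .op o e f => e.Fits W σ ∧ f.Fits W σ ∧ o.apply (e.val σ) (f.val σ) < W

/-- `Exec W P σ t τ`: on the machine whose words are the numbers smaller than `W`, the program `P`
started in the store `σ` halts after exactly `t` steps in the store `τ`. The machine is
deterministic; a computation of a value that is not a word has no successor. -/
inductive Exec (W : ℕ) : Prog → Store → ℕ → Store → Prop
  | skip (σ : Store) : Exec W .skip σ 1 σ
  | assign {σ : Store} {x : ℕ} {e : Expr} (he : e.Fits W σ) :
      Exec W (.assign x e) σ (e.time + 1) (σ.setReg x (e.val σ))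
  | write {σ : Store} {A : ℕ} {i e : Expr} (hi : i.Fits W σ) (he : e.Fits W σ) :
      Exec W (.write A i e) σ (i.time + e.time + 1) (σ.setCell A (i.val σ) (e.val σ))
  | seq {P Q : Prog} {σ τ ρ : Store} {t u : ℕ} (h : Exec W P σ t τ) (h' : Exec W Q τ u ρ) :
      Exec W (.seq P Q) σ (t + u) ρ
  | ite_true {e : Expr} {P Q : Prog} {σ τ : Store} {t : ℕ} (he : e.Fits W σ) (hv : e.val σ ≠ 0)
      (h : Exec W P σ t τ) : Exec W (.ite e P Q) σ (e.time + 1 + t) τ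
  | ite_false {e : Expr} {P Q : Prog} {σ τ : Store} {t : ℕ} (he : e.Fits W σ) (hv : e.val σ = 0)
      (h : Exec W Q σ t τ) : Exec W (.ite e P Q) σ (e.time + 1 + t) τ
  | loop_done {e : Expr} {P : Prog} {σ : Store} (he : e.Fits W σ) (hv : e.val σ = 0) :
      Exec W (.loop e P) σ (e.time + 1) σ
  | loop_step {e : Expr} {P : Prog} {σ τ ρ : Store} {t u : ℕ} (he : e.Fits W σ)
      (hv : e.val σ ≠ 0) (h : Exec W P σ t τ) (h' : Exec W (.loop e P) τ u ρ) :
      Exec W (.loop e P) σ (e.time + 1 + t + u) ρ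

/-- The initial store: register `0` holds the length of the input word, array `0` holds the
word, everything else is `0`. -/
def Store.init (w : List ℕ) : Store where
  reg x := if x = 0 then w.length else 0
  cell A i := if A = 0 then w.getD i 0 else 0

/-- The store `σ` holds the list `out` at the beginning of array `1`. -/
def Store.Outputs (σ : Store) (out : List ℕ) : Prop :=
  ∀ (i : ℕ) (h : i < out.length), σ.cell 1 i = out[i]

/-- The code of a symbol, if the nonterminal `X` has the number `ν X`. -/
def encodeSymbol {N : Type} (ν : N → ℕ) : Symbol ℕ N → ℕ
  | .terminal a => 2 * a
  | .nonterminal X => 2 * ν X + 1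

/-- The code of a production: its head, the length of its body, its body. -/
def encodeRule {N : Type} (ν : N → ℕ) (r : ContextFreeRule ℕ N) : List ℕ :=
  ν r.input :: r.output.length :: r.output.map (encodeSymbol ν)

/-- `out` is an explicit listing of the grammar `G`, up to the names of the nonterminals: the number
of the start symbol, the number of productions, and the productions one after another, each listed
once; different nonterminals that occur in `G` have different numbers. -/
def Encodes (out : List ℕ) (G : ContextFreeGrammar ℕ) : Prop :=
  ∃ (ν : G.NT → ℕ) (rs : List (ContextFreeRule ℕ G.NT)),
    Set.InjOn ν {X | X = G.initial ∨ ∃ r ∈ G.rules, X = r.input ∨ .nonterminal X ∈ r.output} ∧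
    rs.Nodup ∧ (∀ r, r ∈ rs ↔ r ∈ G.rules) ∧
    out = ν G.initial :: rs.length :: rs.flatMap (encodeRule ν)

end WordRAM

/-! Size. Let `g` be the least size of a grammar for `w`, `N` the length of `w`, and `c = log₂ (N /
g)`. In a smallest grammar, every letter and every suffix of a rule body that occurs in a derivation
of `w` derives only one word, because the grammar generates nothing but `w`. These words form a
family of O(g) factors of `w`, each a letter or the concatenation of two members
(`exists_factor_family`); no normal form of the grammar is needed. During the run the text is always
described by this family (`Rep`): each member stands for a factor of the text, composed of explicit
letters and at most two lower members. At a compression step every member except the whole text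
gives up a prefix and a suffix (its outer maximal blocks, or a first letter in the right part and a
last letter in the left part), which become explicit wherever the member is used. What remains is
compressed in the same way in every context (`LocalStep`, `Rep.exists_step`). A step adds at most
four units, blocks or letters, to the explicit words of a member.

In pair compression every new letter is explicit somewhere, and its creation shortens an explicit
word by one; so explicit letters pay, at O(g) per phase. In block compression the cost is O(log (1 +
d)) for each difference `d` of consecutive block lengths. Each block is charged to a lowest member
that contains it. A block inside an explicit word is paid by the letters that disappear there. A
block that extends a block of a part is paid by the explicit extension, since only the difference of
lengths counts. Two kinds of blocks remain. - Blocks at the junctions with parts that disappear: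
boundedly many per member in the whole run. Each pays at most `c`; what exceeds `c` is covered by a
tax of order `2 ^ (-c) * d`, and these differences sum to at most `N`, so that the tax is O(g) per
phase. - Blocks that fill the whole room between two parts. Their cost is bounded by the explicit
letters and the logarithm of the factor by which the word derived in that room grows; these
logarithms telescope to O(c) per member in the whole run (`growth`), again up to a tax.

Hence `i` phases cost O(g + g c + g i) (`IsRun.cost_le`). The greedy partition covers at least a
quarter of the pairs, so a phase shortens the text by a factor of about 3/4, and after about `3 c`
phases its length is at most `g + 1`. The state reached then has size O(g + g c), and the output is
no larger.

Time. The program is verified on a machine with unbounded words, where only loop iterations are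
counted (`Run`, `Spec`). It never stores a value that exceeds the earlier ones by more than a fixed
polynomial in `N`, so the whole computation fits into words of O(log N) bits (`Run.exec`). There is
no sorting and no clearing of arrays: tables are indexed by injective codes of pairs, each phase
uses a fresh zero row, and block lengths are ordered by sweeping a table up to the greatest length,
which is at most the number of occurrences of the letter. Texts are stored from right to left, so
that a scan follows the recursions on lists. A phase takes 15 iterations per letter of the text, and
the geometric decrease makes the sum linear. -/

set_option linter.unusedSectionVars false

/-! ### Parse forests and the factors derived by the parts of a grammar -/

namespace ContextFreeGrammar

variable {α : Type} {G : ContextFreeGrammar α}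

/-- `G.Parses s w`: the sentential form `s` derives the word `w`, as witnessed by a forest of parse
trees. -/
inductive Parses (G : ContextFreeGrammar α) : List (Symbol α G.NT) → List α → Prop
  | nil : Parses G [] []
  | terminal {s : List (Symbol α G.NT)} {w : List α} (a : α) (h : Parses G s w) :
      Parses G (.terminal a :: s) (a :: w)
  | nonterminal {r : ContextFreeRule α G.NT} {s : List (Symbol α G.NT)} {u v : List α}
      (hr : r ∈ G.rules) (h : Parses G r.output u) (h' : Parses G s v) :
      Parses G (.nonterminal r.input :: s) (u ++ v)

theorem Parses.append {s t : List (Symbol α G.NT)} {u v : List α} (h : G.Parses s u)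
    (h' : G.Parses t v) : G.Parses (s ++ t) (u ++ v) := by
  induction h with
  | nil => simpa
  | terminal a _ ih => exact .terminal a ih
  | nonterminal hr h₁ _ _ ih => simpa [List.append_assoc] using Parses.nonterminal hr h₁ ih

theorem Parses.exists_append {s t : List (Symbol α G.NT)} {w : List α} (h : G.Parses (s ++ t) w) :
    ∃ u v, w = u ++ v ∧ G.Parses s u ∧ G.Parses t v := by
  induction s generalizing w with
  | nil => exact ⟨[], w, rfl, .nil, h⟩
  | cons c s ih =>
    cases h with
    | terminal a h =>
      obtain ⟨u, v, rfl, hu, hv⟩ := ih h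
      exact ⟨a :: u, v, rfl, .terminal a hu, hv⟩
    | @nonterminal r _ x y hr h h' =>
      obtain ⟨u, v, rfl, hu, hv⟩ := ih h'
      exact ⟨x ++ u, v, by simp, .nonterminal hr h hu, hv⟩

theorem parses_map_terminal (w : List α) : G.Parses (w.map .terminal) w := by
  induction w with
  | nil => exact .nil
  | cons a w ih => exact .terminal a ih

theorem Parses.derives {s : List (Symbol α G.NT)} {w : List α} (h : G.Parses s w) :
    G.Derives s (w.map .terminal) := by
  induction h with
  | nil => rfl
  | terminal a _ ih => exact ih.append_left [.terminal a]
  | @nonterminal r s u v hr _ _ ih ih' =>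
    have h₁ : G.Derives (.nonterminal r.input :: s) (r.output ++ s) :=
      Produces.single ⟨r, hr, .head s⟩
    have h₂ := (ih.append_right s).trans (ih'.append_left (u.map .terminal))
    simpa using h₁.trans h₂

theorem Produces.parses {s t : List (Symbol α G.NT)} {w : List α} (h : G.Produces s t)
    (ht : G.Parses t w) : G.Parses s w := by
  obtain ⟨r, hr, h⟩ := h
  obtain ⟨p, q, rfl, rfl⟩ := h.exists_parts
  obtain ⟨u, v, rfl, hu, hv⟩ := ht.exists_append
  obtain ⟨x, y, rfl, hx, hy⟩ := hu.exists_append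
  have := (Parses.nonterminal hr hy .nil)
  simpa using (hx.append this).append hv

/-- By induction from the front of the derivation: undoing a first step wraps the trees of the rule
body under one node. Forests are used because they cut along a concatenation, which gives each part
of a body its own derived word. -/
theorem derives_iff_parses {s : List (Symbol α G.NT)} {w : List α} :
    G.Derives s (w.map .terminal) ↔ G.Parses s w := by
  refine ⟨fun h => ?_, Parses.derives⟩
  induction h using Relation.ReflTransGen.head_induction_on with
  | refl => exact parses_map_terminal w
  | head h _ ih => exact h.parses ih

/-- The sentential form `s` occurs in a derivation of `w`: every word derived by it is a factor of
`w` at a fixed place. -/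
def IsContextOf (G : ContextFreeGrammar α) (w : List α) (s : List (Symbol α G.NT)) : Prop :=
  ∃ x y : List α, ∀ u, G.Parses s u → x ++ u ++ y = w

/-- The fixed surroundings `x`, `y` cancel. This is the only use of the grammar generating a single
word; ambiguous, cyclic or useless rules do no harm. -/
theorem IsContextOf.eq {w u v : List α} {s : List (Symbol α G.NT)} (h : G.IsContextOf w s)
    (hu : G.Parses s u) (hv : G.Parses s v) : u = v := by
  obtain ⟨x, y, h⟩ := h
  have := (h u hu).trans (h v hv).symm
  simpa using this

theorem IsContextOf.infix {w u : List α} {s : List (Symbol α G.NT)} (h : G.IsContextOf w s)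
    (hu : G.Parses s u) : u <:+: w := by
  obtain ⟨x, y, h⟩ := h
  exact ⟨x, y, h u hu⟩

theorem IsContextOf.left {w v : List α} {s t : List (Symbol α G.NT)}
    (h : G.IsContextOf w (s ++ t)) (hv : G.Parses t v) : G.IsContextOf w s := by
  obtain ⟨x, y, h⟩ := h
  exact ⟨x, v ++ y, fun u hu => by simpa using h _ (hu.append hv)⟩

theorem IsContextOf.right {w u : List α} {s t : List (Symbol α G.NT)}
    (h : G.IsContextOf w (s ++ t)) (hu : G.Parses s u) : G.IsContextOf w t := by
  obtain ⟨x, y, h⟩ := h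
  exact ⟨x ++ u, y, fun v hv => by simpa using h _ (hu.append hv)⟩

theorem IsContextOf.output {w : List α} {r : ContextFreeRule α G.NT} (hr : r ∈ G.rules)
    (h : G.IsContextOf w [.nonterminal r.input]) : G.IsContextOf w r.output := by
  obtain ⟨x, y, h⟩ := h
  exact ⟨x, y, fun u hu => by simpa using h _ (.nonterminal hr hu .nil)⟩

open Classical in
/-- The nonempty suffixes and the letters of the bodies of the rules, and the start symbol. -/
noncomputable def bodyParts (G : ContextFreeGrammar α) : Finset (List (Symbol α G.NT)) :=
  insert [.nonterminal G.initial]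
    (G.rules.biUnion fun r => ((List.range r.output.length).map fun i => r.output.drop i).toFinset ∪
      (r.output.map fun c => [c]).toFinset)

theorem card_bodyParts_le (G : ContextFreeGrammar α) : G.bodyParts.card ≤ 2 * G.size + 1 := by
  classical
  refine (Finset.card_insert_le _ _).trans (Nat.succ_le_succ ?_)
  refine Finset.card_biUnion_le.trans ?_
  rw [size, Finset.mul_sum]
  refine Finset.sum_le_sum fun r _ => (Finset.card_union_le _ _).trans ?_
  have h₁ := List.toFinset_card_le ((List.range r.output.length).map fun i => r.output.drop i)
  have h₂ := List.toFinset_card_le (r.output.map fun c => [c])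
  simp only [List.length_map, List.length_range] at h₁ h₂
  omega

theorem cons_mem_bodyParts {c : Symbol α G.NT} {s : List (Symbol α G.NT)}
    (h : c :: s ∈ G.bodyParts) : [c] ∈ G.bodyParts ∧ (s = [] ∨ s ∈ G.bodyParts) := by
  classical
  simp only [bodyParts, Finset.mem_insert, Finset.mem_biUnion, Finset.mem_union, List.mem_toFinset,
    List.mem_map, List.mem_range] at h ⊢
  rcases h with h | ⟨r, hr, ⟨i, hi, h⟩ | ⟨d, hd, h⟩⟩
  · obtain ⟨rfl, rfl⟩ := List.cons.inj h
    exact ⟨.inl rfl, .inl rfl⟩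
  · have hc : c ∈ r.output := List.mem_of_mem_drop (i := i) (by simp [h])
    refine ⟨.inr ⟨r, hr, .inr ⟨c, hc, rfl⟩⟩, ?_⟩
    rcases eq_or_ne s [] with hs | hs
    · exact .inl hs
    · refine .inr (.inr ⟨r, hr, .inl ⟨i + 1, ?_, ?_⟩⟩)
      · by_contra hi'
        have h' := congrArg List.length h
        simp only [List.length_drop, List.length_cons] at h'
        have := List.length_pos_of_ne_nil hs
        omega
      · have := congrArg List.tail h
        simpa [List.tail_drop] using this
  · obtain ⟨rfl, rfl⟩ := List.cons.inj h
    exact ⟨.inr ⟨r, hr, .inr ⟨d, hd, rfl⟩⟩, .inl rfl⟩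

theorem output_mem_bodyParts {r : ContextFreeRule α G.NT} (hr : r ∈ G.rules)
    (h : r.output ≠ []) : r.output ∈ G.bodyParts := by
  classical
  simp only [bodyParts, Finset.mem_insert, Finset.mem_biUnion, Finset.mem_union, List.mem_toFinset,
    List.mem_map, List.mem_range]
  exact .inr ⟨r, hr, .inl ⟨0, List.length_pos_of_ne_nil h, rfl⟩⟩

open Classical in
/-- The words derived by the parts of rule bodies that occur in a derivation of `w`. -/
noncomputable def derivedFactors (G : ContextFreeGrammar α) (w : List α) : Finset (List α) :=
  (G.bodyParts.image fun s => if h : ∃ u, G.Parses s u ∧ G.IsContextOf w s then h.choose else []).filter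
    (· ≠ [])

/-- The arbitrary choice of a derived word is harmless, since a part that occurs in a derivation of
`w` derives at most one word; the default value `[]` for the other parts is filtered out. -/
theorem mem_derivedFactors {w u : List α} :
    u ∈ G.derivedFactors w ↔
      u ≠ [] ∧ ∃ s ∈ G.bodyParts, G.Parses s u ∧ G.IsContextOf w s := by
  classical
  simp only [derivedFactors, Finset.mem_filter, Finset.mem_image]
  constructor
  · rintro ⟨⟨s, hs, rfl⟩, hu⟩
    refine ⟨hu, s, hs, ?_⟩
    split_ifs at hu ⊢ with h
    · exact h.choose_spec
    · exact absurd rfl hu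
  · rintro ⟨hu, s, hs, h, hw⟩
    refine ⟨⟨s, hs, ?_⟩, hu⟩
    have hex : ∃ u, G.Parses s u ∧ G.IsContextOf w s := ⟨u, h, hw⟩
    rw [dif_pos hex]
    exact hw.eq hex.choose_spec.1 h

/-- The forest is unwound until it splits into two nonempty words: an empty first tree is dropped,
and a first tree that derives everything is entered through its rule body. Induction on the forest,
not on the grammar, makes this terminate in spite of unit cycles and empty rules. -/
theorem exists_append_of_parses {w u : List α} {s : List (Symbol α G.NT)} (h : G.Parses s u)
    (hs : s ∈ G.bodyParts) (hw : G.IsContextOf w s) (hu : 2 ≤ u.length) :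
    ∃ x ∈ G.derivedFactors w, ∃ y ∈ G.derivedFactors w, u = x ++ y := by
  induction h with
  | nil => simp at hu
  | @terminal s v a h ih =>
    obtain ⟨h₁, h₂⟩ := cons_mem_bodyParts hs
    have hv : v ≠ [] := by rintro rfl; simp at hu
    refine ⟨[a], mem_derivedFactors.2 ⟨by simp, _, h₁, .terminal a .nil, hw.left (s := [_]) h⟩, v,
      mem_derivedFactors.2 ⟨hv, s, ?_, h, hw.right (s := [_]) (.terminal a .nil)⟩, rfl⟩
    rcases h₂ with rfl | h₂
    · cases h; simp at hv
    · exact h₂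
  | @nonterminal r s x y hr h h' ih ih' =>
    obtain ⟨h₁, h₂⟩ := cons_mem_bodyParts hs
    have hx : G.Parses [.nonterminal r.input] x := by simpa using Parses.nonterminal hr h .nil
    have hwx := hw.left (s := [_]) h'
    have hwy := hw.right (s := [_]) hx
    rcases eq_or_ne x [] with rfl | hx₀
    · rcases h₂ with rfl | h₂
      · cases h'; simp at hu
      · exact ih' h₂ hwy hu
    rcases eq_or_ne y [] with rfl | hy₀
    · rw [List.append_nil] at hu ⊢
      refine ih (output_mem_bodyParts hr ?_) (hwx.output hr) hu
      intro h₀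
      rw [h₀] at h
      cases h
      exact hx₀ rfl
    · refine ⟨x, mem_derivedFactors.2 ⟨hx₀, _, h₁, hx, hwx⟩, y,
        mem_derivedFactors.2 ⟨hy₀, s, ?_, h', hwy⟩, rfl⟩
      rcases h₂ with rfl | h₂
      · cases h'; simp at hy₀
      · exact h₂

/-- The words derived by the parts of a grammar for `w` form a family of at most `2 |G| + 1` factors
of `w`, each of which is a letter or the concatenation of two words of the family. -/
theorem exists_factor_family {w : List α} (hw : w ≠ []) (hG : G.language = {w}) :
    ∃ F : Finset (List α), w ∈ F ∧ F.card ≤ 2 * G.size + 1 ∧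
      ∀ u ∈ F, u ≠ [] ∧ u <:+: w ∧ (u.length = 1 ∨ ∃ x ∈ F, ∃ y ∈ F, u = x ++ y) := by
  classical
  have hlang : ∀ u, G.Parses [.nonterminal G.initial] u ↔ u = w := fun u => by
    rw [← derives_iff_parses, ← mem_language_iff, hG]; rfl
  refine ⟨G.derivedFactors w, ?_, ?_, fun u hu => ?_⟩
  · refine mem_derivedFactors.2 ⟨hw, _, Finset.mem_insert_self _ _, (hlang w).2 rfl, [], [], ?_⟩
    intro u hu
    simp [(hlang u).1 hu]
  · exact (Finset.card_filter_le _ _).trans (Finset.card_image_le.trans G.card_bodyParts_le)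
  · obtain ⟨hu₀, s, hs, h, hw⟩ := mem_derivedFactors.1 hu
    refine ⟨hu₀, hw.infix h, ?_⟩
    have := List.length_pos_of_ne_nil hu₀
    rcases (show u.length = 1 ∨ 2 ≤ u.length by omega) with h₁ | h₁
    · exact .inl h₁
    · exact .inr (exists_append_of_parses h hs hw h₁)

end ContextFreeGrammar

/-! ### Correctness: each state generates exactly the input word -/

namespace Recompression

variable {α : Type} [DecidableEq α]

/-! ### Maximal blocks -/

/-- The word with the given blocks. -/
def unblock (B : List (Letter α × ℕ)) : List (Letter α) :=
  B.flatMap fun q => List.replicate q.2 q.1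

/-- The blocks are nonempty, and blocks of the same letter are not adjacent. -/
def IsBlockList (B : List (Letter α × ℕ)) : Prop :=
  (∀ q ∈ B, 0 < q.2) ∧ B.IsChain fun p q => p.1 ≠ q.1

theorem unblock_maximalBlocks (T : List (Letter α)) : unblock (maximalBlocks T) = T := by
  induction T with
  | nil => rfl
  | cons a t ih =>
    rw [maximalBlocks]
    split
    · next h => rw [h] at ih; simp_all [unblock]
    · next b l r h =>
      rw [h] at ih
      split_ifs with hab
      · subst hab
        simpa [unblock, List.replicate_succ] using ih
      · simpa [unblock, List.replicate_succ] using ih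

theorem isBlockList_maximalBlocks (T : List (Letter α)) : IsBlockList (maximalBlocks T) := by
  induction T with
  | nil => exact ⟨by simp [maximalBlocks], by simp [maximalBlocks]⟩
  | cons a t ih =>
    rw [maximalBlocks]
    split
    · exact ⟨by simp, by simp⟩
    · next b l r h =>
      rw [h] at ih
      obtain ⟨h₁, h₂⟩ := ih
      split_ifs with hab
      · refine ⟨?_, ?_⟩
        · intro q hq
          rcases List.mem_cons.1 hq with rfl | hq
          · simp
          · exact h₁ q (List.mem_cons_of_mem _ hq)
        · rw [List.isChain_cons] at h₂ ⊢
          exact h₂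
      · refine ⟨?_, ?_⟩
        · intro q hq
          rcases List.mem_cons.1 hq with rfl | hq
          · simp
          · exact h₁ q hq
        · rw [List.isChain_cons]
          exact ⟨by simpa using hab, h₂⟩

theorem maximalBlocks_replicate_append {b : Letter α} {l : ℕ} (hl : 0 < l) {t : List (Letter α)}
    (h : ∀ q ∈ (maximalBlocks t).head?, b ≠ q.1) :
    maximalBlocks (List.replicate l b ++ t) = (b, l) :: maximalBlocks t := by
  induction l with
  | zero => omega
  | succ l ih =>
    rw [List.replicate_succ, List.cons_append, maximalBlocks]
    rcases Nat.eq_zero_or_pos l with rfl | hl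
    · rw [List.replicate_zero, List.nil_append]
      cases hm : maximalBlocks t with
      | nil => rfl
      | cons q r =>
        have hb : b ≠ q.1 := h q (by simp [hm])
        simp [hb]
    · simp [ih hl]

/-- Uniqueness of the decomposition into maximal blocks. Later the blocks of a composed word are
found by exhibiting any admissible list of blocks for it. -/
theorem maximalBlocks_unblock {B : List (Letter α × ℕ)} (hB : IsBlockList B) :
    maximalBlocks (unblock B) = B := by
  induction B with
  | nil => rfl
  | cons q B ih =>
    obtain ⟨h₁, h₂⟩ := hB
    rw [List.isChain_cons] at h₂
    have ih' := ih ⟨fun x hx => h₁ x (List.mem_cons_of_mem _ hx), h₂.2⟩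
    have : unblock (q :: B) = List.replicate q.2 q.1 ++ unblock B := by simp [unblock]
    rw [this, maximalBlocks_replicate_append (h₁ q List.mem_cons_self), ih']
    rw [ih']
    exact h₂.1

theorem maximalBlocks_eq {B : List (Letter α × ℕ)} (hB : IsBlockList B) {T : List (Letter α)}
    (h : unblock B = T) : maximalBlocks T = B := h ▸ maximalBlocks_unblock hB

theorem unblock_append (B B' : List (Letter α × ℕ)) :
    unblock (B ++ B') = unblock B ++ unblock B' := by simp [unblock]

theorem maximalBlocks_nil_iff {T : List (Letter α)} : maximalBlocks T = [] ↔ T = [] := by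
  constructor
  · intro h
    rw [← unblock_maximalBlocks T, h]; rfl
  · rintro rfl; rfl

theorem maximalBlocks_pos {T : List (Letter α)} {q : Letter α × ℕ} (h : q ∈ maximalBlocks T) :
    0 < q.2 := (isBlockList_maximalBlocks T).1 q h

/-- The blocks of a concatenation: the last block of the first word may join with the first block
of the second word. -/
theorem maximalBlocks_append (x y : List (Letter α)) :
    ((∀ p ∈ (maximalBlocks x).getLast?, ∀ q ∈ (maximalBlocks y).head?, p.1 ≠ q.1) ∧
      maximalBlocks (x ++ y) = maximalBlocks x ++ maximalBlocks y) ∨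
    ∃ P b i j Q, maximalBlocks x = P ++ [(b, i)] ∧ maximalBlocks y = (b, j) :: Q ∧
      maximalBlocks (x ++ y) = P ++ (b, i + j) :: Q := by
  obtain ⟨hx₁, hx₂⟩ := isBlockList_maximalBlocks x
  obtain ⟨hy₁, hy₂⟩ := isBlockList_maximalBlocks y
  by_cases h : ∀ p ∈ (maximalBlocks x).getLast?, ∀ q ∈ (maximalBlocks y).head?, p.1 ≠ q.1
  · refine .inl ⟨h, maximalBlocks_eq ⟨?_, ?_⟩ ?_⟩
    · intro q hq
      rcases List.mem_append.1 hq with hq | hq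
      exacts [hx₁ q hq, hy₁ q hq]
    · exact List.isChain_append.2 ⟨hx₂, hy₂, h⟩
    · rw [unblock_append, unblock_maximalBlocks, unblock_maximalBlocks]
  · push Not at h
    obtain ⟨⟨b, i⟩, hp, ⟨c, j⟩, hq, hbc⟩ := h
    obtain rfl : b = c := hbc
    obtain ⟨P, hP⟩ : ∃ P, maximalBlocks x = P ++ [(b, i)] := by
      obtain ⟨P, hP⟩ := List.getLast?_eq_some_iff.1 hp
      exact ⟨P, hP⟩
    obtain ⟨Q, hQ⟩ : ∃ Q, maximalBlocks y = (b, j) :: Q := List.head?_eq_some_iff.1 hq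
    refine .inr ⟨P, b, i, j, Q, hP, hQ, maximalBlocks_eq ⟨?_, ?_⟩ ?_⟩
    · intro q hq
      rw [hP] at hx₁
      rw [hQ] at hy₁
      simp only [List.mem_append, List.mem_cons] at hq hx₁ hy₁
      rcases hq with hq | rfl | hq
      · exact hx₁ q (.inl hq)
      · have := hx₁ (b, i) (.inr (.inl rfl))
        simp only at this ⊢
        omega
      · exact hy₁ q (.inr hq)
    · rw [hP] at hx₂
      rw [hQ] at hy₂
      rw [List.isChain_append] at hx₂ ⊢
      rw [List.isChain_cons] at hy₂ ⊢
      refine ⟨hx₂.1, hy₂, ?_⟩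
      simpa using hx₂.2.2
    · rw [← unblock_maximalBlocks x, ← unblock_maximalBlocks y, hP, hQ]
      simp [unblock, -List.replicate_append_replicate]
      rw [← List.append_assoc, ← List.replicate_add]

theorem head?_maximalBlocks (T : List (Letter α)) :
    (maximalBlocks T).head?.map Prod.fst = T.head? := by
  cases T with
  | nil => rfl
  | cons a t =>
    rw [maximalBlocks]
    split
    · rfl
    · split_ifs with h
      · simp [h]
      · rfl

theorem getLast?_maximalBlocks (T : List (Letter α)) :
    (maximalBlocks T).getLast?.map Prod.fst = T.getLast? := by
  rcases List.eq_nil_or_concat (maximalBlocks T) with h | ⟨P, ⟨b, i⟩, h⟩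
  · rw [h, maximalBlocks_nil_iff.1 h]; rfl
  · have hi := maximalBlocks_pos (T := T) (q := (b, i)) (by simp [h])
    rw [← unblock_maximalBlocks T, h, maximalBlocks_eq (h ▸ isBlockList_maximalBlocks T) rfl]
    obtain ⟨i, rfl⟩ := Nat.exists_eq_add_of_lt hi
    simp [unblock, List.replicate_succ']

/-- At a place where the letter changes, the blocks do not join. -/
theorem maximalBlocks_append_of_ne {x y : List (Letter α)}
    (h : ∀ a ∈ x.getLast?, ∀ b ∈ y.head?, a ≠ b) :
    maximalBlocks (x ++ y) = maximalBlocks x ++ maximalBlocks y := by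
  rcases maximalBlocks_append x y with ⟨-, h'⟩ | ⟨P, b, i, j, Q, hP, hQ, -⟩
  · exact h'
  · have h₁ := getLast?_maximalBlocks x
    have h₂ := head?_maximalBlocks y
    rw [hP] at h₁
    rw [hQ] at h₂
    exact absurd rfl (h b (by simp [← h₁]) b (by simp [← h₂]))

theorem mem_of_mem_maximalBlocks {T : List (Letter α)} {q : Letter α × ℕ}
    (h : q ∈ maximalBlocks T) : q.1 ∈ T := by
  rw [← unblock_maximalBlocks T]
  exact List.mem_flatMap.2 ⟨q, h, by simp [(maximalBlocks_pos h).ne']⟩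

/-! ### The words derived by the letters -/

/-- The word over the input alphabet that a letter stands for. -/
def Letter.expand : Letter α → List α
  | .input a => [a]
  | .pair _ a b => a.expand ++ b.expand
  | .block _ a l => (List.replicate l a.expand).flatten
  | .power _ a i => (List.replicate (2 ^ i) a.expand).flatten
  | .diff _ a k l => (List.replicate (l - k) a.expand).flatten

/-- The letters whose words can be derived with the productions of `Q`. -/
inductive Represented (Q : Finset (Letter α × List (Letter α))) : Letter α → Prop
  | input (a : α) : Represented Q (.input a)
  | prod {h : Letter α} {b : List (Letter α)} (hq : (h, b) ∈ Q) (hb : ∀ x ∈ b, Represented Q x) :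
      Represented Q h

theorem Represented.mono {Q Q' : Finset (Letter α × List (Letter α))} (hQ : Q ⊆ Q') {x : Letter α}
    (h : Represented Q x) : Represented Q' x := by
  induction h with
  | input a => exact .input a
  | prod hq _ ih => exact .prod (hQ hq) ih

/-- The productions are correct: heads are introduced letters, and derive the right words. -/
def Sound (Q : Finset (Letter α × List (Letter α))) : Prop :=
  ∀ q ∈ Q, q.1.toSymbol = .nonterminal (some q.1) ∧ q.1.expand = q.2.flatMap Letter.expand

theorem flatMap_expand_powerLetter (p : ℕ) (a : Letter α) (i : ℕ) :
    (powerLetter p a i).expand = (List.replicate (2 ^ i) a.expand).flatten := by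
  unfold powerLetter
  split_ifs with h
  · simp [h]
  · simp [Letter.expand]

theorem flatten_replicate_add (m n : ℕ) (u : List α) :
    (List.replicate (m + n) u).flatten
      = (List.replicate m u).flatten ++ (List.replicate n u).flatten := by
  rw [List.replicate_add, List.flatten_append]

theorem flatMap_powerLetter (p : ℕ) (a : Letter α) (L : List ℕ) :
    (L.map (powerLetter p a)).flatMap Letter.expand
      = (List.replicate ((L.map fun i => 2 ^ i).sum) a.expand).flatten := by
  induction L with
  | nil => simp
  | cons i L ih =>
    rw [List.map_cons, List.flatMap_cons, ih, flatMap_expand_powerLetter, List.map_cons,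
      List.sum_cons, flatten_replicate_add]

theorem lt_of_mem_zip_of_sorted {k : ℕ} {ls : List ℕ} (h : (k :: ls).SortedLT) {q : ℕ × ℕ}
    (hq : q ∈ (k :: ls).zip ls) : q.1 < q.2 := by
  induction ls generalizing k with
  | nil => simp at hq
  | cons l ls ih =>
    rw [List.sortedLT_iff_pairwise, List.pairwise_cons] at h
    rw [List.zip_cons_cons, List.mem_cons] at hq
    rcases hq with rfl | hq
    · exact h.1 l (by simp)
    · exact ih h.2.sortedLT hq

theorem sortedLT_blockLengths (T : List (Letter α)) (a : Letter α) :
    (0 :: blockLengths T a).SortedLT := by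
  rw [List.sortedLT_iff_pairwise, List.pairwise_cons]
  refine ⟨fun l hl => ?_, ?_⟩
  · simp only [blockLengths, Finset.mem_sort, List.mem_toFinset, List.mem_map, List.mem_filter] at hl
    obtain ⟨q, ⟨-, h⟩, rfl⟩ := hl
    have := of_decide_eq_true h
    omega
  · exact (Finset.sortedLT_sort _).pairwise

theorem mem_blockLengths {T : List (Letter α)} {a : Letter α} {l : ℕ} :
    l ∈ blockLengths T a ↔ (a, l) ∈ maximalBlocks T ∧ 1 < l := by
  simp only [blockLengths, Finset.mem_sort, List.mem_toFinset, List.mem_map, List.mem_filter,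
    decide_eq_true_eq]
  constructor
  · rintro ⟨⟨b, k⟩, ⟨h, rfl, h'⟩, rfl⟩
    exact ⟨h, h'⟩
  · rintro ⟨h, h'⟩
    exact ⟨(a, l), ⟨h, rfl, h'⟩, rfl⟩

theorem lt_of_mem_consecutive {T : List (Letter α)} {a : Letter α} {q : ℕ × ℕ}
    (hq : q ∈ consecutive (blockLengths T a)) : q.1 < q.2 :=
  lt_of_mem_zip_of_sorted (sortedLT_blockLengths T a) hq

theorem mem_blockProds {p : ℕ} {a : Letter α} {ls : List ℕ} {q : Letter α × List (Letter α)} :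
    q ∈ blockProds p a ls ↔
      (∃ i, (1 ≤ i ∧ i ≤ Nat.log 2 (((consecutive ls).map fun q => q.2 - q.1).foldr max 0)) ∧
        q = (.power p a i, [powerLetter p a (i - 1), powerLetter p a (i - 1)])) ∨
      (∃ r ∈ consecutive ls,
        q = (.diff p a r.1 r.2, (Nat.bitIndices (r.2 - r.1)).map (powerLetter p a))) ∨
      (∃ r ∈ consecutive ls, q = (.block p a r.2,
        .diff p a r.1 r.2 :: if r.1 = 0 then [] else [.block p a r.1])) := by
  simp only [blockProds, Finset.mem_union, Finset.mem_image, Finset.mem_Icc, List.mem_toFinset,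
    List.mem_map, or_assoc, eq_comm]

theorem sound_blockProds (p : ℕ) (T : List (Letter α)) (a : Letter α) :
    Sound (blockProds p a (blockLengths T a)) := by
  intro q hq
  rcases mem_blockProds.1 hq with ⟨i, ⟨h₁, -⟩, rfl⟩ | ⟨r, hr, rfl⟩ | ⟨r, hr, rfl⟩
  · refine ⟨rfl, ?_⟩
    obtain ⟨i, rfl⟩ : ∃ j, i = j + 1 := ⟨i - 1, by omega⟩
    simp only [Letter.expand, Nat.add_sub_cancel, List.flatMap_cons, List.flatMap_nil,
      List.append_nil, flatMap_expand_powerLetter, ← flatten_replicate_add]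
    congr 2
    ring
  · refine ⟨rfl, ?_⟩
    rw [flatMap_powerLetter]
    -- The powers of two at the binary digits of a number sum to that number.
    simp [Letter.expand]
  · refine ⟨rfl, ?_⟩
    have := lt_of_mem_consecutive hr
    split_ifs with h
    · simp [Letter.expand, h]
    · simp only [Letter.expand, List.flatMap_cons, List.flatMap_nil, List.append_nil,
        ← flatten_replicate_add]
      congr 2
      omega

theorem le_foldr_max {L : List ℕ} {n : ℕ} (h : n ∈ L) : n ≤ L.foldr max 0 := by
  induction L with
  | nil => simp at h
  | cons m L ih =>
    rcases List.mem_cons.1 h with rfl | h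
    · simp
    · exact (ih h).trans (by simp)

/-- Soundness of productions does not exclude circular ones, so derivability is built from below:
the powers by doubling, the differences from powers (no digit exceeds the logarithm of the greatest
difference), then the blocks in the order of increasing length. -/
theorem represented_block {p : ℕ} {a : Letter α} {T : List (Letter α)}
    {Q : Finset (Letter α × List (Letter α))} (hQ : blockProds p a (blockLengths T a) ⊆ Q)
    (ha : Represented Q a) {l : ℕ} (hl : l ∈ blockLengths T a) : Represented Q (.block p a l) := by
  set ls := blockLengths T a
  set m := ((consecutive ls).map fun q => q.2 - q.1).foldr max 0
  have hpow : ∀ i ≤ Nat.log 2 m, Represented Q (powerLetter p a i) := by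
    intro i
    induction i with
    | zero => intro _; simpa [powerLetter] using ha
    | succ i ih =>
      intro hi
      have : powerLetter p a (i + 1) = .power p a (i + 1) := by simp [powerLetter]
      rw [this]
      refine .prod (hQ (mem_blockProds.2 (.inl ⟨i + 1, ⟨by omega, hi⟩, rfl⟩))) ?_
      simpa using ih (by omega)
  have hdiff : ∀ r ∈ consecutive ls, Represented Q (.diff p a r.1 r.2) := by
    intro r hr
    refine .prod (hQ (mem_blockProds.2 (.inr (.inl ⟨r, hr, rfl⟩)))) ?_
    intro x hx
    obtain ⟨i, hi, rfl⟩ := List.mem_map.1 hx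
    refine hpow i ?_
    have h₁ : r.2 - r.1 ≤ m := le_foldr_max (List.mem_map.2 ⟨r, hr, rfl⟩)
    have h₂ : 2 ^ i ≤ r.2 - r.1 := Nat.two_pow_le_of_mem_bitIndices hi
    exact Nat.le_log_of_pow_le (by norm_num) (h₂.trans h₁)
  have key : ∀ j (hj : j < ls.length), Represented Q (.block p a ls[j]) := by
    intro j
    induction j with
    | zero =>
      intro hj
      have hr : ((0 : ℕ), ls[0]) ∈ consecutive ls := by
        refine List.mem_iff_getElem.2 ⟨0, by simp [consecutive, hj], by simp [consecutive]⟩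
      refine .prod (hQ (mem_blockProds.2 (.inr (.inr ⟨_, hr, rfl⟩)))) ?_
      simpa using hdiff _ hr
    | succ j ih =>
      intro hj
      have hr : (ls[j], ls[j + 1]) ∈ consecutive ls := by
        refine List.mem_iff_getElem.2 ⟨j + 1, by simp [consecutive, hj], by simp [consecutive]⟩
      refine .prod (hQ (mem_blockProds.2 (.inr (.inr ⟨_, hr, rfl⟩)))) ?_
      intro x hx
      rcases List.mem_cons.1 hx with rfl | hx
      · exact hdiff _ hr
      · split_ifs at hx with h
        · simp at hx
        · rw [List.mem_singleton.1 hx]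
          exact ih (by omega)
  obtain ⟨j, hj, rfl⟩ := List.mem_iff_getElem.1 hl
  exact key j hj

/-- The state derives the word `w`. -/
structure State.Derives (s : State α) (w : List α) : Prop where
  text : s.text.flatMap Letter.expand = w
  sound : Sound s.prods
  represented : ∀ x ∈ s.text, Represented s.prods x

theorem flatMap_expand_compressBlocks (p : ℕ) (T : List (Letter α)) :
    (compressBlocks p T).flatMap Letter.expand = T.flatMap Letter.expand := by
  conv_rhs => rw [← unblock_maximalBlocks T]
  rw [compressBlocks, unblock, List.flatMap_map, List.flatMap_assoc]
  refine List.flatMap_congr fun q hq => ?_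
  have := maximalBlocks_pos hq
  split_ifs with h
  · simp [Letter.expand, List.flatMap_def]
  · have : q.2 = 1 := by omega
    simp [this]

theorem flatMap_expand_compressPairs (p : ℕ) (A B : Finset (Letter α)) (T : List (Letter α)) :
    (compressPairs p A B T).flatMap Letter.expand = T.flatMap Letter.expand := by
  induction T using compressPairs.induct A B with
  | case1 => simp [compressPairs]
  | case2 => simp [compressPairs]
  | case3 a b t h ih => simp [compressPairs, h, Letter.expand, ih]
  | case4 a b t h ih =>
    rw [compressPairs, if_neg h, List.flatMap_cons, ih]
    simp

theorem mem_compressBlocks {p : ℕ} {T : List (Letter α)} {x : Letter α}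
    (h : x ∈ compressBlocks p T) :
    x ∈ T ∨ ∃ a l, (a, l) ∈ maximalBlocks T ∧ 1 < l ∧ x = .block p a l := by
  obtain ⟨q, hq, rfl⟩ := List.mem_map.1 h
  split_ifs with h
  · exact .inr ⟨q.1, q.2, hq, h, rfl⟩
  · exact .inl (mem_of_mem_maximalBlocks hq)

theorem mem_compressPairs {p : ℕ} {A B : Finset (Letter α)} {T : List (Letter α)} {x : Letter α}
    (h : x ∈ compressPairs p A B T) :
    x ∈ T ∨ ∃ a b, (a, b) ∈ pairs T ∧ a ∈ A ∧ b ∈ B ∧ x = .pair p a b := by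
  induction T using compressPairs.induct A B with
  | case1 => simp [compressPairs] at h
  | case2 => exact .inl (by simpa [compressPairs] using h)
  | case3 a b t hab ih =>
    rw [compressPairs, if_pos hab, List.mem_cons] at h
    rcases h with rfl | h
    · exact .inr ⟨a, b, by simp [pairs], hab.1, hab.2, rfl⟩
    · rcases ih h with h | ⟨c, d, h, h'⟩
      · exact .inl (by simp [h])
      · refine .inr ⟨c, d, ?_, h'⟩
        cases t with
        | nil => simp [pairs] at h
        | cons e t => simp only [pairs, List.tail_cons, List.zip_cons_cons, List.mem_cons] at h ⊢; tauto
  | case4 a b t hab ih =>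
    rw [compressPairs, if_neg hab, List.mem_cons] at h
    rcases h with rfl | h
    · exact .inl (by simp)
    · rcases ih h with h | ⟨c, d, h, h'⟩
      · exact .inl (List.mem_cons_of_mem _ h)
      · refine .inr ⟨c, d, ?_, h'⟩
        simp only [pairs, List.tail_cons, List.zip_cons_cons, List.mem_cons] at h ⊢; tauto

theorem Sound.union {Q Q' : Finset (Letter α × List (Letter α))} (h : Sound Q) (h' : Sound Q') :
    Sound (Q ∪ Q') := by
  intro q hq
  rcases Finset.mem_union.1 hq with hq | hq
  exacts [h q hq, h' q hq]

theorem mem_of_mem_pairs {T : List (Letter α)} {q : Letter α × Letter α} (h : q ∈ pairs T) :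
    q.1 ∈ T ∧ q.2 ∈ T :=
  ⟨(List.of_mem_zip h).1, List.mem_of_mem_tail (List.of_mem_zip h).2⟩

theorem State.Derives.phase {s : State α} {w : List α} (h : s.Derives w) (p : ℕ)
    (L : List (Letter α)) : (phase p L s).Derives w := by
  have hB : ∀ x ∈ compressBlocks p s.text,
      Represented (s.prods ∪ allBlockProds p s.text) x := by
    intro x hx
    rcases mem_compressBlocks hx with hx | ⟨a, l, hal, hl, rfl⟩
    · exact (h.represented x hx).mono Finset.subset_union_left
    · have haT : a ∈ s.text := mem_of_mem_maximalBlocks hal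
      refine represented_block (T := s.text) ?_ ((h.represented a haT).mono Finset.subset_union_left)
        (mem_blockLengths.2 ⟨hal, hl⟩)
      refine Finset.Subset.trans ?_ Finset.subset_union_right
      exact Finset.subset_biUnion_of_mem (fun a => blockProds p a (blockLengths s.text a))
        (List.mem_toFinset.2 haT)
  refine ⟨?_, ?_, ?_⟩
  · simp only [Recompression.phase]
    rw [flatMap_expand_compressPairs, flatMap_expand_compressBlocks, h.text]
  · refine (h.sound.union fun q hq => ?_).union fun q hq => ?_
    · obtain ⟨a, -, hq⟩ := Finset.mem_biUnion.1 hq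
      exact sound_blockProds p s.text a q hq
    · obtain ⟨r, -, rfl⟩ := Finset.mem_image.1 hq
      exact ⟨rfl, by simp [Letter.expand]⟩
  · intro x hx
    rcases mem_compressPairs hx with hx | ⟨a, b, hab, ha, hb, rfl⟩
    · exact (hB x hx).mono Finset.subset_union_left
    · have hm := mem_of_mem_pairs hab
      refine .prod (b := [a, b]) (Finset.mem_union_right _ ?_) ?_
      · exact Finset.mem_image.2 ⟨(a, b), by simp [hab, ha, hb], rfl⟩
      · simp only [List.mem_cons, List.not_mem_nil, or_false, forall_eq_or_imp, forall_eq]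
        exact ⟨(hB a hm.1).mono Finset.subset_union_left, (hB b hm.2).mono Finset.subset_union_left⟩

theorem derives_init (w : List α) : (⟨w.map .input, ∅⟩ : State α).Derives w := by
  refine ⟨?_, by simp [Sound], ?_⟩
  · induction w with
    | nil => rfl
    | cons a w ih => simpa [Letter.expand] using ih
  · intro x hx
    obtain ⟨a, -, rfl⟩ := List.mem_map.1 hx
    exact .input a

/-- The word that a symbol of the grammar of a state for `w` stands for. -/
def symbolExpand (w : List α) : Symbol α (Option (Letter α)) → List α
  | .terminal a => [a]
  | .nonterminal none => w
  | .nonterminal (some x) => x.expand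

theorem symbolExpand_toSymbol (w : List α) (x : Letter α) :
    symbolExpand w x.toSymbol = x.expand := by
  cases x <;> rfl

theorem flatMap_symbolExpand (w : List α) (L : List (Letter α)) :
    (L.map Letter.toSymbol).flatMap (symbolExpand w) = L.flatMap Letter.expand := by
  rw [List.flatMap_map]
  exact List.flatMap_congr fun x _ => symbolExpand_toSymbol w x

theorem parses_map_toSymbol {s : State α} {L : List (Letter α)}
    (h : ∀ x ∈ L, s.grammar.Parses [x.toSymbol] x.expand) :
    s.grammar.Parses (L.map Letter.toSymbol) (L.flatMap Letter.expand) := by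
  induction L with
  | nil => exact .nil
  | cons z L ih => exact (h z (by simp)).append (ih fun x hx => h x (by simp [hx]))

theorem Represented.parses {s : State α} {w : List α} (h : s.Derives w) {x : Letter α}
    (hx : Represented s.prods x) : s.grammar.Parses [x.toSymbol] x.expand := by
  induction hx with
  | input a => exact .terminal a .nil
  | @prod y b hq hb ih =>
    obtain ⟨h₁, h₂⟩ := h.sound _ hq
    have hbody : s.grammar.Parses (b.map Letter.toSymbol) (b.flatMap Letter.expand) :=
      parses_map_toSymbol ih
    have hr : (⟨some y, b.map Letter.toSymbol⟩ : ContextFreeRule α (Option (Letter α)))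
        ∈ s.grammar.rules :=
      Finset.mem_insert_of_mem (Finset.mem_image.2 ⟨(y, b), hq, rfl⟩)
    have := ContextFreeGrammar.Parses.nonterminal hr hbody .nil
    simp only [List.append_nil] at this
    rw [h₁, h₂]
    exact this

/-- A valuation of the symbols that is compatible with every rule computes the word of every parse
forest. With `symbolExpand` it shows that nothing but `w` is generated; `Represented` supplies the
converse. -/
theorem parses_eq_flatMap {G : ContextFreeGrammar α} (f : Symbol α G.NT → List α)
    (h₁ : ∀ a, f (.terminal a) = [a])
    (h₂ : ∀ r ∈ G.rules, f (.nonterminal r.input) = r.output.flatMap f)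
    {t : List (Symbol α G.NT)} {u : List α} (h : G.Parses t u) : u = t.flatMap f := by
  induction h with
  | nil => rfl
  | terminal a _ ih => simp [h₁, ← ih]
  | nonterminal hr _ _ ih ih' => rw [List.flatMap_cons, h₂ _ hr, ← ih, ← ih']

theorem mem_rules_grammar {s : State α} {r : ContextFreeRule α (Option (Letter α))} :
    r ∈ s.grammar.rules ↔ r = ⟨none, s.text.map Letter.toSymbol⟩ ∨
      ∃ q ∈ s.prods, r = ⟨some q.1, q.2.map Letter.toSymbol⟩ := by
  refine Finset.mem_insert.trans (or_congr_right (Finset.mem_image.trans ?_))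
  simp only [eq_comm]

/-- A state that derives `w` has a grammar that generates exactly `w`. -/
theorem State.Derives.language_eq {s : State α} {w : List α} (h : s.Derives w) :
    s.grammar.language = {w} := by
  have key : ∀ u, s.grammar.Parses [.nonterminal s.grammar.initial] u → u = w := by
    intro u hu
    refine (parses_eq_flatMap (G := s.grammar) (symbolExpand w) (fun a => rfl)
      (fun r hr => ?_) hu).trans (List.flatMap_singleton _ _)
    rcases mem_rules_grammar.1 hr with rfl | ⟨q, hq, rfl⟩
    · exact (h.text.symm.trans (flatMap_symbolExpand w _).symm)
    · exact (h.sound q hq).2.trans (flatMap_symbolExpand w _).symm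
  ext u
  rw [ContextFreeGrammar.mem_language_iff, ContextFreeGrammar.derives_iff_parses]
  refine ⟨key u, fun hu => ?_⟩
  rw [show u = w from hu]
  have hr : (⟨none, s.text.map Letter.toSymbol⟩ : ContextFreeRule α (Option (Letter α)))
      ∈ s.grammar.rules := Finset.mem_insert_self _ _
  have := ContextFreeGrammar.Parses.nonterminal hr
    (parses_map_toSymbol fun x hx => (h.represented x hx).parses h) .nil
  rw [h.text, List.append_nil] at this
  exact this

theorem State.size_grammar_le (s : State α) : s.grammar.size ≤ s.size := by
  rw [ContextFreeGrammar.size, State.size]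
  simp only [State.grammar]
  have h₁ : ∑ r ∈ s.prods.image (fun q => (⟨some q.1, q.2.map Letter.toSymbol⟩ :
      ContextFreeRule α (Option (Letter α)))), r.output.length ≤ ∑ q ∈ s.prods, q.2.length := by
    refine (Finset.sum_image_le_of_nonneg (fun _ _ => Nat.zero_le _)).trans ?_
    simp
  refine le_trans ?_ (Nat.add_le_add_left h₁ _)
  by_cases h : (⟨none, s.text.map Letter.toSymbol⟩ : ContextFreeRule α (Option (Letter α))) ∈
      s.prods.image (fun q => ⟨some q.1, q.2.map Letter.toSymbol⟩)
  · rw [Finset.insert_eq_of_mem h]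
    exact Nat.le_add_left _ _
  · rw [Finset.sum_insert h]
    simp

end Recompression

/-! ### The greedy partition and the geometric decrease of the text -/

namespace Recompression

variable {α : Type} [DecidableEq α]

/-! ### The greedy partition -/

theorem mem_greedyLoop (T : List (Letter α)) (L : List (Letter α))
    (S : Finset (Letter α) × Finset (Letter α)) (x : Letter α) :
    x ∈ (greedyLoop T L S).1 ∨ x ∈ (greedyLoop T L S).2 ↔ x ∈ S.1 ∨ x ∈ S.2 ∨ x ∈ L := by
  induction L generalizing S with
  | nil => simp [greedyLoop]
  | cons a L ih =>
    obtain ⟨Sl, Sr⟩ := S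
    rw [greedyLoop]
    split_ifs
    · rw [ih]; simp only [Finset.mem_insert, List.mem_cons]; tauto
    · rw [ih]; simp only [Finset.mem_insert, List.mem_cons]; tauto

theorem disjoint_greedyLoop (T : List (Letter α)) (L : List (Letter α))
    (S : Finset (Letter α) × Finset (Letter α)) (hL : L.Nodup) (h : ∀ x ∈ L, x ∉ S.1 ∧ x ∉ S.2)
    (hS : Disjoint S.1 S.2) : Disjoint (greedyLoop T L S).1 (greedyLoop T L S).2 := by
  induction L generalizing S with
  | nil => simpa [greedyLoop]
  | cons a L ih =>
    obtain ⟨Sl, Sr⟩ := S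
    obtain ⟨ha, hL⟩ := List.nodup_cons.1 hL
    have haS := h a (by simp)
    have h' : ∀ x ∈ L, x ≠ a ∧ x ∉ Sl ∧ x ∉ Sr := fun x hx =>
      ⟨fun hxa => ha (hxa ▸ hx), h x (by simp [hx])⟩
    rw [greedyLoop]
    split_ifs
    · refine ih _ hL (fun x hx => ?_) ?_
      · simpa [and_assoc] using h' x hx
      · exact Finset.disjoint_insert_left.2 ⟨haS.2, hS⟩
    · refine ih _ hL (fun x hx => ?_) ?_
      · have := h' x hx
        simp only [Finset.mem_insert, not_or]
        tauto
      · exact Finset.disjoint_insert_right.2 ⟨haS.1, hS⟩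

theorem countP_eq_add_add {β : Type} {Ps : List β} {P A B C : β → Prop} [DecidablePred P]
    [DecidablePred A] [DecidablePred B] [DecidablePred C]
    (h : ∀ q ∈ Ps, (if P q then 1 else 0) =
      (if A q then 1 else 0) + (if B q then 1 else 0) + (if C q then 1 else 0)) :
    (Ps.countP fun q => P q)
      = (Ps.countP fun q => A q) + (Ps.countP fun q => B q) + (Ps.countP fun q => C q) := by
  induction Ps with
  | nil => simp
  | cons q Ps ih =>
    have hq := h q (by simp)
    simp only [List.countP_cons, decide_eq_true_eq, ih fun x hx => h x (by simp [hx]), hq]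
    omega

theorem countP_add_eq_add_add {β : Type} {Ps : List β} {P P' A B C : β → Prop} [DecidablePred P]
    [DecidablePred P'] [DecidablePred A] [DecidablePred B] [DecidablePred C]
    (h : ∀ q ∈ Ps, (if P q then 1 else 0) + (if P' q then 1 else 0) =
      (if A q then 1 else 0) + (if B q then 1 else 0) + (if C q then 1 else 0)) :
    (Ps.countP fun q => P q) + (Ps.countP fun q => P' q)
      = (Ps.countP fun q => A q) + (Ps.countP fun q => B q) + (Ps.countP fun q => C q) := by
  induction Ps with
  | nil => simp
  | cons q Ps ih =>
    have hq := h q (by simp)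
    have ih := ih fun x hx => h x (by simp [hx])
    simp only [List.countP_cons, decide_eq_true_eq]
    omega

/-- When `a` joins `A`, the pairs that become assigned are those joining `a` to `A` or to `B`, and
the ones among them that run between the parts are those joining `a` to `B`. No pair `aa` occurs,
and the parts are disjoint, so nothing is counted twice. -/
theorem countP_step (Ps : List (Letter α × Letter α)) (hPs : ∀ q ∈ Ps, q.1 ≠ q.2)
    (A B : Finset (Letter α)) (a : Letter α) (hA : a ∉ A) (hB : a ∉ B) (hAB : Disjoint A B) :
    (Ps.countP fun q => (q.1 ∈ insert a A ∨ q.1 ∈ B) ∧ (q.2 ∈ insert a A ∨ q.2 ∈ B))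
      = (Ps.countP fun q => (q.1 ∈ A ∨ q.1 ∈ B) ∧ (q.2 ∈ A ∨ q.2 ∈ B))
        + (Ps.countP fun q => (q.1 = a ∧ q.2 ∈ A) ∨ (q.1 ∈ A ∧ q.2 = a))
        + (Ps.countP fun q => (q.1 = a ∧ q.2 ∈ B) ∨ (q.1 ∈ B ∧ q.2 = a)) ∧
    (Ps.countP fun q => q.1 ∈ insert a A ∧ q.2 ∈ B) + (Ps.countP fun q => q.1 ∈ B ∧ q.2 ∈ insert a A)
      = (Ps.countP fun q => q.1 ∈ A ∧ q.2 ∈ B) + (Ps.countP fun q => q.1 ∈ B ∧ q.2 ∈ A)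
        + (Ps.countP fun q => (q.1 = a ∧ q.2 ∈ B) ∨ (q.1 ∈ B ∧ q.2 = a)) := by
  have hd : ∀ z, z ∈ A → z ∉ B := fun z hz hz' => Finset.disjoint_left.1 hAB hz hz'
  refine ⟨countP_eq_add_add fun q hq => ?_, ?_⟩
  · have := hPs q hq
    have := hd q.1
    have := hd q.2
    simp only [Finset.mem_insert]
    grind
  · refine countP_add_eq_add_add fun q hq => ?_
    have := hPs q hq
    have := hd q.1
    have := hd q.2
    simp only [Finset.mem_insert]
    grind

/-- The occurrences of pairs with both letters already assigned. -/
def assigned (T : List (Letter α)) (A B : Finset (Letter α)) : ℕ :=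
  (pairs T).countP fun q => (q.1 ∈ A ∨ q.1 ∈ B) ∧ (q.2 ∈ A ∨ q.2 ∈ B)

theorem assigned_comm (T : List (Letter α)) (A B : Finset (Letter α)) :
    assigned T A B = assigned T B A := by
  unfold assigned
  refine List.countP_congr fun q _ => ?_
  simp only [decide_eq_true_eq]
  tauto

/-- The invariant is that at least half of the assigned pairs run between the parts. A new letter
goes opposite to the part with which it has more pairs, so at least half of the newly assigned pairs
run between the parts as well. -/
theorem assigned_le_greedyLoop (T : List (Letter α)) (hT : ∀ q ∈ pairs T, q.1 ≠ q.2)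
    (L : List (Letter α)) (S : Finset (Letter α) × Finset (Letter α)) (hL : L.Nodup)
    (h : ∀ x ∈ L, x ∉ S.1 ∧ x ∉ S.2) (hS : Disjoint S.1 S.2)
    (hc : assigned T S.1 S.2 ≤ 2 * (cover T S.1 S.2 + cover T S.2 S.1)) :
    assigned T (greedyLoop T L S).1 (greedyLoop T L S).2 ≤
      2 * (cover T (greedyLoop T L S).1 (greedyLoop T L S).2
        + cover T (greedyLoop T L S).2 (greedyLoop T L S).1) := by
  induction L generalizing S with
  | nil => simpa [greedyLoop]
  | cons a L ih =>
    obtain ⟨Sl, Sr⟩ := S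
    obtain ⟨ha, hL⟩ := List.nodup_cons.1 hL
    have haS := h a (by simp)
    have h' : ∀ x ∈ L, x ≠ a ∧ x ∉ Sl ∧ x ∉ Sr := fun x hx =>
      ⟨fun hxa => ha (hxa ▸ hx), h x (by simp [hx])⟩
    simp only at hS haS hc
    rw [greedyLoop]
    split_ifs with hle
    · refine ih _ hL (fun x hx => ?_) ?_ ?_
      · simpa [and_assoc] using h' x hx
      · exact Finset.disjoint_insert_left.2 ⟨haS.2, hS⟩
      · obtain ⟨e₁, e₂⟩ := countP_step (pairs T) hT Sl Sr a haS.1 haS.2 hS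
        unfold assigned cover count at *
        simp only at *
        omega
    · refine ih _ hL (fun x hx => ?_) ?_ ?_
      · have := h' x hx
        simp only [Finset.mem_insert, not_or]
        tauto
      · exact Finset.disjoint_insert_right.2 ⟨haS.1, hS⟩
      -- The same computation with the roles of the two parts exchanged.
      · obtain ⟨e₁, e₂⟩ := countP_step (pairs T) hT Sr Sl a haS.2 haS.1 hS.symm
        simp only at *
        rw [assigned_comm] at hc ⊢
        unfold assigned cover count at *
        omega

theorem disjoint_greedyPairs {T L : List (Letter α)} (hL : L.Nodup) :
    Disjoint (greedyPairs T L).1 (greedyPairs T L).2 := by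
  have h := disjoint_greedyLoop T L (∅, ∅) hL (by simp) (by simp)
  unfold greedyPairs
  simp only
  split_ifs
  · exact h.symm
  · exact h

theorem length_pairs (T : List (Letter α)) : (pairs T).length = T.length - 1 := by
  simp [pairs]

/-- At the end all pairs are assigned, at least half of them run between the parts in one of the two
directions, and the switch keeps the better direction: a quarter is covered. -/
theorem length_le_cover_greedyPairs {T L : List (Letter α)} (hT : ∀ q ∈ pairs T, q.1 ≠ q.2)
    (hL : IsLetterList T L) :
    T.length - 1 ≤ 4 * cover T (greedyPairs T L).1 (greedyPairs T L).2 := by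
  have h := assigned_le_greedyLoop T hT L (∅, ∅) hL.1 (by simp) (by simp) (by simp [assigned])
  have hall : assigned T (greedyLoop T L (∅, ∅)).1 (greedyLoop T L (∅, ∅)).2 = T.length - 1 := by
    rw [← length_pairs, assigned, List.countP_eq_length]
    intro q hq
    simp only [mem_greedyLoop, decide_eq_true_eq]
    exact ⟨.inr (.inr ((hL.2 _).2 ⟨q, hq, .inl rfl⟩)), .inr (.inr ((hL.2 _).2 ⟨q, hq, .inr rfl⟩))⟩
  unfold greedyPairs
  simp only
  split_ifs
  · show _ ≤ 4 * cover T (greedyLoop T L (∅, ∅)).2 (greedyLoop T L (∅, ∅)).1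
    omega
  · omega

/-- Each covered occurrence saves one letter. Covered occurrences cannot overlap: the second letter
of one lies in `B`, hence not in `A`. -/
theorem length_compressPairs (p : ℕ) {A B : Finset (Letter α)} (h : Disjoint A B)
    (T : List (Letter α)) : (compressPairs p A B T).length + cover T A B = T.length := by
  induction T using compressPairs.induct A B with
  | case1 => simp [compressPairs, cover, pairs]
  | case2 => simp [compressPairs, cover, pairs]
  | case3 a b t hab ih =>
    have hbA : b ∉ A := fun hb => Finset.disjoint_left.1 h hb hab.2
    have : cover (a :: b :: t) A B = cover t A B + 1 := by
      cases t with
      | nil => simp [cover, pairs, hab]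
      | cons c t => simp [cover, pairs, hab, hbA]
    rw [compressPairs, if_pos hab, List.length_cons, List.length_cons, List.length_cons, this]
    omega
  | case4 a b t hab ih =>
    have : cover (a :: b :: t) A B = cover (b :: t) A B := by
      simp only [cover, pairs, List.tail_cons, List.zip_cons_cons, List.countP_cons]
      simp [hab]
    rw [compressPairs, if_neg hab, List.length_cons, List.length_cons, this]
    omega

/-! ### Runs -/

/-- The letter is an input letter or was introduced before phase `p`. -/
def Letter.Old (p : ℕ) : Letter α → Prop
  | .input _ => True
  | .pair q _ _ => q < p
  | .block q _ _ => q < p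
  | .power q _ _ => q < p
  | .diff q _ _ _ => q < p

theorem Letter.Old.succ {p : ℕ} {x : Letter α} (h : x.Old p) : x.Old (p + 1) := by
  cases x <;> simp only [Letter.Old] at * <;> omega

/-- Neighbouring maximal blocks have different letters, and a letter introduced for a block in phase
`p` differs from every older letter. The second reason is why the texts must be known to consist of
old letters. -/
theorem ne_of_mem_pairs_compressBlocks {p : ℕ} {T : List (Letter α)} (hT : ∀ x ∈ T, x.Old p) :
    ∀ q ∈ pairs (compressBlocks p T), q.1 ≠ q.2 := by
  have hc : (compressBlocks p T).IsChain (· ≠ ·) := by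
    rw [compressBlocks, List.isChain_map]
    have h := (isBlockList_maximalBlocks T).2
    refine h.imp_of_mem_imp fun q r hq hr hqr => ?_
    have hqo := hT _ (mem_of_mem_maximalBlocks hq)
    have hro := hT _ (mem_of_mem_maximalBlocks hr)
    split_ifs
    · simp [hqr]
    · intro h; rw [← h] at hro; simp [Letter.Old] at hro
    · intro h; rw [h] at hqo; simp [Letter.Old] at hqo
    · exact hqr
  generalize compressBlocks p T = U at hc
  intro q hq
  induction U with
  | nil => simp [pairs] at hq
  | cons a U ih =>
    cases U with
    | nil => simp [pairs] at hq
    | cons b U =>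
      rw [List.isChain_cons_cons] at hc
      rw [pairs, List.tail_cons, List.zip_cons_cons, List.mem_cons] at hq
      rcases hq with rfl | hq
      · exact hc.1
      · exact ih hc.2 hq

theorem length_compressBlocks_le (p : ℕ) (T : List (Letter α)) :
    (compressBlocks p T).length ≤ T.length := by
  conv_rhs => rw [← unblock_maximalBlocks T]
  simp only [compressBlocks, unblock, List.length_map, List.length_flatMap, List.length_replicate]
  have : ∀ B : List (Letter α × ℕ), (∀ q ∈ B, 0 < q.2) → B.length ≤ (B.map Prod.snd).sum := by
    intro B hB
    induction B with
    | nil => simp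
    | cons q B ih =>
      have := ih fun x hx => hB x (by simp [hx])
      have := hB q (by simp)
      simp only [List.length_cons, List.map_cons, List.sum_cons]
      omega
  exact this _ fun q hq => maximalBlocks_pos hq

theorem old_compressBlocks {p : ℕ} {T : List (Letter α)} (hT : ∀ x ∈ T, x.Old p) :
    ∀ x ∈ compressBlocks p T, x.Old (p + 1) := by
  intro x hx
  rcases mem_compressBlocks hx with hx | ⟨a, l, -, -, rfl⟩
  · exact (hT x hx).succ
  · simp [Letter.Old]

theorem old_phase {p : ℕ} {s : State α} (L : List (Letter α)) (h : ∀ x ∈ s.text, x.Old p) :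
    ∀ x ∈ (phase p L s).text, x.Old (p + 1) := by
  intro x hx
  rcases mem_compressPairs hx with hx | ⟨a, b, -, -, -, rfl⟩
  · exact old_compressBlocks h x hx
  · simp [Letter.Old]

/-- Block compression does not lengthen the text, and pair compression then removes at least a
quarter of the remaining length minus one. -/
theorem length_phase {p : ℕ} {s : State α} {L : List (Letter α)} (h : ∀ x ∈ s.text, x.Old p)
    (hL : IsLetterList (compressBlocks p s.text) L) :
    4 * (phase p L s).text.length ≤ 3 * s.text.length + 1 := by
  have h₁ := length_le_cover_greedyPairs (ne_of_mem_pairs_compressBlocks h) hL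
  have h₂ := length_compressPairs p (disjoint_greedyPairs (T := compressBlocks p s.text) hL.1)
    (compressBlocks p s.text)
  have h₃ := length_compressBlocks_le p s.text
  simp only [phase]
  omega

theorem exists_isLetterList (T : List (Letter α)) : ∃ L, IsLetterList T L := by
  refine ⟨((pairs T).flatMap fun q => [q.1, q.2]).dedup, List.nodup_dedup _, fun a => ?_⟩
  simp

theorem IsRun.derives {w : List α} {n : ℕ} {s : ℕ → State α} (h : IsRun w n s) {i : ℕ}
    (hi : i ≤ n) : (s i).Derives w ∧ ∀ x ∈ (s i).text, x.Old i := by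
  induction i with
  | zero =>
    rw [h.1]
    refine ⟨derives_init w, fun x hx => ?_⟩
    obtain ⟨a, -, rfl⟩ := List.mem_map.1 hx
    trivial
  | succ i ih =>
    obtain ⟨-, L, -, hs⟩ := h.2.1 i hi
    obtain ⟨h₁, h₂⟩ := ih (by omega)
    rw [hs]
    exact ⟨h₁.phase i L, old_phase L h₂⟩

theorem IsRun.length_succ {w : List α} {n : ℕ} {s : ℕ → State α} (h : IsRun w n s) {i : ℕ}
    (hi : i < n) : 4 * (s (i + 1)).text.length ≤ 3 * (s i).text.length + 1 := by
  obtain ⟨-, L, hL, hs⟩ := h.2.1 i hi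
  rw [hs]
  exact length_phase (h.derives hi.le).2 hL

open Classical in
/-- The states of a run in which the letter lists are chosen arbitrarily; it goes on for ever. -/
noncomputable def someRun (w : List α) : ℕ → State α
  | 0 => ⟨w.map .input, ∅⟩
  | i + 1 =>
    phase i (exists_isLetterList (compressBlocks i (someRun w i).text)).choose (someRun w i)

/-- Above length `1` the contraction by `length_phase` is strict, so the infinite sequence `someRun`
reaches length at most `1`; the run is cut at the first such index. -/
theorem exists_isRun (w : List α) : ∃ n s, IsRun w n s := by
  have hold : ∀ i, ∀ x ∈ (someRun w i).text, x.Old i := by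
    intro i
    induction i with
    | zero =>
      intro x hx
      obtain ⟨a, -, rfl⟩ := List.mem_map.1 hx
      trivial
    | succ i ih => exact old_phase _ ih
  have hlen : ∀ i, 4 * (someRun w (i + 1)).text.length ≤ 3 * (someRun w i).text.length + 1 :=
    fun i => length_phase (hold i)
      (exists_isLetterList (compressBlocks i (someRun w i).text)).choose_spec
  have hex : ∃ n, (someRun w n).text.length ≤ 1 := by
    by_contra hcon
    push Not at hcon
    have : ∀ i, (someRun w i).text.length + i ≤ (someRun w 0).text.length := by
      intro i
      induction i with
      | zero => simp
      | succ i ih =>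
        have h₁ := hlen i
        have h₂ := hcon i
        omega
    have h₁ := this (someRun w 0).text.length
    have h₂ := hcon (someRun w 0).text.length
    omega
  classical
  refine ⟨Nat.find hex, someRun w, rfl, fun i hi => ⟨?_, _,
    (exists_isLetterList (compressBlocks i (someRun w i).text)).choose_spec, rfl⟩,
    Nat.find_spec hex⟩
  have := Nat.find_min hex hi
  omega

theorem exists_isOutput (w : List α) : ∃ G, IsOutput w G := by
  obtain ⟨n, s, h⟩ := exists_isRun w
  obtain ⟨i, hi, hmin⟩ := Finset.exists_min_image (Finset.range (n + 1)) (fun j => (s j).size)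
    ⟨0, by simp⟩
  refine ⟨(s i).grammar, n, s, h, i, ?_, rfl, fun j hj => hmin j ?_⟩
  · simpa [Nat.lt_succ_iff] using hi
  · simpa [Nat.lt_succ_iff] using hj

end Recompression

/-! ### Compression that acts in the same way in every context -/

namespace Recompression

/-! ### Shapes: words composed of explicit letters and of at most two other words -/

/-- The way in which a word is composed of explicit letters and of the words with indices in `ι`. -/
inductive Shape (β ι : Type) : Type
  | leaf (u : List β)
  | one (u : List β) (Y : ι) (v : List β)
  | two (u : List β) (Y : ι) (v : List β) (Z : ι) (w : List β)

namespace Shape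

variable {β ι : Type}

/-- The word `x` has the given shape, with parts that are nonempty and satisfy `ok`. -/
def Fits (x : List β) (val : ι → List β) (ok : ι → Prop) : Shape β ι → Prop
  | leaf u => x = u
  | one u Y v => ok Y ∧ val Y ≠ [] ∧ x = u ++ (val Y ++ v)
  | two u Y v Z w => (ok Y ∧ val Y ≠ []) ∧ (ok Z ∧ val Z ≠ []) ∧
      x = u ++ (val Y ++ (v ++ (val Z ++ w)))

/-- The total size of the explicit words of a shape. -/
def gap (μ : List β → ℕ) : Shape β ι → ℕ
  | leaf u => μ u
  | one u _ v => μ u + μ v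
  | two u _ v _ w => μ u + μ v + μ w

def map (c : List β → List β) : Shape β ι → Shape β ι
  | leaf u => leaf (c u)
  | one u Y v => one (c u) Y (c v)
  | two u Y v Z w => two (c u) Y (c v) Z (c w)

end Shape

/-- A compression of words that is local in the following sense: from each word a bounded prefix and
suffix is cut off, and the rest is compressed in the same way in each context. -/
structure LocalStep (β : Type) where
  c : List β → List β
  pre : List β → List β
  core : List β → List β
  suf : List β → List β
  μ : List β → ℕ
  split : ∀ v, pre v ++ (core v ++ suf v) = v
  c_nil : ∀ v, c v = [] ↔ v = []
  -- The explicit word `u` before the core is only a suffix of some `x ++ pre Y`, because the word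
  -- around it may itself have been cut. It may even be empty.
  sep_left : ∀ Y u₀ u x z, core Y ≠ [] → u₀ ++ u = x ++ pre Y →
    c (u ++ (core Y ++ z)) = c u ++ c (core Y ++ z)
  sep_right : ∀ Y u u₀ x z, core Y ≠ [] → u ++ u₀ = suf Y ++ z →
    c (x ++ core Y ++ u) = c (x ++ core Y) ++ c u
  -- Cutting a composed word does not touch the cores inside it: only the explicit words at the two
  -- ends lose something.
  core_strip : ∀ Y Z m x z, core Y ≠ [] → core Z ≠ [] → core Y <+: m → core Z <:+ m →
    ∃ u₀ u w w₀, u₀ ++ u = x ++ pre Y ∧ w ++ w₀ = suf Z ++ z ∧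
      core ((x ++ pre Y) ++ (m ++ (suf Z ++ z))) = u ++ (m ++ w)
  -- The size is chosen such that a cut costs at most one: blocks are counted in block compression,
  -- letters in pair compression.
  μ_append : ∀ x y, μ (x ++ y) ≤ μ x + μ y
  μ_left : ∀ x y, μ x ≤ μ (x ++ y)
  μ_right : ∀ x y, μ y ≤ μ (x ++ y)
  μ_pre : ∀ v, μ (pre v) ≤ 1
  μ_suf : ∀ v, μ (suf v) ≤ 1

namespace LocalStep

variable {β ι : Type} (S : LocalStep β)

theorem c_core_append (Y : List β) (u u₀ x : List β) (hY : S.core Y ≠ [])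
    (h : u ++ u₀ = S.suf Y ++ x) : S.c (S.core Y ++ u) = S.c (S.core Y) ++ S.c u := by
  simpa using S.sep_right Y u u₀ [] x hY h

theorem core_infix {x T : List β} (hT : x <:+: T) : S.c (S.core x) <:+: S.c T := by
  obtain ⟨y, z, rfl⟩ := hT
  by_cases h : S.core x = []
  · rw [h, (S.c_nil []).2 rfl]
    exact List.nil_infix
  · have e : y ++ x ++ z = (y ++ S.pre x) ++ (S.core x ++ (S.suf x ++ z)) := by
      conv_lhs => rw [← S.split x]
      simp
    rw [e, S.sep_left x [] (y ++ S.pre x) y _ h rfl, S.c_core_append x _ [] z h (by simp)]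
    exact ⟨S.c (y ++ S.pre x), S.c (S.suf x ++ z), by simp⟩

/-- How a shape changes when the parts `Y` are cut to their cores. -/
def Evolves (val : ι → List β) : Shape β ι → Shape β ι → Prop
  -- Only the middle word is followed exactly. It is never cut, so it grows by precisely what the
  -- two parts give up, and it is the only word that the budget depends on.
  | .two _ Y v Z _, .two _ Y' v' Z' _ =>
    Y' = Y ∧ Z' = Z ∧ v' = S.suf (val Y) ++ (v ++ S.pre (val Z))
  | .two _ _ _ _ _, _ => True
  | .one _ Y _, .one _ Y' _ => Y' = Y
  | .one _ _ _, .leaf _ => True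
  | .leaf _, .leaf _ => True
  | _, _ => False

/-- The explicit words next to a part contain what was cut off from it, up to letters at the other
end. -/
def Borders (val : ι → List β) : Shape β ι → Prop
  | .leaf _ => True
  | .one u Y v => (∃ u₀ x, u₀ ++ u = x ++ S.pre (val Y)) ∧ ∃ v₀ z, v ++ v₀ = S.suf (val Y) ++ z
  | .two u Y v Z w => (∃ u₀ x, u₀ ++ u = x ++ S.pre (val Y)) ∧
      (∃ t, v = S.suf (val Y) ++ (t ++ S.pre (val Z))) ∧ ∃ w₀ z, w ++ w₀ = S.suf (val Z) ++ z

theorem fits_map {val : ι → List β} {ok : ι → Prop} {x : List β} {sh : Shape β ι}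
    (h : sh.Fits x (fun Y => S.core (val Y)) ok) (hb : S.Borders val sh) :
    (sh.map S.c).Fits (S.c x) (fun Y => S.c (S.core (val Y))) ok := by
  cases sh with
  | leaf u => exact congrArg S.c h
  | one u Y v =>
    obtain ⟨hok, hY, rfl⟩ := h
    obtain ⟨⟨u₀, x, hu⟩, v₀, z, hv⟩ := hb
    refine ⟨hok, fun h => hY ((S.c_nil _).1 h), ?_⟩
    rw [S.sep_left _ u₀ u x _ hY hu, S.c_core_append _ v v₀ z hY hv]
  | two u Y v Z w =>
    obtain ⟨⟨hok, hY⟩, ⟨hok', hZ⟩, rfl⟩ := h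
    obtain ⟨⟨u₀, x, hu⟩, ⟨t, ht⟩, w₀, z, hw⟩ := hb
    refine ⟨⟨hok, fun h => hY ((S.c_nil _).1 h)⟩, ⟨hok', fun h => hZ ((S.c_nil _).1 h)⟩, ?_⟩
    rw [S.sep_left _ u₀ u x _ hY hu]
    congr 1
    have e : S.core (val Y) ++ (v ++ (S.core (val Z) ++ w)) =
        (S.core (val Y) ++ v) ++ (S.core (val Z) ++ w) := by simp
    rw [e, S.sep_left (val Z) [] (S.core (val Y) ++ v) (S.core (val Y) ++ S.suf (val Y) ++ t) w hZ
      (by simp [ht]), S.c_core_append _ v [] (t ++ S.pre (val Z)) hY (by simp [ht]),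
      S.c_core_append _ w w₀ z hZ hw]
    simp

/-- Cutting the parts of a shape to their cores. -/
theorem exists_shape {val : ι → List β} {ok : ι → Prop} {x : List β} {sh : Shape β ι}
    (h : sh.Fits x val ok) :
    -- The first alternative is for the whole text, which is not cut; the second is for all other
    -- members of a family.
    (∃ sh', sh'.Fits x (fun Y => S.core (val Y)) ok ∧ S.Borders val sh' ∧ S.Evolves val sh sh' ∧
      sh'.gap S.μ ≤ sh.gap S.μ + 4) ∧
    (∃ sh', sh'.Fits (S.core x) (fun Y => S.core (val Y)) ok ∧ S.Borders val sh' ∧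
      S.Evolves val sh sh' ∧ sh'.gap S.μ ≤ sh.gap S.μ + 4) := by
  -- A part with empty core consists of what was cut off. It disappears from the shape and becomes
  -- explicit, at a price of at most two.
  have hμ : ∀ v, S.core v = [] → S.μ v ≤ 2 := by
    intro v hv
    have h₁ := S.split v
    rw [hv, List.nil_append] at h₁
    rw [← h₁]
    have := S.μ_append (S.pre v) (S.suf v)
    have := S.μ_pre v
    have := S.μ_suf v
    omega
  have hcore : ∀ v, S.μ (S.core v) ≤ S.μ v := by
    intro v
    conv_rhs => rw [← S.split v]
    exact (S.μ_left _ _).trans (S.μ_right _ _)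
  have hleaf : ∀ (y : List β) n, S.μ y ≤ n → S.Evolves val sh (.leaf y) →
      S.Evolves val sh (.leaf (S.core y)) →
      (∃ sh', sh'.Fits y (fun Y => S.core (val Y)) ok ∧ S.Borders val sh' ∧ S.Evolves val sh sh' ∧
        sh'.gap S.μ ≤ n) ∧
      (∃ sh', sh'.Fits (S.core y) (fun Y => S.core (val Y)) ok ∧ S.Borders val sh' ∧
        S.Evolves val sh sh' ∧ sh'.gap S.μ ≤ n) := by
    intro y n hy h₁ h₂
    exact ⟨⟨.leaf y, rfl, trivial, h₁, hy⟩, .leaf (S.core y), rfl, trivial, h₂, (hcore y).trans hy⟩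
  have hone : ∀ (u : List β) (Y : ι) (v : List β) n, ok Y → S.core (val Y) ≠ [] →
      S.μ u + S.μ v + 2 ≤ n → (∀ u v, S.Evolves val sh (.one u Y v)) →
      (∃ sh', sh'.Fits (u ++ (val Y ++ v)) (fun Y => S.core (val Y)) ok ∧ S.Borders val sh' ∧
        S.Evolves val sh sh' ∧ sh'.gap S.μ ≤ n) ∧
      (∃ sh', sh'.Fits (S.core (u ++ (val Y ++ v))) (fun Y => S.core (val Y)) ok ∧
        S.Borders val sh' ∧ S.Evolves val sh sh' ∧ sh'.gap S.μ ≤ n) := by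
    intro u Y v n hok hY hn hev
    have e : u ++ (val Y ++ v) =
        (u ++ S.pre (val Y)) ++ (S.core (val Y) ++ (S.suf (val Y) ++ v)) := by
      conv_lhs => rw [← S.split (val Y)]
      simp
    have h₁ := S.μ_append u (S.pre (val Y))
    have h₂ := S.μ_append (S.suf (val Y)) v
    have h₃ := S.μ_pre (val Y)
    have h₄ := S.μ_suf (val Y)
    refine ⟨⟨.one (u ++ S.pre (val Y)) Y (S.suf (val Y) ++ v), ⟨hok, hY, e⟩,
      ⟨⟨[], u, rfl⟩, [], v, by simp⟩, hev _ _, ?_⟩, ?_⟩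
    · simp only [Shape.gap]; omega
    -- A single remaining core is both the first and the last one.
    · obtain ⟨u₀, u', w', w₀, hu, hw, hcs⟩ := S.core_strip (val Y) (val Y) (S.core (val Y)) u v hY hY
        List.prefix_rfl List.suffix_rfl
      refine ⟨.one u' Y w', ⟨hok, hY, by rw [e, hcs]⟩, ⟨⟨u₀, u, hu⟩, w₀, v, hw⟩, hev _ _, ?_⟩
      have h₅ := S.μ_right u₀ u'
      have h₆ := S.μ_left w' w₀
      rw [hu] at h₅
      rw [hw] at h₆
      simp only [Shape.gap]
      omega
  cases sh with
  | leaf u =>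
    obtain rfl : x = u := h
    exact hleaf x _ (by simp [Shape.gap]) trivial trivial
  | one u Y v =>
    obtain ⟨hok, hY, rfl⟩ := h
    by_cases hc : S.core (val Y) = []
    · refine hleaf _ _ ?_ trivial trivial
      have h₁ := S.μ_append u (val Y ++ v)
      have h₂ := S.μ_append (val Y) v
      have h₃ := hμ _ hc
      simp only [Shape.gap]
      omega
    · exact hone u Y v _ hok hc (by simp only [Shape.gap]; omega) fun _ _ => rfl
  | two u Y v Z w =>
    obtain ⟨⟨hok, hY⟩, ⟨hok', hZ⟩, rfl⟩ := h
    by_cases hc : S.core (val Y) = []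
    -- Without a core in `Y`, the word of `Y` merges with `u` and `v` into one explicit word. Each
    -- part contributes at most two in all cases, hence the total of four.
    · have h₁ := S.μ_append u (val Y ++ v)
      have h₂ := S.μ_append (val Y) v
      have h₃ := hμ _ hc
      by_cases hc' : S.core (val Z) = []
      · refine hleaf _ _ ?_ trivial trivial
        have h₄ := S.μ_append (u ++ (val Y ++ v)) (val Z ++ w)
        have h₅ := S.μ_append (val Z) w
        have h₆ := hμ _ hc'
        have e : u ++ (val Y ++ (v ++ (val Z ++ w))) = (u ++ (val Y ++ v)) ++ (val Z ++ w) := by simp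
        rw [e]
        simp only [Shape.gap]
        omega
      · have e : u ++ (val Y ++ (v ++ (val Z ++ w))) = (u ++ (val Y ++ v)) ++ (val Z ++ w) := by simp
        rw [e]
        refine hone _ Z w _ hok' hc' ?_ fun _ _ => trivial
        simp only [Shape.gap]
        omega
    · by_cases hc' : S.core (val Z) = []
      · refine hone u Y _ _ hok hc ?_ fun _ _ => trivial
        have h₄ := S.μ_append v (val Z ++ w)
        have h₅ := S.μ_append (val Z) w
        have h₆ := hμ _ hc'
        simp only [Shape.gap]
        omega
      · have e : u ++ (val Y ++ (v ++ (val Z ++ w))) =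
            (u ++ S.pre (val Y)) ++ ((S.core (val Y) ++ ((S.suf (val Y) ++ (v ++ S.pre (val Z))) ++
              S.core (val Z))) ++ (S.suf (val Z) ++ w)) := by
          conv_lhs => rw [← S.split (val Y), ← S.split (val Z)]
          simp
        have h₁ := S.μ_append u (S.pre (val Y))
        have h₂ := S.μ_append (S.suf (val Z)) w
        have h₃ := S.μ_pre (val Y)
        have h₄ := S.μ_suf (val Y)
        have h₅ := S.μ_pre (val Z)
        have h₆ := S.μ_suf (val Z)
        have h₇ := S.μ_append (S.suf (val Y)) (v ++ S.pre (val Z))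
        have h₈ := S.μ_append v (S.pre (val Z))
        refine ⟨⟨.two (u ++ S.pre (val Y)) Y (S.suf (val Y) ++ (v ++ S.pre (val Z))) Z
          (S.suf (val Z) ++ w), ⟨⟨hok, hc⟩, ⟨hok', hc'⟩, by rw [e]; simp⟩,
          ⟨⟨[], u, rfl⟩, ⟨v, rfl⟩, [], w, by simp⟩, ⟨rfl, rfl, rfl⟩, ?_⟩, ?_⟩
        · simp only [Shape.gap]; omega
        · obtain ⟨u₀, u', w', w₀, hu, hw, hcs⟩ := S.core_strip (val Y) (val Z)
            (S.core (val Y) ++ ((S.suf (val Y) ++ (v ++ S.pre (val Z))) ++ S.core (val Z))) u w hc hc'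
            (List.prefix_append _ _) ((List.suffix_append _ _).trans (List.suffix_append _ _))
          refine ⟨.two u' Y (S.suf (val Y) ++ (v ++ S.pre (val Z))) Z w',
            ⟨⟨hok, hc⟩, ⟨hok', hc'⟩, by rw [e, hcs]; simp⟩,
            ⟨⟨u₀, u, hu⟩, ⟨v, rfl⟩, w₀, w, hw⟩, ⟨rfl, rfl, rfl⟩, ?_⟩
          have h₉ := S.μ_right u₀ u'
          have h₁₀ := S.μ_left w' w₀
          rw [hu] at h₉
          rw [hw] at h₁₀
          simp only [Shape.gap]
          omega

end LocalStep

end Recompression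

namespace Recompression

variable {α : Type} [DecidableEq α]

/-! ### Block compression is local -/

/-- The number of maximal blocks of a word. -/
def blockCount (v : List (Letter α)) : ℕ := (maximalBlocks v).length

theorem blockCount_append (x y : List (Letter α)) :
    blockCount (x ++ y) ≤ blockCount x + blockCount y ∧ blockCount x ≤ blockCount (x ++ y) ∧
      blockCount y ≤ blockCount (x ++ y) := by
  unfold blockCount
  rcases maximalBlocks_append x y with ⟨-, h⟩ | ⟨P, b, i, j, Q, hx, hy, h⟩
  · rw [h, List.length_append]; omega
  · rw [h, hx, hy]
    simp only [List.length_append, List.length_cons, List.length_nil]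
    omega

/-- The maximal block at the beginning of a word. -/
def leadBlock : List (Letter α) → List (Letter α)
  | [] => []
  | a :: t => a :: t.takeWhile (· = a)

/-- The word without the maximal block at its beginning. -/
def dropLead : List (Letter α) → List (Letter α)
  | [] => []
  | a :: t => t.dropWhile (· = a)

theorem leadBlock_append_dropLead (v : List (Letter α)) : leadBlock v ++ dropLead v = v := by
  cases v with
  | nil => rfl
  | cons a t => simp [leadBlock, dropLead]

theorem leadBlock_cons (a : Letter α) (t : List (Letter α)) :
    ∃ n, leadBlock (a :: t) = List.replicate (n + 1) a := by
  refine ⟨(t.takeWhile (· = a)).length, ?_⟩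
  rw [leadBlock, List.replicate_succ]
  congr 1
  refine List.eq_replicate_iff.2 ⟨rfl, fun b hb => ?_⟩
  simpa using List.mem_takeWhile_imp hb

theorem head?_dropLead_ne {a b : Letter α} {t : List (Letter α)}
    (h : (dropLead (a :: t)).head? = some b) : b ≠ a := by
  rintro rfl
  have := List.head?_dropWhile_not (fun x => decide (x = b)) t
  rw [show List.dropWhile (fun x => decide (x = b)) t = dropLead (b :: t) from rfl, h] at this
  simp at this

theorem getLast_leadBlock_ne {v : List (Letter α)} {a b : Letter α}
    (ha : (leadBlock v).getLast? = some a) (hb : (dropLead v).head? = some b) : a ≠ b := by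
  cases v with
  | nil => simp [leadBlock] at ha
  | cons c t =>
    obtain ⟨n, hn⟩ := leadBlock_cons c t
    rw [hn, List.replicate_succ'] at ha
    have := head?_dropLead_ne hb
    simp only [List.getLast?_append, List.getLast?_singleton, Option.some_or, Option.some.injEq] at ha
    exact ha ▸ this.symm

theorem dropLead_append {u m : List (Letter α)} (hu : u ≠ [])
    (h : ∀ a ∈ u.getLast?, ∀ b ∈ m.head?, a ≠ b) : dropLead (u ++ m) = dropLead u ++ m := by
  obtain ⟨a, t, rfl⟩ := List.exists_cons_of_ne_nil hu
  simp only [dropLead, List.cons_append]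
  rw [List.dropWhile_append]
  split_ifs with he
  · have hall : ∀ x ∈ t, x = a := by simpa [List.isEmpty_iff] using he
    have hl : a ∈ (a :: t).getLast? := by
      have := List.getLast_mem (List.cons_ne_nil a t)
      rw [List.getLast?_eq_some_getLast (List.cons_ne_nil a t)]
      rcases List.mem_cons.1 this with h | h
      · simp only [h, Option.mem_some_iff]
      · simp only [hall _ h, Option.mem_some_iff]
    have hd : List.dropWhile (fun x => decide (x = a)) t = [] := by simpa [List.isEmpty_iff] using he
    rw [hd, List.nil_append]
    cases m with
    | nil => rfl
    | cons b m =>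
      have := h a hl b (by simp)
      simp [this.symm]
  · rfl

theorem blockCount_leadBlock (v : List (Letter α)) : blockCount (leadBlock v) ≤ 1 := by
  cases v with
  | nil => simp [leadBlock, blockCount, maximalBlocks]
  | cons a t =>
    obtain ⟨n, hn⟩ := leadBlock_cons a t
    have := maximalBlocks_replicate_append (b := a) (l := n + 1) (by omega) (t := [])
      (by simp [maximalBlocks])
    rw [List.append_nil] at this
    simp [hn, blockCount, this, maximalBlocks]

/-- The word without the maximal blocks at its ends. -/
def blockCore (v : List (Letter α)) : List (Letter α) := (dropLead (dropLead v).reverse).reverse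

/-- The maximal block at the end of the word without the one at its beginning. -/
def tailBlock (v : List (Letter α)) : List (Letter α) := (leadBlock (dropLead v).reverse).reverse

theorem blockCore_append_tailBlock (v : List (Letter α)) :
    blockCore v ++ tailBlock v = dropLead v := by
  rw [blockCore, tailBlock, ← List.reverse_append, leadBlock_append_dropLead, List.reverse_reverse]

theorem tailBlock_eq {v : List (Letter α)} (h : blockCore v ≠ []) :
    ∃ n b, tailBlock v = List.replicate (n + 1) b := by
  have hd : dropLead v ≠ [] := by
    intro h'
    rw [blockCore, h'] at h
    simp [dropLead] at h
  obtain ⟨b, t, hbt⟩ := List.exists_cons_of_ne_nil (show (dropLead v).reverse ≠ [] by simpa)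
  obtain ⟨n, hn⟩ := leadBlock_cons b t
  exact ⟨n, b, by rw [tailBlock, hbt, hn]; simp⟩

theorem ne_of_blockCore_tailBlock {v : List (Letter α)} {a b : Letter α}
    (ha : (blockCore v).getLast? = some a) (hb : (tailBlock v).head? = some b) : a ≠ b := by
  rw [blockCore, List.getLast?_reverse] at ha
  rw [tailBlock, List.head?_reverse] at hb
  exact (getLast_leadBlock_ne hb ha).symm

theorem ne_of_leadBlock_blockCore {v : List (Letter α)} {a b : Letter α}
    (ha : (leadBlock v).getLast? = some a) (hb : (blockCore v).head? = some b) : a ≠ b := by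
  refine getLast_leadBlock_ne ha ?_
  rw [← blockCore_append_tailBlock, List.head?_append, hb]
  rfl

theorem leadBlock_ne_nil {v : List (Letter α)} (h : blockCore v ≠ []) : leadBlock v ≠ [] := by
  rintro h'
  cases v with
  | nil => simp [blockCore, dropLead] at h
  | cons a t => simp [leadBlock] at h'

/-- The letter changes at both ends of `m`, so removing the outer blocks stays within `u` and `w`,
even if `u` or `w` is a single block. -/
theorem blockCore_strip {u m w : List (Letter α)} (hu : u ≠ []) (hw : w ≠ []) (hm : m ≠ [])
    (h₁ : ∀ a ∈ u.getLast?, ∀ b ∈ m.head?, a ≠ b) (h₂ : ∀ a ∈ m.getLast?, ∀ b ∈ w.head?, a ≠ b) :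
    blockCore (u ++ (m ++ w)) = dropLead u ++ (m ++ (dropLead w.reverse).reverse) := by
  have e₁ : dropLead (u ++ (m ++ w)) = dropLead u ++ (m ++ w) := by
    refine dropLead_append hu fun a ha b hb => h₁ a ha b ?_
    rw [List.head?_append_of_ne_nil _ hm] at hb
    exact hb
  have e₂ : dropLead (w.reverse ++ (dropLead u ++ m).reverse) =
      dropLead w.reverse ++ (dropLead u ++ m).reverse := by
    refine dropLead_append (by simpa) fun a ha b hb => ?_
    rw [List.getLast?_reverse] at ha
    rw [List.head?_reverse, List.getLast?_append_of_ne_nil _ hm] at hb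
    exact (h₂ b hb a ha).symm
  rw [blockCore, e₁, ← List.append_assoc, List.reverse_append (bs := w), e₂]
  simp

theorem compressBlocks_append {p : ℕ} {x y : List (Letter α)}
    (h : ∀ a ∈ x.getLast?, ∀ b ∈ y.head?, a ≠ b) :
    compressBlocks p (x ++ y) = compressBlocks p x ++ compressBlocks p y := by
  simp [compressBlocks, maximalBlocks_append_of_ne h]

theorem head?_mem_of_prefix {β : Type} {x y : List β} (hx : x ≠ []) (h : x <+: y) :
    y.head? = x.head? := by
  obtain ⟨t, rfl⟩ := h
  exact List.head?_append_of_ne_nil _ hx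

theorem getLast?_mem_of_suffix {β : Type} {x y : List β} (hx : x ≠ []) (h : x <:+ y) :
    y.getLast? = x.getLast? := by
  obtain ⟨t, rfl⟩ := h
  exact List.getLast?_append_of_ne_nil _ hx

/-- If `u` is a nonempty suffix of `x ++ y` and `y` is nonempty, then `u` and `y` have the same last
letter. -/
theorem getLast?_eq_of_append_eq {β : Type} {u₀ u x y : List β} (hu : u ≠ []) (hy : y ≠ [])
    (h : u₀ ++ u = x ++ y) : u.getLast? = y.getLast? := by
  rw [← List.getLast?_append_of_ne_nil u₀ hu, h, List.getLast?_append_of_ne_nil x hy]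

theorem head?_eq_of_append_eq {β : Type} {u₀ u x y : List β} (hu : u ≠ []) (hy : y ≠ [])
    (h : u ++ u₀ = y ++ x) : u.head? = y.head? := by
  rw [← List.head?_append_of_ne_nil u hu, h, List.head?_append_of_ne_nil y hy]

/-- Block compression as a local step. -/
def blockStep (p : ℕ) : LocalStep (Letter α) where
  c := compressBlocks p
  pre := leadBlock
  core := blockCore
  suf := tailBlock
  μ := blockCount
  split v := by rw [blockCore_append_tailBlock, leadBlock_append_dropLead]
  c_nil v := by rw [compressBlocks, List.map_eq_nil_iff, maximalBlocks_nil_iff]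
  sep_left Y u₀ u x z hY h := by
    refine compressBlocks_append fun a ha b hb => ?_
    -- A nonempty `u` ends like the leading block of `Y`, and the core begins with a different
    -- letter.
    have hu : u ≠ [] := by rintro rfl; simp at ha
    rw [getLast?_eq_of_append_eq hu (leadBlock_ne_nil hY) h] at ha
    rw [List.head?_append_of_ne_nil _ hY] at hb
    exact ne_of_leadBlock_blockCore ha hb
  sep_right Y u u₀ x z hY h := by
    refine compressBlocks_append fun a ha b hb => ?_
    have hu : u ≠ [] := by rintro rfl; simp at hb
    obtain ⟨n, c, hn⟩ := tailBlock_eq hY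
    rw [head?_eq_of_append_eq hu (by simp [hn]) h] at hb
    rw [List.getLast?_append_of_ne_nil _ hY] at ha
    exact ne_of_blockCore_tailBlock ha hb
  core_strip Y Z m x z hY hZ h₁ h₂ := by
    obtain ⟨n, c, hn⟩ := tailBlock_eq hZ
    have ht : tailBlock Z ≠ [] := by simp [hn]
    have hl := leadBlock_ne_nil hY
    refine ⟨leadBlock (x ++ leadBlock Y), dropLead (x ++ leadBlock Y),
      (dropLead (tailBlock Z ++ z).reverse).reverse, (leadBlock (tailBlock Z ++ z).reverse).reverse,
      leadBlock_append_dropLead _, ?_, blockCore_strip (by simp [hl]) (by simp [ht]) ?_ ?_ ?_⟩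
    · rw [← List.reverse_append, leadBlock_append_dropLead, List.reverse_reverse]
    · rintro rfl
      exact hY (List.prefix_nil.1 h₁)
    · intro a ha b hb
      rw [List.getLast?_append_of_ne_nil _ hl] at ha
      rw [head?_mem_of_prefix hY h₁] at hb
      exact ne_of_leadBlock_blockCore ha hb
    · intro a ha b hb
      rw [List.head?_append_of_ne_nil _ ht] at hb
      rw [getLast?_mem_of_suffix hZ h₂] at ha
      exact ne_of_blockCore_tailBlock ha hb
  μ_append x y := (blockCount_append x y).1
  μ_left x y := (blockCount_append x y).2.1
  μ_right x y := (blockCount_append x y).2.2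
  μ_pre := blockCount_leadBlock
  μ_suf v := by
    -- A block is its own reversal.
    have : (leadBlock (dropLead v).reverse).reverse = leadBlock (dropLead v).reverse := by
      cases (dropLead v).reverse with
      | nil => rfl
      | cons a t =>
        obtain ⟨n, hn⟩ := leadBlock_cons a t
        rw [hn, List.reverse_replicate]
    rw [tailBlock, this]
    exact blockCount_leadBlock _

/-! ### Pair compression is local -/

/-- Only a replaced pair across the border could make the compression depend on both sides. -/
theorem compressPairs_append (p : ℕ) (A B : Finset (Letter α)) {x y : List (Letter α)}
    (h : ∀ a ∈ x.getLast?, ∀ b ∈ y.head?, ¬ (a ∈ A ∧ b ∈ B)) :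
    compressPairs p A B (x ++ y) = compressPairs p A B x ++ compressPairs p A B y := by
  induction x using compressPairs.induct A B with
  | case1 => simp [compressPairs]
  | case2 a =>
    cases y with
    | nil => simp [compressPairs]
    | cons b t =>
      have := h a (by simp) b (by simp)
      simp [compressPairs, this]
  | case3 a b t hab ih =>
    rw [List.cons_append, List.cons_append, compressPairs, if_pos hab, ih, compressPairs, if_pos hab,
      List.cons_append]
    intro c hc d hd
    refine h c ?_ d hd
    have ht : t ≠ [] := by rintro rfl; simp at hc
    rw [getLast?_mem_of_suffix ht ((List.suffix_cons b t).trans (List.suffix_cons a _))]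
    exact hc
  | case4 a b t hab ih =>
    rw [List.cons_append, List.cons_append, compressPairs, if_neg hab, ← List.cons_append, ih,
      compressPairs, if_neg hab, List.cons_append]
    intro c hc d hd
    refine h c ?_ d hd
    rw [getLast?_mem_of_suffix (by simp) (List.suffix_cons a _)]
    exact hc

/-- The first letter of a word, if it belongs to `B`. -/
def firstIn (B : Finset (Letter α)) : List (Letter α) → List (Letter α)
  | [] => []
  | a :: _ => if a ∈ B then [a] else []

/-- The word without its first letter if this belongs to `B`. -/
def dropFirst (B : Finset (Letter α)) : List (Letter α) → List (Letter α)
  | [] => []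
  | a :: t => if a ∈ B then t else a :: t

theorem firstIn_append_dropFirst (B : Finset (Letter α)) (v : List (Letter α)) :
    firstIn B v ++ dropFirst B v = v := by
  cases v with
  | nil => rfl
  | cons a t => simp only [firstIn, dropFirst]; split_ifs <;> rfl

theorem length_firstIn (B : Finset (Letter α)) (v : List (Letter α)) : (firstIn B v).length ≤ 1 := by
  cases v with
  | nil => simp [firstIn]
  | cons a t => simp only [firstIn]; split_ifs <;> simp

theorem mem_of_mem_firstIn {B : Finset (Letter α)} {v : List (Letter α)} {a : Letter α}
    (h : a ∈ firstIn B v) : a ∈ B := by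
  cases v with
  | nil => simp [firstIn] at h
  | cons b t =>
    simp only [firstIn] at h
    split_ifs at h with hb
    · rwa [List.mem_singleton.1 h]
    · simp at h

theorem not_mem_of_firstIn {B : Finset (Letter α)} {v : List (Letter α)} {b : Letter α}
    (h : firstIn B v = []) (hb : v.head? = some b) : b ∉ B := by
  cases v with
  | nil => simp at hb
  | cons c t =>
    obtain rfl : c = b := by simpa using hb
    intro hc
    simp [firstIn, hc] at h

theorem dropFirst_append {B : Finset (Letter α)} {u m : List (Letter α)}
    (h : u = [] → ∀ b ∈ m.head?, b ∉ B) : dropFirst B (u ++ m) = dropFirst B u ++ m := by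
  cases u with
  | nil =>
    cases m with
    | nil => rfl
    | cons b m => simp [dropFirst, h rfl b (by simp)]
  | cons a t => simp only [dropFirst, List.cons_append]; split_ifs <;> rfl

/-- The word without its first letter if it belongs to `B` and without its last letter if it belongs
to `A`. -/
def pairCore (A B : Finset (Letter α)) (v : List (Letter α)) : List (Letter α) :=
  (dropFirst A (dropFirst B v).reverse).reverse

def lastIn (A B : Finset (Letter α)) (v : List (Letter α)) : List (Letter α) :=
  (firstIn A (dropFirst B v).reverse).reverse

theorem pairCore_append_lastIn (A B : Finset (Letter α)) (v : List (Letter α)) :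
    pairCore A B v ++ lastIn A B v = dropFirst B v := by
  rw [pairCore, lastIn, ← List.reverse_append, firstIn_append_dropFirst, List.reverse_reverse]

theorem pair_split (A B : Finset (Letter α)) (v : List (Letter α)) :
    firstIn B v ++ (pairCore A B v ++ lastIn A B v) = v := by
  rw [pairCore_append_lastIn, firstIn_append_dropFirst]

theorem pair_left {A B : Finset (Letter α)} {Y : List (Letter α)} {b : Letter α}
    (h : firstIn B Y = []) (hb : (pairCore A B Y).head? = some b) : b ∉ B := by
  have e := pair_split A B Y
  rw [h, List.nil_append] at e
  refine not_mem_of_firstIn h ?_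
  rw [← e, List.head?_append, hb]
  rfl

theorem pair_right {A B : Finset (Letter α)} {Y : List (Letter α)} {a : Letter α}
    (h : lastIn A B Y = []) (ha : (pairCore A B Y).getLast? = some a) : a ∉ A := by
  have e := pairCore_append_lastIn A B Y
  rw [h, List.append_nil] at e
  rw [lastIn, List.reverse_eq_nil_iff] at h
  refine not_mem_of_firstIn h ?_
  rw [List.head?_reverse, ← e, ha]

/-- Pair compression as a local step. -/
def pairStep (p : ℕ) (A B : Finset (Letter α)) (hAB : Disjoint A B) : LocalStep (Letter α) where
  c := compressPairs p A B
  pre := firstIn B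
  core := pairCore A B
  suf := lastIn A B
  μ := List.length
  split := pair_split A B
  c_nil v := by
    have := length_compressPairs p hAB v
    constructor
    · intro h
      rcases v with _ | ⟨a, _ | ⟨b, t⟩⟩
      · rfl
      · simp [compressPairs] at h
      · rw [compressPairs] at h
        split_ifs at h
    · rintro rfl; rfl
  sep_left Y u₀ u x z hY h := by
    refine compressPairs_append p A B fun a ha b hb hab => ?_
    have hu : u ≠ [] := by rintro rfl; simp at ha
    rw [List.head?_append_of_ne_nil _ hY] at hb
    -- Either nothing was cut off on the left, and the core does not begin in `B`; or a letter of
    -- `B` was cut off, and `u` ends with this letter, which is not in `A`.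
    by_cases he : firstIn B Y = []
    · exact pair_left he hb hab.2
    · rw [getLast?_eq_of_append_eq hu he h] at ha
      exact Finset.disjoint_left.1 hAB hab.1 (mem_of_mem_firstIn (List.mem_of_getLast? ha))
  sep_right Y u u₀ x z hY h := by
    refine compressPairs_append p A B fun a ha b hb hab => ?_
    have hu : u ≠ [] := by rintro rfl; simp at hb
    rw [List.getLast?_append_of_ne_nil _ hY] at ha
    by_cases he : lastIn A B Y = []
    · exact pair_right he ha hab.1
    · rw [head?_eq_of_append_eq hu he h] at hb
      have := List.mem_of_head? hb
      rw [lastIn, List.mem_reverse] at this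
      exact Finset.disjoint_left.1 hAB (mem_of_mem_firstIn this) hab.2
  core_strip Y Z m x z hY hZ h₁ h₂ := by
    refine ⟨firstIn B (x ++ firstIn B Y), dropFirst B (x ++ firstIn B Y),
      (dropFirst A (lastIn A B Z ++ z).reverse).reverse,
      (firstIn A (lastIn A B Z ++ z).reverse).reverse, firstIn_append_dropFirst _ _, ?_, ?_⟩
    · rw [← List.reverse_append, firstIn_append_dropFirst, List.reverse_reverse]
    · have hm : m ≠ [] := by
        rintro rfl
        exact hY (List.prefix_nil.1 h₁)
      have e₁ : dropFirst B ((x ++ firstIn B Y) ++ (m ++ (lastIn A B Z ++ z))) =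
          dropFirst B (x ++ firstIn B Y) ++ (m ++ (lastIn A B Z ++ z)) := by
        refine dropFirst_append fun hu b hb => ?_
        rw [List.head?_append_of_ne_nil _ hm, head?_mem_of_prefix hY h₁] at hb
        exact pair_left (List.append_eq_nil_iff.1 hu).2 hb
      have e₂ : dropFirst A ((lastIn A B Z ++ z).reverse ++
          (dropFirst B (x ++ firstIn B Y) ++ m).reverse) =
          dropFirst A (lastIn A B Z ++ z).reverse ++
            (dropFirst B (x ++ firstIn B Y) ++ m).reverse := by
        refine dropFirst_append fun hu b hb => ?_
        rw [List.head?_reverse, List.getLast?_append_of_ne_nil _ hm, getLast?_mem_of_suffix hZ h₂]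
          at hb
        exact pair_right (List.append_eq_nil_iff.1 (List.reverse_eq_nil_iff.1 hu)).1 hb
      rw [pairCore, e₁, ← List.append_assoc, List.reverse_append (bs := lastIn A B Z ++ z), e₂]
      simp
  μ_append x y := (List.length_append).le
  μ_left x y := by simp
  μ_right x y := by simp
  μ_pre := length_firstIn B
  μ_suf v := by rw [lastIn, List.length_reverse]; exact length_firstIn _ _

end Recompression

/-! ### Amortised cost of the compression over a family of factors -/

namespace Recompression

/-! ### Representations of a text by a family of words -/

namespace Shape

variable {β ι : Type}

/-- The explicit letters of a shape. -/
def letters : Shape β ι → List β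
  | leaf u => u
  | one u _ v => u ++ v
  | two u _ v _ w => u ++ (v ++ w)

theorem Fits.mem {x : List β} {val : ι → List β} {ok : ι → Prop} {sh : Shape β ι}
    (h : sh.Fits x val ok) {a : β} (ha : a ∈ x) : a ∈ sh.letters ∨ ∃ Y, ok Y ∧ a ∈ val Y := by
  cases sh with
  | leaf u => obtain rfl : x = u := h; exact .inl ha
  | one u Y v =>
    obtain ⟨hY, -, rfl⟩ := h
    simp only [List.mem_append, letters] at ha ⊢
    rcases ha with ha | ha | ha
    exacts [.inl (.inl ha), .inr ⟨Y, hY, ha⟩, .inl (.inr ha)]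
  | two u Y v Z w =>
    obtain ⟨⟨hY, -⟩, ⟨hZ, -⟩, rfl⟩ := h
    simp only [List.mem_append, letters] at ha ⊢
    rcases ha with ha | ha | ha | ha | ha
    exacts [.inl (.inl ha), .inr ⟨Y, hY, ha⟩, .inl (.inr (.inl ha)), .inr ⟨Z, hZ, ha⟩,
      .inl (.inr (.inr ha))]

theorem Fits.letters_subset {x : List β} {val : ι → List β} {ok : ι → Prop} {sh : Shape β ι}
    (h : sh.Fits x val ok) {a : β} (ha : a ∈ sh.letters) : a ∈ x := by
  cases sh with
  | leaf u => obtain rfl : x = u := h; exact ha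
  | one u Y v =>
    obtain ⟨-, -, rfl⟩ := h
    simp only [List.mem_append, letters] at ha ⊢
    tauto
  | two u Y v Z w =>
    obtain ⟨-, -, rfl⟩ := h
    simp only [List.mem_append, letters] at ha ⊢
    tauto

theorem Fits.congr {x : List β} {val val' : ι → List β} {ok : ι → Prop} {sh : Shape β ι}
    (h : sh.Fits x val ok) (hv : ∀ Y, ok Y → val Y = val' Y) : sh.Fits x val' ok := by
  cases sh with
  | leaf u => exact h
  | one u Y v =>
    obtain ⟨hY, h₀, h⟩ := h
    rw [hv Y hY] at h h₀
    exact ⟨hY, h₀, h⟩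
  | two u Y v Z w =>
    obtain ⟨⟨hY, h₀⟩, ⟨hZ, h₁⟩, h⟩ := h
    rw [hv Y hY] at h h₀
    rw [hv Z hZ] at h h₁
    exact ⟨⟨hY, h₀⟩, ⟨hZ, h₁⟩, h⟩

end Shape

/-- A family of factors of the text, each composed of explicit letters and of at most two
lower words of the family; the whole text is the word of `top`. -/
structure Rep {β ι : Type} (W : Finset ι) (rank : ι → ℕ) (top : ι) (T : List β)
    (val : ι → List β) (shape : ι → Shape β ι) : Prop where
  top_mem : top ∈ W
  val_top : val top = T
  infix_text : ∀ X ∈ W, val X <:+: T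
  -- The top is excluded as a part, because its word is not cut whereas the word of every part is.
  -- The decreasing rank makes descents into parts terminate.
  fits : ∀ X ∈ W, (shape X).Fits (val X) val fun Y => Y ∈ W ∧ Y ≠ top ∧ rank Y < rank X

namespace Rep

variable {β ι : Type} {W : Finset ι} {rank : ι → ℕ} {top : ι} {T : List β} {val : ι → List β}
  {shape : ι → Shape β ι}

/-- Descent along the rank: a letter that is not explicit in a word belongs to a lower part. New
letters of the text can therefore be counted among the explicit letters. -/
theorem exists_mem_letters (h : Rep W rank top T val shape) {X : ι} (hX : X ∈ W) {a : β}
    (ha : a ∈ val X) : ∃ Y ∈ W, a ∈ (shape Y).letters := by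
  induction hr : rank X using Nat.strong_induction_on generalizing X with
  | _ n ih =>
    rcases (h.fits X hX).mem ha with ha | ⟨Y, ⟨hY, -, hlt⟩, ha⟩
    · exact ⟨X, hX, ha⟩
    · exact ih (rank Y) (hr ▸ hlt) hY ha rfl

/-- A local step leads to a new representation. -/
theorem exists_step [DecidableEq ι] (S : LocalStep β) (h : Rep W rank top T val shape) :
    ∃ (val' : ι → List β) (shape' : ι → Shape β ι),
      Rep W rank top (S.c T) val' (fun X => (shape' X).map S.c) ∧
      (∀ X ∈ W, X ≠ top → val' X = S.c (S.core (val X))) ∧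
      ∀ X ∈ W, (∀ a ∈ (shape' X).letters, a ∈ T) ∧ S.Evolves val (shape X) (shape' X) ∧
        (shape' X).gap S.μ ≤ (shape X).gap S.μ + 4 := by
  have key : ∀ X, ∃ sh' : Shape β ι, X ∈ W →
      sh'.Fits (if X = top then T else S.core (val X)) (fun Y => S.core (val Y))
        (fun Y => Y ∈ W ∧ Y ≠ top ∧ rank Y < rank X) ∧ S.Borders val sh' ∧
      S.Evolves val (shape X) sh' ∧ sh'.gap S.μ ≤ (shape X).gap S.μ + 4 := by
    intro X
    by_cases hX : X ∈ W
    · obtain ⟨⟨sh₁, h₁⟩, sh₂, h₂⟩ := S.exists_shape (h.fits X hX)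
      by_cases ht : X = top
      · refine ⟨sh₁, fun _ => ?_⟩
        rw [if_pos ht, ← h.val_top]
        rw [ht] at h₁ ⊢
        exact h₁
      · refine ⟨sh₂, fun _ => ?_⟩
        rw [if_neg ht]
        exact h₂
    · exact ⟨shape X, fun h => absurd h hX⟩
  choose shape' hs using key
  refine ⟨fun X => S.c (if X = top then T else S.core (val X)), shape', ⟨h.top_mem, ?_, ?_, ?_⟩, ?_,
    fun X hX => ⟨fun a ha => ?_, (hs X hX).2.2⟩⟩
  · simp
  · intro X hX
    by_cases ht : X = top
    · simp [ht]
    · simp only [if_neg ht]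
      exact S.core_infix (h.infix_text X hX)
  · intro X hX
    refine (S.fits_map (hs X hX).1 (hs X hX).2.1).congr ?_
    rintro Y ⟨-, hY, -⟩
    simp [hY]
  · intro X hX ht
    simp [ht]
  · have := (hs X hX).1.letters_subset ha
    by_cases ht : X = top
    · rwa [if_pos ht] at this
    · rw [if_neg ht] at this
      refine (h.infix_text X hX).subset ?_
      rw [← S.split (val X)]
      exact List.mem_append_right _ (List.mem_append_left _ this)

end Rep

/-! ### The cost of pair compression -/

section

variable {α : Type} [DecidableEq α]

/-- The letter replaces a pair in phase `p`. -/
def Letter.isPair (p : ℕ) : Letter α → Bool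
  | .pair q _ _ => q == p
  | _ => false

/-- A replacement turns two letters into one letter of the counted kind, so the number of new
letters is at most the decrease of the length. This is how an explicit word pays for its pairs. -/
theorem countP_isPair_compressPairs (p : ℕ) (A B : Finset (Letter α)) (T : List (Letter α)) :
    (compressPairs p A B T).countP (Letter.isPair p) + (compressPairs p A B T).length ≤
      T.length + T.countP (Letter.isPair p) := by
  induction T using compressPairs.induct A B with
  | case1 => simp [compressPairs]
  | case2 a => rw [compressPairs]; omega
  | case3 a b t h ih =>
    rw [compressPairs, if_pos h]
    simp only [List.countP_cons, List.length_cons]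
    have : Letter.isPair p (.pair p a b) = true := by simp [Letter.isPair]
    simp only [this, if_true]
    omega
  | case4 a b t h ih =>
    rw [compressPairs, if_neg h]
    simp only [List.countP_cons, List.length_cons] at ih ⊢
    omega

theorem pair_mem_compressPairs {p : ℕ} {A B : Finset (Letter α)} (hAB : Disjoint A B)
    {T : List (Letter α)} {a b : Letter α} (h : (a, b) ∈ pairs T) (ha : a ∈ A) (hb : b ∈ B) :
    .pair p a b ∈ compressPairs p A B T := by
  induction T using compressPairs.induct A B with
  | case1 => simp [pairs] at h
  | case2 c => simp [pairs] at h
  | case3 c d t hcd ih =>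
    rw [compressPairs, if_pos hcd, List.mem_cons]
    simp only [pairs, List.tail_cons, List.zip_cons_cons, List.mem_cons, Prod.mk.injEq] at h
    rcases h with ⟨rfl, rfl⟩ | h
    · exact .inl rfl
    · right
      cases t with
      | nil => simp at h
      | cons e t =>
        simp only [List.zip_cons_cons, List.mem_cons, Prod.mk.injEq] at h
        rcases h with ⟨rfl, rfl⟩ | h
        · exact absurd hcd.2 (Finset.disjoint_left.1 hAB ha)
        · exact ih h
  | case4 c d t hcd ih =>
    rw [compressPairs, if_neg hcd, List.mem_cons]
    simp only [pairs, List.tail_cons, List.zip_cons_cons, List.mem_cons, Prod.mk.injEq] at h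
    rcases h with ⟨rfl, rfl⟩ | h
    · exact absurd ⟨ha, hb⟩ hcd
    · exact .inr (ih h)

theorem card_filter_le_sum_countP {β ι : Type} [DecidableEq β] (s : Finset β) (W : Finset ι)
    (f : ι → List β) (P : β → Bool) (h : ∀ x ∈ s, P x = true ∧ ∃ X ∈ W, x ∈ f X) :
    s.card ≤ ∑ X ∈ W, (f X).countP P := by
  classical
  have hsub : s ⊆ W.biUnion fun X => ((f X).filter P).toFinset := by
    intro x hx
    obtain ⟨hP, X, hX, hxX⟩ := h x hx
    exact Finset.mem_biUnion.2 ⟨X, hX, by simp [hxX, hP]⟩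
  refine (Finset.card_le_card hsub).trans (Finset.card_biUnion_le.trans ?_)
  refine Finset.sum_le_sum fun X _ => ?_
  rw [List.countP_eq_length_filter]
  exact List.toFinset_card_le _

theorem countP_letters_map_le {ι : Type} (p : ℕ) (A B : Finset (Letter α))
    (sh : Shape (Letter α) ι) (h : ∀ x ∈ sh.letters, x.isPair p = false) :
    (sh.map (compressPairs p A B)).letters.countP (Letter.isPair p) +
      (sh.map (compressPairs p A B)).gap List.length ≤ sh.gap List.length := by
  have key : ∀ u : List (Letter α), (∀ x ∈ u, x.isPair p = false) →
      (compressPairs p A B u).countP (Letter.isPair p) + (compressPairs p A B u).length ≤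
        u.length := by
    intro u hu
    have h₁ := countP_isPair_compressPairs p A B u
    have h₂ : u.countP (Letter.isPair p) = 0 := List.countP_eq_zero.2 fun x hx => by simp [hu x hx]
    omega
  cases sh with
  | leaf u => exact key u h
  | one u Y v =>
    simp only [Shape.letters, List.mem_append] at h
    have h₁ := key u fun x hx => h x (.inl hx)
    have h₂ := key v fun x hx => h x (.inr hx)
    simp only [Shape.map, Shape.letters, Shape.gap, List.countP_append]
    omega
  | two u Y v Z w =>
    simp only [Shape.letters, List.mem_append] at h
    have h₁ := key u fun x hx => h x (.inl hx)
    have h₂ := key v fun x hx => h x (.inr (.inl hx))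
    have h₃ := key w fun x hx => h x (.inr (.inr hx))
    simp only [Shape.map, Shape.letters, Shape.gap, List.countP_append]
    omega

/-- The length of the word over the input alphabet that a word stands for. -/
def expandLength (v : List (Letter α)) : ℕ := (v.flatMap Letter.expand).length

theorem expandLength_append (u v : List (Letter α)) :
    expandLength (u ++ v) = expandLength u + expandLength v := by simp [expandLength]

/-- The budget for blocks that cover a whole word between two parts; `c` is the length, on a
logarithmic scale, up to which it is granted. -/
noncomputable def growth (c : ℝ) (v : List (Letter α)) : ℝ :=
  -- The empty word is granted `c` more than any other: when it becomes nonempty, the drop by at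
  -- least `c` pays for a block that then fills the room between the parts.
  if v = [] then 2 * c else max 0 (c - Real.logb 2 (expandLength v))

/-- The budget for a shape. -/
noncomputable def Shape.budget {ι : Type} (c : ℝ) : Shape (Letter α) ι → ℝ
  -- Each loss of a part releases at least `4 * c`, enough for the blocks at all four junctions of a
  -- word with two parts at `c` each.
  | .leaf _ => 0
  | .one _ _ _ => 4 * c
  | .two _ _ v _ _ => 8 * c + growth c v

theorem growth_nonneg {c : ℝ} (hc : 0 ≤ c) (v : List (Letter α)) : 0 ≤ growth c v := by
  unfold growth
  split_ifs
  · positivity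
  · exact le_max_left _ _

theorem growth_le {c : ℝ} (hc : 0 ≤ c) {v : List (Letter α)} (hv : v ≠ []) : growth c v ≤ c := by
  rw [growth, if_neg hv]
  refine max_le hc ?_
  rcases Nat.eq_zero_or_pos (expandLength v) with h | h
  -- The logarithm of `0` is `0` by convention.
  · simp [h]
  · have : 0 ≤ Real.logb 2 (expandLength v) :=
      Real.logb_nonneg (by norm_num) (by exact_mod_cast h)
    linarith

theorem growth_anti {c : ℝ} (hc : 0 ≤ c) {u v : List (Letter α)} (h₀ : v = [] → u = [])
    (hu : u ≠ [] → 0 < expandLength u) (h : expandLength u ≤ expandLength v) :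
    growth c v ≤ growth c u := by
  by_cases hu₀ : u = []
  · rw [growth, growth, if_pos hu₀]
    split_ifs with hv
    · exact le_rfl
    · have := growth_le hc hv
      rw [growth, if_neg hv] at this
      linarith
  · have hv : v ≠ [] := fun h => hu₀ (h₀ h)
    rw [growth, growth, if_neg hu₀, if_neg hv]
    refine max_le_max le_rfl (sub_le_sub_left ?_ c)
    have hpos := hu hu₀
    exact Real.logb_le_logb_of_le (by norm_num) (by exact_mod_cast hpos) (by exact_mod_cast h)

/-- In a local step that preserves the words the letters stand for, the budgets do not grow. -/
theorem budget_map_le {ι : Type} {c : ℝ} (hc : 0 ≤ c) (S : LocalStep (Letter α))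
    (hS : ∀ v, expandLength (S.c v) = expandLength v) {val : ι → List (Letter α)}
    {sh sh' : Shape (Letter α) ι} (hpos : ∀ x ∈ sh.letters, 0 < expandLength [x])
    (h : S.Evolves val sh sh') : (sh'.map S.c).budget c ≤ sh.budget c := by
  cases sh with
  | leaf u =>
    cases sh' with
    | leaf u' => exact le_rfl
    | one u' Y' v' => exact h.elim
    | two u' Y' v' Z' w' => exact h.elim
  | one u Y v =>
    cases sh' with
    | leaf u' => simp only [Shape.map, Shape.budget]; positivity
    | one u' Y' v' => exact le_rfl
    | two u' Y' v' Z' w' => exact h.elim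
  | two u Y v Z w =>
    have := growth_nonneg hc v
    cases sh' with
    | leaf u' => simp only [Shape.map, Shape.budget]; positivity
    | one u' Y' v' => simp only [Shape.map, Shape.budget]; linarith
    | two u' Y' v' Z' w' =>
      obtain ⟨-, -, hv⟩ := h
      simp only [Shape.map, Shape.budget]
      refine add_le_add_right ?_ _
      refine growth_anti hc (fun h₀ => ?_) (fun hv₀ => ?_) ?_
      · rw [S.c_nil, hv] at h₀
        simp only [List.append_eq_nil_iff] at h₀
        exact h₀.2.1
      · obtain ⟨a, t, rfl⟩ := List.exists_cons_of_ne_nil hv₀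
        have h₁ := hpos a (by simp [Shape.letters])
        have := expandLength_append [a] t
        rw [List.singleton_append] at this
        omega
      · rw [hS, hv, expandLength_append, expandLength_append]
        omega

theorem expandLength_compressPairs (p : ℕ) (A B : Finset (Letter α)) (v : List (Letter α)) :
    expandLength (compressPairs p A B v) = expandLength v := by
  rw [expandLength, flatMap_expand_compressPairs, expandLength]

theorem expandLength_compressBlocks (p : ℕ) (v : List (Letter α)) :
    expandLength (compressBlocks p v) = expandLength v := by
  rw [expandLength, flatMap_expand_compressBlocks, expandLength]

/-- The cost of pair compression is paid by the explicit letters. -/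
theorem Rep.exists_pairStep {ι : Type} [DecidableEq ι] {W : Finset ι} {rank : ι → ℕ} {top : ι}
    {T : List (Letter α)} {val : ι → List (Letter α)} {shape : ι → Shape (Letter α) ι}
    (h : Rep W rank top T val shape) {p : ℕ} {A B : Finset (Letter α)} (hAB : Disjoint A B)
    (hT : ∀ x ∈ T, x.isPair p = false) (hpos : ∀ x ∈ T, 0 < expandLength [x]) {c : ℝ}
    (hc : 0 ≤ c) :
    ∃ val' shape', Rep W rank top (compressPairs p A B T) val' shape' ∧
      ∑ q ∈ pairProds p A B T, q.2.length + 2 * ∑ X ∈ W, (shape' X).gap List.length ≤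
        2 * ∑ X ∈ W, (shape X).gap List.length + 8 * W.card ∧
      ∑ X ∈ W, (shape' X).budget c ≤ ∑ X ∈ W, (shape X).budget c := by
  obtain ⟨val', shape', h', -, hs⟩ := h.exists_step (pairStep p A B hAB)
  refine ⟨val', fun X => (shape' X).map (compressPairs p A B), h', ?_, ?_⟩
  · have h₁ : ∑ q ∈ pairProds p A B T, q.2.length ≤ 2 * (pairProds p A B T).card := by
      rw [mul_comm, ← smul_eq_mul]
      refine Finset.sum_le_card_nsmul _ _ _ fun q hq => ?_
      obtain ⟨r, -, rfl⟩ := Finset.mem_image.1 hq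
      simp
    -- Each production has its own head, each head occurs in the new text, and each letter of the
    -- text is explicit in some member of the family.
    have h₂ : (pairProds p A B T).card ≤
        ∑ X ∈ W, ((shape' X).map (compressPairs p A B)).letters.countP (Letter.isPair p) := by
      have hcard : (pairProds p A B T).card ≤ ((pairProds p A B T).image Prod.fst).card := by
        rw [Finset.card_image_of_injOn]
        intro x hx y hy hxy
        obtain ⟨r, -, rfl⟩ := Finset.mem_image.1 hx
        obtain ⟨r', -, rfl⟩ := Finset.mem_image.1 hy
        simp only [Letter.pair.injEq, true_and] at hxy
        simp [hxy.1, hxy.2]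
      refine hcard.trans (card_filter_le_sum_countP _ W _ _ fun x hx => ?_)
      obtain ⟨q, hq, rfl⟩ := Finset.mem_image.1 hx
      obtain ⟨⟨a, b⟩, hab, rfl⟩ := Finset.mem_image.1 hq
      simp only [Finset.mem_filter, List.mem_toFinset] at hab
      refine ⟨by simp [Letter.isPair], h'.exists_mem_letters h'.top_mem ?_⟩
      rw [h'.val_top]
      exact pair_mem_compressPairs hAB hab.1 hab.2.1 hab.2.2
    have h₃ : ∑ X ∈ W, (((shape' X).map (compressPairs p A B)).letters.countP (Letter.isPair p) +
        ((shape' X).map (compressPairs p A B)).gap List.length) ≤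
        ∑ X ∈ W, ((shape X).gap List.length + 4) := by
      refine Finset.sum_le_sum fun X hX => ?_
      refine (countP_letters_map_le p A B _ fun x hx => hT x ((hs X hX).1 x hx)).trans ?_
      exact (hs X hX).2.2
    rw [Finset.sum_add_distrib, Finset.sum_add_distrib] at h₃
    simp only [Finset.sum_const, smul_eq_mul] at h₃
    change _ + 2 * ∑ X ∈ W, ((shape' X).map (compressPairs p A B)).gap List.length ≤ _
    omega
  · refine Finset.sum_le_sum fun X hX => ?_
    refine budget_map_le hc (pairStep p A B hAB) (expandLength_compressPairs p A B) (fun x hx => ?_)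
      (hs X hX).2.1
    exact hpos x ((h.infix_text X hX).subset ((h.fits X hX).letters_subset hx))

end

end Recompression

namespace Recompression

variable {α : Type} [DecidableEq α]

/-! ### The cost of block compression: the blocks of a composed word -/

/-- The lengths of the blocks of a word minus their number. -/
noncomputable def excess (u : List (Letter α)) : ℝ := (u.length : ℝ) - blockCount u

theorem sum_maximalBlocks (u : List (Letter α)) :
    ((maximalBlocks u).map fun q => (q.2 : ℝ) - 1).sum = excess u := by
  have : ∀ B : List (Letter α × ℕ),
      (B.map fun q => (q.2 : ℝ) - 1).sum = ((unblock B).length : ℝ) - B.length := by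
    intro B
    induction B with
    | nil => simp [unblock]
    | cons q B ih =>
      simp only [List.map_cons, List.sum_cons, ih, unblock, List.flatMap_cons, List.length_append,
        List.length_replicate, List.length_cons, Nat.cast_add, Nat.cast_one]
      ring
  rw [this, unblock_maximalBlocks, excess, blockCount]

theorem sum_toFinset_le {β : Type} [DecidableEq β] (l : List β) (f : β → ℝ) (hf : ∀ q ∈ l, 0 ≤ f q) :
    ∑ q ∈ l.toFinset, f q ≤ (l.map f).sum := by
  induction l with
  | nil => simp
  | cons q l ih =>
    have ih := ih fun x hx => hf x (by simp [hx])
    have hq := hf q (by simp)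
    rw [List.toFinset_cons, List.map_cons, List.sum_cons]
    by_cases h : q ∈ l.toFinset
    · rw [Finset.insert_eq_of_mem h]; linarith
    · rw [Finset.sum_insert h]; linarith

theorem sub_one_nonneg_of_mem {u : List (Letter α)} {q : Letter α × ℕ} (h : q ∈ maximalBlocks u) :
    (0 : ℝ) ≤ (q.2 : ℝ) - 1 := by
  have : 1 ≤ q.2 := maximalBlocks_pos h
  have : (1 : ℝ) ≤ q.2 := by exact_mod_cast this
  linarith

theorem excess_nonneg (u : List (Letter α)) : 0 ≤ excess u := by
  rw [← sum_maximalBlocks]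
  refine List.sum_nonneg fun x hx => ?_
  obtain ⟨q, hq, rfl⟩ := List.mem_map.1 hx
  exact sub_one_nonneg_of_mem hq

theorem le_excess {u : List (Letter α)} {q : Letter α × ℕ} (h : q ∈ maximalBlocks u) :
    (q.2 : ℝ) ≤ excess u + 1 := by
  have h₁ : ∑ x ∈ (maximalBlocks u).toFinset, ((x.2 : ℝ) - 1) ≤ excess u := by
    rw [← sum_maximalBlocks]
    exact sum_toFinset_le _ _ fun x hx => sub_one_nonneg_of_mem hx
  have h₂ := Finset.single_le_sum (f := fun x : Letter α × ℕ => (x.2 : ℝ) - 1)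
    (s := (maximalBlocks u).toFinset) (fun x hx => sub_one_nonneg_of_mem (List.mem_toFinset.1 hx))
    (List.mem_toFinset.2 h)
  linarith

/-- The blocks of length at least two. -/
def longBlocks (u : List (Letter α)) : Finset (Letter α × ℕ) :=
  (maximalBlocks u).toFinset.filter fun q => 1 < q.2

theorem mem_longBlocks {u : List (Letter α)} {q : Letter α × ℕ} :
    q ∈ longBlocks u ↔ q ∈ maximalBlocks u ∧ 1 < q.2 := by simp [longBlocks]

/-- The blocks within an explicit word: a charge of at most `2 * (l - 1)` for a block of length `l`
is covered by the `l - 1` letters that vanish with it. -/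
theorem sum_longBlocks_le {h : Letter α × ℕ → ℝ} (hh : ∀ q, 1 < q.2 → h q ≤ 2 * ((q.2 : ℝ) - 1))
    (u : List (Letter α)) : ∑ q ∈ longBlocks u, h q ≤ 2 * excess u := by
  have h₁ : ∑ q ∈ longBlocks u, h q ≤ ∑ q ∈ longBlocks u, 2 * ((q.2 : ℝ) - 1) :=
    Finset.sum_le_sum fun q hq => hh q (mem_longBlocks.1 hq).2
  have h₂ : ∑ q ∈ longBlocks u, 2 * ((q.2 : ℝ) - 1) ≤
      ∑ q ∈ (maximalBlocks u).toFinset, 2 * ((q.2 : ℝ) - 1) := by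
    refine Finset.sum_le_sum_of_subset_of_nonneg (Finset.filter_subset _ _) fun q hq _ => ?_
    have := sub_one_nonneg_of_mem (List.mem_toFinset.1 hq)
    positivity
  have h₃ : ∑ x ∈ (maximalBlocks u).toFinset, ((x.2 : ℝ) - 1) ≤ excess u := by
    rw [← sum_maximalBlocks]
    exact sum_toFinset_le _ _ fun x hx => sub_one_nonneg_of_mem hx
  simp only [← Finset.mul_sum] at h₁ h₂
  linarith

/-- The block that `x ++ y` has at the junction. -/
theorem exists_junction (x y : List (Letter α)) :
    ∃ m : Option (Letter α × ℕ),
      (∀ q ∈ maximalBlocks (x ++ y), q ∈ maximalBlocks x ∨ q ∈ maximalBlocks y ∨ q ∈ m) ∧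
      ∀ q ∈ m, ∃ b i j P Q, q = (b, i + j) ∧ maximalBlocks x = P ++ [(b, i)] ∧
        maximalBlocks y = (b, j) :: Q := by
  rcases maximalBlocks_append x y with ⟨-, h⟩ | ⟨P, b, i, j, Q, hx, hy, h⟩
  · refine ⟨none, fun q hq => ?_, by simp⟩
    rw [h, List.mem_append] at hq
    tauto
  · refine ⟨some (b, i + j), fun q hq => ?_, fun q hq => ⟨b, i, j, P, Q, ?_, hx, hy⟩⟩
    · rw [h, List.mem_append, List.mem_cons] at hq
      simp only [hx, hy, List.mem_append, List.mem_cons, Option.mem_def, Option.some.injEq]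
      rcases hq with hq | hq | hq
      exacts [.inl (.inl hq), .inr (.inr hq.symm), .inr (.inl (.inr hq))]
    · simpa using hq.symm

/-- With at least two blocks, the first one cannot be extended from the right. A word with nonempty
core has this property, which keeps its two outer junctions apart. -/
theorem head_maximalBlocks_append {x : List (Letter α)} {q : Letter α × ℕ}
    {l : List (Letter α × ℕ)} (hx : maximalBlocks x = q :: l) (hl : l ≠ []) (y : List (Letter α)) :
    (maximalBlocks (x ++ y)).head? = some q := by
  rcases maximalBlocks_append x y with ⟨-, h⟩ | ⟨P, b, i, j, Q, hx', -, h⟩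
  · rw [h, hx]; rfl
  · rw [h]
    rw [hx] at hx'
    cases P with
    | nil => simp at hx'; exact absurd hx'.2 hl
    | cons r P => simp at hx'; simp [hx'.1]

theorem maximalBlocks_replicate {n : ℕ} (hn : 0 < n) (a : Letter α) :
    maximalBlocks (List.replicate n a) = [(a, n)] := by
  have := maximalBlocks_replicate_append (b := a) hn (t := []) (by simp [maximalBlocks])
  simpa [maximalBlocks] using this

/-- The blocks of a word with nonempty core. -/
theorem maximalBlocks_of_core {Y : List (Letter α)} (h : blockCore Y ≠ []) :
    ∃ a n M b i, M ≠ [] ∧ 0 < n ∧ 0 < i ∧ leadBlock Y = List.replicate n a ∧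
      tailBlock Y = List.replicate i b ∧ maximalBlocks Y = (a, n) :: (M ++ [(b, i)]) := by
  have hY : Y ≠ [] := by rintro rfl; simp [blockCore, dropLead] at h
  obtain ⟨a, t, rfl⟩ := List.exists_cons_of_ne_nil hY
  obtain ⟨n, hn⟩ := leadBlock_cons a t
  obtain ⟨i, b, hi⟩ := tailBlock_eq h
  refine ⟨a, n + 1, maximalBlocks (blockCore (a :: t)), b, i + 1,
    fun h' => h (maximalBlocks_nil_iff.1 h'), by omega, by omega, hn, hi, ?_⟩
  have e : a :: t = leadBlock (a :: t) ++ (blockCore (a :: t) ++ tailBlock (a :: t)) := by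
    rw [blockCore_append_tailBlock, leadBlock_append_dropLead]
  conv_lhs => rw [e]
  rw [maximalBlocks_append_of_ne, maximalBlocks_append_of_ne, hn, hi,
    maximalBlocks_replicate (by omega), maximalBlocks_replicate (by omega)]
  · rfl
  · intro c hc d hd
    exact ne_of_blockCore_tailBlock hc hd
  · intro c hc d hd
    rw [List.head?_append_of_ne_nil _ h] at hd
    exact ne_of_leadBlock_blockCore hc hd

theorem growth_compressBlocks (c : ℝ) (p : ℕ) (v : List (Letter α)) :
    growth c (compressBlocks p v) = growth c v := by
  have : compressBlocks p v = [] ↔ v = [] := (blockStep p).c_nil v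
  simp only [growth, this, expandLength_compressBlocks]

/-- The parts of a shape. -/
def Shape.parts {β ι : Type} : Shape β ι → List ι
  | .leaf _ => []
  | .one _ Y _ => [Y]
  | .two _ Y _ Z _ => [Y, Z]

/-- The block `b ^ n` occurs in `x` with other letters on both sides. -/
def IsInner (x : List (Letter α)) (b : Letter α) (n : ℕ) : Prop :=
  ∃ P R, x = P ++ (List.replicate n b ++ R) ∧ P ≠ [] ∧ R ≠ [] ∧
    (∀ a ∈ P.getLast?, a ≠ b) ∧ ∀ a ∈ R.head?, a ≠ b

/-- The bounds for the charge `h` of the blocks of a word `x` that is composed of the given parts. -/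
structure Charge {ι : Type} (c : ℝ) (h : Letter α × ℕ → ℝ) (x : List (Letter α))
    (val : ι → List (Letter α)) (parts : List ι) : Prop where
  nonneg : ∀ q, 0 ≤ h q
  le_length : ∀ q, 1 < q.2 → h q ≤ 2 * ((q.2 : ℝ) - 1)
  -- For a block that lengthens a block of a part by `t`: the shorter length is represented anyway,
  -- so only a difference of at most about `t` has to be paid.
  le_diff : ∀ Y ∈ parts, ∀ b n t, 0 < t → (b, n) ∈ maximalBlocks (val Y) → h (b, n + t) ≤ t + 1
  -- For the junctions with parts that disappear, where no better bound is available.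
  le_max : ∀ q, h q ≤ c
  -- For a block with an explicit portion of length `t` between two parts that both lengthen it; it
  -- is paid by the portion and by the loss of budget.
  le_growth : ∀ b t n, 0 < t → t ≤ n → IsInner x b n →
    h (b, n) ≤ t + growth c (List.replicate t b) - growth c (List.replicate n b)

theorem sum_le_sum_add_sum {β : Type} [DecidableEq β] {O O₁ O₂ : Finset β} {h : β → ℝ}
    (hh : ∀ q, 0 ≤ h q) (hO : O ⊆ O₁ ∪ O₂) : ∑ q ∈ O, h q ≤ ∑ q ∈ O₁, h q + ∑ q ∈ O₂, h q := by
  have h₁ := Finset.sum_le_sum_of_subset_of_nonneg (f := h) hO fun q _ _ => hh q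
  have h₂ := Finset.sum_union_inter (s₁ := O₁) (s₂ := O₂) (f := h)
  have h₃ := Finset.sum_nonneg (s := O₁ ∩ O₂) fun q _ => hh q
  linarith

theorem sum_filter_option_le {β : Type} [DecidableEq β] {O : Finset β} {h : β → ℝ} (m : Option β)
    {s : ℝ} (hs : 0 ≤ s) (hm : ∀ q ∈ O, q ∈ m → h q ≤ s) : ∑ q ∈ O.filter (· ∈ m), h q ≤ s := by
  cases m with
  | none => simpa
  | some r =>
    by_cases hr : r ∈ O
    · have : O.filter (· ∈ some r) = {r} := by
        ext q
        simp only [Finset.mem_filter, Option.mem_def, Option.some.injEq, Finset.mem_singleton]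
        constructor
        · rintro ⟨-, h⟩; exact h.symm
        · rintro rfl; exact ⟨hr, rfl⟩
      rw [this, Finset.sum_singleton]
      exact hm r hr rfl
    · have : O.filter (· ∈ some r) = ∅ := by
        refine Finset.filter_eq_empty_iff.2 fun q hq h => hr ?_
        rw [Option.mem_def, Option.some.injEq] at h
        rwa [h]
      rw [this, Finset.sum_empty]
      exact hs

theorem Charge.single {ι : Type} {c : ℝ} {h : Letter α × ℕ → ℝ} {x : List (Letter α)}
    {val : ι → List (Letter α)} {parts : List ι} (H : Charge c h x val parts) {Y : ι}
    (hY : Y ∈ parts) {b : Letter α} {n t : ℕ} {u : List (Letter α)}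
    (h₁ : (b, n) ∈ maximalBlocks (val Y)) (h₂ : (b, t) ∈ maximalBlocks u) :
    h (b, n + t) ≤ excess u + 2 := by
  have h₃ := H.le_diff Y hY b n t (maximalBlocks_pos h₂) h₁
  have h₄ := le_excess h₂
  simp only at h₄
  linarith

section own

variable {ι : Type} {c : ℝ} {h : Letter α × ℕ → ℝ} {val : ι → List (Letter α)} {p : ℕ}
  {O : Finset (Letter α × ℕ)}

/-- A block that is not in `val Y` lies in `u` or in `v`, or arises at one of the two junctions. If
the core of `Y` vanishes, a junction pays `c`; otherwise the block there lengthens the first or the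
last block of `val Y` by a block of `u` or `v`, and the letters of that block pay up to a constant.
-/
theorem own_cost_one (hc : 0 ≤ c) {u v : List (Letter α)} {Y : ι}
    (H : Charge c h (u ++ (val Y ++ v)) val [Y])
    (hO : ∀ q ∈ O, q ∈ maximalBlocks (u ++ (val Y ++ v)) ∧ 1 < q.2 ∧ q ∉ maximalBlocks (val Y)) :
    ∑ q ∈ O, h q ≤ 2 * (excess u + excess v) + 4 * c ∧
    (blockCore (val Y) ≠ [] → ∑ q ∈ O, h q ≤ 4 * (excess u + excess v) + 8) := by
  obtain ⟨m₀, hm₀, hd₀⟩ := exists_junction u (val Y ++ v)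
  obtain ⟨m₁, hm₁, hd₁⟩ := exists_junction (val Y) v
  have key : ∀ s₀ s₁, 0 ≤ s₀ → 0 ≤ s₁ → (∀ q ∈ O, q ∈ m₀ → h q ≤ s₀) →
      (∀ q ∈ O, q ∈ m₁ → h q ≤ s₁) →
      ∑ q ∈ O, h q ≤ 2 * (excess u + excess v) + s₀ + s₁ := by
    intro s₀ s₁ h₀ h₁ hs₀ hs₁
    have hsub : O ⊆ longBlocks u ∪ (longBlocks v ∪ (O.filter (· ∈ m₀) ∪ O.filter (· ∈ m₁))) := by
      intro q hq
      obtain ⟨hq₁, hq₂, hq₃⟩ := hO q hq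
      simp only [Finset.mem_union, mem_longBlocks, Finset.mem_filter]
      rcases hm₀ q hq₁ with h | h | h
      · tauto
      · rcases hm₁ q h with h | h | h <;> tauto
      · tauto
    have e₁ := sum_le_sum_add_sum H.nonneg hsub
    have e₂ := sum_le_sum_add_sum H.nonneg
      (Finset.Subset.refl (longBlocks v ∪ (O.filter (· ∈ m₀) ∪ O.filter (· ∈ m₁))))
    have e₃ := sum_le_sum_add_sum H.nonneg
      (Finset.Subset.refl (O.filter (· ∈ m₀) ∪ O.filter (· ∈ m₁)))
    have e₄ := sum_longBlocks_le H.le_length u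
    have e₅ := sum_longBlocks_le H.le_length v
    have e₆ := sum_filter_option_le m₀ h₀ hs₀
    have e₇ := sum_filter_option_le m₁ h₁ hs₁
    linarith
  have hu := excess_nonneg u
  have hv := excess_nonneg v
  refine ⟨?_, fun hY => ?_⟩
  · have := key c c hc hc (fun q _ _ => H.le_max q) (fun q _ _ => H.le_max q)
    linarith
  · obtain ⟨a, n, M, b, i, hM, -, -, -, -, hB⟩ := maximalBlocks_of_core hY
    have := key (excess u + 2) (excess v + 2) (by linarith) (by linarith) ?_ ?_
    · linarith
    · intro q _ hq
      obtain ⟨b', i', j', P, Q, rfl, h₁, h₂⟩ := hd₀ q hq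
      -- Since `val Y` has several blocks, its first one is not changed by `v`, so the block at this
      -- junction lengthens a block of `val Y` itself.
      have h₃ := head_maximalBlocks_append hB (by simp) v
      rw [h₂] at h₃
      simp only [List.head?_cons, Option.some.injEq] at h₃
      rw [add_comm]
      refine H.single (Y := Y) (by simp) ?_ (u := u) (by simp [h₁])
      rw [hB, h₃]
      simp
    · intro q _ hq
      obtain ⟨b', i', j', P, Q, rfl, h₁, h₂⟩ := hd₁ q hq
      exact H.single (Y := Y) (by simp) (by simp [h₁]) (u := v) (by simp [h₂])

/-- There are four junctions. If both cores survive, only the one after `Y` can be difficult: when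
the last block of `Y`, the whole of `v` and the first block of `Z` join, neither part alone accounts
for the length up to the explicit portion. This case is paid by the decrease of `growth`; every
other junction lengthens a block of one part by a block of an explicit word. -/
theorem own_cost_two (hc : 0 ≤ c) {u v w : List (Letter α)} {Y Z : ι}
    (H : Charge c h (u ++ (val Y ++ (v ++ (val Z ++ w)))) val [Y, Z])
    (hpos : ∀ x ∈ v, 0 < expandLength [x])
    (hO : ∀ q ∈ O, q ∈ maximalBlocks (u ++ (val Y ++ (v ++ (val Z ++ w)))) ∧ 1 < q.2 ∧
      q ∉ maximalBlocks (val Y) ∧ q ∉ maximalBlocks (val Z)) :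
    ∑ q ∈ O, h q ≤ 2 * (excess u + excess v + excess w) + 4 * c ∧
    (blockCore (val Y) ≠ [] → blockCore (val Z) ≠ [] →
      ∑ q ∈ O, h q ≤ 4 * (excess u + excess v + excess w) + 8 + growth c v -
        growth c (tailBlock (val Y) ++ (v ++ leadBlock (val Z)))) := by
  obtain ⟨m₀, hm₀, hd₀⟩ := exists_junction u (val Y ++ (v ++ (val Z ++ w)))
  obtain ⟨m₁, hm₁, hd₁⟩ := exists_junction (val Y) (v ++ (val Z ++ w))
  obtain ⟨m₂, hm₂, hd₂⟩ := exists_junction v (val Z ++ w)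
  obtain ⟨m₃, hm₃, hd₃⟩ := exists_junction (val Z) w
  have key : ∀ s₀ s₁ s₂ s₃, 0 ≤ s₀ → 0 ≤ s₁ → 0 ≤ s₂ → 0 ≤ s₃ → (∀ q ∈ O, q ∈ m₀ → h q ≤ s₀) →
      (∀ q ∈ O, q ∈ m₁ → h q ≤ s₁) → (∀ q ∈ O, q ∈ m₂ → h q ≤ s₂) → (∀ q ∈ O, q ∈ m₃ → h q ≤ s₃) →
      ∑ q ∈ O, h q ≤ 2 * (excess u + excess v + excess w) + s₀ + s₁ + s₂ + s₃ := by
    intro s₀ s₁ s₂ s₃ h₀ h₁ h₂ h₃ hs₀ hs₁ hs₂ hs₃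
    have hsub : O ⊆ (longBlocks u ∪ (longBlocks v ∪ longBlocks w)) ∪
        ((O.filter (· ∈ m₀) ∪ O.filter (· ∈ m₁)) ∪ (O.filter (· ∈ m₂) ∪ O.filter (· ∈ m₃))) := by
      intro q hq
      obtain ⟨hq₁, hq₂, hq₃, hq₄⟩ := hO q hq
      simp only [Finset.mem_union, mem_longBlocks, Finset.mem_filter]
      rcases hm₀ q hq₁ with h | h | h
      · tauto
      · rcases hm₁ q h with h | h | h
        · tauto
        · rcases hm₂ q h with h | h | h
          · tauto
          · rcases hm₃ q h with h | h | h <;> tauto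
          · tauto
        · tauto
      · tauto
    have e₁ := sum_le_sum_add_sum H.nonneg hsub
    have e₂ := sum_le_sum_add_sum H.nonneg
      (Finset.Subset.refl (longBlocks u ∪ (longBlocks v ∪ longBlocks w)))
    have e₃ := sum_le_sum_add_sum H.nonneg (Finset.Subset.refl (longBlocks v ∪ longBlocks w))
    have e₄ := sum_le_sum_add_sum H.nonneg (Finset.Subset.refl
      ((O.filter (· ∈ m₀) ∪ O.filter (· ∈ m₁)) ∪ (O.filter (· ∈ m₂) ∪ O.filter (· ∈ m₃))))
    have e₅ := sum_le_sum_add_sum H.nonneg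
      (Finset.Subset.refl (O.filter (· ∈ m₀) ∪ O.filter (· ∈ m₁)))
    have e₆ := sum_le_sum_add_sum H.nonneg
      (Finset.Subset.refl (O.filter (· ∈ m₂) ∪ O.filter (· ∈ m₃)))
    have f₁ := sum_longBlocks_le H.le_length u
    have f₂ := sum_longBlocks_le H.le_length v
    have f₃ := sum_longBlocks_le H.le_length w
    have g₀ := sum_filter_option_le m₀ h₀ hs₀
    have g₁ := sum_filter_option_le m₁ h₁ hs₁
    have g₂ := sum_filter_option_le m₂ h₂ hs₂
    have g₃ := sum_filter_option_le m₃ h₃ hs₃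
    linarith
  have hu := excess_nonneg u
  have hv := excess_nonneg v
  have hw := excess_nonneg w
  refine ⟨?_, fun hY hZ => ?_⟩
  · have := key c c c c hc hc hc hc (fun q _ _ => H.le_max q) (fun q _ _ => H.le_max q)
      (fun q _ _ => H.le_max q) (fun q _ _ => H.le_max q)
    linarith
  · obtain ⟨a, n, M, b, i, hM, hn, hi, hlY, htY, hBY⟩ := maximalBlocks_of_core hY
    obtain ⟨a', n', M', b', i', hM', hn', hi', hlZ, htZ, hBZ⟩ := maximalBlocks_of_core hZ
    have hgr : growth c (tailBlock (val Y) ++ (v ++ leadBlock (val Z))) ≤ growth c v := by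
      refine growth_anti hc (fun h₀ => ?_) (fun hv₀ => ?_) ?_
      · simp only [List.append_eq_nil_iff] at h₀
        exact h₀.2.1
      · obtain ⟨x, t, rfl⟩ := List.exists_cons_of_ne_nil hv₀
        have h₁ := hpos x (by simp)
        have := expandLength_append [x] t
        rw [List.singleton_append] at this
        omega
      · rw [expandLength_append, expandLength_append]
        omega
    have hZw : (maximalBlocks (val Z ++ w)).head? = some (a', n') :=
      head_maximalBlocks_append hBZ (by simp) w
    have := key (excess u + 2) (excess v + 2 + (growth c v -
      growth c (tailBlock (val Y) ++ (v ++ leadBlock (val Z))))) (excess v + 2) (excess w + 2)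
      (by linarith) (by linarith) (by linarith) (by linarith) ?_ ?_ ?_ ?_
    · linarith
    · intro q _ hq
      obtain ⟨c₁, k, j, P, Q, rfl, h₁, h₂⟩ := hd₀ q hq
      have h₃ := head_maximalBlocks_append hBY (by simp) (v ++ (val Z ++ w))
      rw [h₂] at h₃
      simp only [List.head?_cons, Option.some.injEq] at h₃
      rw [add_comm]
      refine H.single (Y := Y) (by simp) ?_ (u := u) (by simp [h₁])
      rw [hBY, h₃]
      simp
    · intro q _ hq
      obtain ⟨c₁, k, j, P, Q, rfl, h₁, h₂⟩ := hd₁ q hq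
      obtain ⟨rfl, rfl⟩ : c₁ = b ∧ k = i := by
        have := congrArg List.getLast? h₁
        rw [hBY, ← List.cons_append, List.getLast?_concat, List.getLast?_concat] at this
        simpa [eq_comm] using this
      have hsingle : (c₁, j) ∈ maximalBlocks v → h (c₁, k + j) ≤ excess v + 2 := fun hj =>
        H.single (Y := Y) (by simp) (by simp [h₁]) (u := v) hj
      have hsingle' : (c₁, j) ∈ maximalBlocks v → h (c₁, k + j) ≤ excess v + 2 + (growth c v -
          growth c (tailBlock (val Y) ++ (v ++ leadBlock (val Z)))) := fun hj => by
        have := hsingle hj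
        linarith
      -- For empty `v` the budget falls from `2 * c` to at most `c`, which pays the maximal charge.
      -- With two or more blocks in `v`, the junction sees only the first of them. With exactly one,
      -- it matters whether this block also joins the first block of `Z`.
      cases hv₀ : maximalBlocks v with
      | nil =>
        rw [maximalBlocks_nil_iff] at hv₀
        have h₃ := growth_le hc (v := tailBlock (val Y) ++ (v ++ leadBlock (val Z)))
          (by simp [htY, hi.ne'])
        have h₄ : growth c v = 2 * c := by simp [growth, hv₀]
        have h₅ := H.le_max (c₁, k + j)
        linarith
      | cons r l =>
        by_cases hl : l = []
        · rcases maximalBlocks_append v (val Z ++ w) with ⟨-, h₃⟩ | ⟨P', d, k', j', Q', h₃, h₄, h₅⟩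
          · rw [h₃, hv₀] at h₂
            simp only [List.cons_append, List.cons.injEq] at h₂
            exact hsingle' (by simp [hv₀, h₂.1])
          · rw [hv₀, hl] at h₃
            have hP' : P' = [] := by
              cases P' with
              | nil => rfl
              | cons s P' => simp at h₃
            subst hP'
            rw [h₅] at h₂
            rw [h₄] at hZw
            simp only [List.nil_append, List.cons.injEq, Prod.mk.injEq, and_true, List.head?_cons,
              Option.some.injEq] at h₂ h₃ hZw
            obtain ⟨⟨rfl, rfl⟩, -⟩ := h₂
            obtain ⟨rfl, rfl⟩ := hZw
            have hk' : 0 < k' := maximalBlocks_pos (T := v) (q := (d, k')) (by simp [hv₀, h₃])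
            have hvr : v = List.replicate k' d := by
              rw [← unblock_maximalBlocks v, hv₀, hl, h₃]
              simp [unblock]
            have hmid : tailBlock (val Y) ++ (v ++ leadBlock (val Z)) =
                List.replicate (k + (k' + j')) d := by
              rw [htY, hvr, hlZ, ← List.replicate_add, ← List.replicate_add]
            have h₆ := H.le_growth d k' (k + (k' + j')) hk' (by omega) ?_
            · have h₇ := le_excess (u := v) (q := (d, k')) (by simp [hv₀, h₃])
              rw [← hmid, ← hvr] at h₆
              simp only at h₇
              linarith
            -- The cores of `Y` and `Z` surround the joint block, and the letter changes where they
            -- meet it.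
            · refine ⟨u ++ (leadBlock (val Y) ++ blockCore (val Y)),
                blockCore (val Z) ++ (tailBlock (val Z) ++ w), ?_, by simp [hY], by simp [hZ], ?_, ?_⟩
              · rw [← hmid]
                conv_lhs => rw [← (blockStep 0).split (val Y), ← (blockStep 0).split (val Z)]
                simp [blockStep]
              · intro x hx
                rw [← List.append_assoc, List.getLast?_append_of_ne_nil _ hY] at hx
                refine ne_of_blockCore_tailBlock hx ?_
                obtain ⟨k, rfl⟩ := Nat.exists_eq_add_of_lt hi
                simp [htY, List.replicate_succ]
              · intro x hx
                rw [List.head?_append_of_ne_nil _ hZ] at hx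
                refine (ne_of_leadBlock_blockCore ?_ hx).symm
                obtain ⟨k, rfl⟩ := Nat.exists_eq_add_of_lt hn'
                simp [hlZ, List.replicate_succ']
        · have h₃ := head_maximalBlocks_append hv₀ hl (val Z ++ w)
          rw [h₂] at h₃
          simp only [List.head?_cons, Option.some.injEq] at h₃
          exact hsingle' (by simp [hv₀, h₃])
    · intro q _ hq
      obtain ⟨c₁, k, j, P, Q, rfl, h₁, h₂⟩ := hd₂ q hq
      rw [h₂] at hZw
      simp only [List.head?_cons, Option.some.injEq] at hZw
      rw [add_comm]
      refine H.single (Y := Z) (by simp) ?_ (u := v) (by simp [h₁])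
      rw [hBZ, hZw]
      simp
    · intro q _ hq
      obtain ⟨c₁, k, j, P, Q, rfl, h₁, h₂⟩ := hd₃ q hq
      exact H.single (Y := Z) (by simp) (by simp [h₁]) (u := w) (by simp [h₂])

/-- The charges of the blocks that occur in a word but not in its parts. -/
theorem own_cost (hc : 0 ≤ c) {x : List (Letter α)} {ok : ι → Prop} {sh sh' : Shape (Letter α) ι}
    (hx : sh.Fits x val ok) (H : Charge c h x val sh.parts)
    (hpos : ∀ x ∈ sh.letters, 0 < expandLength [x]) (hev : (blockStep p).Evolves val sh sh')
    (hcore : ∀ Y ∈ sh'.parts, blockCore (val Y) ≠ [])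
    (hO : ∀ q ∈ O, q ∈ maximalBlocks x ∧ 1 < q.2 ∧ ∀ Y ∈ sh.parts, q ∉ maximalBlocks (val Y)) :
    ∑ q ∈ O, h q + 4 * (sh.gap blockCount : ℝ) + (sh'.map (compressBlocks p)).budget c ≤
      4 * (sh.gap List.length : ℝ) + sh.budget c + 8 := by
  -- The sums of `excess` are the differences between counting the explicit words in letters and in
  -- blocks. Four times this difference is available, and the loss of a part releases at least `4 *
  -- c` of budget.
  cases sh with
  | leaf u =>
    obtain rfl : x = u := hx
    have h₁ : ∑ q ∈ O, h q ≤ 2 * excess x := by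
      refine (Finset.sum_le_sum_of_subset_of_nonneg (t := longBlocks x) (fun q hq => ?_)
        fun q _ _ => H.nonneg q).trans (sum_longBlocks_le H.le_length x)
      exact mem_longBlocks.2 ⟨(hO q hq).1, (hO q hq).2.1⟩
    have h₂ := excess_nonneg x
    cases sh' with
    | leaf u' =>
      simp only [Shape.gap, Shape.map, Shape.budget]
      unfold excess at *
      linarith
    | one u' Y' v' => exact hev.elim
    | two u' Y' v' Z' w' => exact hev.elim
  | one u Y v =>
    obtain ⟨-, -, rfl⟩ := hx
    obtain ⟨h₁, h₂⟩ := own_cost_one hc H fun q hq =>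
      ⟨(hO q hq).1, (hO q hq).2.1, (hO q hq).2.2 Y (by simp [Shape.parts])⟩
    have hu := excess_nonneg u
    have hv := excess_nonneg v
    cases sh' with
    | leaf u' =>
      simp only [Shape.gap, Shape.map, Shape.budget, Nat.cast_add]
      unfold excess at *
      linarith
    | one u' Y' v' =>
      obtain rfl : Y' = Y := hev
      have := h₂ (hcore _ (by simp [Shape.parts]))
      simp only [Shape.gap, Shape.map, Shape.budget, Nat.cast_add]
      unfold excess at *
      linarith
    | two u' Y' v' Z' w' => exact hev.elim
  | two u Y v Z w =>
    obtain ⟨-, -, rfl⟩ := hx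
    obtain ⟨h₁, h₂⟩ := own_cost_two hc H
      (fun x hx => hpos x (by simp [Shape.letters, hx])) fun q hq =>
      ⟨(hO q hq).1, (hO q hq).2.1, (hO q hq).2.2 Y (by simp [Shape.parts]),
        (hO q hq).2.2 Z (by simp [Shape.parts])⟩
    have hu := excess_nonneg u
    have hv := excess_nonneg v
    have hw := excess_nonneg w
    have hg := growth_nonneg hc v
    cases sh' with
    | leaf u' =>
      simp only [Shape.gap, Shape.map, Shape.budget, Nat.cast_add]
      unfold excess at *
      linarith
    | one u' Y' v' =>
      simp only [Shape.gap, Shape.map, Shape.budget, Nat.cast_add]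
      unfold excess at *
      linarith
    | two u' Y' v' Z' w' =>
      obtain ⟨rfl, rfl, rfl⟩ := hev
      have := h₂ (hcore _ (by simp [Shape.parts])) (hcore _ (by simp [Shape.parts]))
      simp only [Shape.gap, Shape.map, Shape.budget, Nat.cast_add, growth_compressBlocks]
      unfold excess at *
      simp only [blockStep]
      linarith

end own

end Recompression

namespace Recompression

variable {α : Type} [DecidableEq α]

/-! ### The cost of block compression: differences of block lengths -/

/-- The largest length smaller than that of `q` of a block of the same letter in `L`, or `0`. -/
def predLength (L : Finset (Letter α × ℕ)) (q : Letter α × ℕ) : ℕ :=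
  (L.filter fun r => r.1 = q.1 ∧ r.2 < q.2).sup Prod.snd

/-- The logarithm of the difference to the preceding length. -/
noncomputable def diffCost (L : Finset (Letter α × ℕ)) (q : Letter α × ℕ) : ℝ :=
  Real.logb 2 (1 + ((q.2 - predLength L q : ℕ) : ℝ))

theorem diffCost_nonneg (L : Finset (Letter α × ℕ)) (q : Letter α × ℕ) : 0 ≤ diffCost L q :=
  Real.logb_nonneg (by norm_num) (by
    have : (0 : ℝ) ≤ ((q.2 - predLength L q : ℕ) : ℝ) := Nat.cast_nonneg _
    linarith)

theorem le_predLength {L : Finset (Letter α × ℕ)} {q r : Letter α × ℕ} (hr : r ∈ L)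
    (h₁ : r.1 = q.1) (h₂ : r.2 < q.2) : r.2 ≤ predLength L q :=
  Finset.le_sup (f := Prod.snd) (Finset.mem_filter.2 ⟨hr, h₁, h₂⟩)

theorem predLength_mem {L : Finset (Letter α × ℕ)} {q : Letter α × ℕ} (h : 0 < predLength L q) :
    (q.1, predLength L q) ∈ L ∧ predLength L q < q.2 := by
  have hne : (L.filter fun r => r.1 = q.1 ∧ r.2 < q.2).Nonempty := by
    rw [Finset.nonempty_iff_ne_empty]
    intro h₀
    rw [predLength, h₀] at h
    simp at h
  obtain ⟨r, hr, he⟩ := Finset.exists_mem_eq_sup _ hne Prod.snd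
  rw [Finset.mem_filter] at hr
  have : predLength L q = r.2 := he
  rw [this, ← hr.2.1]
  exact ⟨hr.1, hr.2.2⟩

theorem logb_one_add_mono {m n : ℕ} (h : m ≤ n) :
    Real.logb 2 (1 + (m : ℝ)) ≤ Real.logb 2 (1 + (n : ℝ)) := by
  have : (m : ℝ) ≤ n := by exact_mod_cast h
  exact Real.logb_le_logb_of_le (by norm_num) (by positivity) (by linarith)

theorem logb_one_add_add (m n : ℕ) :
    Real.logb 2 (1 + ((m + n : ℕ) : ℝ)) ≤ Real.logb 2 (1 + (m : ℝ)) + Real.logb 2 (1 + (n : ℝ)) := by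
  rw [← Real.logb_mul (by positivity) (by positivity)]
  refine Real.logb_le_logb_of_le (by norm_num) (by positivity) ?_
  push_cast
  nlinarith [(Nat.cast_nonneg m : (0 : ℝ) ≤ m), (Nat.cast_nonneg n : (0 : ℝ) ≤ n)]

/-- Since `log (1 + m + n) ≤ log (1 + m) + log (1 + n)`, refining the set of lengths can only raise
the sum. This permits `L` to contain more blocks than those of the text. -/
theorem logb_le_sum_diffCost (L : Finset (Letter α × ℕ)) (a : Letter α) (k l : ℕ) (hkl : k < l)
    (hl : (a, l) ∈ L) :
    Real.logb 2 (1 + ((l - k : ℕ) : ℝ)) ≤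
      ∑ q ∈ L.filter (fun q => q.1 = a ∧ k < q.2 ∧ q.2 ≤ l), diffCost L q := by
  induction l using Nat.strong_induction_on with
  | _ l ih =>
    have hmem : (a, l) ∈ L.filter (fun q => q.1 = a ∧ k < q.2 ∧ q.2 ≤ l) := by
      simp [hl, hkl]
    by_cases hy : predLength L (a, l) ≤ k
    · refine le_trans ?_ (Finset.single_le_sum (fun q _ => diffCost_nonneg L q) hmem)
      exact logb_one_add_mono (by simp only; omega)
    · push Not at hy
      obtain ⟨h₁, h₂⟩ := predLength_mem (q := (a, l)) (by omega : 0 < predLength L (a, l))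
      simp only at h₁ h₂
      have := ih _ h₂ hy h₁
      have e : l - k = (l - predLength L (a, l)) + (predLength L (a, l) - k) := by omega
      rw [e]
      refine (logb_one_add_add _ _).trans ?_
      rw [← Finset.add_sum_erase _ _ hmem]
      refine add_le_add le_rfl (this.trans ?_)
      refine Finset.sum_le_sum_of_subset_of_nonneg (fun q hq => ?_) fun q _ _ => diffCost_nonneg L q
      simp only [Finset.mem_filter, Finset.mem_erase] at hq ⊢
      refine ⟨?_, hq.1, hq.2.1, hq.2.2.1, by omega⟩
      rintro rfl
      simp only at hq
      omega

theorem sum_zip_le (L : Finset (Letter α × ℕ)) (a : Letter α) (k : ℕ) (ls : List ℕ)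
    (hs : (k :: ls).SortedLT) (hL : ∀ l ∈ ls, (a, l) ∈ L) :
    (((k :: ls).zip ls).map fun r => Real.logb 2 (1 + ((r.2 - r.1 : ℕ) : ℝ))).sum ≤
      ∑ q ∈ L.filter (fun q => q.1 = a ∧ k < q.2), diffCost L q := by
  induction ls generalizing k with
  | nil =>
    simp only [List.zip_nil_right, List.map_nil, List.sum_nil]
    exact Finset.sum_nonneg fun q _ => diffCost_nonneg L q
  | cons l ls ih =>
    rw [List.sortedLT_iff_pairwise, List.pairwise_cons] at hs
    have hkl : k < l := hs.1 l (by simp)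
    have h₁ := ih l hs.2.sortedLT fun x hx => hL x (by simp [hx])
    have h₂ := logb_le_sum_diffCost L a k l hkl (hL l (by simp))
    rw [List.zip_cons_cons, List.map_cons, List.sum_cons]
    refine (add_le_add h₂ h₁).trans ?_
    rw [← Finset.sum_union]
    · refine Finset.sum_le_sum_of_subset_of_nonneg (fun q hq => ?_) fun q _ _ => diffCost_nonneg L q
      simp only [Finset.mem_union, Finset.mem_filter] at hq ⊢
      rcases hq with hq | hq
      · exact ⟨hq.1, hq.2.1, hq.2.2.1⟩
      · exact ⟨hq.1, hq.2.1, by omega⟩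
    · refine Finset.disjoint_left.2 fun q hq hq' => ?_
      simp only [Finset.mem_filter] at hq hq'
      omega

theorem length_bitIndices_le (n : ℕ) : n.bitIndices.length ≤ Nat.log 2 n + 1 := by
  have h : n.bitIndices.toFinset ⊆ Finset.range (Nat.log 2 n + 1) := by
    intro i hi
    rw [List.mem_toFinset] at hi
    rw [Finset.mem_range, Nat.lt_succ_iff]
    exact Nat.le_log_of_pow_le (by norm_num) (Nat.two_pow_le_of_mem_bitIndices hi)
  have := Finset.card_le_card h
  rwa [List.toFinset_card_of_nodup Nat.bitIndices_nodup, Finset.card_range] at this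

theorem natLog_le_logb (n : ℕ) : (Nat.log 2 n : ℝ) ≤ Real.logb 2 (1 + (n : ℝ)) := by
  rcases Nat.eq_zero_or_pos n with rfl | hn
  · simp
  · refine (Real.natLog_le_logb n 2).trans ?_
    exact Real.logb_le_logb_of_le (by norm_num) (by exact_mod_cast hn) (by simp)

theorem one_le_logb {n : ℕ} (hn : n ≠ 0) : 1 ≤ Real.logb 2 (1 + (n : ℝ)) := by
  have h : (1 : ℝ) ≤ n := by exact_mod_cast Nat.one_le_iff_ne_zero.2 hn
  have : Real.logb 2 2 ≤ Real.logb 2 (1 + (n : ℝ)) :=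
    Real.logb_le_logb_of_le (by norm_num) (by norm_num) (by linarith)
  simpa using this

theorem sum_toFinset_nat_le {β γ : Type} [DecidableEq β] (l : List γ) (g : γ → β) (f : β → ℕ) :
    ∑ q ∈ (l.map g).toFinset, f q ≤ (l.map fun r => f (g r)).sum := by
  induction l with
  | nil => simp
  | cons q l ih =>
    rw [List.map_cons, List.toFinset_cons, List.map_cons, List.sum_cons]
    by_cases h : g q ∈ (l.map g).toFinset
    · rw [Finset.insert_eq_of_mem h]; omega
    · rw [Finset.sum_insert h]; omega

theorem log_foldr_max_le (l : List ℕ) :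
    Nat.log 2 (l.foldr max 0) ≤ (l.map (Nat.log 2)).sum := by
  induction l with
  | nil => simp
  | cons n l ih =>
    rw [List.foldr_cons, List.map_cons, List.sum_cons]
    rcases max_cases n (l.foldr max 0) with ⟨h, -⟩ | ⟨h, -⟩ <;> rw [h] <;> omega

/-- For a difference `d`: the powers cost `2 log d` (the logarithm of the maximum is at most the sum
of all), the binary digits `log d + 1`, the production of the block `2`. With `log d` and `1` both
at most `log (1 + d)` this gives the factor `6`. -/
theorem cost_blockProds_le (p : ℕ) (a : Letter α) (ls : List ℕ)
    (h : ∀ r ∈ consecutive ls, r.1 < r.2) :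
    ((∑ q ∈ blockProds p a ls, q.2.length : ℕ) : ℝ) ≤
      6 * ((consecutive ls).map fun r => Real.logb 2 (1 + ((r.2 - r.1 : ℕ) : ℝ))).sum := by
  have hnat : ∑ q ∈ blockProds p a ls, q.2.length ≤
      ((consecutive ls).map fun r => 3 * Nat.log 2 (r.2 - r.1) + 3).sum := by
    have hun : ∀ s t : Finset (Letter α × List (Letter α)),
        ∑ q ∈ s ∪ t, q.2.length ≤ ∑ q ∈ s, q.2.length + ∑ q ∈ t, q.2.length := fun s t =>
      (Nat.le_add_right _ _).trans (Finset.sum_union_inter (s₁ := s) (s₂ := t)).le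
    unfold blockProds
    refine (hun _ _).trans ((Nat.add_le_add_right (hun _ _) _).trans ?_)
    have h₁ : ∑ q ∈ (Finset.Icc 1 (Nat.log 2 (((consecutive ls).map fun q => q.2 - q.1).foldr max 0))).image
        (fun i => (Letter.power p a i, [powerLetter p a (i - 1), powerLetter p a (i - 1)])),
        q.2.length ≤ 2 * ((consecutive ls).map fun r => Nat.log 2 (r.2 - r.1)).sum := by
      refine (Finset.sum_image_le_of_nonneg fun _ _ => Nat.zero_le _).trans ?_
      have := log_foldr_max_le ((consecutive ls).map fun q => q.2 - q.1)
      simp only [List.map_map] at this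
      simp only [List.length_cons, List.length_nil, Finset.sum_const, Nat.card_Icc, smul_eq_mul]
      have e : (Nat.log 2 ∘ fun q : ℕ × ℕ => q.2 - q.1) = fun r : ℕ × ℕ => Nat.log 2 (r.2 - r.1) := rfl
      rw [e] at this
      omega
    have h₂ := sum_toFinset_nat_le (consecutive ls) (fun q =>
      (Letter.diff p a q.1 q.2, (Nat.bitIndices (q.2 - q.1)).map (powerLetter p a)))
      fun q => q.2.length
    have h₃ := sum_toFinset_nat_le (consecutive ls) (fun q => (Letter.block p a q.2,
      Letter.diff p a q.1 q.2 :: if q.1 = 0 then [] else [Letter.block p a q.1])) fun q => q.2.length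
    refine (Nat.add_le_add (Nat.add_le_add h₁ h₂) h₃).trans ?_
    clear h₁ h₂ h₃
    generalize consecutive ls = R at h
    induction R with
    | nil => simp
    | cons r R ih =>
      have ih := ih fun x hx => h x (by simp [hx])
      have hr := h r (by simp)
      have hb := length_bitIndices_le (r.2 - r.1)
      have : (if r.1 = 0 then [] else [Letter.block p a r.1] : List (Letter α)).length ≤ 1 := by
        split_ifs <;> simp
      simp only [List.map_cons, List.sum_cons, List.length_map, List.length_cons] at ih ⊢
      omega
  refine (Nat.cast_le.2 hnat).trans ?_
  clear hnat
  generalize consecutive ls = R at h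
  induction R with
  | nil => simp
  | cons r R ih =>
    have ih := ih fun x hx => h x (by simp [hx])
    have hr := h r (by simp)
    have h₁ := natLog_le_logb (r.2 - r.1)
    have h₂ := one_le_logb (n := r.2 - r.1) (by omega)
    simp only [List.map_cons, List.sum_cons, Nat.cast_add, Nat.cast_mul, Nat.cast_ofNat] at ih ⊢
    linarith

theorem sum_fiber_le (L : Finset (Letter α × ℕ)) (A : Finset (Letter α)) (f : Letter α × ℕ → ℝ)
    (hf : ∀ q, 0 ≤ f q) : ∑ a ∈ A, ∑ q ∈ L.filter (fun q => q.1 = a), f q ≤ ∑ q ∈ L, f q := by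
  simp only [Finset.sum_filter]
  rw [Finset.sum_comm]
  refine Finset.sum_le_sum fun q _ => ?_
  rw [Finset.sum_ite_eq]
  split_ifs
  · exact le_rfl
  · exact hf q

/-- The cost of block compression is bounded by the logarithms of the differences of lengths, in
each set of blocks that contains the ones compressed. -/
theorem cost_allBlockProds_le (p : ℕ) (T : List (Letter α)) (L : Finset (Letter α × ℕ))
    (hL : longBlocks T ⊆ L) :
    ((∑ q ∈ allBlockProds p T, q.2.length : ℕ) : ℝ) ≤ 6 * ∑ q ∈ L, diffCost L q := by
  have h₁ : ∑ q ∈ allBlockProds p T, q.2.length ≤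
      ∑ a ∈ T.toFinset, ∑ q ∈ blockProds p a (blockLengths T a), q.2.length := by
    unfold allBlockProds
    induction T.toFinset using Finset.induction_on with
    | empty => simp
    | insert a A ha ih =>
      rw [Finset.biUnion_insert, Finset.sum_insert ha]
      have := Finset.sum_union_inter (s₁ := blockProds p a (blockLengths T a))
        (s₂ := A.biUnion fun a => blockProds p a (blockLengths T a)) (f := fun q => q.2.length)
      omega
  have h₂ : ∀ a ∈ T.toFinset, ((∑ q ∈ blockProds p a (blockLengths T a), q.2.length : ℕ) : ℝ) ≤
      6 * ∑ q ∈ L.filter (fun q => q.1 = a), diffCost L q := by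
    intro a _
    refine (cost_blockProds_le p a _ fun r hr => lt_of_mem_consecutive hr).trans ?_
    refine mul_le_mul_of_nonneg_left ?_ (by norm_num)
    refine (sum_zip_le L a 0 _ (sortedLT_blockLengths T a) fun l hl => hL ?_).trans ?_
    · exact mem_longBlocks.2 (mem_blockLengths.1 hl)
    · refine Finset.sum_le_sum_of_subset_of_nonneg (fun q hq => ?_) fun q _ _ => diffCost_nonneg L q
      simp only [Finset.mem_filter] at hq ⊢
      exact ⟨hq.1, hq.2.1⟩
  refine (Nat.cast_le.2 h₁).trans ?_
  push_cast at h₂ ⊢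
  refine (Finset.sum_le_sum h₂).trans ?_
  rw [← Finset.mul_sum]
  exact mul_le_mul_of_nonneg_left (sum_fiber_le L _ _ (diffCost_nonneg L)) (by norm_num)

/-- The differences of consecutive lengths of one letter telescope to the greatest length. -/
theorem sum_diff_le (L : Finset (Letter α × ℕ)) (a : Letter α) (m : ℕ) :
    ∑ q ∈ L.filter (fun q => q.1 = a ∧ q.2 ≤ m), (q.2 - predLength L q) ≤ m := by
  induction m using Nat.strong_induction_on with
  | _ m ih =>
    by_cases hm : (a, m) ∈ L
    · have hmem : (a, m) ∈ L.filter (fun q => q.1 = a ∧ q.2 ≤ m) := by simp [hm]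
      rw [← Finset.add_sum_erase _ _ hmem]
      simp only
      have hsub : (L.filter (fun q => q.1 = a ∧ q.2 ≤ m)).erase (a, m) ⊆
          L.filter (fun q => q.1 = a ∧ q.2 ≤ predLength L (a, m)) := by
        intro q hq
        simp only [Finset.mem_filter, Finset.mem_erase] at hq ⊢
        refine ⟨hq.2.1, hq.2.2.1, le_predLength hq.2.1 hq.2.2.1 ?_⟩
        refine lt_of_le_of_ne hq.2.2.2 fun h => hq.1 (Prod.ext hq.2.2.1 h)
      have h₁ := Finset.sum_le_sum_of_subset (f := fun q => q.2 - predLength L q) hsub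
      rcases Nat.eq_zero_or_pos (predLength L (a, m)) with h₀ | h₀
      · rcases Nat.eq_zero_or_pos m with rfl | hm₀
        · refine le_of_eq ?_
          simp only [Nat.zero_sub, zero_add]
          refine Finset.sum_eq_zero fun q hq => ?_
          simp only [Finset.mem_erase, Finset.mem_filter] at hq
          omega
        · have := ih 0 hm₀
          rw [h₀] at h₁
          omega
      · have h₂ := (predLength_mem h₀).2
        have := ih _ h₂
        simp only at h₂
        omega
    · rcases Nat.eq_zero_or_pos m with rfl | hm₀
      · refine le_of_eq (Finset.sum_eq_zero fun q hq => ?_)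
        simp only [Finset.mem_filter] at hq
        omega
      · refine le_trans (Finset.sum_le_sum_of_subset fun q hq => ?_) ((ih (m - 1) (by omega)).trans
          (by omega))
        simp only [Finset.mem_filter] at hq ⊢
        refine ⟨hq.1, hq.2.1, ?_⟩
        have : q.2 ≠ m := fun h => hm (by rw [← h, ← hq.2.1]; exact hq.1)
        omega

theorem le_count_of_mem_maximalBlocks {T : List (Letter α)} {q : Letter α × ℕ}
    (h : q ∈ maximalBlocks T) : q.2 ≤ T.count q.1 := by
  conv_rhs => rw [← unblock_maximalBlocks T, unblock, List.count_flatMap]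
  have := List.single_le_sum (l := (maximalBlocks T).map
    (List.count q.1 ∘ fun r => List.replicate r.2 r.1)) (fun _ _ => Nat.zero_le _) q.2
    (List.mem_map.2 ⟨q, h, by simp⟩)
  exact this

/-- For each letter the telescoping sum is at most its number of occurrences in the text. -/
theorem sum_diff_le_length (L : Finset (Letter α × ℕ)) (T : List (Letter α))
    (hL : ∀ q ∈ L, q.1 ∈ T ∧ q.2 ≤ T.count q.1) :
    ∑ q ∈ L, (q.2 - predLength L q) ≤ T.length := by
  rw [← Finset.sum_fiberwise_of_maps_to (t := T.toFinset) (g := Prod.fst)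
    fun q hq => List.mem_toFinset.2 (hL q hq).1]
  have : T.length = ∑ a ∈ T.toFinset, T.count a := (List.sum_toFinset_count_eq_length T).symm
  rw [this]
  refine Finset.sum_le_sum fun a _ => ?_
  refine le_trans (Finset.sum_le_sum_of_subset fun q hq => ?_) (sum_diff_le L a (T.count a))
  simp only [Finset.mem_filter] at hq ⊢
  exact ⟨hq.1, hq.2, hq.2 ▸ (hL q hq.1).2⟩

theorem expandLength_replicate (n : ℕ) (a : Letter α) :
    expandLength (List.replicate n a) = n * expandLength [a] := by
  induction n with
  | zero => simp [expandLength]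
  | succ n ih =>
    have := expandLength_append [a] (List.replicate n a)
    rw [List.singleton_append, ← List.replicate_succ] at this
    rw [this, ih]
    ring

theorem sum_expandLength_blocks (T : List (Letter α)) :
    ∑ q ∈ (maximalBlocks T).toFinset, q.2 * expandLength [q.1] ≤ expandLength T := by
  have h₁ := sum_toFinset_nat_le (maximalBlocks T) id fun q => q.2 * expandLength [q.1]
  rw [List.map_id] at h₁
  refine h₁.trans (le_of_eq ?_)
  conv_rhs => rw [← unblock_maximalBlocks T]
  generalize maximalBlocks T = B
  induction B with
  | nil => simp [unblock, expandLength]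
  | cons q B ih =>
    have : unblock (q :: B) = List.replicate q.2 q.1 ++ unblock B := by simp [unblock]
    rw [this, expandLength_append, expandLength_replicate, ← ih]
    simp

end Recompression

namespace Recompression

variable {α : Type} [DecidableEq α]

/-! ### The cost of block compression: the choice of the charges -/

theorem sum_biUnion_le {β ι : Type} [DecidableEq β] [DecidableEq ι] (W : Finset ι)
    (O : ι → Finset β) (h : β → ℝ) (hh : ∀ q, 0 ≤ h q) :
    ∑ q ∈ W.biUnion O, h q ≤ ∑ X ∈ W, ∑ q ∈ O X, h q := by
  induction W using Finset.induction_on with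
  | empty => simp
  | insert X W hX ih =>
    rw [Finset.biUnion_insert, Finset.sum_insert hX]
    exact (sum_le_sum_add_sum hh subset_rfl).trans (add_le_add le_rfl ih)

/-- Used with `y = d * 2 ^ (-c)`: the part of `log d` that exceeds `c` is at most a tax proportional
to `d`. -/
theorem logb_le_two_mul {y : ℝ} (hy : 0 < y) : Real.logb 2 y ≤ 2 * y := by
  have h₁ := Real.log_le_sub_one_of_pos hy
  have h₂ := Real.log_two_gt_d9
  rw [Real.logb, div_le_iff₀ (by linarith)]
  nlinarith

theorem logb_le_natCast {m n : ℕ} (hm : 0 < m) (h : m ≤ 2 ^ n) : Real.logb 2 (m : ℝ) ≤ n := by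
  have : Real.logb 2 (m : ℝ) ≤ Real.logb 2 ((2 : ℝ) ^ (n : ℝ)) :=
    Real.logb_le_logb_of_le (by norm_num) (by exact_mod_cast hm)
      (by rw [Real.rpow_natCast]; exact_mod_cast h)
  rwa [Real.logb_rpow (by norm_num) (by norm_num)] at this

theorem length_le_expandLength {T : List (Letter α)} (h : ∀ x ∈ T, 0 < expandLength [x]) :
    T.length ≤ expandLength T := by
  induction T with
  | nil => simp
  | cons a T ih =>
    have h₁ := expandLength_append [a] T
    have h₂ := h a (by simp)
    have h₃ := ih fun x hx => h x (by simp [hx])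
    rw [List.singleton_append] at h₁
    rw [List.length_cons]
    omega

theorem IsInner.mem_maximalBlocks {x T : List (Letter α)} {b : Letter α} {n : ℕ}
    (h : IsInner x b n) (hn : 0 < n) (hT : x <:+: T) : (b, n) ∈ maximalBlocks T := by
  obtain ⟨P, R, rfl, hP, hR, hP', hR'⟩ := h
  obtain ⟨y, z, rfl⟩ := hT
  have e : y ++ (P ++ (List.replicate n b ++ R)) ++ z =
      (y ++ P) ++ (List.replicate n b ++ (R ++ z)) := by simp
  have hne : List.replicate n b ++ (R ++ z) ≠ [] := by simp [hR]
  rw [e, maximalBlocks_append_of_ne, maximalBlocks_replicate_append hn]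
  · simp
  · intro q hq
    have h₁ := head?_maximalBlocks (R ++ z)
    obtain ⟨r, R, rfl⟩ := List.exists_cons_of_ne_nil hR
    rw [Option.mem_def.1 hq] at h₁
    simp only [Option.map_some, List.cons_append, List.head?_cons, Option.some.injEq] at h₁
    exact h₁ ▸ (hR' r rfl).symm
  · intro a ha d hd
    rw [List.getLast?_append_of_ne_nil _ hP] at ha
    obtain ⟨n, rfl⟩ := Nat.exists_eq_add_of_lt hn
    simp only [Nat.zero_add, List.replicate_succ, List.cons_append, List.head?_cons,
      Option.mem_some_iff] at hd
    exact hd ▸ hP' a ha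

/-- The part of the cost of a block that is paid by the length of the input. -/
noncomputable def blockTax (c : ℝ) (T : List (Letter α)) (L : Finset (Letter α × ℕ))
    (q : Letter α × ℕ) : ℝ :=
  -- The first term is the tax on large differences, the second the tax on blocks that stand for
  -- long factors of the input. Differences sum to at most the length of the text, factors to at
  -- most that of the input.
  2 * (1 + ((q.2 - predLength L q : ℕ) : ℝ)) * (2 : ℝ) ^ (-c) +
    if q ∈ maximalBlocks T then 2 * (q.2 * expandLength [q.1] : ℕ) * (2 : ℝ) ^ (-c) else 0

/-- The part of the cost of a block that is paid by the words of the family. -/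
noncomputable def blockCharge (c : ℝ) (T : List (Letter α)) (L : Finset (Letter α × ℕ))
    (q : Letter α × ℕ) : ℝ :=
  if q ∈ L then max 0 (diffCost L q - blockTax c T L q) else 0

theorem blockTax_nonneg (c : ℝ) (T : List (Letter α)) (L : Finset (Letter α × ℕ))
    (q : Letter α × ℕ) : 0 ≤ blockTax c T L q := by
  unfold blockTax
  split_ifs <;> positivity

theorem blockCharge_nonneg (c : ℝ) (T : List (Letter α)) (L : Finset (Letter α × ℕ))
    (q : Letter α × ℕ) : 0 ≤ blockCharge c T L q := by
  unfold blockCharge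
  split_ifs
  · exact le_max_left _ _
  · exact le_rfl

theorem blockCharge_le {c : ℝ} {T : List (Letter α)} {L : Finset (Letter α × ℕ)}
    {q : Letter α × ℕ} {s : ℝ} (hs : 0 ≤ s) (h : q ∈ L → diffCost L q - blockTax c T L q ≤ s) :
    blockCharge c T L q ≤ s := by
  unfold blockCharge
  split_ifs with hq
  · exact max_le hs (h hq)
  · exact hs

theorem blockCharge_le_of_diff {c : ℝ} {T : List (Letter α)} {L : Finset (Letter α × ℕ)}
    {q : Letter α × ℕ} {m n : ℕ} (hm : q.2 - predLength L q ≤ m) (h : 1 + m ≤ 2 ^ n) :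
    blockCharge c T L q ≤ n := by
  refine blockCharge_le (Nat.cast_nonneg n) fun _ => ?_
  have h₁ := blockTax_nonneg c T L q
  have h₂ : diffCost L q ≤ Real.logb 2 (1 + (m : ℝ)) := logb_one_add_mono hm
  have h₃ := logb_le_natCast (m := 1 + m) (by omega) h
  push_cast at h₃
  linarith

theorem sum_blockTax_le (c : ℝ) {T : List (Letter α)} {L : Finset (Letter α × ℕ)}
    (hpos : ∀ x ∈ T, 0 < expandLength [x]) (hL : ∀ q ∈ L, q.1 ∈ T ∧ q.2 ≤ T.count q.1)
    (hL₁ : ∀ q ∈ L, 1 < q.2) :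
    ∑ q ∈ L, blockTax c T L q ≤ 6 * ((2 : ℝ) ^ (-c) * expandLength T) := by
  have hθ : (0 : ℝ) < 2 ^ (-c) := by positivity
  unfold blockTax
  rw [Finset.sum_add_distrib]
  have h₁ : ∑ q ∈ L, 2 * (1 + ((q.2 - predLength L q : ℕ) : ℝ)) * (2 : ℝ) ^ (-c) ≤
      4 * ((2 : ℝ) ^ (-c) * expandLength T) := by
    have : ∀ q ∈ L, 2 * (1 + ((q.2 - predLength L q : ℕ) : ℝ)) * (2 : ℝ) ^ (-c) ≤
        4 * (2 : ℝ) ^ (-c) * ((q.2 - predLength L q : ℕ) : ℝ) := by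
      intro q hq
      have h₂ : 1 ≤ q.2 - predLength L q := by
        rcases Nat.eq_zero_or_pos (predLength L q) with h | h
        · have := hL₁ q hq; omega
        · have := (predLength_mem h).2; omega
      have h₃ : (1 : ℝ) ≤ ((q.2 - predLength L q : ℕ) : ℝ) := by exact_mod_cast h₂
      nlinarith
    refine (Finset.sum_le_sum this).trans ?_
    rw [← Finset.mul_sum, ← Nat.cast_sum, ← mul_assoc]
    refine mul_le_mul_of_nonneg_left ?_ (by positivity)
    exact_mod_cast (sum_diff_le_length L T hL).trans (length_le_expandLength hpos)
  have h₂ : ∑ q ∈ L, (if q ∈ maximalBlocks T then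
      2 * ((q.2 * expandLength [q.1] : ℕ) : ℝ) * (2 : ℝ) ^ (-c) else 0) ≤
      2 * ((2 : ℝ) ^ (-c) * expandLength T) := by
    rw [← Finset.sum_filter]
    refine (Finset.sum_le_sum_of_subset_of_nonneg (t := (maximalBlocks T).toFinset)
      (fun q hq => List.mem_toFinset.2 (Finset.mem_filter.1 hq).2) fun q _ _ => by positivity).trans ?_
    have := sum_expandLength_blocks T
    have : ((∑ q ∈ (maximalBlocks T).toFinset, q.2 * expandLength [q.1] : ℕ) : ℝ) ≤
        expandLength T := by exact_mod_cast this
    rw [← Finset.sum_mul, ← Finset.mul_sum, ← Nat.cast_sum]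
    nlinarith
  linarith

theorem charge_blockCharge {ι : Type} {c : ℝ} (hc : 0 ≤ c) {T x : List (Letter α)}
    {L : Finset (Letter α × ℕ)} {val : ι → List (Letter α)} {parts : List ι}
    (hpos : ∀ x ∈ T, 0 < expandLength [x]) (hx : x <:+: T)
    (hL : ∀ Y ∈ parts, longBlocks (val Y) ⊆ L) : Charge c (blockCharge c T L) x val parts where
  nonneg := blockCharge_nonneg c T L
  le_length q hq := by
    -- The bound `log (1 + l) ≤ 2 * (l - 1)` for `l ≥ 2`, in the form `3 + k ≤ 4 ^ (k + 1)`.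
    obtain ⟨k, hk⟩ : ∃ k, q.2 = k + 2 := ⟨q.2 - 2, by omega⟩
    have := blockCharge_le_of_diff (c := c) (T := T) (L := L) (q := q) (m := k + 2)
      (n := 2 * (k + 1)) (by omega) ?_
    · rw [hk]
      push_cast at this ⊢
      linarith
    · rw [pow_mul]
      clear hk
      induction k with
      | zero => norm_num
      | succ k ih => rw [pow_succ]; omega
  le_diff Y hY b n t ht hn := by
    have h₂ : ∀ t, 2 + t ≤ 2 ^ (t + 1) := by
      intro t
      induction t with
      | zero => norm_num
      | succ t ih => rw [pow_succ]; omega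
    have := blockCharge_le_of_diff (c := c) (T := T) (L := L) (q := (b, n + t)) (m := t + 1)
      (n := t + 1) ?_ (by have := h₂ t; omega)
    · exact_mod_cast this
    -- If `n ≥ 2`, the length `n` belongs to `L` and the difference is at most `t`. A block of
    -- length `1` is not in `L`, and then the difference is at most `t + 1`.
    · have h₁ : 1 ≤ n := maximalBlocks_pos hn
      rcases Nat.lt_or_ge 1 n with h | h
      · have := le_predLength (q := (b, n + t)) (hL Y hY (mem_longBlocks.2 ⟨hn, h⟩)) rfl
          (by simp only; omega)
        simp only at this ⊢
        omega
      · simp only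
        omega
  le_max q := by
    refine blockCharge_le hc fun _ => ?_
    have h₀ : (0 : ℝ) < 1 + ((q.2 - predLength L q : ℕ) : ℝ) := by positivity
    have h₁ : Real.logb 2 ((1 + ((q.2 - predLength L q : ℕ) : ℝ)) * (2 : ℝ) ^ (-c)) =
        diffCost L q - c := by
      rw [Real.logb_mul h₀.ne' (by positivity), Real.logb_rpow (by norm_num) (by norm_num), diffCost]
      ring
    have h₂ := logb_le_two_mul (y := (1 + ((q.2 - predLength L q : ℕ) : ℝ)) * (2 : ℝ) ^ (-c))
      (by positivity)
    have h₃ : 2 * (1 + ((q.2 - predLength L q : ℕ) : ℝ)) * (2 : ℝ) ^ (-c) ≤ blockTax c T L q := by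
      unfold blockTax
      split_ifs
      · refine le_add_of_nonneg_right ?_
        positivity
      · simp
    linarith
  le_growth b t n ht htn hI := by
    have hn : 0 < n := by omega
    have hmem := hI.mem_maximalBlocks hn hx
    have he : 0 < expandLength [b] := hpos b (mem_of_mem_maximalBlocks hmem)
    have htR : (0 : ℝ) < t := by exact_mod_cast ht
    have hnR : (0 : ℝ) < n := by exact_mod_cast hn
    have heR : (0 : ℝ) < (expandLength [b] : ℕ) := by exact_mod_cast he
    have hg : ∀ m : ℕ, 0 < m → growth c (List.replicate m b) =
        max 0 (c - (Real.logb 2 m + Real.logb 2 (expandLength [b] : ℕ))) := by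
      intro m hm
      have hmR : (0 : ℝ) < m := by exact_mod_cast hm
      rw [growth, if_neg (by simp; omega), expandLength_replicate, Nat.cast_mul,
        Real.logb_mul hmR.ne' heR.ne']
    rw [hg t ht, hg n hn]
    set e := Real.logb 2 (expandLength [b] : ℕ)
    have hmono : Real.logb 2 (t : ℝ) ≤ Real.logb 2 n :=
      Real.logb_le_logb_of_le (by norm_num) htR (by exact_mod_cast htn)
    have hanti := max_le_max (le_refl (0 : ℝ))
      (by linarith : c - (Real.logb 2 (n : ℝ) + e) ≤ c - (Real.logb 2 t + e))
    refine blockCharge_le (by linarith) fun _ => ?_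
    have h₁ : diffCost L (b, n) ≤ t + Real.logb 2 n - Real.logb 2 t := by
      have h₂ : diffCost L (b, n) ≤ Real.logb 2 (1 + (n : ℝ)) := logb_one_add_mono (by simp only; omega)
      -- From `t ≤ n` and `1 + t ≤ 2 ^ t`: `(1 + n) * t ≤ n * (1 + t) ≤ 2 ^ t * n`.
      have h₃ : Real.logb 2 ((1 + (n : ℝ)) * t) ≤ Real.logb 2 ((2 : ℝ) ^ (t : ℝ) * n) := by
        refine Real.logb_le_logb_of_le (by norm_num) (by positivity) ?_
        rw [Real.rpow_natCast]
        have : t + 1 ≤ 2 ^ t := Nat.lt_two_pow_self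
        have : ((t : ℝ) + 1) ≤ 2 ^ t := by exact_mod_cast this
        have h₅ : (t : ℝ) ≤ n := by exact_mod_cast htn
        nlinarith
      rw [Real.logb_mul (by positivity) htR.ne', Real.logb_mul (by positivity) hnR.ne',
        Real.logb_rpow (by norm_num) (by norm_num)] at h₃
      linarith
    have h₄ := blockTax_nonneg c T L (b, n)
    -- While the block derives a word of length at most `2 ^ c`, the budget falls by exactly `log n
    -- - log t`. Beyond that the new budget is `0`, and the second tax covers what is missing.
    rcases le_total 0 (c - (Real.logb 2 (n : ℝ) + e)) with h | h
    · rw [max_eq_right h, max_eq_right (by linarith)]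
      linarith
    · rw [max_eq_left h]
      have h₅ : Real.logb 2 ((n : ℝ) * (expandLength [b] : ℕ) * (2 : ℝ) ^ (-c)) =
          Real.logb 2 n + e - c := by
        rw [Real.logb_mul (by positivity) (by positivity), Real.logb_mul hnR.ne' heR.ne',
          Real.logb_rpow (by norm_num) (by norm_num)]
        ring
      have h₆ := logb_le_two_mul (y := (n : ℝ) * (expandLength [b] : ℕ) * (2 : ℝ) ^ (-c))
        (by positivity)
      have h₇ : 2 * ((n : ℝ) * (expandLength [b] : ℕ) * (2 : ℝ) ^ (-c)) ≤ blockTax c T L (b, n) := by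
        unfold blockTax
        rw [if_pos hmem]
        push_cast
        have : 0 ≤ 2 * (1 + ((n - predLength L (b, n) : ℕ) : ℝ)) * (2 : ℝ) ^ (-c) := by positivity
        linarith
      have h₈ := le_max_right 0 (c - (Real.logb 2 (t : ℝ) + e))
      linarith

theorem Shape.Fits.of_mem_parts {β ι : Type} {x : List β} {val : ι → List β} {ok : ι → Prop}
    {sh : Shape β ι} (h : sh.Fits x val ok) {Y : ι} (hY : Y ∈ sh.parts) : ok Y ∧ val Y ≠ [] := by
  cases sh with
  | leaf u => simp [Shape.parts] at hY
  | one u Z v =>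
    simp only [Shape.parts, List.mem_singleton] at hY
    exact hY ▸ ⟨h.1, h.2.1⟩
  | two u Z v Z' w =>
    simp only [Shape.parts, List.mem_cons, List.not_mem_nil, or_false] at hY
    rcases hY with rfl | rfl
    · exact h.1
    · exact h.2.1

theorem parts_map {β ι : Type} (c : List β → List β) (sh : Shape β ι) :
    (sh.map c).parts = sh.parts := by cases sh <;> rfl

theorem gap_map_compressBlocks {ι : Type} (p : ℕ) (sh : Shape (Letter α) ι) :
    (sh.map (compressBlocks p)).gap List.length = sh.gap blockCount := by
  cases sh <;> simp [Shape.map, Shape.gap, compressBlocks, blockCount]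

/-- The cost of block compression is paid by the explicit letters, the budgets, and a part of the
length of the input. -/
theorem Rep.exists_blockStep {ι : Type} [DecidableEq ι] {W : Finset ι} {rank : ι → ℕ} {top : ι}
    {T : List (Letter α)} {val : ι → List (Letter α)} {shape : ι → Shape (Letter α) ι}
    (h : Rep W rank top T val shape) (p : ℕ) (hpos : ∀ x ∈ T, 0 < expandLength [x]) {c : ℝ}
    (hc : 0 ≤ c) :
    ∃ val' shape', Rep W rank top (compressBlocks p T) val' shape' ∧
      ((∑ q ∈ allBlockProds p T, q.2.length : ℕ) : ℝ) +
          6 * (4 * (∑ X ∈ W, (shape' X).gap List.length : ℕ) + ∑ X ∈ W, (shape' X).budget c) ≤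
        6 * (4 * (∑ X ∈ W, (shape X).gap List.length : ℕ) + ∑ X ∈ W, (shape X).budget c) +
          144 * W.card + 36 * ((2 : ℝ) ^ (-c) * expandLength T) := by
  obtain ⟨val', shape', h', hval, hs⟩ := h.exists_step (blockStep p)
  refine ⟨val', fun X => (shape' X).map (compressBlocks p), h', ?_⟩
  -- The long blocks of all members count, not only those of the text, so that a block of a part is
  -- available as a preceding length.
  set L := W.biUnion fun X => longBlocks (val X) with hL
  have hLT : ∀ q ∈ L, q.1 ∈ T ∧ q.2 ≤ T.count q.1 := by
    intro q hq
    obtain ⟨X, hX, hq⟩ := Finset.mem_biUnion.1 hq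
    have hm := (mem_longBlocks.1 hq).1
    exact ⟨(h.infix_text X hX).subset (mem_of_mem_maximalBlocks hm),
      (le_count_of_mem_maximalBlocks hm).trans ((h.infix_text X hX).sublist.count_le _)⟩
  have hL₁ : ∀ q ∈ L, 1 < q.2 := by
    intro q hq
    obtain ⟨X, hX, hq⟩ := Finset.mem_biUnion.1 hq
    exact (mem_longBlocks.1 hq).2
  have hcost := cost_allBlockProds_le p T L (by
    intro q hq
    rw [← h.val_top] at hq
    exact Finset.mem_biUnion.2 ⟨top, h.top_mem, hq⟩)
  have htax := sum_blockTax_le c hpos hLT hL₁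
  set own : ι → Finset (Letter α × ℕ) := fun X =>
    (longBlocks (val X)).filter fun q => ∀ Y ∈ (shape X).parts, q ∉ maximalBlocks (val Y) with hown
  have hsplit : ∑ q ∈ L, diffCost L q ≤
      ∑ q ∈ L, blockCharge c T L q + ∑ q ∈ L, blockTax c T L q := by
    rw [← Finset.sum_add_distrib]
    refine Finset.sum_le_sum fun q hq => ?_
    rw [blockCharge, if_pos hq]
    have := le_max_right 0 (diffCost L q - blockTax c T L q)
    linarith
  have hcharge : ∑ q ∈ L, blockCharge c T L q ≤ ∑ X ∈ W, ∑ q ∈ own X, blockCharge c T L q := by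
    refine le_trans (Finset.sum_le_sum_of_subset_of_nonneg (t := W.biUnion own) ?_
      fun q _ _ => blockCharge_nonneg c T L q) (sum_biUnion_le W own _ (blockCharge_nonneg c T L))
    intro q hq
    -- Each block is charged to a member of least rank that contains it, hence one whose parts do
    -- not contain it.
    obtain ⟨X, hX, hmin⟩ := Finset.exists_min_image (W.filter fun X => q ∈ longBlocks (val X)) rank
      (by
        obtain ⟨X, hX, hq⟩ := Finset.mem_biUnion.1 hq
        exact ⟨X, Finset.mem_filter.2 ⟨hX, hq⟩⟩)
    obtain ⟨hXW, hXq⟩ := Finset.mem_filter.1 hX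
    refine Finset.mem_biUnion.2 ⟨X, hXW, Finset.mem_filter.2 ⟨hXq, fun Y hY hqY => ?_⟩⟩
    obtain ⟨⟨hYW, -, hlt⟩, -⟩ := (h.fits X hXW).of_mem_parts hY
    have := hmin Y (Finset.mem_filter.2 ⟨hYW, mem_longBlocks.2 ⟨hqY, (mem_longBlocks.1 hXq).2⟩⟩)
    omega
  have hX : ∀ X ∈ W, ∑ q ∈ own X, blockCharge c T L q +
      (4 * (((shape' X).map (compressBlocks p)).gap List.length : ℝ) +
        ((shape' X).map (compressBlocks p)).budget c) ≤
      4 * ((shape X).gap List.length : ℝ) + (shape X).budget c + 24 := by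
    intro X hX
    have hfit := h.fits X hX
    have h₁ := own_cost (p := p) (O := own X) (sh' := shape' X) hc hfit
      (charge_blockCharge (L := L) hc hpos (h.infix_text X hX) fun Y hY => by
        obtain ⟨⟨hYW, -⟩, -⟩ := hfit.of_mem_parts hY
        exact fun q hq => Finset.mem_biUnion.2 ⟨Y, hYW, hq⟩)
      (fun x hx => hpos x ((h.infix_text X hX).subset (hfit.letters_subset hx))) (hs X hX).2.1
      (fun Y hY hcore => by
        rw [← parts_map (compressBlocks p)] at hY
        obtain ⟨⟨hYW, hYt, -⟩, hne⟩ := (h'.fits X hX).of_mem_parts hY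
        rw [hval Y hYW hYt] at hne
        exact hne (((blockStep p).c_nil _).2 hcore))
      (fun q hq => by
        obtain ⟨h₁, h₂⟩ := Finset.mem_filter.1 hq
        exact ⟨(mem_longBlocks.1 h₁).1, (mem_longBlocks.1 h₁).2, h₂⟩)
    have h₂ : (shape' X).gap blockCount ≤ (shape X).gap blockCount + 4 := (hs X hX).2.2
    have h₃ : ((shape' X).gap blockCount : ℝ) ≤ (shape X).gap blockCount + 4 := by exact_mod_cast h₂
    rw [gap_map_compressBlocks]
    linarith
  have hsum := Finset.sum_le_sum hX
  simp only [Finset.sum_add_distrib, ← Finset.mul_sum, Finset.sum_const, nsmul_eq_mul] at hsum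
  push_cast at hsum hcost ⊢
  linarith

end Recompression

/-! ### Smallest grammars and the bound for the output -/

namespace ContextFreeGrammar

/-- A grammar that generates a non-empty word has a nonempty production. -/
theorem size_pos {α : Type} {G : ContextFreeGrammar α} {w : List α} (hw : w ≠ [])
    (h : w ∈ G.language) : 0 < G.size := by
  rw [Nat.pos_iff_ne_zero]
  intro h₀
  have hr : ∀ r ∈ G.rules, r.output = [] := fun r hr => by
    simpa using Finset.sum_eq_zero_iff.1 h₀ r hr
  have key : ∀ v, G.Derives [.nonterminal G.initial] v → ∀ a, .terminal a ∉ v := by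
    intro v hv
    induction hv with
    | refl => simp
    | tail _ hp ih =>
      intro a ha
      obtain ⟨r, hrG, hrw⟩ := hp
      obtain ⟨p, q, rfl, rfl⟩ := hrw.exists_parts
      rw [hr r hrG] at ha
      refine ih a ?_
      simp only [List.append_nil, List.mem_append] at ha ⊢
      tauto
  obtain ⟨a, t, rfl⟩ := List.exists_cons_of_ne_nil hw
  exact key _ h a (by simp)

end ContextFreeGrammar

/-- The infimum is attained because the set of sizes is not empty: the initial state provides the
grammar with the single rule `X → w`. -/
theorem exists_smallest_grammar {α : Type} [DecidableEq α] (w : List α) :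
    ∃ G : ContextFreeGrammar α, G.language = {w} ∧ G.size = smallestGrammarSize w :=
  Nat.sInf_mem (s := {n : ℕ | ∃ G : ContextFreeGrammar α, G.language = {w} ∧ G.size = n})
    ⟨_, _, (Recompression.derives_init w).language_eq, rfl⟩

theorem smallestGrammarSize_le {α : Type} [DecidableEq α] (w : List α) :
    smallestGrammarSize w ≤ w.length := by
  refine (Nat.sInf_le (m := _) (s := {n : ℕ | ∃ G : ContextFreeGrammar α, G.language = {w} ∧ G.size = n})
    ⟨_, (Recompression.derives_init w).language_eq, rfl⟩).trans ?_
  refine (Recompression.State.size_grammar_le _).trans ?_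
  simp [Recompression.State.size]

theorem smallestGrammarSize_pos {α : Type} [DecidableEq α] {w : List α} (hw : w ≠ []) :
    0 < smallestGrammarSize w := by
  obtain ⟨G, hG, hs⟩ := exists_smallest_grammar w
  exact hs ▸ ContextFreeGrammar.size_pos hw (by rw [hG]; rfl)

namespace Recompression

variable {α : Type} [DecidableEq α]

/-! ### The size of the output -/

theorem pos_compressBlocks {p : ℕ} {T : List (Letter α)} (h : ∀ x ∈ T, 0 < expandLength [x]) :
    ∀ x ∈ compressBlocks p T, 0 < expandLength [x] := by
  intro x hx
  rcases mem_compressBlocks hx with hx | ⟨a, l, ha, hl, rfl⟩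
  · exact h x hx
  · have := h a (mem_of_mem_maximalBlocks ha)
    simp only [expandLength, List.flatMap_cons, List.flatMap_nil, List.append_nil, Letter.expand,
      List.length_flatten, List.map_replicate, List.sum_replicate, smul_eq_mul] at this ⊢
    positivity

theorem pos_compressPairs {p : ℕ} {A B : Finset (Letter α)} {T : List (Letter α)}
    (h : ∀ x ∈ T, 0 < expandLength [x]) : ∀ x ∈ compressPairs p A B T, 0 < expandLength [x] := by
  intro x hx
  rcases mem_compressPairs hx with hx | ⟨a, b, hab, -, -, rfl⟩
  · exact h x hx
  · have := h a (mem_of_mem_pairs hab).1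
    simp only [expandLength, List.flatMap_cons, List.flatMap_nil, List.append_nil, Letter.expand,
      List.length_append] at this ⊢
    omega

theorem isPair_compressBlocks {p : ℕ} {T : List (Letter α)} (h : ∀ x ∈ T, x.Old p) :
    ∀ x ∈ compressBlocks p T, x.isPair p = false := by
  intro x hx
  rcases mem_compressBlocks hx with hx | ⟨a, l, -, -, rfl⟩
  · have := h x hx
    cases x <;> simp only [Letter.isPair, Letter.Old] at *
    simp [this.ne]
  · rfl

/-- The cost of representing the letters of a state. -/
def State.cost (s : State α) : ℕ := ∑ q ∈ s.prods, q.2.length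

theorem cost_phase_le (p : ℕ) (L : List (Letter α)) (s : State α) :
    (phase p L s).cost ≤ s.cost + ∑ q ∈ allBlockProds p s.text, q.2.length +
      ∑ q ∈ pairProds p (greedyPairs (compressBlocks p s.text) L).1
        (greedyPairs (compressBlocks p s.text) L).2 (compressBlocks p s.text), q.2.length := by
  have hun : ∀ s t : Finset (Letter α × List (Letter α)),
      ∑ q ∈ s ∪ t, q.2.length ≤ ∑ q ∈ s, q.2.length + ∑ q ∈ t, q.2.length := fun s t =>
    (Nat.le_add_right _ _).trans (Finset.sum_union_inter (s₁ := s) (s₂ := t)).le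
  unfold State.cost
  exact (hun _ _).trans (Nat.add_le_add_right (hun _ _) _)

/-- What is left of the credit for the later costs. -/
noncomputable def potential {ι : Type} (c : ℝ) (W : Finset ι) (shape : ι → Shape (Letter α) ι) : ℝ :=
  24 * (∑ X ∈ W, (shape X).gap List.length : ℕ) + 6 * ∑ X ∈ W, (shape X).budget c

theorem Rep.exists_phase {ι : Type} [DecidableEq ι] {W : Finset ι} {rank : ι → ℕ} {top : ι}
    {s : State α} {val : ι → List (Letter α)} {shape : ι → Shape (Letter α) ι}
    (h : Rep W rank top s.text val shape) {p : ℕ} {L : List (Letter α)} (hL : L.Nodup)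
    (hold : ∀ x ∈ s.text, x.Old p) (hpos : ∀ x ∈ s.text, 0 < expandLength [x]) {c : ℝ}
    (hc : 0 ≤ c) :
    ∃ val' shape', Rep W rank top (phase p L s).text val' shape' ∧
      ((phase p L s).cost : ℝ) + potential c W shape' ≤ s.cost + potential c W shape +
        240 * W.card + 36 * ((2 : ℝ) ^ (-c) * expandLength s.text) := by
  obtain ⟨val₁, shape₁, h₁, hb⟩ := h.exists_blockStep p hpos hc
  obtain ⟨val₂, shape₂, h₂, hp, hbud⟩ := h₁.exists_pairStep (p := p)
    (disjoint_greedyPairs (T := compressBlocks p s.text) hL) (isPair_compressBlocks hold)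
    (pos_compressBlocks hpos) hc
  refine ⟨val₂, shape₂, h₂, ?_⟩
  have hcost := cost_phase_le p L s
  have hcost : ((phase p L s).cost : ℝ) ≤ s.cost + (∑ q ∈ allBlockProds p s.text, q.2.length : ℕ) +
      (∑ q ∈ pairProds p (greedyPairs (compressBlocks p s.text) L).1
        (greedyPairs (compressBlocks p s.text) L).2 (compressBlocks p s.text), q.2.length : ℕ) := by
    exact_mod_cast hcost
  have hp' : ((∑ q ∈ pairProds p (greedyPairs (compressBlocks p s.text) L).1
      (greedyPairs (compressBlocks p s.text) L).2 (compressBlocks p s.text), q.2.length : ℕ) : ℝ) +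
      2 * (∑ X ∈ W, (shape₂ X).gap List.length : ℕ) ≤
      2 * (∑ X ∈ W, (shape₁ X).gap List.length : ℕ) + 8 * W.card := by exact_mod_cast hp
  -- The inequality for pairs is used twelvefold, to match the weight `24` of the explicit letters.
  -- It adds `12 * 8 = 96` to the `144` of block compression.
  have h₀ := Nat.cast_nonneg (α := ℝ) (∑ q ∈ pairProds p (greedyPairs (compressBlocks p s.text) L).1
      (greedyPairs (compressBlocks p s.text) L).2 (compressBlocks p s.text), q.2.length)
  unfold potential
  linarith

/-- A family of words for the input word, from a smallest grammar. -/
theorem exists_rep {w : List α} (hw : w ≠ []) {c : ℝ} (hc : 0 ≤ c) :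
    ∃ (W : Finset (Option (List α))) (rank : Option (List α) → ℕ)
      (val : Option (List α) → List (Letter α))
      (shape : Option (List α) → Shape (Letter α) (Option (List α))),
      Rep W rank none (w.map .input) val shape ∧
      W.card ≤ 4 * smallestGrammarSize w ∧ potential c W shape ≤ W.card * (24 + 60 * c) := by
  obtain ⟨G, hG, hs⟩ := exists_smallest_grammar w
  obtain ⟨F, hwF, hcard, hF⟩ := ContextFreeGrammar.exists_factor_family hw hG
  rw [hs] at hcard
  have hg := smallestGrammarSize_pos hw
  let word : Option (List α) → List α := fun X => X.getD w
  let rank : Option (List α) → ℕ := fun X => X.elim (w.length + 1) List.length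
  let val : Option (List α) → List (Letter α) := fun X => (word X).map .input
  let W : Finset (Option (List α)) := insert none (F.image some)
  have hW : ∀ {X}, X ∈ W ↔ X = none ∨ ∃ u ∈ F, some u = X := by
    intro X
    simp [W]
  have key : ∀ X, ∃ sh : Shape (Letter α) (Option (List α)), X ∈ W →
      sh.Fits (val X) val (fun Y => Y ∈ W ∧ Y ≠ none ∧ rank Y < rank X) ∧
      sh.gap List.length ≤ 1 ∧ sh.budget c ≤ 10 * c := by
    -- A concatenation starts with an empty middle word, so its budget is `8 * c + 2 * c`.
    have hgrowth : growth c ([] : List (Letter α)) = 2 * c := if_pos rfl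
    intro X
    by_cases hX : X ∈ W
    · rcases hW.1 hX with rfl | ⟨u, hu, rfl⟩
      · refine ⟨.one [] (some w) [], fun _ => ⟨⟨⟨hW.2 (.inr ⟨w, hwF, rfl⟩), by simp, ?_⟩, ?_, ?_⟩,
          by simp [Shape.gap], ?_⟩⟩
        · simp [rank]
        · simpa [val, word] using hw
        · simp [val, word]
        · simp only [Shape.budget]; linarith
      · obtain ⟨hne, -, h | ⟨x, hx, y, hy, rfl⟩⟩ := hF u hu
        · refine ⟨.leaf (val (some u)), fun _ => ⟨rfl, ?_, ?_⟩⟩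
          · simp [Shape.gap, val, word, h]
          · simp only [Shape.budget]; positivity
        · have hx' := List.length_pos_iff.2 (hF x hx).1
          have hy' := List.length_pos_iff.2 (hF y hy).1
          refine ⟨.two [] (some x) [] (some y) [], fun _ => ⟨⟨⟨⟨hW.2 (.inr ⟨x, hx, rfl⟩), by simp, ?_⟩,
            ?_⟩, ⟨⟨hW.2 (.inr ⟨y, hy, rfl⟩), by simp, ?_⟩, ?_⟩, ?_⟩, by simp [Shape.gap], ?_⟩⟩
          · simp only [rank, Option.elim_some, List.length_append]; omega
          · simpa [val, word] using (hF x hx).1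
          · simp only [rank, Option.elim_some, List.length_append]; omega
          · simpa [val, word] using (hF y hy).1
          · simp [val, word]
          · simp only [Shape.budget, hgrowth]; linarith
    · exact ⟨.leaf [], fun h => absurd h hX⟩
  choose shape hshape using key
  refine ⟨W, rank, val, shape, ⟨by simp [W], rfl, fun X hX => ?_, fun X hX => (hshape X hX).1⟩,
    ?_, ?_⟩
  · refine List.IsInfix.map _ ?_
    rcases hW.1 hX with rfl | ⟨u, hu, rfl⟩
    · exact List.infix_rfl
    · exact (hF u hu).2.1
  -- At most `2 * g + 1` words and the extra top, hence at most `4 * g` members, as `g ≥ 1`.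
  · have h₁ := Finset.card_insert_le (none : Option (List α)) (F.image some)
    have h₂ := Finset.card_image_le (s := F) (f := (some : List α → Option (List α)))
    have : W.card ≤ F.card + 1 := h₁.trans (by omega)
    omega
  · have h₁ : ∑ X ∈ W, (shape X).gap List.length ≤ W.card := by
      simpa using Finset.sum_le_card_nsmul W _ 1 fun X hX => (hshape X hX).2.1
    have h₂ : ∑ X ∈ W, (shape X).budget c ≤ W.card * (10 * c) := by
      simpa using Finset.sum_le_card_nsmul W _ _ fun X hX => (hshape X hX).2.2
    have h₁ : ((∑ X ∈ W, (shape X).gap List.length : ℕ) : ℝ) ≤ W.card := by exact_mod_cast h₁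
    unfold potential
    linarith

/-- The inequalities of the single phases are added; the initial potential pays for the surcharges
in `c`, and the final one is not negative. The threshold `c` is still free here. -/
theorem IsRun.cost_le {w : List α} {n : ℕ} {s : ℕ → State α} (h : IsRun w n s) (hw : w ≠ []) {c : ℝ}
    (hc : 0 ≤ c) {i : ℕ} (hi : i ≤ n) :
    ((s i).cost : ℝ) ≤ 4 * smallestGrammarSize w * (24 + 60 * c + 240 * i) +
      36 * i * ((2 : ℝ) ^ (-c) * w.length) := by
  obtain ⟨W, rank, val, shape, hrep, hW, hpot⟩ := exists_rep hw hc
  have hpotnn : ∀ shape : Option (List α) → Shape (Letter α) (Option (List α)),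
      0 ≤ potential c W shape := by
    intro shape
    have : 0 ≤ ∑ X ∈ W, (shape X).budget c := Finset.sum_nonneg fun X _ => by
      cases shape X <;> simp only [Shape.budget]
      · exact le_rfl
      · positivity
      · rename_i v _ _
        have := growth_nonneg hc v
        positivity
    unfold potential
    positivity
  have key : ∃ val' shape', Rep W rank none (s i).text val' shape' ∧
      (∀ x ∈ (s i).text, 0 < expandLength [x]) ∧
      ((s i).cost : ℝ) + potential c W shape' ≤ potential c W shape +
        i * (240 * W.card + 36 * ((2 : ℝ) ^ (-c) * w.length)) := by
    induction i with
    | zero =>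
      refine ⟨val, shape, by rw [h.1]; exact hrep, ?_, ?_⟩
      · rw [h.1]
        intro x hx
        obtain ⟨a, -, rfl⟩ := List.mem_map.1 hx
        simp [expandLength, Letter.expand]
      · rw [h.1]
        simp [State.cost]
    | succ i ih =>
      obtain ⟨val₁, shape₁, h₁, hpos, hcost⟩ := ih (by omega)
      obtain ⟨-, L, hL, hs⟩ := h.2.1 i hi
      obtain ⟨hd, hold⟩ := h.derives (i := i) (by omega)
      obtain ⟨val₂, shape₂, h₂, hcost₂⟩ := h₁.exists_phase hL.1 hold hpos hc
      rw [hs]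
      refine ⟨val₂, shape₂, h₂, pos_compressPairs (pos_compressBlocks hpos), ?_⟩
      have : expandLength (s i).text = w.length := by rw [expandLength, hd.text]
      rw [this] at hcost₂
      push_cast
      linarith
  obtain ⟨val', shape', -, -, hcost⟩ := key
  have h₁ := hpotnn shape'
  have h₂ : (W.card : ℝ) ≤ 4 * smallestGrammarSize w := by exact_mod_cast hW
  have h₃ : (W.card : ℝ) * (24 + 60 * c + 240 * i) ≤
      4 * smallestGrammarSize w * (24 + 60 * c + 240 * i) :=
    mul_le_mul_of_nonneg_right h₂ (by positivity)
  linarith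

theorem IsRun.length_le {w : List α} {n : ℕ} {s : ℕ → State α} (h : IsRun w n s) {i : ℕ}
    (hi : i ≤ n) : ((s i).text.length : ℝ) ≤ 1 + (3 / 4 : ℝ) ^ i * w.length := by
  induction i with
  | zero => rw [h.1]; simp
  | succ i ih =>
    have h₁ : (4 * (s (i + 1)).text.length : ℝ) ≤ 3 * (s i).text.length + 1 := by
      exact_mod_cast h.length_succ hi
    have h₂ := ih (by omega)
    rw [pow_succ]
    linarith

/-- The cube of `3 / 4` is less than `1 / 2`. -/
theorem three_fourths_pow_le {c : ℝ} {m : ℕ} (h : 3 * c ≤ m) : (3 / 4 : ℝ) ^ m ≤ 2 ^ (-c) := by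
  have h₁ : (3 / 4 : ℝ) ≤ 2 ^ (-(1 / 3) : ℝ) := by
    rw [← Real.rpow_le_rpow_iff (z := 3) (by norm_num) (by positivity) (by norm_num),
      ← Real.rpow_mul (by norm_num)]
    norm_num
  calc (3 / 4 : ℝ) ^ m ≤ (2 ^ (-(1 / 3) : ℝ)) ^ m := pow_le_pow_left₀ (by norm_num) h₁ m
    _ = 2 ^ (-(1 / 3) * m : ℝ) := by rw [← Real.rpow_natCast, ← Real.rpow_mul (by norm_num)]
    _ ≤ 2 ^ (-c) := Real.rpow_le_rpow_of_exponent_le (by norm_num) (by linarith)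

/-- The grammar returned by the algorithm is small. -/
theorem IsOutput.size_le {w : List α} (hw : w ≠ []) {G : ContextFreeGrammar α} (h : IsOutput w G) :
    (G.size : ℝ) ≤ 4000 * ((smallestGrammarSize w : ℝ) + (smallestGrammarSize w : ℝ) *
      Real.logb 2 ((w.length : ℝ) / (smallestGrammarSize w : ℝ))) := by
  obtain ⟨n, s, hrun, i, hi, rfl, hmin⟩ := h
  set g := smallestGrammarSize w with hg
  have hg₀ : 0 < g := smallestGrammarSize_pos hw
  have hgN : g ≤ w.length := smallestGrammarSize_le w
  have hg₁ : (1 : ℝ) ≤ g := by exact_mod_cast hg₀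
  have hgN' : (g : ℝ) ≤ w.length := by exact_mod_cast hgN
  -- This threshold makes the tax `2 ^ (-c) * N` equal to `g` per phase.
  set c := Real.logb 2 ((w.length : ℝ) / g) with hc
  have hq : (0 : ℝ) < (w.length : ℝ) / g := by
    have : (0 : ℝ) < w.length := by linarith
    positivity
  have hc₀ : 0 ≤ c := Real.logb_nonneg (by norm_num) ((one_le_div (by positivity)).2 hgN')
  have hθ : (2 : ℝ) ^ (-c) * w.length = g := by
    rw [Real.rpow_neg (by norm_num), hc, Real.rpow_logb (by norm_num) (by norm_num) hq]
    have : (w.length : ℝ) ≠ 0 := by linarith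
    field_simp
  have hm := Nat.ceil_lt_add_one (show 0 ≤ 3 * c by positivity)
  set m := ⌈3 * c⌉₊ with hm'
  have hm₁ : 3 * c ≤ m := Nat.le_ceil _
  -- The state to compare with: after `⌈3 c⌉` phases the text has length at most `1 + 2 ^ (-c) * N =
  -- 1 + g`; if the run ends earlier, its last text has length at most `1`.
  have key : ∃ j ≤ n, (j : ℝ) ≤ 3 * c + 1 ∧ ((s j).text.length : ℝ) ≤ 1 + g := by
    rcases le_total n m with hnm | hnm
    · refine ⟨n, le_rfl, ?_, ?_⟩
      · have : (n : ℝ) ≤ m := by exact_mod_cast hnm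
        linarith
      · have : ((s n).text.length : ℝ) ≤ 1 := by exact_mod_cast hrun.2.2
        linarith
    · refine ⟨m, hnm, hm.le, (hrun.length_le hnm).trans ?_⟩
      rw [← hθ]
      gcongr
      exact three_fourths_pow_le hm₁
  obtain ⟨j, hj, hj₁, hj₂⟩ := key
  have h₁ := hrun.cost_le hw hc₀ hj
  rw [hθ, ← hg] at h₁
  have h₂ : ((s i).grammar.size : ℝ) ≤ (s j).text.length + (s j).cost := by
    exact_mod_cast (State.size_grammar_le _).trans (hmin j hj)
  have h₃ : (g : ℝ) * j ≤ g * (3 * c + 1) := mul_le_mul_of_nonneg_left hj₁ (by positivity)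
  have h₄ : 0 ≤ (g : ℝ) * c := by positivity
  -- With `j ≤ 3 * c + 1` the cost is at most `1092 * g + 3228 * g * c`, and the text adds at most
  -- `2 * g`.
  nlinarith

theorem IsOutput.language_eq {w : List α} {G : ContextFreeGrammar α} (h : IsOutput w G) :
    G.language = {w} := by
  obtain ⟨n, s, hrun, i, hi, rfl, -⟩ := h
  exact (hrun.derives hi).1.language_eq

end Recompression

/-! ### From loop iterations on an unbounded machine to steps of the word RAM -/

namespace WordRAM

/-! ### Programs on a machine with unbounded words -/

/-- `Run P σ n τ`: without a bound on the words, the program `P` started in `σ` halts in `τ`, after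
`n` iterations of loops. -/
inductive Run : Prog → Store → ℕ → Store → Prop
  | skip (σ : Store) : Run .skip σ 0 σ
  | assign (σ : Store) (x : ℕ) (e : Expr) : Run (.assign x e) σ 0 (σ.setReg x (e.val σ))
  | write (σ : Store) (A : ℕ) (i e : Expr) : Run (.write A i e) σ 0 (σ.setCell A (i.val σ) (e.val σ))
  | seq {P Q : Prog} {σ τ ρ : Store} {m n : ℕ} (h : Run P σ m τ) (h' : Run Q τ n ρ) :
      Run (.seq P Q) σ (m + n) ρ
  | ite_true {e : Expr} {P Q : Prog} {σ τ : Store} {n : ℕ} (hv : e.val σ ≠ 0) (h : Run P σ n τ) :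
      Run (.ite e P Q) σ n τ
  | ite_false {e : Expr} {P Q : Prog} {σ τ : Store} {n : ℕ} (hv : e.val σ = 0) (h : Run Q σ n τ) :
      Run (.ite e P Q) σ n τ
  | loop_done {e : Expr} {P : Prog} {σ : Store} (hv : e.val σ = 0) : Run (.loop e P) σ 0 σ
  | loop_step {e : Expr} {P : Prog} {σ τ ρ : Store} {m n : ℕ} (hv : e.val σ ≠ 0)
      (h : Run P σ m τ) (h' : Run (.loop e P) τ n ρ) : Run (.loop e P) σ (m + 1 + n) ρ

/-- The time for executing each instruction of the program once. -/
def Prog.weight : Prog → ℕ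
  | .skip => 1
  | .assign _ e => e.time + 1
  | .write _ i e => i.time + e.time + 1
  | .seq P Q => P.weight + Q.weight
  | .ite e P Q => e.time + 1 + P.weight + Q.weight
  | .loop e P => e.time + 1 + P.weight

/-- The greatest time for evaluating an expression of the program. -/
def Prog.exprTime : Prog → ℕ
  | .skip => 0
  | .assign _ e => e.time
  | .write _ i e => max i.time e.time
  | .seq P Q => max P.exprTime Q.exprTime
  | .ite e P Q => max e.time (max P.exprTime Q.exprTime)
  | .loop e P => max e.time P.exprTime

def Expr.maxConst : Expr → ℕ
  | .const k => k
  | .reg _ => 0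
  | .cell _ i => i.maxConst
  | .op _ e f => max e.maxConst f.maxConst

/-- The greatest constant in the program. -/
def Prog.maxConst : Prog → ℕ
  | .skip => 0
  | .assign _ e => e.maxConst
  | .write _ i e => max i.maxConst e.maxConst
  | .seq P Q => max P.maxConst Q.maxConst
  | .ite e P Q => max e.maxConst (max P.maxConst Q.maxConst)
  | .loop e P => max e.maxConst P.maxConst

/-- The value of the expression is bounded in terms of the input only, if array `0` is not
changed. -/
def Expr.small : Expr → Bool
  | .const _ => true
  | .cell 0 _ => true
  | .op .add e f => e.small && f.small
  | .op .mul e f => e.small && f.small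
  | _ => false

/-- The value of the expression exceeds those in the store at most by a small number. -/
def Expr.tame : Expr → Bool
  | .const _ => true
  | .reg _ => true
  | .cell _ _ => true
  | .op .add e f => e.tame && f.small
  | .op .mul e f => e.small && f.small
  | .op .sub e _ => e.tame
  | .op .div e _ => e.tame
  | .op .mod e _ => e.tame
  | .op .eq _ _ => true
  | .op .lt _ _ => true

/-- Every stored value exceeds those in the store at most by a small number, and array `0` is not
changed. -/
def Prog.tame : Prog → Bool
  | .skip => true
  | .assign _ e => e.tame
  | .write A _ e => e.tame && A != 0
  | .seq P Q => P.tame && Q.tame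
  | .ite _ P Q => P.tame && Q.tame
  | .loop _ P => P.tame

/-- The values in the store are at most `M`, those in array `0` at most `m`. -/
structure Store.Bounded (m M : ℕ) (σ : Store) : Prop where
  reg : ∀ x, σ.reg x ≤ M
  cell : ∀ A i, σ.cell A i ≤ M
  input : ∀ i, σ.cell 0 i ≤ m

theorem Expr.one_le_time (e : Expr) : 1 ≤ e.time := by
  cases e <;> simp [Expr.time]

/-- Multiplication at most adds exponents, and a sum is absorbed by one more factor `B ≥ 2`, so the
number of nodes of an expression bounds the exponent. This covers addresses too, which may be
products of register values. -/
theorem Expr.fits_of_bounded {B m W : ℕ} {σ : Store} (h : σ.Bounded m B) (hB : 2 ≤ B) (e : Expr)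
    (he : e.maxConst ≤ B) (hW : B ^ e.time < W) : e.Fits W σ ∧ e.val σ ≤ B ^ e.time := by
  have hle : ∀ {s t : ℕ}, s ≤ t → B ^ s ≤ B ^ t := fun h => Nat.pow_le_pow_right (by omega) h
  induction e with
  | const k =>
    simp only [Expr.maxConst, Expr.time, pow_one, Expr.Fits, Expr.val] at *
    omega
  | reg x =>
    have := h.reg x
    simp only [Expr.time, pow_one, Expr.Fits, Expr.val] at *
    omega
  | cell A i ih =>
    simp only [Expr.time] at hW
    obtain ⟨h₁, -⟩ := ih he (lt_of_le_of_lt (hle (by omega)) hW)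
    have h₃ := h.cell A (i.val σ)
    have : B ^ 1 ≤ B ^ (i.time + 1) := hle (by omega)
    simp only [Expr.time, Expr.Fits, Expr.val, pow_one] at *
    exact ⟨⟨h₁, by omega⟩, by omega⟩
  | op o e f ihe ihf =>
    simp only [Expr.time] at hW
    simp only [Expr.maxConst] at he
    obtain ⟨h₁, h₁'⟩ := ihe (by omega) (lt_of_le_of_lt (hle (by omega)) hW)
    obtain ⟨h₂, h₂'⟩ := ihf (by omega) (lt_of_le_of_lt (hle (by omega)) hW)
    have he₁ := e.one_le_time
    have hf₁ := f.one_le_time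
    have key : o.apply (e.val σ) (f.val σ) ≤ B ^ (e.time + f.time + 1) := by
      have h₃ : B ^ e.time ≤ B ^ (e.time + f.time + 1) := hle (by omega)
      have h₄ : B ^ f.time ≤ B ^ (e.time + f.time) := hle (by omega)
      have h₅ : B ^ e.time ≤ B ^ (e.time + f.time) := hle (by omega)
      have h₆ : B ^ (e.time + f.time + 1) = B ^ (e.time + f.time) * B := pow_succ _ _
      have h₇ : B ^ (e.time + f.time) * 2 ≤ B ^ (e.time + f.time) * B := Nat.mul_le_mul_left _ hB
      have h₈ : 1 ≤ B ^ (e.time + f.time) := Nat.one_le_pow _ _ (by omega)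
      cases o <;> simp only [BinOp.apply]
      · omega
      · omega
      · have h₉ := Nat.mul_le_mul h₁' h₂'
        rw [← pow_add] at h₉
        omega
      · exact (Nat.div_le_self _ _).trans (by omega)
      · exact (Nat.mod_le _ _).trans (by omega)
      · split_ifs <;> omega
      · split_ifs <;> omega
    exact ⟨⟨h₁, h₂, lt_of_le_of_lt key hW⟩, key⟩

theorem Expr.val_le_of_small {b m M : ℕ} {σ : Store} (h : σ.Bounded m M) (hb : 2 ≤ b) (hm : m ≤ b)
    (e : Expr) (hs : e.small = true) (he : e.maxConst ≤ b) : e.val σ ≤ b ^ e.time := by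
  induction e with
  | const k => simpa [Expr.time, Expr.val, Expr.maxConst] using he
  | reg x => simp [Expr.small] at hs
  | cell A i ih =>
    cases A with
    | zero =>
      have : b ^ 1 ≤ b ^ (i.time + 1) := Nat.pow_le_pow_right (by omega) (by omega)
      have h₁ := h.input (i.val σ)
      simp only [Expr.val, Expr.time, pow_one] at *
      omega
    | succ A => simp [Expr.small] at hs
  | op o e f ihe ihf =>
    simp only [Expr.maxConst] at he
    have h₀ : e.small = true ∧ f.small = true := by
      cases o <;> simp_all [Expr.small]
    have h₁ := ihe h₀.1 (by omega)
    have h₂ := ihf h₀.2 (by omega)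
    have he₁ := e.one_le_time
    have hf₁ := f.one_le_time
    have hle : ∀ {s t : ℕ}, s ≤ t → b ^ s ≤ b ^ t := fun h => Nat.pow_le_pow_right (by omega) h
    have h₄ : b ^ f.time ≤ b ^ (e.time + f.time) := hle (by omega)
    have h₅ : b ^ e.time ≤ b ^ (e.time + f.time) := hle (by omega)
    have h₆ : b ^ (e.time + f.time + 1) = b ^ (e.time + f.time) * b := pow_succ _ _
    have h₇ : b ^ (e.time + f.time) * 2 ≤ b ^ (e.time + f.time) * b := Nat.mul_le_mul_left _ hb
    cases o <;> simp [Expr.small] at hs <;> simp only [Expr.val, BinOp.apply, Expr.time]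
    · omega
    · have h₉ := Nat.mul_le_mul h₁ h₂
      rw [← pow_add] at h₉
      omega

/-- The growth is additive because a stored value is never a product of values from the working
store. Such products occur only in addresses and conditions, so values grow linearly with time
instead of exponentially. -/
theorem Expr.val_le_of_tame {b m M : ℕ} {σ : Store} (h : σ.Bounded m M) (hb : 2 ≤ b) (hm : m ≤ b)
    (e : Expr) (hs : e.tame = true) (he : e.maxConst ≤ b) : e.val σ ≤ M + b ^ e.time := by
  induction e with
  | const k => simp only [Expr.val, Expr.time, pow_one, Expr.maxConst] at *; omega
  | reg x => exact (h.reg x).trans (Nat.le_add_right _ _)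
  | cell A i ih => exact (h.cell A _).trans (Nat.le_add_right _ _)
  | op o e f ihe ihf =>
    simp only [Expr.maxConst] at he
    have hle : ∀ {s t : ℕ}, s ≤ t → b ^ s ≤ b ^ t := fun h => Nat.pow_le_pow_right (by omega) h
    have he₁ := e.one_le_time
    have hf₁ := f.one_le_time
    have h₃ : b ^ e.time ≤ b ^ (e.time + f.time + 1) := hle (by omega)
    have h₄ : b ^ f.time ≤ b ^ (e.time + f.time) := hle (by omega)
    have h₅ : b ^ e.time ≤ b ^ (e.time + f.time) := hle (by omega)
    have h₆ : b ^ (e.time + f.time + 1) = b ^ (e.time + f.time) * b := pow_succ _ _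
    have h₇ : b ^ (e.time + f.time) * 2 ≤ b ^ (e.time + f.time) * b := Nat.mul_le_mul_left _ hb
    have h₈ : 1 ≤ b ^ (e.time + f.time + 1) := Nat.one_le_pow _ _ (by omega)
    cases o
    case add =>
      simp only [Expr.tame, Bool.and_eq_true] at hs
      have h₁ := ihe hs.1 (by omega)
      have h₂ := f.val_le_of_small h hb hm hs.2 (by omega)
      simp only [Expr.val, BinOp.apply, Expr.time]
      omega
    case mul =>
      have := Expr.val_le_of_small (e := .op .mul e f) h hb hm hs he
      omega
    all_goals simp only [Expr.tame] at hs; simp only [Expr.val, BinOp.apply, Expr.time]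
    · have h₁ := ihe hs (by omega)
      omega
    · exact (Nat.div_le_self _ _).trans ((ihe hs (by omega)).trans (by omega))
    · exact (Nat.mod_le _ _).trans ((ihe hs (by omega)).trans (by omega))
    · split_ifs <;> omega
    · split_ifs <;> omega

theorem Store.Bounded.mono {m M M' : ℕ} {σ : Store} (h : σ.Bounded m M) (hM : M ≤ M') :
    σ.Bounded m M' :=
  ⟨fun x => (h.reg x).trans hM, fun A i => (h.cell A i).trans hM, h.input⟩

theorem Store.Bounded.setReg {m M x v : ℕ} {σ : Store} (h : σ.Bounded m M) (hv : v ≤ M) :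
    (σ.setReg x v).Bounded m M := by
  refine ⟨fun y => ?_, h.cell, h.input⟩
  simp only [Store.setReg, Function.update_apply]
  split_ifs
  exacts [hv, h.reg y]

theorem Store.Bounded.setCell {m M A i v : ℕ} {σ : Store} (h : σ.Bounded m M) (hA : A ≠ 0)
    (hv : v ≤ M) : (σ.setCell A i v).Bounded m M := by
  refine ⟨h.reg, fun B j => ?_, fun j => ?_⟩
  · simp only [Store.setCell, Function.update_apply]
    split_ifs with h₁
    · subst h₁
      rw [Function.update_apply]
      split_ifs
      exacts [hv, h.cell _ j]
    · exact h.cell B j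
  · simp only [Store.setCell, Function.update_apply, if_neg hA.symm]
    exact h.input j

/-- A run of a tame program is a computation of the word RAM, if the words are large enough for the
values that are possible after that number of steps. -/
theorem Run.exec {P : Prog} {σ τ : Store} {n : ℕ} (h : Run P σ n τ) {b d m W : ℕ} (hb : 2 ≤ b)
    (hm : m ≤ b) (hconst : P.maxConst ≤ b) (htame : P.tame = true) (hd : P.exprTime ≤ d) :
    -- Between two loop iterations each instruction is executed at most once. The time is fixed
    -- before the bounds `M` and `B`, since `B` has to be chosen in terms of it.
    ∃ t ≤ P.weight * (n + 1), ∀ M B : ℕ, σ.Bounded m M → b ≤ B → M + t * b ^ d ≤ B → B ^ d < W →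
      Exec W P σ t τ ∧ τ.Bounded m (M + t * b ^ d) := by
  have hpow : ∀ {s : ℕ}, s ≤ d → b ^ s ≤ b ^ d := fun h => Nat.pow_le_pow_right (by omega) h
  have hfit : ∀ {e : Expr} {σ : Store} {M B : ℕ}, e.maxConst ≤ b → e.time ≤ d → σ.Bounded m M →
      b ≤ B → M ≤ B → B ^ d < W → e.Fits W σ := by
    intro e σ M B h₁ h₂ h₃ h₄ h₅ h₆
    refine (Expr.fits_of_bounded (h₃.mono h₅) (hb.trans h₄) e (h₁.trans h₄) ?_).1
    exact lt_of_le_of_lt (Nat.pow_le_pow_right (by omega) h₂) h₆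
  induction h with
  | skip σ => exact ⟨1, by simp [Prog.weight], fun M B hM _ _ _ => ⟨.skip σ, hM.mono (by omega)⟩⟩
  | assign σ x e =>
    refine ⟨e.time + 1, by simp [Prog.weight], fun M B hM hB hMB hW => ⟨.assign ?_, ?_⟩⟩
    · exact hfit hconst hd hM hB (by omega) hW
    · have h₁ := Expr.val_le_of_tame hM hb hm e htame hconst
      have h₂ : b ^ e.time ≤ (e.time + 1) * b ^ d := (hpow hd).trans (Nat.le_mul_of_pos_left _ (by omega))
      exact (hM.mono (by omega)).setReg (by omega)
  | write σ A i e =>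
    simp only [Prog.maxConst, Prog.tame, Prog.exprTime, Bool.and_eq_true, bne_iff_ne,
      max_le_iff] at hconst htame hd
    refine ⟨i.time + e.time + 1, by simp [Prog.weight],
      fun M B hM hB hMB hW => ⟨.write ?_ ?_, ?_⟩⟩
    · exact hfit hconst.1 hd.1 hM hB (by omega) hW
    · exact hfit hconst.2 hd.2 hM hB (by omega) hW
    · have h₁ := Expr.val_le_of_tame hM hb hm e htame.1 hconst.2
      have h₂ : b ^ e.time ≤ (i.time + e.time + 1) * b ^ d :=
        (hpow hd.2).trans (Nat.le_mul_of_pos_left _ (by omega))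
      exact (hM.mono (by omega)).setCell htame.2 (by omega)
  | @seq P Q σ τ ρ n n' _ _ ih ih' =>
    simp only [Prog.maxConst, Prog.tame, Prog.exprTime, Bool.and_eq_true, max_le_iff] at hconst htame hd
    obtain ⟨t, ht, h₁⟩ := ih hconst.1 htame.1 hd.1
    obtain ⟨u, hu, h₂⟩ := ih' hconst.2 htame.2 hd.2
    refine ⟨t + u, ?_, fun M B hM hB hMB hW => ?_⟩
    · simp only [Prog.weight]
      nlinarith
    · rw [Nat.add_mul, ← Nat.add_assoc] at hMB ⊢
      obtain ⟨h₃, h₄⟩ := h₁ M B hM hB (by omega) hW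
      obtain ⟨h₅, h₆⟩ := h₂ _ B h₄ hB hMB hW
      exact ⟨.seq h₃ h₅, h₆⟩
  | @ite_true e P Q σ τ n hv _ ih =>
    simp only [Prog.maxConst, Prog.tame, Prog.exprTime, Bool.and_eq_true, max_le_iff] at hconst htame hd
    obtain ⟨t, ht, h₁⟩ := ih hconst.2.1 htame.1 hd.2.1
    refine ⟨e.time + 1 + t, ?_, fun M B hM hB hMB hW => ?_⟩
    · simp only [Prog.weight]
      nlinarith
    · have h₀ : t * b ^ d ≤ (e.time + 1 + t) * b ^ d := Nat.mul_le_mul_right _ (by omega)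
      obtain ⟨h₃, h₄⟩ := h₁ M B hM hB (by omega) hW
      exact ⟨.ite_true (hfit hconst.1 hd.1 hM hB (by omega) hW) hv h₃, h₄.mono (by omega)⟩
  | @ite_false e P Q σ τ n hv _ ih =>
    simp only [Prog.maxConst, Prog.tame, Prog.exprTime, Bool.and_eq_true, max_le_iff] at hconst htame hd
    obtain ⟨t, ht, h₁⟩ := ih hconst.2.2 htame.2 hd.2.2
    refine ⟨e.time + 1 + t, ?_, fun M B hM hB hMB hW => ?_⟩
    · simp only [Prog.weight]
      nlinarith
    · have h₀ : t * b ^ d ≤ (e.time + 1 + t) * b ^ d := Nat.mul_le_mul_right _ (by omega)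
      obtain ⟨h₃, h₄⟩ := h₁ M B hM hB (by omega) hW
      exact ⟨.ite_false (hfit hconst.1 hd.1 hM hB (by omega) hW) hv h₃, h₄.mono (by omega)⟩
  | @loop_done e P σ hv =>
    simp only [Prog.maxConst, Prog.exprTime, max_le_iff] at hconst hd
    refine ⟨e.time + 1, by simp [Prog.weight], fun M B hM hB hMB hW => ⟨.loop_done ?_ hv, ?_⟩⟩
    · exact hfit hconst.1 hd.1 hM hB (by omega) hW
    · exact hM.mono (by omega)
  | @loop_step e P σ τ ρ n n' hv _ _ ih ih' =>
    have hconst' := hconst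
    have hd' := hd
    simp only [Prog.maxConst, Prog.exprTime, max_le_iff] at hconst hd
    obtain ⟨t, ht, h₁⟩ := ih hconst.2 htame hd.2
    obtain ⟨u, hu, h₂⟩ := ih' hconst' htame hd'
    refine ⟨e.time + 1 + t + u, ?_, fun M B hM hB hMB hW => ?_⟩
    · simp only [Prog.weight] at hu ⊢
      nlinarith
    · rw [Nat.add_mul, ← Nat.add_assoc] at hMB ⊢
      have h₀ : t * b ^ d ≤ (e.time + 1 + t) * b ^ d := Nat.mul_le_mul_right _ (by omega)
      obtain ⟨h₃, h₄⟩ := h₁ M B hM hB (by omega) hW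
      obtain ⟨h₅, h₆⟩ := h₂ _ B (h₄.mono (M' := M + (e.time + 1 + t) * b ^ d) (by omega)) hB hMB hW
      exact ⟨.loop_step (hfit hconst.1 hd.1 hM hB (by omega) hW) hv h₃ h₅, h₆⟩

/-! ### Rules for verifying programs -/

/-- From the store `σ` the program reaches, with at most `n` iterations of loops, a store that
satisfies `Q`. -/
def Spec (P : Prog) (σ : Store) (n : ℕ) (Q : Store → Prop) : Prop :=
  ∃ m ≤ n, ∃ τ, Run P σ m τ ∧ Q τ

theorem Spec.mono {P : Prog} {σ : Store} {n n' : ℕ} {Q Q' : Store → Prop} (h : Spec P σ n Q)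
    (hn : n ≤ n') (hQ : ∀ τ, Q τ → Q' τ) : Spec P σ n' Q' := by
  obtain ⟨m, hm, τ, h₁, h₂⟩ := h
  exact ⟨m, hm.trans hn, τ, h₁, hQ τ h₂⟩

theorem Spec.seq {P P' : Prog} {σ : Store} {n n' : ℕ} {Q Q' : Store → Prop} (h : Spec P σ n Q)
    (h' : ∀ τ, Q τ → Spec P' τ n' Q') : Spec (.seq P P') σ (n + n') Q' := by
  obtain ⟨m, hm, τ, h₁, h₂⟩ := h
  obtain ⟨m', hm', ρ, h₃, h₄⟩ := h' τ h₂
  exact ⟨m + m', by omega, ρ, .seq h₁ h₃, h₄⟩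

/-- The store after the execution of a program without loops. -/
def Prog.eval : Prog → Store → Store
  | .skip, σ => σ
  | .assign x e, σ => σ.setReg x (e.val σ)
  | .write A i e, σ => σ.setCell A (i.val σ) (e.val σ)
  | .seq P Q, σ => Q.eval (P.eval σ)
  | .ite e P Q, σ => if e.val σ ≠ 0 then P.eval σ else Q.eval σ
  | .loop _ _, σ => σ

def Prog.loopFree : Prog → Bool
  | .seq P Q => P.loopFree && Q.loopFree
  | .ite _ P Q => P.loopFree && Q.loopFree
  | .loop _ _ => false
  | _ => true

theorem Run.eval {P : Prog} (hP : P.loopFree = true) (σ : Store) : Run P σ 0 (P.eval σ) := by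
  induction P generalizing σ with
  | skip => exact .skip σ
  | assign x e => exact .assign σ x e
  | write A i e => exact .write σ A i e
  | seq P Q ihP ihQ =>
    simp only [Prog.loopFree, Bool.and_eq_true] at hP
    exact .seq (ihP hP.1 σ) (ihQ hP.2 _)
  | ite e P Q ihP ihQ =>
    simp only [Prog.loopFree, Bool.and_eq_true] at hP
    simp only [Prog.eval]
    split_ifs with h
    · exact .ite_true h (ihP hP.1 σ)
    · exact .ite_false (not_not.1 h) (ihQ hP.2 σ)
  | loop e P => simp [Prog.loopFree] at hP

theorem Spec.eval {P : Prog} (hP : P.loopFree = true) {σ : Store} {Q : Store → Prop}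
    (h : Q (P.eval σ)) : Spec P σ 0 Q :=
  ⟨0, le_rfl, _, .eval hP σ, h⟩

theorem Spec.ite {e : Expr} {P P' : Prog} {σ : Store} {n : ℕ} {Q : Store → Prop}
    (h : e.val σ ≠ 0 → Spec P σ n Q) (h' : e.val σ = 0 → Spec P' σ n Q) :
    Spec (.ite e P P') σ n Q := by
  by_cases hv : e.val σ = 0
  · obtain ⟨m, hm, τ, h₁, h₂⟩ := h' hv
    exact ⟨m, hm, τ, .ite_false hv h₁, h₂⟩
  · obtain ⟨m, hm, τ, h₁, h₂⟩ := h hv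
    exact ⟨m, hm, τ, .ite_true hv h₁, h₂⟩

/-- The program may change the register. -/
def Prog.setsReg : Prog → ℕ → Bool
  | .assign x _, y => x == y
  | .seq P Q, y => P.setsReg y || Q.setsReg y
  | .ite _ P Q, y => P.setsReg y || Q.setsReg y
  | .loop _ P, y => P.setsReg y
  | _, _ => false

/-- The program may change the array. -/
def Prog.setsCell : Prog → ℕ → Bool
  | .write A _ _, B => A == B
  | .seq P Q, B => P.setsCell B || Q.setsCell B
  | .ite _ P Q, B => P.setsCell B || Q.setsCell B
  | .loop _ P, B => P.setsCell B
  | _, _ => false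

theorem Run.reg_eq {P : Prog} {σ τ : Store} {n x : ℕ} (h : Run P σ n τ) (hx : P.setsReg x = false) :
    τ.reg x = σ.reg x := by
  induction h with
  | assign σ y e =>
    simp only [Prog.setsReg, beq_eq_false_iff_ne] at hx
    simp [Store.setReg, hx.symm]
  | seq _ _ ih ih' =>
    simp only [Prog.setsReg, Bool.or_eq_false_iff] at hx
    rw [ih' hx.2, ih hx.1]
  | ite_true _ _ ih => simp only [Prog.setsReg, Bool.or_eq_false_iff] at hx; exact ih hx.1
  | ite_false _ _ ih => simp only [Prog.setsReg, Bool.or_eq_false_iff] at hx; exact ih hx.2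
  | loop_step _ _ _ ih ih' => rw [ih' hx, ih hx]
  | _ => rfl

theorem Run.cell_eq {P : Prog} {σ τ : Store} {n A : ℕ} (h : Run P σ n τ)
    (hA : P.setsCell A = false) : τ.cell A = σ.cell A := by
  induction h with
  | write σ B i e =>
    simp only [Prog.setsCell, beq_eq_false_iff_ne] at hA
    simp [Store.setCell, hA.symm]
  | seq _ _ ih ih' =>
    simp only [Prog.setsCell, Bool.or_eq_false_iff] at hA
    rw [ih' hA.2, ih hA.1]
  | ite_true _ _ ih => simp only [Prog.setsCell, Bool.or_eq_false_iff] at hA; exact ih hA.1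
  | ite_false _ _ ih => simp only [Prog.setsCell, Bool.or_eq_false_iff] at hA; exact ih hA.2
  | loop_step _ _ _ ih ih' => rw [ih' hA, ih hA]
  | _ => rfl

/-- An injective numbering of the pairs of numbers. -/
def key (x y : ℕ) : ℕ := (x + y) * (x + y) + x

/-- As `key x y` lies between `(x + y) ^ 2` and the next square, it determines `x + y`, and then
`x`. -/
theorem key_inj {x y x' y' : ℕ} : key x y = key x' y' ↔ x = x' ∧ y = y' := by
  refine ⟨fun h => ?_, fun h => by rw [h.1, h.2]⟩
  unfold key at h
  have : x + y = x' + y' := by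
    rcases lt_trichotomy (x + y) (x' + y') with h₁ | h₁ | h₁
    · nlinarith
    · exact h₁
    · nlinarith
  rw [this] at h
  omega

/-- The expression for the number of a pair. -/
def Expr.key (e f : Expr) : Expr := .op .add (.op .mul (.op .add e f) (.op .add e f)) e

theorem Expr.val_key (σ : Store) (e f : Expr) :
    (Expr.key e f).val σ = WordRAM.key (e.val σ) (f.val σ) := rfl

/-- All changes of arrays other than array `1` are in the row with the number in register `r`. -/
def Prog.Rowed (r : ℕ) : Prog → Prop
  | .assign x _ => x ≠ r
  | .write A i _ => A = 1 ∨ ∃ f, i = Expr.key (.reg r) f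
  | .seq P Q => P.Rowed r ∧ Q.Rowed r
  | .ite _ P Q => P.Rowed r ∧ Q.Rowed r
  | .loop _ P => P.Rowed r
  | .skip => True

/-- Codes of pairs with different first components differ. A phase that writes only to its own row
therefore leaves the earlier texts intact and finds its own tables still zero. -/
theorem Run.row_eq {P : Prog} {σ τ : Store} {n r : ℕ} (h : Run P σ n τ) (hr : P.Rowed r) :
    τ.reg r = σ.reg r ∧
      ∀ A ≠ 1, ∀ q ≠ σ.reg r, ∀ z, τ.cell A (key q z) = σ.cell A (key q z) := by
  induction h with
  | assign σ y e => exact ⟨by simp [Store.setReg, Ne.symm hr], fun _ _ _ _ _ => rfl⟩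
  | write σ B i e =>
    refine ⟨rfl, fun A hA q hq z => ?_⟩
    simp only [Store.setCell, Function.update_apply]
    split_ifs with h₁
    · subst h₁
      obtain ⟨f, rfl⟩ := hr.resolve_left hA
      rw [Function.update_of_ne]
      rw [Expr.val_key, Ne, key_inj]
      exact fun h => hq h.1
    · rfl
  | seq _ _ ih ih' =>
    obtain ⟨h₁, h₂⟩ := ih hr.1
    obtain ⟨h₃, h₄⟩ := ih' hr.2
    exact ⟨h₃.trans h₁, fun A hA q hq z => (h₄ A hA q (h₁ ▸ hq) z).trans (h₂ A hA q hq z)⟩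
  | ite_true _ _ ih => exact ih hr.1
  | ite_false _ _ ih => exact ih hr.2
  | loop_step _ _ _ ih ih' =>
    obtain ⟨h₁, h₂⟩ := ih hr
    obtain ⟨h₃, h₄⟩ := ih' hr
    exact ⟨h₃.trans h₁, fun A hA q hq z => (h₄ A hA q (h₁ ▸ hq) z).trans (h₂ A hA q hq z)⟩
  | _ => exact ⟨rfl, fun _ _ _ _ _ => rfl⟩

/-- What a program leaves unchanged. -/
structure Frame (P : Prog) (σ τ : Store) : Prop where
  reg : ∀ x, P.setsReg x = false → τ.reg x = σ.reg x
  cell : ∀ A, P.setsCell A = false → τ.cell A = σ.cell A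
  row : ∀ r, P.Rowed r → τ.reg r = σ.reg r ∧
    ∀ A ≠ 1, ∀ q ≠ σ.reg r, ∀ z, τ.cell A (key q z) = σ.cell A (key q z)

theorem Frame.refl (P : Prog) (σ : Store) : Frame P σ σ :=
  ⟨fun _ _ => rfl, fun _ _ => rfl, fun _ _ => ⟨rfl, fun _ _ _ _ _ => rfl⟩⟩

theorem Frame.trans {P : Prog} {σ τ ρ : Store} (h : Frame P σ τ) (h' : Frame P τ ρ) :
    Frame P σ ρ where
  reg x hx := (h'.reg x hx).trans (h.reg x hx)
  cell A hA := (h'.cell A hA).trans (h.cell A hA)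
  row r hr := by
    obtain ⟨h₁, h₂⟩ := h.row r hr
    obtain ⟨h₃, h₄⟩ := h'.row r hr
    exact ⟨h₃.trans h₁, fun A hA q hq z => (h₄ A hA q (h₁ ▸ hq) z).trans (h₂ A hA q hq z)⟩

theorem Run.frame {P : Prog} {σ τ : Store} {n : ℕ} (h : Run P σ n τ) : Frame P σ τ :=
  ⟨fun _ => h.reg_eq, fun _ => h.cell_eq, fun _ => h.row_eq⟩

theorem Spec.frame {P : Prog} {σ : Store} {n : ℕ} {Q : Store → Prop} (h : Spec P σ n Q) :
    Spec P σ n fun τ => Q τ ∧ Frame P σ τ := by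
  obtain ⟨m, hm, τ, h₁, h₂⟩ := h
  exact ⟨m, hm, τ, h₁, h₂, h₁.frame⟩

/-- The rule for loops, with an invariant `J` and a potential `Φ` that pays for the iterations. -/
theorem Spec.loop {γ : Type} (J : γ → Store → Prop) (Φ : γ → ℕ) {e : Expr} {P : Prog} {σ₀ : Store}
    (h : ∀ g σ, Frame P σ₀ σ → J g σ → e.val σ ≠ 0 →
      ∃ n, Spec P σ n fun τ => ∃ g', J g' τ ∧ n + 1 + Φ g' ≤ Φ g)
    {g₀ : γ} (hJ : J g₀ σ₀) :
    Spec (.loop e P) σ₀ (Φ g₀) fun τ => ∃ g', J g' τ ∧ e.val τ = 0 := by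
  have key : ∀ k g σ, Frame P σ₀ σ → J g σ → Φ g = k →
      Spec (.loop e P) σ k fun τ => ∃ g', J g' τ ∧ e.val τ = 0 := by
    intro k
    induction k using Nat.strong_induction_on with
    | _ k ih =>
      intro g σ hf hJ hk
      by_cases hv : e.val σ = 0
      · exact ⟨0, Nat.zero_le _, σ, .loop_done hv, g, hJ, hv⟩
      · obtain ⟨n, m, hm, τ, h₁, g', h₂, h₃⟩ := h g σ hf hJ hv
        obtain ⟨m', hm', ρ, h₄, h₅⟩ := ih (Φ g') (by omega) g' τ (hf.trans h₁.frame) h₂ rfl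
        exact ⟨m + 1 + m', by omega, ρ, .loop_step hv h₁ h₄, h₅⟩
  exact key _ g₀ σ₀ (.refl P σ₀) hJ rfl

/-- A program without loops before another one. -/
theorem Spec.init {P P' : Prog} {σ : Store} {n : ℕ} {Q : Store → Prop} (hP : P.loopFree = true)
    (h : Spec P' (P.eval σ) n Q) : Spec (.seq P P') σ n Q := by
  obtain ⟨m, hm, τ, h₁, h₂⟩ := h
  exact ⟨0 + m, by omega, τ, .seq (.eval hP σ) h₁, h₂⟩

theorem Store.reg_setReg (σ : Store) (x v y : ℕ) :
    (σ.setReg x v).reg y = if y = x then v else σ.reg y := by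
  simp [Store.setReg, Function.update_apply]

theorem Store.cell_setReg (σ : Store) (x v : ℕ) : (σ.setReg x v).cell = σ.cell := rfl

theorem Store.reg_setCell (σ : Store) (A i v : ℕ) : (σ.setCell A i v).reg = σ.reg := rfl

theorem Store.cell_setCell (σ : Store) (A i v B j : ℕ) :
    (σ.setCell A i v).cell B j = if B = A ∧ j = i then v else σ.cell B j := by
  simp only [Store.setCell, Function.update_apply]
  by_cases h : B = A
  · subst h
    simp [Function.update_apply]
  · simp [h]

/-- The rule for loops that scan a word from right to left; register `i` counts the letters that have
been scanned. -/
theorem Spec.scan {β : Type} {T : List β} {i n : ℕ} {P : Prog} (Inv : List β → Store → Prop)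
    (Φ : List β → ℕ) (hn : P.setsReg n = false)
    {σ₀ : Store}
    (h : ∀ a s σ, a :: s <:+ T → Frame P σ₀ σ → Inv s σ → σ.reg i = s.length → ∃ k, k + 1 + Φ s ≤ Φ (a :: s) ∧
      Spec P σ k fun τ => Inv (a :: s) τ ∧ τ.reg i = s.length + 1)
    (hT : σ₀.reg n = T.length) (hi : σ₀.reg i = 0) (hInv : Inv [] σ₀) :
    Spec (.loop (.op .lt (.reg i) (.reg n)) P) σ₀ (Φ T) fun τ => Inv T τ := by
  have key : ∀ (u s : List β) (σ : Store), u ++ s = T → Frame P σ₀ σ → Inv s σ → σ.reg i = s.length →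
      σ.reg n = T.length → ∃ b, b + Φ s ≤ Φ T ∧
        Spec (.loop (.op .lt (.reg i) (.reg n)) P) σ b fun τ => Inv T τ := by
    intro u
    induction u using List.reverseRecOn with
    | nil =>
      rintro s σ rfl hf h₁ h₂ h₃
      refine ⟨0, by simp, 0, le_rfl, σ, .loop_done ?_, h₁⟩
      simp [Expr.val, BinOp.apply, h₂, h₃]
    | append_singleton u a ih =>
      intro s σ hu hf h₁ h₂ h₃
      have hs : u ++ a :: s = T := by simpa using hu
      obtain ⟨k, hk, m, hm, τ, h₄, h₅, h₆⟩ := h a s σ ⟨u, hs⟩ hf h₁ h₂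
      obtain ⟨b, hb, m', hm', ρ, h₇, h₈⟩ := ih (a :: s) τ hs (hf.trans h₄.frame) h₅ h₆ ((h₄.reg_eq hn).trans h₃)
      refine ⟨k + 1 + b, by omega, m + 1 + m', by omega, ρ, .loop_step ?_ h₄ h₇, h₈⟩
      have : s.length < T.length := by simp [← hs]; omega
      simp [Expr.val, BinOp.apply, h₂, h₃, this]
  obtain ⟨b, hb, h'⟩ := key T [] σ₀ (by simp) (.refl P σ₀) hInv hi hT
  exact h'.mono (by omega) fun _ h => h

end WordRAM

/-! ### Notation for programs: registers and arrays -/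

prefix:max "♯" => WordRAM.Expr.reg
infix:50 "≔" => WordRAM.Prog.assign
infixr:40 "⨾" => WordRAM.Prog.seq

notation "Rp" => (1 : ℕ)
notation "Rq" => (2 : ℕ)
notation "Rn" => (3 : ℕ)
notation "Rm" => (4 : ℕ)
notation "Rk" => (5 : ℕ)
notation "Rid" => (6 : ℕ)
notation "Rout" => (7 : ℕ)
notation "Rcost" => (8 : ℕ)
notation "Rj" => (9 : ℕ)
notation "Ra" => (10 : ℕ)
notation "Rb" => (11 : ℕ)
notation "Rmax" => (12 : ℕ)
notation "Rl" => (13 : ℕ)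
notation "Rprev" => (14 : ℕ)
notation "Rgap" => (15 : ℕ)
notation "Ri" => (16 : ℕ)
notation "Rd" => (17 : ℕ)
notation "Rx" => (18 : ℕ)
notation "Ry" => (19 : ℕ)
notation "Rc" => (20 : ℕ)
notation "Rs" => (21 : ℕ)
notation "Rt" => (22 : ℕ)
notation "Rbest" => (23 : ℕ)
notation "RbestLen" => (24 : ℕ)
notation "RbestOut" => (25 : ℕ)
notation "RbestId" => (26 : ℕ)
notation "RbestCost" => (27 : ℕ)

notation "Atext" => (2 : ℕ)
notation "Abl" => (3 : ℕ)
notation "Abn" => (4 : ℕ)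
notation "Apres" => (5 : ℕ)
notation "Amax" => (6 : ℕ)
notation "Apow" => (7 : ℕ)
notation "Ablock" => (8 : ℕ)
notation "Amid" => (9 : ℕ)
notation "Adeg" => (10 : ℕ)
notation "Aadj" => (11 : ℕ)
notation "Aside" => (12 : ℕ)
notation "Apair" => (13 : ℕ)

namespace WordRAM

instance : Add Expr := ⟨.op .add⟩
instance : Sub Expr := ⟨.op .sub⟩
instance : Div Expr := ⟨.op .div⟩
instance : Mod Expr := ⟨.op .mod⟩
instance (n : ℕ) : OfNat Expr n := ⟨.const n⟩

/-- A cell in the row of the present phase. -/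
def Expr.row (A : ℕ) (z : Expr) : Expr := .cell A (.key ♯Rp z)

/-- Change a cell in the row of the present phase. -/
def Prog.put (A : ℕ) (z e : Expr) : Prog := .write A (.key ♯Rp z) e

def Expr.less (e f : Expr) : Expr := .op .lt e f

def Expr.same (e f : Expr) : Expr := .op .eq e f

def Expr.both (e f : Expr) : Expr := .op .mul e f

/-- The row of an array, as a function. -/
def Store.row (σ : Store) (A p : ℕ) : ℕ → ℕ := fun z => σ.cell A (key p z)

theorem Store.row_setReg (σ : Store) (x v A p : ℕ) : (σ.setReg x v).row A p = σ.row A p := rfl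

theorem Store.row_setCell (σ : Store) (A p z v B q w : ℕ) :
    (σ.setCell A (WordRAM.key p z) v).row B q w =
      if B = A ∧ q = p ∧ w = z then v else σ.row B q w := by
  simp only [Store.row, Store.cell_setCell, key_inj]

theorem Store.row_setCell_one (σ : Store) (i v B q w : ℕ) (hB : B ≠ 1) :
    (σ.setCell 1 i v).row B q w = σ.row B q w := by
  simp [Store.row, Store.cell_setCell, hB]

@[simp] theorem Store.cell_setCell_of_ne (σ : Store) {A B : ℕ} (i v : ℕ) (h : B ≠ A) :
    (σ.setCell A i v).cell B = σ.cell B := Function.update_of_ne h _ _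

theorem Store.row_congr {σ τ : Store} {A : ℕ} (h : τ.cell A = σ.cell A) (p : ℕ) :
    τ.row A p = σ.row A p := by
  unfold Store.row
  rw [h]

@[simp] theorem Expr.val_row (σ : Store) (A : ℕ) (z : Expr) :
    (Expr.row A z).val σ = σ.row A (σ.reg Rp) (z.val σ) := rfl

@[simp] theorem Prog.eval_put (σ : Store) (A : ℕ) (z e : Expr) :
    (Prog.put A z e).eval σ = σ.setCell A (WordRAM.key (σ.reg Rp) (z.val σ)) (e.val σ) := rfl

@[simp] theorem Expr.val_const (σ : Store) (n : ℕ) :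
    (OfNat.ofNat n : Expr).val σ = n := rfl

@[simp] theorem Expr.val_add (σ : Store) (e f : Expr) : (e + f).val σ = e.val σ + f.val σ := rfl

@[simp] theorem Expr.val_sub (σ : Store) (e f : Expr) : (e - f).val σ = e.val σ - f.val σ := rfl

@[simp] theorem Expr.val_div (σ : Store) (e f : Expr) : (e / f).val σ = e.val σ / f.val σ := rfl

@[simp] theorem Expr.val_mod (σ : Store) (e f : Expr) : (e % f).val σ = e.val σ % f.val σ := rfl

@[simp] theorem Expr.val_less (σ : Store) (e f : Expr) :
    (e.less f).val σ = if e.val σ < f.val σ then 1 else 0 := rfl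

@[simp] theorem Expr.val_same (σ : Store) (e f : Expr) :
    (e.same f).val σ = if e.val σ = f.val σ then 1 else 0 := rfl

@[simp] theorem Expr.val_both (σ : Store) (e f : Expr) :
    (e.both f).val σ = e.val σ * f.val σ := rfl

@[simp] theorem Store.reg_ite (c : Prop) [Decidable c] (σ τ : Store) (x : ℕ) :
    (if c then σ else τ).reg x = if c then σ.reg x else τ.reg x := by split_ifs <;> rfl

@[simp] theorem Store.cell_ite (c : Prop) [Decidable c] (σ τ : Store) (A i : ℕ) :
    (if c then σ else τ).cell A i = if c then σ.cell A i else τ.cell A i := by split_ifs <;> rfl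

@[simp] theorem Store.row_ite (c : Prop) [Decidable c] (σ τ : Store) (A p z : ℕ) :
    (if c then σ else τ).row A p z = if c then σ.row A p z else τ.row A p z := by split_ifs <;> rfl

attribute [simp] Expr.val Prog.eval BinOp.apply Expr.val_key Store.reg_setReg Store.cell_setReg
  Store.reg_setCell Store.cell_setCell Store.row_setReg Store.row_setCell Store.row_setCell_one
  key_inj

theorem Frame.row_eq {P : Prog} {σ τ : Store} (h : Frame P σ τ) {A : ℕ} (hA : P.setsCell A = false)
    (p : ℕ) : τ.row A p = σ.row A p := Store.row_congr (h.cell A hA) p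

/-! ### Lists in the store -/

/-- The values `f 0, f 1, …` stand for the elements of the list, from the last one to the first. -/
def Stk {β γ : Type} (f : ℕ → γ) (R : β → γ → Prop) (L : List β) : Prop :=
  ∀ a s, a :: s <:+ L → R a (f s.length)

section

variable {β γ : Type} {f g : ℕ → γ} {R R' : β → γ → Prop} {L : List β}

theorem Stk.nil : Stk f R ([] : List β) := fun a s h => by simp at h

theorem Stk.cons {a : β} (h : Stk f R L) (ha : R a (f L.length)) : Stk f R (a :: L) := by
  intro b s hs
  rcases List.suffix_cons_iff.1 hs with hs | hs
  · obtain ⟨rfl, rfl⟩ := List.cons_eq_cons.1 hs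
    exact ha
  · exact h b s hs

theorem Stk.tail {a : β} (h : Stk f R (a :: L)) : Stk f R L :=
  fun b s hs => h b s (hs.trans (List.suffix_cons a L))

theorem Stk.head {a : β} (h : Stk f R (a :: L)) : R a (f L.length) := h a L List.suffix_rfl

theorem Stk.congr (h : Stk f R L) (hg : ∀ i < L.length, g i = f i) : Stk g R L := by
  intro a s hs
  rw [hg _ (by have := hs.length_le; simp at this; omega)]
  exact h a s hs

theorem Stk.imp (h : Stk f R L) (hR : ∀ a ∈ L, ∀ n, R a n → R' a n) : Stk f R' L :=
  fun a s hs => hR a (hs.subset (by simp)) _ (h a s hs)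

end

/-- The list is stored from address `k` on. -/
def Holds (f : ℕ → ℕ) (k : ℕ) (L : List ℕ) : Prop :=
  ∀ (i : ℕ) (h : i < L.length), f (k + i) = L[i]

theorem Holds.append {f : ℕ → ℕ} {k : ℕ} {L L' : List ℕ} (h : Holds f k L)
    (h' : Holds f (k + L.length) L') : Holds f k (L ++ L') := by
  intro i hi
  rw [List.getElem_append]
  split_ifs with h₁
  · exact h i h₁
  · rw [List.length_append] at hi
    rw [← h' (i - L.length) (by omega)]
    congr 1
    omega

theorem Holds.left {f : ℕ → ℕ} {k : ℕ} {L L' : List ℕ} (h : Holds f k (L ++ L')) : Holds f k L := by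
  intro i hi
  rw [h i (by simp; omega), List.getElem_append_left hi]

theorem Holds.congr {f g : ℕ → ℕ} {k : ℕ} {L : List ℕ} (h : Holds f k L)
    (hg : ∀ i, k ≤ i → i < k + L.length → g i = f i) : Holds g k L := by
  intro i hi
  rw [hg _ (by omega) (by omega)]
  exact h i hi

theorem Holds.cons {f : ℕ → ℕ} {k a : ℕ} {L : List ℕ} (ha : f k = a) (h : Holds f (k + 1) L) :
    Holds f k (a :: L) := by
  intro i hi
  cases i with
  | zero => simpa
  | succ i =>
    rw [List.getElem_cons_succ, ← h i (by simpa using hi)]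
    congr 1
    omega

theorem Holds.nil {f : ℕ → ℕ} {k : ℕ} : Holds f k [] := fun i hi => by simp at hi

end WordRAM

namespace Recompression

open WordRAM

/-! ### Numbers of letters and the list of productions -/

/-- The heads of the productions. -/
def heads (ps : List (Letter ℕ × List (Letter ℕ))) : List (Letter ℕ) := ps.map Prod.fst

theorem heads_append (ps qs : List (Letter ℕ × List (Letter ℕ))) :
    heads (ps ++ qs) = heads ps ++ heads qs := List.map_append

/-- The letter is an input letter or the head of a production. -/
def Known (ps : List (Letter ℕ × List (Letter ℕ))) (x : Letter ℕ) : Prop :=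
  (∃ a, x = .input a) ∨ x ∈ heads ps

/-- The number of a letter, if the others are numbered in the order of the list. -/
def enc (hs : List (Letter ℕ)) : Letter ℕ → ℕ
  | .input a => 2 * a
  | x => 2 * (hs.idxOf x + 1) + 1

/-- The number `n` stands for the letter `x`. -/
def Code (ps : List (Letter ℕ × List (Letter ℕ))) (x : Letter ℕ) (n : ℕ) : Prop :=
  Known ps x ∧ enc (heads ps) x = n

theorem enc_of_ne {hs : List (Letter ℕ)} {x : Letter ℕ} (h : ∀ a, x ≠ .input a) :
    enc hs x = 2 * (hs.idxOf x + 1) + 1 := by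
  cases x with
  | input a => exact absurd rfl (h a)
  | _ => rfl

/-- A letter is numbered by the place of its production, and productions are only appended; numbers
once written to memory stay valid. -/
theorem enc_append {ps qs : List (Letter ℕ × List (Letter ℕ))} {x : Letter ℕ} (h : Known ps x) :
    enc (heads (ps ++ qs)) x = enc (heads ps) x := by
  rcases h with ⟨a, rfl⟩ | h
  · rfl
  · by_cases hx : ∃ a, x = .input a
    · obtain ⟨a, rfl⟩ := hx
      rfl
    · push Not at hx
      rw [enc_of_ne hx, enc_of_ne hx, heads_append, List.idxOf_append_of_mem h]

theorem Known.append {ps : List (Letter ℕ × List (Letter ℕ))} {x : Letter ℕ} (h : Known ps x)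
    (qs : List (Letter ℕ × List (Letter ℕ))) : Known (ps ++ qs) x := by
  rcases h with h | h
  · exact .inl h
  · exact .inr (by rw [heads_append]; exact List.mem_append_left _ h)

theorem Code.append {ps : List (Letter ℕ × List (Letter ℕ))} {x : Letter ℕ} {n : ℕ}
    (h : Code ps x n) (qs : List (Letter ℕ × List (Letter ℕ))) : Code (ps ++ qs) x n :=
  ⟨h.1.append qs, (enc_append h.1).trans h.2⟩

theorem Code.inj {ps : List (Letter ℕ × List (Letter ℕ))} {x y : Letter ℕ} {m n : ℕ}
    (hx : Code ps x m) (hy : Code ps y n) : m = n ↔ x = y := by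
  obtain ⟨hx, rfl⟩ := hx
  obtain ⟨hy, rfl⟩ := hy
  refine ⟨fun h => ?_, fun h => by rw [h]⟩
  by_cases h₁ : ∃ a, x = .input a <;> by_cases h₂ : ∃ b, y = .input b
  · obtain ⟨a, rfl⟩ := h₁
    obtain ⟨b, rfl⟩ := h₂
    simp only [enc] at h
    rw [show a = b by omega]
  · obtain ⟨a, rfl⟩ := h₁
    push Not at h₂
    rw [enc_of_ne h₂] at h
    simp only [enc] at h
    omega
  · obtain ⟨a, rfl⟩ := h₂
    push Not at h₁
    rw [enc_of_ne h₁] at h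
    simp only [enc] at h
    omega
  · have hx' := hx.resolve_left h₁
    push Not at h₁ h₂
    rw [enc_of_ne h₁, enc_of_ne h₂] at h
    exact (List.idxOf_inj hx').1 (by omega)

/-- Introduced letters have nonzero numbers, so that `0` in a table can mean that there is no entry.
-/
theorem Code.pos {ps : List (Letter ℕ × List (Letter ℕ))} {x : Letter ℕ} {n : ℕ}
    (h : Code ps x n) (hx : ∀ a, x ≠ .input a) : 0 < n := by
  rw [← h.2, enc_of_ne hx]
  omega

/-- The listing of the productions by numbers. -/
def flat (ps : List (Letter ℕ × List (Letter ℕ))) : List ℕ :=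
  ps.flatMap fun q => ((heads ps).idxOf q.1 + 1) :: q.2.length :: q.2.map (enc (heads ps))

/-- The list of productions is stored in the output array. -/
structure Out (ps : List (Letter ℕ × List (Letter ℕ))) (σ : Store) : Prop where
  nodup : (heads ps).Nodup
  ne_input : ∀ x ∈ heads ps, ∀ a, x ≠ .input a
  closed : ∀ q ∈ ps, ∀ x ∈ q.2, Known ps x
  holds : Holds (σ.cell 1) 2 (flat ps)
  id : σ.reg Rid = 2 * ps.length + 3
  out : σ.reg Rout = 2 + (flat ps).length
  cost : σ.reg Rcost = (ps.map fun q => q.2.length).sum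

theorem Out.congr {ps : List (Letter ℕ × List (Letter ℕ))} {σ τ : Store} (h : Out ps σ)
    (h₁ : τ.cell 1 = σ.cell 1) (h₂ : τ.reg Rid = σ.reg Rid) (h₃ : τ.reg Rout = σ.reg Rout)
    (h₄ : τ.reg Rcost = σ.reg Rcost) : Out ps τ where
  nodup := h.nodup
  ne_input := h.ne_input
  closed := h.closed
  holds := h₁ ▸ h.holds
  id := h₂.trans h.id
  out := h₃.trans h.out
  cost := h₄.trans h.cost

theorem Out.frame {ps : List (Letter ℕ × List (Letter ℕ))} {P : Prog} {σ τ : Store} (h : Out ps σ)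
    (hf : Frame P σ τ) (h₁ : P.setsCell 1 = false) (h₂ : P.setsReg Rid = false)
    (h₃ : P.setsReg Rout = false) (h₄ : P.setsReg Rcost = false) : Out ps τ :=
  h.congr (hf.cell _ h₁) (hf.reg _ h₂) (hf.reg _ h₃) (hf.reg _ h₄)

theorem flat_append_singleton {ps : List (Letter ℕ × List (Letter ℕ))} {h : Letter ℕ}
    {b : List (Letter ℕ)} (hh : h ∉ heads ps) (hps : ∀ q ∈ ps, ∀ x ∈ q.2, Known ps x)
    (hb : ∀ x ∈ b, Known ps x) :
    flat (ps ++ [(h, b)]) = flat ps ++ ((ps.length + 1) :: b.length :: b.map (enc (heads ps))) := by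
  have hidx : (heads (ps ++ [(h, b)])).idxOf h = ps.length := by
    rw [heads_append, List.idxOf_append_of_notMem hh]
    simp [heads]
  rw [flat, List.flatMap_append, flat]
  congr 1
  · refine List.flatMap_congr fun q hq => ?_
    have h₁ : q.1 ∈ heads ps := List.mem_map.2 ⟨q, hq, rfl⟩
    have h₂ : q.2.map (enc (heads (ps ++ [(h, b)]))) = q.2.map (enc (heads ps)) :=
      List.map_congr_left fun x hx => enc_append (hps q hq x hx)
    rw [h₂, heads_append, List.idxOf_append_of_mem h₁]
  · have h₂ : b.map (enc (heads (ps ++ [(h, b)]))) = b.map (enc (heads ps)) :=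
      List.map_congr_left fun x hx => enc_append (hb x hx)
    simp only [List.flatMap_cons, List.flatMap_nil, List.append_nil, hidx, h₂]

/-- A production is appended to the listing. -/
theorem Out.append {ps : List (Letter ℕ × List (Letter ℕ))} {σ τ : Store} (h : Out ps σ)
    {x : Letter ℕ} {b : List (Letter ℕ)} {ns : List ℕ} (hx : x ∉ heads ps) (hx' : ∀ a, x ≠ .input a)
    (hb : List.Forall₂ (Code ps) b ns) (h₁ : ∀ i < σ.reg Rout, τ.cell 1 i = σ.cell 1 i)
    (h₂ : Holds (τ.cell 1) (σ.reg Rout) (σ.reg Rid / 2 :: b.length :: ns))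
    (h₃ : τ.reg Rid = σ.reg Rid + 2) (h₄ : τ.reg Rout = σ.reg Rout + (2 + b.length))
    (h₅ : τ.reg Rcost = σ.reg Rcost + b.length) :
    Out (ps ++ [(x, b)]) τ ∧ Code (ps ++ [(x, b)]) x (σ.reg Rid) := by
  have hns : b.map (enc (heads ps)) = ns ∧ ∀ y ∈ b, Known ps y := by
    clear h₂ h₄ h₅
    induction hb with
    | nil => simp
    | cons h _ ih => exact ⟨by rw [List.map_cons, h.2, ih.1], List.forall_mem_cons.2 ⟨h.1, ih.2⟩⟩
  obtain ⟨hns, hbk⟩ := hns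
  have hflat := flat_append_singleton hx h.closed hbk
  rw [hns] at hflat
  have hlen := hb.length_eq
  have hid := h.id
  have hout := h.out
  refine ⟨⟨?_, ?_, ?_, ?_, ?_, ?_, ?_⟩, .inr (by simp [heads]), ?_⟩
  · rw [heads_append]
    refine List.nodup_append.2 ⟨h.nodup, by simp [heads], ?_⟩
    rintro y hy z hz rfl
    simp only [heads, List.map_cons, List.map_nil, List.mem_singleton] at hz
    exact hx (hz ▸ hy)
  · intro y hy
    simp only [heads, List.map_append, List.map_cons, List.map_nil, List.mem_append,
      List.mem_singleton] at hy
    rcases hy with hy | rfl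
    · exact h.ne_input y hy
    · exact hx'
  · intro q hq y hy
    rcases List.mem_append.1 hq with hq | hq
    · exact (h.closed q hq y hy).append _
    · rw [List.mem_singleton] at hq
      subst hq
      exact (hbk y hy).append _
  · rw [hflat]
    refine (h.holds.congr fun i _ hi => h₁ i (by omega)).append ?_
    rw [← hout]
    rwa [show ps.length + 1 = σ.reg Rid / 2 by omega]
  · simp; omega
  · rw [hflat, h₄, hout]
    simp
    omega
  · simp [h₅, h.cost]
  · rw [enc_of_ne hx', heads_append, List.idxOf_append_of_notMem hx]
    simp [heads]
    omega

/-- Append a production with a body of two letters. -/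
def emitTwo : Prog :=
  .write 1 ♯Rout (♯Rid / 2) ⨾ .write 1 (♯Rout + 1) 2 ⨾ .write 1 (♯Rout + 2) ♯Rx ⨾
  .write 1 (♯Rout + 3) ♯Ry ⨾ Rc ≔ ♯Rid ⨾ Rid ≔ ♯Rid + 2 ⨾ Rout ≔ ♯Rout + 4 ⨾ Rcost ≔ ♯Rcost + 2

/-- Append a production with a body of one letter. -/
def emitOne : Prog :=
  .write 1 ♯Rout (♯Rid / 2) ⨾ .write 1 (♯Rout + 1) 1 ⨾ .write 1 (♯Rout + 2) ♯Rx ⨾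
  Rc ≔ ♯Rid ⨾ Rid ≔ ♯Rid + 2 ⨾ Rout ≔ ♯Rout + 3 ⨾ Rcost ≔ ♯Rcost + 1

theorem spec_emitTwo {ps : List (Letter ℕ × List (Letter ℕ))} {σ : Store} (h : Out ps σ)
    {x y z : Letter ℕ} (hx : x ∉ heads ps) (hx' : ∀ a, x ≠ .input a) (hy : Code ps y (σ.reg Rx))
    (hz : Code ps z (σ.reg Ry)) :
    Spec emitTwo σ 0 fun τ => (Out (ps ++ [(x, [y, z])]) τ ∧
      Code (ps ++ [(x, [y, z])]) x (τ.reg Rc)) ∧ Frame emitTwo σ τ := by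
  refine (Spec.eval rfl ?_).frame
  have := h.append (τ := emitTwo.eval σ) hx hx' (.cons hy (.cons hz .nil)) (fun i hi => ?_) ?_ ?_ ?_ ?_
  · refine ⟨this.1, ?_⟩
    have e : (emitTwo.eval σ).reg Rc = σ.reg Rid := by simp [emitTwo]
    rw [e]
    exact this.2
  · have h₁ : i ≠ σ.reg Rout := by omega
    simp [emitTwo, h₁, show i ≠ σ.reg Rout + 1 by omega, show i ≠ σ.reg Rout + 2 by omega,
      show i ≠ σ.reg Rout + 3 by omega]
  · refine .cons ?_ (.cons ?_ (.cons ?_ (.cons ?_ .nil))) <;> simp [emitTwo, Nat.add_assoc]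
  all_goals simp [emitTwo]

theorem spec_emitOne {ps : List (Letter ℕ × List (Letter ℕ))} {σ : Store} (h : Out ps σ)
    {x y : Letter ℕ} (hx : x ∉ heads ps) (hx' : ∀ a, x ≠ .input a) (hy : Code ps y (σ.reg Rx)) :
    Spec emitOne σ 0 fun τ => (Out (ps ++ [(x, [y])]) τ ∧
      Code (ps ++ [(x, [y])]) x (τ.reg Rc)) ∧ Frame emitOne σ τ := by
  refine (Spec.eval rfl ?_).frame
  have := h.append (τ := emitOne.eval σ) hx hx' (.cons hy .nil) (fun i hi => ?_) ?_ ?_ ?_ ?_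
  · refine ⟨this.1, ?_⟩
    have e : (emitOne.eval σ).reg Rc = σ.reg Rid := by simp [emitOne]
    rw [e]
    exact this.2
  · have h₁ : i ≠ σ.reg Rout := by omega
    simp [emitOne, h₁, show i ≠ σ.reg Rout + 1 by omega, show i ≠ σ.reg Rout + 2 by omega]
  · refine .cons ?_ (.cons ?_ (.cons ?_ .nil)) <;> simp [emitOne, Nat.add_assoc]
  all_goals simp [emitOne]

end Recompression

/-! ### The linear-time program and its verification -/

namespace Recompression

open WordRAM

/-! ### The program: maximal blocks -/

/-- The maximal blocks `B` are stored in the arrays of letters and of lengths. -/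
def BlockStk (ps : List (Letter ℕ × List (Letter ℕ))) (B : List (Letter ℕ × ℕ)) (σ : Store) : Prop :=
  Stk (fun i => (σ.row Abl (σ.reg Rp) i, σ.row Abn (σ.reg Rp) i))
    (fun q c => Code ps q.1 c.1 ∧ c.2 = q.2) B

def findBlocksBody : Prog :=
  Ra ≔ .cell Atext (.key ♯Rq ♯Rj) ⨾
  .ite ((Expr.less 0 ♯Rm).both (.same (.row Abl (♯Rm - 1)) ♯Ra))
    (.put Abn (♯Rm - 1) (.row Abn (♯Rm - 1) + 1))
    (.put Abl ♯Rm ♯Ra ⨾ .put Abn ♯Rm 1 ⨾ Rm ≔ ♯Rm + 1) ⨾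
  Rj ≔ ♯Rj + 1

/-- Find the maximal blocks of the text. -/
def findBlocks : Prog :=
  (Rj ≔ 0 ⨾ Rm ≔ 0) ⨾ .loop (.op .lt ♯Rj ♯Rn) findBlocksBody

theorem spec_findBlocks {ps : List (Letter ℕ × List (Letter ℕ))} {T : List (Letter ℕ)} {σ : Store}
    (hT : Stk (σ.row Atext (σ.reg Rq)) (Code ps) T) (hn : σ.reg Rn = T.length) :
    Spec findBlocks σ T.length fun τ =>
      τ.reg Rm = (maximalBlocks T).length ∧ BlockStk ps (maximalBlocks T) τ := by
  refine Spec.init rfl (Spec.scan (fun s σ => σ.reg Rm = (maximalBlocks s).length ∧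
    BlockStk ps (maximalBlocks s) σ) List.length rfl ?_ (by simpa) (by simp) ?_)
  · rintro a s τ hs hf ⟨h₁, h₂⟩ h₃
    refine ⟨0, by simp; omega, Spec.eval rfl ?_⟩
    have hq : τ.reg Rq = σ.reg Rq := by simpa using hf.reg Rq rfl
    have ht : τ.row Atext (τ.reg Rq) = σ.row Atext (σ.reg Rq) := by
      rw [hq, hf.row_eq rfl]; simp
    have ha : Code ps a (τ.cell Atext (key (τ.reg Rq) s.length)) := by
      have := hT a s hs
      rw [← ht] at this
      exact this
    unfold BlockStk at h₂ ⊢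
    rw [maximalBlocks]
    rcases hB : maximalBlocks s with - | ⟨⟨b, l⟩, r⟩
    · rw [hB] at h₁
      simp only [List.length_nil] at h₁
      refine ⟨⟨by simp [findBlocksBody, h₁, h₃], Stk.nil.cons ?_⟩, by simp [findBlocksBody, h₁, h₃]⟩
      simpa [findBlocksBody, h₁, h₃] using ha
    · rw [hB] at h₁ h₂
      simp only [List.length_cons] at h₁
      have h₄ := h₂.head
      simp only at h₄
      have h₅ := h₄.1.inj ha
      by_cases hab : a = b
      · subst hab
        have hc := h₅.2 rfl
        dsimp only
        rw [if_pos rfl]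
        refine ⟨⟨by simp [findBlocksBody, h₁, h₃, hc], (h₂.tail.congr fun i hi => ?_).cons ?_⟩,
          by simp [findBlocksBody, h₁, h₃, hc]⟩
        · simp [findBlocksBody, h₁, h₃, hc, hi.ne]
        · simp [findBlocksBody, h₁, h₃, hc, h₄.2, ha]
      · have hc := mt h₅.1 (Ne.symm hab)
        dsimp only
        rw [if_neg hab]
        refine ⟨⟨by simp [findBlocksBody, h₁, h₃, hc], (h₂.congr fun i hi => ?_).cons ?_⟩,
          by simp [findBlocksBody, h₁, h₃, hc]⟩
        · have : i ≠ r.length + 1 := by simp at hi; omega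
          simp [findBlocksBody, h₁, h₃, hc, this]
        · simp [findBlocksBody, h₁, h₃, hc, ha]
  · simp [BlockStk, maximalBlocks, Stk.nil]

/-- The lengths greater than `1` of the blocks in `B` are marked, and their maxima are recorded. -/
def Marked (ps : List (Letter ℕ × List (Letter ℕ))) (B : List (Letter ℕ × ℕ)) (σ : Store) : Prop :=
  ∀ a c, Code ps a c →
    (∀ l, σ.row Apres (σ.reg Rp) (key c l) = if (a, l) ∈ B ∧ 1 < l then 1 else 0) ∧
    (∀ l, (a, l) ∈ B → 1 < l → l ≤ σ.row Amax (σ.reg Rp) c) ∧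
    (σ.row Amax (σ.reg Rp) c = 0 ∨ 1 < σ.row Amax (σ.reg Rp) c ∧
      (a, σ.row Amax (σ.reg Rp) c) ∈ B)

def markBlocksBody : Prog :=
  Ra ≔ .row Abl ♯Rj ⨾ Rl ≔ .row Abn ♯Rj ⨾
  .ite (.less 1 ♯Rl)
    (.put Apres (.key ♯Ra ♯Rl) 1 ⨾ .ite (.less (.row Amax ♯Ra) ♯Rl) (.put Amax ♯Ra ♯Rl) .skip)
    .skip ⨾
  Rj ≔ ♯Rj + 1

/-- Mark the lengths of the blocks that are replaced. -/
def markBlocks : Prog :=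
  Rj ≔ 0 ⨾ .loop (.op .lt ♯Rj ♯Rm) markBlocksBody

theorem spec_markBlocks {ps : List (Letter ℕ × List (Letter ℕ))} {B : List (Letter ℕ × ℕ)}
    {σ : Store} (hB : BlockStk ps B σ) (hm : σ.reg Rm = B.length)
    (h₁ : ∀ z, σ.row Apres (σ.reg Rp) z = 0) (h₂ : ∀ z, σ.row Amax (σ.reg Rp) z = 0) :
    Spec markBlocks σ B.length (Marked ps B) := by
  refine Spec.init rfl (Spec.scan (Marked ps) List.length rfl ?_ (by simpa) (by simp) ?_)
  · rintro ⟨b, l⟩ s τ hs hf hI hj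
    refine ⟨0, by simp; omega, Spec.eval rfl ?_⟩
    have hp : τ.reg Rp = σ.reg Rp := by simpa using hf.reg Rp rfl
    have hb : Code ps b (τ.row Abl (τ.reg Rp) (τ.reg Rj)) ∧
        τ.row Abn (τ.reg Rp) (τ.reg Rj) = l := by
      have := hB _ s hs
      rw [hp, hj, hf.row_eq rfl, hf.row_eq rfl]
      exact this
    obtain ⟨hb, hl⟩ := hb
    set p := τ.reg Rp with hp'
    set c₀ := τ.row Abl p (τ.reg Rj) with hc₀
    have e₀ : (markBlocksBody.eval τ).reg Rj = s.length + 1 ∧ (markBlocksBody.eval τ).reg Rp = p := by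
      simp [markBlocksBody, hj, hp']
    have e₁ : ∀ z, (markBlocksBody.eval τ).row Apres p z =
        if 1 < l ∧ z = key c₀ l then 1 else τ.row Apres p z := by
      intro z
      by_cases h1 : 1 < l <;> by_cases h2 : τ.row Amax p c₀ < l <;>
        simp [markBlocksBody, ← hp', ← hc₀, hl, h1, h2]
    have e₂ : ∀ z, (markBlocksBody.eval τ).row Amax p z =
        if 1 < l ∧ z = c₀ ∧ τ.row Amax p c₀ < l then l else τ.row Amax p z := by
      intro z
      by_cases h1 : 1 < l <;> by_cases h2 : τ.row Amax p c₀ < l <;>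
        simp [markBlocksBody, ← hp', ← hc₀, hl, h1, h2]
    refine ⟨fun a c hc => ?_, e₀.1⟩
    obtain ⟨i₁, i₂, i₃⟩ := hI a c hc
    have hab := hc.inj hb
    rw [e₀.2]
    simp only [e₁, e₂, key_inj, List.mem_cons, Prod.mk.injEq, hab]
    refine ⟨fun m => ?_, fun m hm h1 => ?_, ?_⟩
    · rw [i₁]
      by_cases h : 1 < m ∧ a = b ∧ m = l
      · obtain ⟨h1, rfl, rfl⟩ := h
        simp [h1]
      · have e : (((a = b ∧ m = l) ∨ (a, m) ∈ s) ∧ 1 < m) ↔ ((a, m) ∈ s ∧ 1 < m) := by tauto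
        simp only [e]
        rw [if_neg]
        rintro ⟨h1, h2, rfl⟩
        exact h ⟨h1, h2, rfl⟩
    · have hcc : a = b → c = c₀ := hab.2
      rcases hm with ⟨rfl, rfl⟩ | hm
      · rw [hcc rfl]
        split_ifs with h
        · exact le_rfl
        · by_contra hlt
          exact h ⟨h1, rfl, by omega⟩
      · have h₃ : m ≤ τ.row Amax p c := i₂ m hm h1
        split_ifs with h
        · rw [hcc h.2.1] at h₃
          omega
        · exact h₃
    · split_ifs with h
      · exact .inr ⟨h.1, .inl ⟨h.2.1, rfl⟩⟩
      · exact i₃.imp id fun h => ⟨h.1, .inr h.2⟩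
  · intro a c _
    simp [h₁, h₂]

end Recompression

namespace Recompression

open WordRAM

/-! ### The program: the letters for the blocks of one letter -/

theorem zip_append_getLast (k : ℕ) (xs ys : List ℕ) :
    (k :: (xs ++ ys)).zip (xs ++ ys) =
      (k :: xs).zip xs ++ ((k :: xs).getLast (by simp) :: ys).zip ys := by
  induction xs generalizing k with
  | nil => simp
  | cons x xs ih =>
    rw [List.cons_append, List.zip_cons_cons, ih x, List.zip_cons_cons, List.cons_append]
    simp

theorem consecutive_append (xs ys : List ℕ) : consecutive (xs ++ ys) =
    consecutive xs ++ ((0 :: xs).getLast (by simp) :: ys).zip ys := zip_append_getLast 0 xs ys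

theorem map_snd_consecutive (xs : List ℕ) : (consecutive xs).map Prod.snd = xs := by
  rw [consecutive, List.map_snd_zip]
  simp

/-- Execute the body for each marked length, together with the preceding one. -/
def eachGap (body : Prog) : Prog :=
  (Rprev ≔ 0 ⨾ Rl ≔ 2) ⨾ .loop (.less ♯Rl (♯Rmax + 1))
    (.ite (.row Apres (.key ♯Ra ♯Rl)) (body ⨾ Rprev ≔ ♯Rl) .skip ⨾ Rl ≔ ♯Rl + 1)

/-- Sweeping `l` through a table of marks up to the maximum meets the lengths in increasing order
without sorting. The body may use as many iterations as the difference it treats, because the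
differences telescope. -/
theorem spec_eachGap {body : Prog} {ls : List ℕ} {M : ℕ} {σ : Store}
    (hs : ls.SortedLT) (hl : ∀ l ∈ ls, 2 ≤ l ∧ l ≤ M) (hM : σ.reg Rmax = M)
    (hpres : ∀ l, σ.row Apres (σ.reg Rp) (key (σ.reg Ra) l) ≠ 0 ↔ l ∈ ls)
    (h₁ : body.setsReg Ra = false) (h₂ : body.setsReg Rl = false)
    (h₄ : body.setsReg Rmax = false) (h₅ : body.setsReg Rp = false)
    (h₆ : body.setsCell Apres = false) (Inv : List (ℕ × ℕ) → Store → Prop)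
    (hInv : ∀ d τ x v, x = Rl ∨ x = Rprev → Inv d τ → Inv d (τ.setReg x v))
    (hbody : ∀ d k l τ, (∀ x, body.setsReg x = false → x ≠ Rl → x ≠ Rprev → τ.reg x = σ.reg x) →
      (∀ A, body.setsCell A = false → τ.cell A = σ.cell A) → Inv d τ → τ.reg Rprev = k →
      τ.reg Rl = l → k < l → (k, l) ∈ consecutive ls → (k = 0 ∨ ∃ j, (j, k) ∈ d) →
      (∀ r ∈ d, r.2 < l) → Spec body τ (l - k) (Inv (d ++ [(k, l)])))
    (h₀ : Inv [] σ) :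
    Spec (eachGap body) σ (2 * M) (Inv (consecutive ls)) := by
  have hs' := List.sortedLT_iff_pairwise.1 hs
  refine Spec.init rfl ?_
  have := Spec.loop (γ := ℕ × ℕ) (e := .less ♯Rl (♯Rmax + 1))
    (P := .ite (.row Apres (.key ♯Ra ♯Rl)) (body ⨾ Rprev ≔ ♯Rl) .skip ⨾ Rl ≔ ♯Rl + 1)
    (σ₀ := (Rprev ≔ 0 ⨾ Rl ≔ 2).eval σ) (g₀ := (2, 0))
    (fun g τ => τ.reg Rl = g.1 ∧ τ.reg Rprev = g.2 ∧ g.2 < g.1 ∧ ∃ d e, ls = d ++ e ∧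
      (∀ x ∈ d, x < g.1) ∧ (∀ x ∈ e, g.1 ≤ x) ∧ g.2 = (0 :: d).getLast (by simp) ∧
      Inv (consecutive d) τ)
    -- The first summand pays for the sweep, the second for the executions of the body.
    (fun g => (M + 1 - g.1) + (M - g.2)) ?_ ?_
  · refine this.frame.mono (by simp only; omega) ?_
    rintro τ ⟨⟨⟨l, k⟩, ⟨i₁, -, -, d, e, rfl, -, he, -, hI⟩, hv⟩, hf⟩
    have hm : τ.reg Rmax = M := by
      rw [hf.reg Rmax (by simp [Prog.setsReg, h₄])]
      simpa using hM
    simp [i₁, hm] at hv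
    cases e with
    | nil => simpa using hI
    | cons x e =>
      have h₇ := he x (by simp)
      have h₈ := hl x (by simp)
      simp only at h₇
      omega
  · rintro ⟨l, k⟩ τ hf ⟨i₁, i₂, i₃, d, e, rfl, hd, he, hk, hI⟩ hv
    simp only at i₁ i₂ i₃ hd he hk
    have fr : ∀ x, body.setsReg x = false → x ≠ Rl → x ≠ Rprev → τ.reg x = σ.reg x := by
      intro x hx hxl hxp
      rw [hf.reg x (by simp [Prog.setsReg, hx, hxl.symm, hxp.symm])]
      simp [hxl, hxp]
    have fc : ∀ A, body.setsCell A = false → τ.cell A = σ.cell A := by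
      intro A hA
      rw [hf.cell A (by simp [Prog.setsCell, hA])]
      simp
    have hm : τ.reg Rmax = M := (fr _ h₄ (by simp) (by simp)).trans hM
    have hlt : l ≤ M := by
      simp [i₁, hm] at hv
      omega
    have hp : (Expr.row Apres (.key ♯Ra ♯Rl)).val τ ≠ 0 ↔ l ∈ d ++ e := by
      rw [← hpres l]
      simp only [Expr.val_row, Expr.val_key, Expr.val, i₁, fr Ra h₁ (by simp) (by simp),
        fr Rp h₅ (by simp) (by simp), Store.row_congr (fc _ h₆)]
    by_cases hle : l ∈ d ++ e
    · have hle' : l ∈ e := (List.mem_append.1 hle).resolve_left fun h => lt_irrefl l (hd l h)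
      obtain ⟨e, rfl⟩ : ∃ e', e = l :: e' := by
        cases e with
        | nil => simp at hle'
        | cons x e =>
          rcases List.mem_cons.1 hle' with rfl | h
          · exact ⟨e, rfl⟩
          · have := List.rel_of_pairwise_cons ((List.pairwise_append.1 hs').2.1) h
            have := he x (by simp)
            omega
      have hcons : consecutive (d ++ [l]) = consecutive d ++ [(k, l)] := by
        rw [consecutive_append, ← hk]
        rfl
      have hcons' : consecutive (d ++ l :: e) = consecutive (d ++ [l]) ++ (l :: e).zip e := by
        rw [hcons, consecutive_append, ← hk, List.zip_cons_cons, List.append_assoc]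
        rfl
      refine ⟨l - k, ?_⟩
      have hb := hbody (consecutive d) k l τ fr fc hI i₂ i₁ i₃ (by rw [hcons', hcons]; simp) ?_ ?_
      · refine Spec.mono (n := l - k + 0 + 0) ?_ (by omega) fun _ h => h
        refine Spec.seq (Spec.ite (fun _ => (hb.frame.seq fun τ' h => Spec.eval
          (Q := fun ρ => Inv (consecutive (d ++ [l])) ρ ∧ ρ.reg Rl = l ∧ ρ.reg Rprev = l) rfl ?_))
          fun h => absurd h (hp.2 hle)) fun τ' h => Spec.eval rfl ?_
        · obtain ⟨h, hf'⟩ := h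
          have hl' : τ'.reg Rl = l := (hf'.reg _ h₂).trans i₁
          refine ⟨?_, by simp [hl'], by simp [hl']⟩
          rw [hcons]
          exact hInv _ _ _ _ (.inr rfl) h
        · obtain ⟨h, hl', hpr⟩ := h
          refine ⟨(l + 1, l), ⟨by simp [hl'], by simp [hpr], by simp, d ++ [l], e, by simp, ?_, ?_,
            by simp, hInv _ _ _ _ (.inl rfl) h⟩, by simp only; omega⟩
          · intro x hx
            rcases List.mem_append.1 hx with hx | hx
            · have := hd x hx; omega
            · rw [List.mem_singleton] at hx; omega
          · intro x hx
            exact List.rel_of_pairwise_cons ((List.pairwise_append.1 hs').2.1) hx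
      · rcases List.eq_nil_or_concat d with rfl | ⟨d, x, rfl⟩
        · exact .inl (by simpa using hk)
        · right
          have : k = x := by simpa using hk
          subst this
          have hmem : k ∈ (consecutive (d ++ [k])).map Prod.snd := by
            rw [map_snd_consecutive]; simp
          obtain ⟨⟨j, k'⟩, hr, rfl⟩ := List.mem_map.1 hmem
          exact ⟨j, by simpa using hr⟩
      · intro r hr
        have : r.2 ∈ (consecutive d).map Prod.snd := List.mem_map.2 ⟨r, hr, rfl⟩
        rw [map_snd_consecutive] at this
        exact hd _ this
    · refine ⟨0, Spec.mono (n := 0 + 0) ?_ (by omega) fun _ h => h⟩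
      refine Spec.seq (Spec.ite (fun h => absurd (hp.1 h) hle) fun _ => Spec.eval
        (Q := fun ρ => ρ = τ) rfl rfl) ?_
      rintro τ' rfl
      refine Spec.eval rfl ⟨(l + 1, k), ⟨by simp [i₁], by simp [i₂], by simp only; omega, d, e, rfl,
        fun x hx => ?_, fun x hx => ?_, hk, hInv _ _ _ _ (.inl rfl) hI⟩, by simp only; omega⟩
      · have := hd x hx; simp only; omega
      · have h₇ := he x hx
        have : x ≠ l := fun h => hle (h ▸ List.mem_append_right _ hx)
        simp only
        omega
  · refine ⟨by simp, by simp, by simp, [], ls, rfl, by simp, fun x hx => (hl x hx).1, rfl, ?_⟩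
    exact hInv _ _ _ _ (.inl rfl) (hInv _ _ _ _ (.inr rfl) h₀)

/-- The maximum of the differences of consecutive lengths. -/
def maxGapBody : Prog :=
  .ite (.less ♯Rgap (♯Rl - ♯Rprev)) (Rgap ≔ ♯Rl - ♯Rprev) .skip

/-- The letters that derive powers. -/
def powerList (k : ℕ) (a : Letter ℕ) (n : ℕ) : List (Letter ℕ × List (Letter ℕ)) :=
  (List.range n).map fun i => (.power k a (i + 1), [powerLetter k a i, powerLetter k a i])

def powersBody : Prog :=
  (Rx ≔ .row Apow (.key ♯Ra (♯Ri - 1)) ⨾ Ry ≔ ♯Rx) ⨾ emitTwo ⨾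
  .put Apow (.key ♯Ra ♯Ri) ♯Rc ⨾ Ri ≔ ♯Ri + 1 ⨾ Rd ≔ ♯Rd / 2

/-- Introduce the letters that derive powers. -/
def powers : Prog :=
  (.put Apow (.key ♯Ra 0) ♯Ra ⨾ Ri ≔ 1 ⨾ Rd ≔ ♯Rgap / 2) ⨾ .loop (.less 0 ♯Rd) powersBody

/-- The register is halved until it vanishes, which stops the loop exactly at the logarithm of the
greatest difference; the halved values bound the number of iterations. -/
theorem spec_powers {ps : List (Letter ℕ × List (Letter ℕ))} {σ : Store} (hO : Out ps σ)
    {a : Letter ℕ} (ha : Code ps a (σ.reg Ra)) (k : ℕ) (hk : ∀ i, .power k a i ∉ heads ps) :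
    Spec powers σ (σ.reg Rgap) fun τ =>
      Out (ps ++ powerList k a (Nat.log 2 (σ.reg Rgap))) τ ∧
      ∀ i ≤ Nat.log 2 (σ.reg Rgap), Code (ps ++ powerList k a (Nat.log 2 (σ.reg Rgap)))
        (powerLetter k a i) (τ.row Apow (τ.reg Rp) (key (σ.reg Ra) i)) := by
  set D := σ.reg Rgap with hD
  refine Spec.init rfl ?_
  have := Spec.loop (γ := ℕ) (e := .less 0 ♯Rd) (P := powersBody)
    (σ₀ := (Prog.put Apow (.key ♯Ra 0) ♯Ra ⨾ Ri ≔ 1 ⨾ Rd ≔ ♯Rgap / 2).eval σ) (g₀ := 0)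
    (fun i τ => τ.reg Ri = i + 1 ∧ τ.reg Rd = D / 2 ^ (i + 1) ∧ (i = 0 ∨ D / 2 ^ i ≠ 0) ∧
      Out (ps ++ powerList k a i) τ ∧ ∀ j ≤ i, Code (ps ++ powerList k a i)
        (powerLetter k a j) (τ.row Apow (σ.reg Rp) (key (σ.reg Ra) j)))
    (fun i => D / 2 ^ (i + 1)) ?_ ?_
  · refine this.frame.mono (Nat.div_le_self _ _) ?_
    rintro τ ⟨⟨i, ⟨-, h₂, h₃, h₄, h₅⟩, hv⟩, hf⟩
    have hp : τ.reg Rp = σ.reg Rp := by simpa using hf.reg Rp rfl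
    have hlt : D / 2 ^ (i + 1) = 0 := by
      by_contra h
      simp [h₂] at hv
      exact h (by simpa using hv)
    have hi : Nat.log 2 D = i := by
      rw [Nat.div_eq_zero_iff] at hlt
      rcases h₃ with rfl | h₃
      · exact Nat.log_of_lt (by simpa using hlt)
      · refine Nat.log_eq_of_pow_le_of_lt_pow ?_ (by simpa using hlt)
        by_contra h
        exact h₃ (Nat.div_eq_of_lt (by omega))
    rw [hi, hp]
    exact ⟨h₄, h₅⟩
  · rintro i τ hf ⟨i₁, i₂, i₃, i₄, i₅⟩ hv
    have hp : τ.reg Rp = σ.reg Rp := by simpa using hf.reg Rp rfl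
    have hra : τ.reg Ra = σ.reg Ra := by simpa using hf.reg Ra rfl
    have hpl : powerList k a (i + 1) = powerList k a i ++
        [(.power k a (i + 1), [powerLetter k a i, powerLetter k a i])] := by
      simp [powerList, List.range_succ]
    have hpos : D / 2 ^ (i + 1) ≠ 0 := by
      intro h
      simp [i₂, h] at hv
    refine ⟨0, Spec.init rfl ?_⟩
    have hc := i₅ i le_rfl
    have h₁ := spec_emitTwo (σ := (Rx ≔ Expr.row Apow (.key ♯Ra (♯Ri - 1)) ⨾ Ry ≔ ♯Rx).eval τ)
      (i₄.congr (by simp) (by simp) (by simp) (by simp))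
      (x := .power k a (i + 1)) (y := powerLetter k a i) (z := powerLetter k a i) ?_ (by simp) ?_ ?_
    · refine h₁.seq fun τ' ⟨⟨h₂, h₃⟩, hf'⟩ => Spec.eval rfl ⟨i + 1, ⟨?_, ?_, .inr hpos, ?_, ?_⟩, ?_⟩
      · simp [hf'.reg Ri rfl, i₁]
      · simp [hf'.reg Rd rfl, i₂, Nat.div_div_eq_div_mul, pow_succ]
      · rw [hpl, ← List.append_assoc]
        exact h₂.congr (by simp) (by simp) (by simp) (by simp)
      · intro j hj
        rw [hpl, ← List.append_assoc]
        have hr : τ'.row Apow (σ.reg Rp) = τ.row Apow (σ.reg Rp) := by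
          rw [hf'.row_eq rfl]; simp
        have hp' : τ'.reg Rp = σ.reg Rp := by rw [hf'.reg Rp rfl]; simpa using hp
        have ha' : τ'.reg Ra = σ.reg Ra := by rw [hf'.reg Ra rfl]; simpa using hra
        have hi' : τ'.reg Ri = i + 1 := by rw [hf'.reg Ri rfl]; simpa using i₁
        rcases Nat.lt_or_ge j (i + 1) with h | h
        · simpa [hp', ha', hi', h.ne, hr] using (i₅ j (by omega)).append _
        · obtain rfl : j = i + 1 := by omega
          simpa [hp', ha', hi', powerLetter] using h₃
      · have : D / 2 ^ (i + 1 + 1) = D / 2 ^ (i + 1) / 2 := by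
          rw [Nat.div_div_eq_div_mul, ← pow_succ]
        omega
    · rw [heads_append, List.mem_append, not_or]
      refine ⟨hk _, ?_⟩
      simp [heads, powerList]
    · simpa [i₁, hp, hra] using hc
    · simpa [i₁, hp, hra] using hc
  · simp only [powerList, List.range_zero, List.map_nil, List.append_nil]
    refine ⟨by simp, by simp [← hD], by simp, hO.congr (by simp) (by simp) (by simp) (by simp), ?_⟩
    intro j hj
    obtain rfl : j = 0 := by omega
    simpa [powerLetter] using ha

end Recompression

namespace Recompression

open WordRAM

/-! ### The program: the letters for the differences of lengths -/

theorem holds_snoc {f : ℕ → ℕ} {k a : ℕ} {L : List ℕ} (h : Holds f k L) (ha : f (k + L.length) = a) :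
    Holds f k (L ++ [a]) := h.append (Holds.nil.cons ha)

def bitsBody : Prog :=
  .ite (♯Rd % 2) (.write 1 ♯Rout (.row Apow (.key ♯Ra ♯Ri)) ⨾ Rout ≔ ♯Rout + 1 ⨾ Rt ≔ ♯Rt + 1 ⨾
    Rcost ≔ ♯Rcost + 1) .skip ⨾ Ri ≔ ♯Ri + 1 ⨾ Rd ≔ ♯Rd / 2

/-- Append the production of a letter for a difference of lengths. -/
def emitDiff : Prog :=
  (.write 1 ♯Rout (♯Rid / 2) ⨾ Rs ≔ ♯Rout + 1 ⨾ Rout ≔ ♯Rout + 2 ⨾ Rt ≔ 0 ⨾ Ri ≔ 0 ⨾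
    Rd ≔ ♯Rl - ♯Rprev) ⨾ .loop (.less 0 ♯Rd) bitsBody ⨾
  .write 1 ♯Rs ♯Rt ⨾ Rx ≔ ♯Rid ⨾ Rid ≔ ♯Rid + 2

/-- The number of digits is known only at the end, so the cell for the length of the body is left
open and filled afterwards. The invariant splits the binary digits into those already written and
those of the current quotient. -/
theorem spec_emitDiff {ps : List (Letter ℕ × List (Letter ℕ))} {σ : Store} (hO : Out ps σ)
    {x : Letter ℕ} (hx : x ∉ heads ps) (hx' : ∀ a, x ≠ .input a) {f : ℕ → Letter ℕ}
    (hf : ∀ i ∈ Nat.bitIndices (σ.reg Rl - σ.reg Rprev),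
      Code ps (f i) (σ.row Apow (σ.reg Rp) (key (σ.reg Ra) i))) :
    Spec emitDiff σ (σ.reg Rl - σ.reg Rprev) fun τ =>
      (Out (ps ++ [(x, (Nat.bitIndices (σ.reg Rl - σ.reg Rprev)).map f)]) τ ∧
        Code (ps ++ [(x, (Nat.bitIndices (σ.reg Rl - σ.reg Rprev)).map f)]) x (τ.reg Rx)) ∧
      Frame emitDiff σ τ := by
  refine Spec.frame ?_
  set D := σ.reg Rl - σ.reg Rprev with hD
  set g : ℕ → ℕ := fun i => σ.row Apow (σ.reg Rp) (key (σ.reg Ra) i) with hg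
  refine Spec.init rfl ?_
  set σ₁ := (Prog.write 1 ♯Rout (♯Rid / 2) ⨾ Rs ≔ ♯Rout + 1 ⨾ Rout ≔ ♯Rout + 2 ⨾ Rt ≔ 0 ⨾ Ri ≔ 0 ⨾
    Rd ≔ ♯Rl - ♯Rprev).eval σ with hσ₁
  have := (Spec.loop (γ := ℕ × ℕ × List ℕ) (e := .less 0 ♯Rd) (P := bitsBody)
    (σ₀ := σ₁) (g₀ := (0, D, []))
    (fun j τ => τ.reg Ri = j.1 ∧ τ.reg Rd = j.2.1 ∧
      Nat.bitIndices D = j.2.2 ++ (Nat.bitIndices j.2.1).map (· + j.1) ∧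
      τ.reg Rt = j.2.2.length ∧ τ.reg Rout = σ.reg Rout + 2 + j.2.2.length ∧
      τ.reg Rcost = σ.reg Rcost + j.2.2.length ∧
      (∀ i < σ.reg Rout, τ.cell 1 i = σ.cell 1 i) ∧ τ.cell 1 (σ.reg Rout) = σ.reg Rid / 2 ∧
      Holds (τ.cell 1) (σ.reg Rout + 2) (j.2.2.map g)) (fun j => j.2.1) ?_ ?_).frame
  · refine Spec.mono (n := D + 0) (this.seq ?_) (by omega) fun _ h => h
    rintro τ ⟨⟨⟨i, d, L⟩, ⟨-, i₂, i₃, i₄, i₅, i₆, i₇, i₈, i₉⟩, hv⟩, hf'⟩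
    simp only at i₂ i₃ i₄ i₅ i₆ i₇ i₈ i₉
    obtain rfl : d = 0 := by
      by_contra h
      simp [i₂] at hv
      omega
    obtain rfl : L = Nat.bitIndices D := by simpa using i₃.symm
    have hs : τ.reg Rs = σ.reg Rout + 1 := by simpa [hσ₁] using hf'.reg Rs rfl
    have hid : τ.reg Rid = σ.reg Rid := by simpa [hσ₁] using hf'.reg Rid rfl
    refine Spec.eval rfl ?_
    have := hO.append (τ := (Prog.write 1 ♯Rs ♯Rt ⨾ Rx ≔ ♯Rid ⨾ Rid ≔ ♯Rid + 2).eval τ) hx hx'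
      (b := (Nat.bitIndices D).map f) (ns := (Nat.bitIndices D).map g) ?_ ?_ ?_ ?_ ?_ ?_
    · simpa [hid] using this
    · rw [List.forall₂_map_left_iff, List.forall₂_map_right_iff, List.forall₂_same]
      exact hf
    · intro i hi
      simp [hs, i₇ i hi, show i ≠ σ.reg Rout + 1 by omega]
    · refine .cons ?_ (.cons ?_ ?_)
      · simp [hs, i₈]
      · simp [hs, i₄]
      · refine i₉.congr fun i hi _ => ?_
        simp [hs, show i ≠ σ.reg Rout + 1 by omega]
    · simp [hid]
    · simp [i₅, Nat.add_assoc]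
    · simp [i₆]
  · rintro ⟨i, d, L⟩ τ hf' ⟨i₁, i₂, i₃, i₄, i₅, i₆, i₇, i₈, i₉⟩ hv
    simp only at i₁ i₂ i₃ i₄ i₅ i₆ i₇ i₈ i₉
    have hpos : 0 < d := by
      by_contra h
      simp [i₂, show d = 0 by omega] at hv
    have hr : τ.row Apow (τ.reg Rp) (key (τ.reg Ra) i) = g i := by
      rw [hf'.row_eq rfl, hf'.reg Rp rfl, hf'.reg Ra rfl]
      simp [hσ₁, hg]
    have hm : (fun x => x + i) ∘ (fun x => x + 1) = fun x => x + (i + 1) := by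
      funext x; simp only [Function.comp]; omega
    refine ⟨0, Spec.eval rfl ?_⟩
    rcases Nat.even_or_odd' d with ⟨e, rfl | rfl⟩
    · refine ⟨(i + 1, e, L), ⟨?_, ?_, ?_, ?_, ?_, ?_, ?_, ?_, ?_⟩, by simp only; omega⟩
      · simp [bitsBody, i₁]
      · simp [bitsBody, i₂]
      · rw [i₃, Nat.bitIndices_two_mul, List.map_map, hm]
      · simp [bitsBody, i₂, i₄]
      · simp [bitsBody, i₂, i₅]
      · simp [bitsBody, i₂, i₆]
      · simpa [bitsBody, i₂] using i₇
      · simpa [bitsBody, i₂] using i₈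
      · simpa [bitsBody, i₂] using i₉
    · have h2 : (2 * e + 1) % 2 = 1 := by omega
      have h3 : (2 * e + 1) / 2 = e := by omega
      refine ⟨(i + 1, e, L ++ [i]), ⟨?_, ?_, ?_, ?_, ?_, ?_, ?_, ?_, ?_⟩, by simp only; omega⟩
      · simp [bitsBody, i₁, i₂, h2]
      · simp [bitsBody, i₂, h2, h3]
      · rw [i₃, Nat.bitIndices_two_mul_add_one, List.map_cons, List.map_map, hm]
        simp
      · simp [bitsBody, i₂, i₄, h2]
      · simp [bitsBody, i₂, i₅, h2, Nat.add_assoc]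
      · simp [bitsBody, i₂, i₆, h2, Nat.add_assoc]
      · intro j hj
        simp [bitsBody, i₂, h2, i₅, i₇ j hj, show j ≠ σ.reg Rout + 2 + L.length by omega]
      · simp [bitsBody, i₂, h2, i₅, i₈, show σ.reg Rout ≠ σ.reg Rout + 2 + L.length by omega]
      · rw [List.map_append]
        refine holds_snoc (i₉.congr fun j h₁ h₂ => ?_) ?_
        · rw [List.length_map] at h₂
          simp [bitsBody, i₂, h2, i₅, show j ≠ σ.reg Rout + 2 + L.length by omega]
        · simp [bitsBody, i₂, h2, i₅, i₁, ← hr]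
  · refine ⟨by simp [hσ₁], by simp [hσ₁, hD], by simp, by simp [hσ₁], by simp [hσ₁], by simp [hσ₁],
      fun i hi => ?_, by simp [hσ₁], Holds.nil⟩
    simp [hσ₁, hi.ne]

/-- The letters for the differences of lengths and for the blocks of one letter. -/
def gapProds (k : ℕ) (a : Letter ℕ) (d : List (ℕ × ℕ)) : List (Letter ℕ × List (Letter ℕ)) :=
  d.flatMap fun q => [(.diff k a q.1 q.2, (Nat.bitIndices (q.2 - q.1)).map (powerLetter k a)),
    (.block k a q.2, .diff k a q.1 q.2 :: if q.1 = 0 then [] else [.block k a q.1])]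

def maxGap (d : List (ℕ × ℕ)) : ℕ := (d.map fun q => q.2 - q.1).foldr max 0

theorem maxGap_append_singleton (d : List (ℕ × ℕ)) (q : ℕ × ℕ) :
    maxGap (d ++ [q]) = max (maxGap d) (q.2 - q.1) := by
  unfold maxGap
  induction d with
  | nil => simp
  | cons r d ih =>
    simp only [List.cons_append, List.map_cons, List.foldr_cons] at ih ⊢
    rw [ih, max_assoc]

theorem maxGap_le {d : List (ℕ × ℕ)} {M : ℕ} (h : ∀ q ∈ d, q.2 ≤ M) : maxGap d ≤ M := by
  unfold maxGap
  induction d with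
  | nil => simp
  | cons r d ih =>
    have := h r (by simp)
    have := ih fun q hq => h q (by simp [hq])
    simp only [List.map_cons, List.foldr_cons]
    omega

/-- The productions for the blocks of one letter. -/
def letterProds (k : ℕ) (a : Letter ℕ) (ls : List ℕ) : List (Letter ℕ × List (Letter ℕ)) :=
  powerList k a (Nat.log 2 (maxGap (consecutive ls))) ++ gapProds k a (consecutive ls)

theorem toFinset_letterProds (k : ℕ) (a : Letter ℕ) (ls : List ℕ) :
    (letterProds k a ls).toFinset = blockProds k a ls := by
  ext q
  simp only [letterProds, blockProds, powerList, gapProds, maxGap, List.mem_toFinset, List.mem_append,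
    Finset.mem_union, Finset.mem_image, Finset.mem_Icc, List.mem_map, List.mem_flatMap,
    List.mem_range, List.mem_cons, List.not_mem_nil, or_false]
  constructor
  · rintro (⟨i, hi, rfl⟩ | ⟨r, hr, rfl | rfl⟩)
    · exact .inl (.inl ⟨i + 1, ⟨by omega, by omega⟩, by simp⟩)
    · exact .inl (.inr ⟨r, hr, rfl⟩)
    · exact .inr ⟨r, hr, rfl⟩
  · rintro ((⟨i, hi, rfl⟩ | ⟨r, hr, rfl⟩) | ⟨r, hr, rfl⟩)
    · exact .inl ⟨i - 1, by omega, by rw [Nat.sub_add_cancel hi.1]⟩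
    · exact .inr ⟨r, hr, .inl rfl⟩
    · exact .inr ⟨r, hr, .inr rfl⟩

theorem mem_heads_gapProds {k : ℕ} {a x : Letter ℕ} {d : List (ℕ × ℕ)} :
    x ∈ heads (gapProds k a d) ↔ ∃ q ∈ d, x = .diff k a q.1 q.2 ∨ x = .block k a q.2 := by
  simp only [heads, gapProds, List.mem_map, List.mem_flatMap, List.mem_cons, List.not_mem_nil,
    or_false]
  constructor
  · rintro ⟨_, ⟨q, hq, rfl | rfl⟩, rfl⟩
    · exact ⟨q, hq, .inl rfl⟩
    · exact ⟨q, hq, .inr rfl⟩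
  · rintro ⟨q, hq, rfl | rfl⟩
    · exact ⟨_, ⟨q, hq, .inl rfl⟩, rfl⟩
    · exact ⟨_, ⟨q, hq, .inr rfl⟩, rfl⟩

theorem mem_heads_powerList {k n : ℕ} {a x : Letter ℕ} (h : x ∈ heads (powerList k a n)) :
    ∃ i, x = .power k a i := by
  simp only [heads, powerList, List.map_map, List.mem_map, Function.comp] at h
  obtain ⟨i, -, rfl⟩ := h
  exact ⟨_, rfl⟩

/-- Introduce the letters for a difference of lengths and for the blocks of the greater length. -/
def defineBody : Prog :=
  emitDiff ⨾ .ite ♯Rprev (Ry ≔ .row Ablock (.key ♯Ra ♯Rprev) ⨾ emitTwo) emitOne ⨾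
  .put Ablock (.key ♯Ra ♯Rl) ♯Rc

/-- Introduce the letters for the blocks of one letter. -/
def processLetter : Prog :=
  (Rmax ≔ .row Amax ♯Ra ⨾ Rgap ≔ 0) ⨾ eachGap maxGapBody ⨾ powers ⨾ eachGap defineBody ⨾
  .put Amax ♯Ra 0

/-- All lengths treated before are smaller, so both heads are new; the preceding length, if there is
one, has its letter in the table. -/
theorem spec_defineBody {ps : List (Letter ℕ × List (Letter ℕ))} {τ : Store} {k k' l : ℕ}
    {a : Letter ℕ} {d : List (ℕ × ℕ)} (hO : Out (ps ++ gapProds k a d) τ)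
    (hb : ∀ r ∈ d, Code (ps ++ gapProds k a d) (.block k a r.2)
      (τ.row Ablock (τ.reg Rp) (key (τ.reg Ra) r.2)))
    (hp : ∀ i ∈ Nat.bitIndices (l - k'), Code (ps ++ gapProds k a d) (powerLetter k a i)
      (τ.row Apow (τ.reg Rp) (key (τ.reg Ra) i)))
    (hk : τ.reg Rprev = k') (hl : τ.reg Rl = l)
    (hdiff : .diff k a k' l ∉ heads ps) (hblock : .block k a l ∉ heads ps)
    (hd : k' = 0 ∨ ∃ j, (j, k') ∈ d) (hlt : ∀ r ∈ d, r.2 < l) :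
    Spec defineBody τ (l - k') fun ρ => Out (ps ++ gapProds k a (d ++ [(k', l)])) ρ ∧
      (∀ r ∈ d ++ [(k', l)], Code (ps ++ gapProds k a (d ++ [(k', l)])) (.block k a r.2)
        (ρ.row Ablock (τ.reg Rp) (key (τ.reg Ra) r.2))) ∧
      ∀ z, z ≠ key (τ.reg Ra) l → ρ.row Ablock (τ.reg Rp) z = τ.row Ablock (τ.reg Rp) z := by
  have e : gapProds k a (d ++ [(k', l)]) = gapProds k a d ++
      [(.diff k a k' l, (Nat.bitIndices (l - k')).map (powerLetter k a))] ++
      [(.block k a l, .diff k a k' l :: if k' = 0 then [] else [.block k a k'])] := by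
    simp [gapProds]
  rw [e, ← List.append_assoc, ← List.append_assoc]
  have h₁ : Letter.diff k a k' l ∉ heads (ps ++ gapProds k a d) := by
    rw [heads_append, List.mem_append, mem_heads_gapProds]
    rintro (h | ⟨q, hq, h | h⟩)
    · exact hdiff h
    · have := hlt q hq
      simp only [Letter.diff.injEq] at h
      omega
    · simp at h
  have h := spec_emitDiff hO h₁ (by simp) (f := powerLetter k a) (by rwa [hk, hl])
  rw [hk, hl] at h
  refine Spec.mono (n := l - k' + (0 + 0)) (h.seq fun τ₁ ⟨⟨h₂, h₃⟩, hf⟩ => ?_) (by omega)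
    fun _ h => h
  have h₄ : Letter.block k a l ∉ heads (ps ++ gapProds k a d ++
      [(.diff k a k' l, (Nat.bitIndices (l - k')).map (powerLetter k a))]) := by
    rw [heads_append, heads_append, List.mem_append, List.mem_append, mem_heads_gapProds]
    rintro ((h | ⟨q, hq, h | h⟩) | h)
    · exact hblock h
    · simp at h
    · have := hlt q hq
      simp only [Letter.block.injEq] at h
      omega
    · simp [heads] at h
  have hrow : τ₁.row Ablock = τ.row Ablock := by funext p; rw [hf.row_eq rfl]
  have hRp : τ₁.reg Rp = τ.reg Rp := hf.reg Rp rfl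
  have hRa : τ₁.reg Ra = τ.reg Ra := hf.reg Ra rfl
  have hRl : τ₁.reg Rl = l := (hf.reg Rl rfl).trans hl
  have hRk : τ₁.reg Rprev = k' := (hf.reg Rprev rfl).trans hk
  have hb' : ∀ r ∈ d, Code (ps ++ gapProds k a d ++ [(.diff k a k' l,
      (Nat.bitIndices (l - k')).map (powerLetter k a))]) (.block k a r.2)
      (τ.row Ablock (τ.reg Rp) (key (τ.reg Ra) r.2)) := fun r hr => (hb r hr).append _
  generalize ps ++ gapProds k a d ++
    [(Letter.diff k a k' l, (Nat.bitIndices (l - k')).map (powerLetter k a))] = ps' at h₂ h₃ h₄ hb' ⊢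
  refine Spec.seq (Q := fun ρ => (Out (ps' ++ [(.block k a l,
    .diff k a k' l :: if k' = 0 then [] else [.block k a k'])]) ρ ∧
    Code (ps' ++ [(.block k a l, .diff k a k' l :: if k' = 0 then [] else [.block k a k'])])
      (.block k a l) (ρ.reg Rc)) ∧ ρ.row Ablock = τ.row Ablock ∧ ρ.reg Rp = τ.reg Rp ∧
      ρ.reg Ra = τ.reg Ra ∧ ρ.reg Rl = l) (Spec.ite (fun hv => ?_) fun hv => ?_)
    fun ρ ⟨⟨h₅, h₆⟩, hr, hp', ha', hl'⟩ => Spec.eval rfl ⟨?_, ?_, ?_⟩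
  · have hk' : k' ≠ 0 := by simpa [hRk] using hv
    obtain ⟨j, hj⟩ := hd.resolve_left hk'
    rw [if_neg hk']
    refine Spec.init rfl ((spec_emitTwo (h₂.congr (by simp) (by simp) (by simp) (by simp)) h₄
      (by simp) (y := .diff k a k' l) (z := .block k a k') (by simpa using h₃) ?_).mono le_rfl
      fun ρ ⟨h, hf'⟩ => ⟨h, ?_, ?_, ?_, ?_⟩)
    · simpa [hRp, hRa, hRk, hrow] using hb' _ hj
    · funext p; rw [hf'.row_eq rfl]; simp [hrow]
    · rw [hf'.reg Rp rfl]; simpa using hRp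
    · rw [hf'.reg Ra rfl]; simpa using hRa
    · rw [hf'.reg Rl rfl]; simpa using hRl
  · have hk' : k' = 0 := by simpa [hRk] using hv
    rw [if_pos hk']
    refine (spec_emitOne h₂ h₄ (by simp) (y := .diff k a k' l) h₃).mono le_rfl
      fun ρ ⟨h, hf'⟩ => ⟨h, ?_, ?_, ?_, ?_⟩
    · funext p; rw [hf'.row_eq rfl, hrow]
    · rw [hf'.reg Rp rfl, hRp]
    · rw [hf'.reg Ra rfl, hRa]
    · rw [hf'.reg Rl rfl, hRl]
  · exact h₅.congr (by simp) (by simp) (by simp) (by simp)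
  · intro r hr'
    rcases List.mem_append.1 hr' with hr' | hr'
    · have := hlt r hr'
      simpa [hp', ha', hl', this.ne, hr] using (hb' r hr').append _
    · rw [List.mem_singleton] at hr'
      subst hr'
      simpa [hp', ha', hl'] using h₆
  · intro z hz
    simp [hp', ha', hl', hz, hr]

/-- Two sweeps of `2 * M` and the powers, at most `M`. Setting the recorded maximum to `0` at the
end marks the letter as treated. -/
theorem spec_processLetter {ps : List (Letter ℕ × List (Letter ℕ))} {σ : Store} (hO : Out ps σ)
    {k M : ℕ} {a : Letter ℕ} {ls : List ℕ} (ha : Code ps a (σ.reg Ra)) (hs : ls.SortedLT)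
    (hl : ∀ l ∈ ls, 2 ≤ l ∧ l ≤ M) (hM : σ.row Amax (σ.reg Rp) (σ.reg Ra) = M)
    (hpres : ∀ l, σ.row Apres (σ.reg Rp) (key (σ.reg Ra) l) ≠ 0 ↔ l ∈ ls)
    (hp : ∀ i, .power k a i ∉ heads ps) (hd : ∀ i j, .diff k a i j ∉ heads ps)
    (hb : ∀ l, .block k a l ∉ heads ps) :
    Spec processLetter σ (5 * M) fun τ => (Out (ps ++ letterProds k a ls) τ ∧
      (∀ l ∈ ls, Code (ps ++ letterProds k a ls) (.block k a l)
        (τ.row Ablock (σ.reg Rp) (key (σ.reg Ra) l))) ∧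
      (∀ c l, c ≠ σ.reg Ra → τ.row Ablock (σ.reg Rp) (key c l) = σ.row Ablock (σ.reg Rp) (key c l)) ∧
      ∀ c, τ.row Amax (σ.reg Rp) c = if c = σ.reg Ra then 0 else σ.row Amax (σ.reg Rp) c) ∧
      Frame processLetter σ τ := by
  have hle : maxGap (consecutive ls) ≤ M := maxGap_le fun q hq => by
    have : q.2 ∈ (consecutive ls).map Prod.snd := List.mem_map.2 ⟨q, hq, rfl⟩
    rw [map_snd_consecutive] at this
    exact (hl _ this).2
  have hmem : ∀ l ∈ ls, ∃ r ∈ consecutive ls, r.2 = l := fun l h => by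
    rw [← map_snd_consecutive ls] at h
    obtain ⟨r, hr, rfl⟩ := List.mem_map.1 h
    exact ⟨r, hr, rfl⟩
  refine Spec.frame (Spec.init rfl ?_)
  set σ₁ := (Rmax ≔ Expr.row Amax ♯Ra ⨾ Rgap ≔ 0).eval σ with hσ₁
  have s₁ : Spec (eachGap maxGapBody) σ₁ (2 * M) fun τ => τ.reg Rgap = maxGap (consecutive ls) :=
    spec_eachGap hs hl (by simp [hσ₁, hM]) (by simpa [hσ₁] using hpres) rfl rfl rfl rfl rfl
      (fun d τ => τ.reg Rgap = maxGap d) (by rintro d τ x v (rfl | rfl) h <;> simpa using h)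
      (fun d k l τ _ _ hI hk hl _ _ _ _ => Spec.mono (n := 0) (Spec.eval rfl (by
        rw [maxGap_append_singleton]
        simp [maxGapBody, hI, hk, hl]
        split_ifs <;> omega)) (by omega) fun _ h => h) (by simp [hσ₁, maxGap])
  refine Spec.mono (n := 2 * M + (M + (2 * M + 0))) (s₁.frame.seq fun σ₂ ⟨hg, hf₂⟩ => ?_) (by omega)
    fun _ h => h
  have e₂ : ∀ x, (eachGap maxGapBody).setsReg x = false → x ≠ Rmax → x ≠ Rgap →
      σ₂.reg x = σ.reg x := fun x h h₁ h₂ => by rw [hf₂.reg x h]; simp [hσ₁, h₁, h₂]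
  have c₂ : ∀ A, (eachGap maxGapBody).setsCell A = false → σ₂.cell A = σ.cell A :=
    fun A h => by rw [hf₂.cell A h]; simp [hσ₁]
  have s₂ := spec_powers (σ := σ₂) (hO.congr (c₂ _ rfl) (e₂ _ rfl (by simp) (by simp))
    (e₂ _ rfl (by simp) (by simp)) (e₂ _ rfl (by simp) (by simp))) (a := a)
    (by rwa [e₂ Ra rfl (by simp) (by simp)]) k hp
  rw [hg] at s₂
  refine (s₂.frame.mono hle fun _ h => h).seq fun σ₃ ⟨⟨hO₃, hP₃⟩, hf₃⟩ => ?_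
  set n := Nat.log 2 (maxGap (consecutive ls)) with hn
  have e₃ : ∀ x, (eachGap maxGapBody).setsReg x = false → powers.setsReg x = false →
      x ≠ Rmax → x ≠ Rgap → σ₃.reg x = σ.reg x := fun x h h' h₁ h₂ => by
    rw [hf₃.reg x h', e₂ x h h₁ h₂]
  have c₃ : ∀ A, (eachGap maxGapBody).setsCell A = false → powers.setsCell A = false →
      σ₃.cell A = σ.cell A := fun A h h' => by rw [hf₃.cell A h', c₂ A h]
  have p₃ : σ₃.reg Rp = σ.reg Rp := e₃ _ rfl rfl (by simp) (by simp)
  have a₃ : σ₃.reg Ra = σ.reg Ra := e₃ _ rfl rfl (by simp) (by simp)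
  rw [e₂ Ra rfl (by simp) (by simp), p₃] at hP₃
  have s₃ : Spec (eachGap defineBody) σ₃ (2 * M) fun τ =>
      Out ((ps ++ powerList k a n) ++ gapProds k a (consecutive ls)) τ ∧
      (∀ r ∈ consecutive ls, Code ((ps ++ powerList k a n) ++ gapProds k a (consecutive ls))
        (.block k a r.2) (τ.row Ablock (σ.reg Rp) (key (σ.reg Ra) r.2))) ∧
      ∀ c l, c ≠ σ.reg Ra → τ.row Ablock (σ.reg Rp) (key c l) = σ.row Ablock (σ.reg Rp) (key c l) := by
    refine spec_eachGap hs hl ?_ ?_ rfl rfl rfl rfl rfl (fun d τ =>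
      Out ((ps ++ powerList k a n) ++ gapProds k a d) τ ∧
      (∀ r ∈ d, Code ((ps ++ powerList k a n) ++ gapProds k a d)
        (.block k a r.2) (τ.row Ablock (σ.reg Rp) (key (σ.reg Ra) r.2))) ∧
      ∀ c l, c ≠ σ.reg Ra → τ.row Ablock (σ.reg Rp) (key c l) = σ.row Ablock (σ.reg Rp) (key c l))
      ?_ ?_ ?_
    · rw [hf₃.reg Rmax rfl, hf₂.reg Rmax rfl]; simpa [hσ₁] using hM
    · simpa only [p₃, a₃, Store.row_congr (c₃ Apres rfl rfl)] using hpres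
    · rintro d τ x v (rfl | rfl) ⟨h₁, h₂, h₃⟩ <;>
        exact ⟨h₁.congr (by simp) (by simp) (by simp) (by simp), h₂, h₃⟩
    · rintro d k' l τ hr hc ⟨h₁, h₂, h₃⟩ hk' hl' hlt hcon hd' hd''
      have hRp : τ.reg Rp = σ.reg Rp := (hr _ rfl (by simp) (by simp)).trans p₃
      have hRa : τ.reg Ra = σ.reg Ra := (hr _ rfl (by simp) (by simp)).trans a₃
      refine (spec_defineBody h₁ (by simpa only [hRp, hRa] using h₂) ?_ hk' hl' ?_ ?_ hd' hd'').mono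
        le_rfl ?_
      · intro i hi
        rw [hRp, hRa, Store.row_congr (hc Apow rfl)]
        refine (hP₃ i ?_).append _
        refine Nat.le_log_of_pow_le (by simp) ((Nat.two_pow_le_of_mem_bitIndices hi).trans ?_)
        exact le_foldr_max (List.mem_map.2 ⟨_, hcon, rfl⟩)
      · rw [heads_append, List.mem_append]
        rintro (h | h)
        · exact hd _ _ h
        · obtain ⟨i, hi⟩ := mem_heads_powerList h
          simp at hi
      · rw [heads_append, List.mem_append]
        rintro (h | h)
        · exact hb _ h
        · obtain ⟨i, hi⟩ := mem_heads_powerList h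
          simp at hi
      · rw [hRp, hRa]
        rintro ρ ⟨g₁, g₂, g₃⟩
        exact ⟨g₁, g₂, fun c l' hcl => (g₃ _ (by simp [hcl])).trans (h₃ c l' hcl)⟩
    · refine ⟨by simpa [gapProds] using hO₃, by simp, fun c l _ => ?_⟩
      rw [Store.row_congr (c₃ Ablock rfl rfl)]
  refine s₃.frame.seq fun σ₄ ⟨⟨h₁, h₂, h₃⟩, hf₄⟩ => Spec.eval rfl ?_
  have hRp : σ₄.reg Rp = σ.reg Rp := (hf₄.reg _ rfl).trans p₃
  have hRa : σ₄.reg Ra = σ.reg Ra := (hf₄.reg _ rfl).trans a₃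
  have hmx : σ₄.row Amax (σ.reg Rp) = σ.row Amax (σ.reg Rp) := by
    rw [hf₄.row_eq rfl, Store.row_congr (c₃ Amax rfl rfl)]
  rw [letterProds, ← hn, ← List.append_assoc]
  refine ⟨h₁.congr (by simp) (by simp) (by simp) (by simp), fun l hl => ?_, fun c l hc => ?_,
    fun c => ?_⟩
  · obtain ⟨r, hr, rfl⟩ := hmem l hl
    simpa using h₂ r hr
  · simpa using h₃ c l hc
  · simp [hRp, hRa, hmx]

end Recompression

namespace Recompression

open WordRAM

/-! ### The program: the letters for all blocks -/

/-- The letter belongs to the blocks of the letter `a`. -/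
def IsBlockLetter (k : ℕ) (a x : Letter ℕ) : Prop :=
  (∃ i, x = .power k a i) ∨ (∃ i j, x = .diff k a i j) ∨ ∃ l, x = .block k a l

theorem isBlockLetter_of_mem_heads {k : ℕ} {a x : Letter ℕ} {ls : List ℕ}
    (h : x ∈ heads (letterProds k a ls)) : IsBlockLetter k a x := by
  rw [letterProds, heads_append, List.mem_append, mem_heads_gapProds] at h
  rcases h with h | ⟨q, -, rfl | rfl⟩
  · exact .inl (mem_heads_powerList h)
  · exact .inr (.inl ⟨_, _, rfl⟩)
  · exact .inr (.inr ⟨_, rfl⟩)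

theorem IsBlockLetter.inj {k : ℕ} {a b x : Letter ℕ} (h : IsBlockLetter k a x)
    (h' : IsBlockLetter k b x) : a = b := by
  rcases h with ⟨i, rfl⟩ | ⟨i, j, rfl⟩ | ⟨l, rfl⟩ <;>
    rcases h' with ⟨i', h'⟩ | ⟨i', j', h'⟩ | ⟨l', h'⟩ <;> simp at h' <;> tauto

theorem IsBlockLetter.not_old {k : ℕ} {a x : Letter ℕ} (h : IsBlockLetter k a x) : ¬ x.Old k := by
  rcases h with ⟨i, rfl⟩ | ⟨i, j, rfl⟩ | ⟨l, rfl⟩ <;> simp [Letter.Old]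

theorem blockProds_nil (k : ℕ) (a : Letter ℕ) : blockProds k a [] = ∅ := by
  simp [blockProds, consecutive]

def defineBlocksBody : Prog :=
  Ra ≔ .row Abl ♯Rj ⨾ .ite (.row Amax ♯Ra) processLetter .skip ⨾ Rj ≔ ♯Rj + 1

/-- Introduce the letters for all blocks. -/
def defineBlocks : Prog :=
  Rj ≔ 0 ⨾ .loop (.op .lt ♯Rj ♯Rm) defineBlocksBody

/-- The letters for the blocks of the letters in `S` have been introduced, in the list `qs`. -/
structure BlocksDefined (ps : List (Letter ℕ × List (Letter ℕ))) (k : ℕ) (T : List (Letter ℕ))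
    (S : Finset (Letter ℕ)) (qs : List (Letter ℕ × List (Letter ℕ))) (σ : Store) : Prop where
  out : Out (ps ++ qs) σ
  prods : qs.toFinset = S.biUnion fun a => blockProds k a (blockLengths T a)
  heads : ∀ x ∈ heads qs, ∃ a ∈ S, IsBlockLetter k a x
  code : ∀ a ∈ S, ∀ l ∈ blockLengths T a, ∀ c, Code ps a c →
    Code (ps ++ qs) (.block k a l) (σ.row Ablock (σ.reg Rp) (key c l))

/-- Each letter is treated once, at its first block in the scan, for five times its greatest block
length, which is at most its number of occurrences. With the scan itself this is `6 * T.length`. -/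
theorem spec_defineBlocks {ps : List (Letter ℕ × List (Letter ℕ))} {k : ℕ} {T : List (Letter ℕ)}
    {σ : Store} (hO : Out ps σ) (hold : ∀ x ∈ heads ps, x.Old k)
    (hB : BlockStk ps (maximalBlocks T) σ) (hm : σ.reg Rm = (maximalBlocks T).length)
    (hM : Marked ps (maximalBlocks T) σ) :
    Spec defineBlocks σ (6 * T.length) fun τ =>
      ∃ qs, Out (ps ++ qs) τ ∧ qs.toFinset = allBlockProds k T ∧
        (∀ x ∈ heads qs, ∃ a, IsBlockLetter k a x) ∧
        ∀ a l c, (a, l) ∈ maximalBlocks T → 1 < l → Code ps a c →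
          Code (ps ++ qs) (.block k a l) (τ.row Ablock (τ.reg Rp) (key c l)) := by
  set B := maximalBlocks T with hBT
  have hempty : ∀ a c, Code ps a c → σ.row Amax (σ.reg Rp) c = 0 → blockLengths T a = [] := by
    intro a c hc h0
    rw [List.eq_nil_iff_forall_not_mem]
    intro l hl
    rw [mem_blockLengths] at hl
    have := (hM a c hc).2.1 l hl.1 hl.2
    omega
  have main := Spec.scan (T := B) (i := Rj) (n := Rm) (P := defineBlocksBody)
    (σ₀ := (Rj ≔ 0).eval σ)
    (fun s τ => (∃ qs, BlocksDefined ps k T (s.map Prod.fst).toFinset qs τ) ∧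
      ∀ a c, Code ps a c → τ.row Amax (σ.reg Rp) c =
        if a ∈ (s.map Prod.fst).toFinset then 0 else σ.row Amax (σ.reg Rp) c)
    -- The sum over a set of letters, not over the blocks, expresses that no letter is treated
    -- twice.
    (fun s => s.length + ∑ a ∈ (s.map Prod.fst).toFinset, 5 * T.count a) rfl ?_ (by simpa)
    (by simp) ?_
  · refine Spec.init rfl (main.frame.mono ?_ ?_)
    · have h₁ : B.length ≤ T.length := by
        simpa [compressBlocks] using length_compressBlocks_le 0 T
      have h₂ : ∑ a ∈ (B.map Prod.fst).toFinset, T.count a ≤ T.length := by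
        rw [← List.sum_toFinset_count_eq_length T]
        refine Finset.sum_le_sum_of_subset fun a ha => ?_
        simp only [List.mem_toFinset, List.mem_map] at ha ⊢
        obtain ⟨q, hq, rfl⟩ := ha
        have := maximalBlocks_pos hq
        have := le_count_of_mem_maximalBlocks hq
        exact List.count_pos_iff.1 (by omega)
      rw [← Finset.mul_sum]
      omega
    · rintro τ ⟨⟨⟨qs, h⟩, -⟩, hf⟩
      refine ⟨qs, h.out, ?_, fun x hx => ?_, ?_⟩
      · rw [h.prods, allBlockProds]
        refine Finset.Subset.antisymm (fun q hq => ?_) (fun q hq => ?_)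
        · simp only [Finset.mem_biUnion, List.mem_toFinset, List.mem_map] at hq ⊢
          obtain ⟨a, ⟨r, hr, rfl⟩, hq⟩ := hq
          refine ⟨_, ?_, hq⟩
          have := maximalBlocks_pos hr
          have := le_count_of_mem_maximalBlocks hr
          exact List.count_pos_iff.1 (by omega)
        · simp only [Finset.mem_biUnion, List.mem_toFinset, List.mem_map] at hq ⊢
          obtain ⟨a, -, hq⟩ := hq
          by_cases hn : blockLengths T a = []
          · rw [hn, blockProds_nil] at hq
            simp at hq
          · obtain ⟨l, hl⟩ := List.exists_mem_of_ne_nil _ hn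
            exact ⟨a, ⟨_, (mem_blockLengths.1 hl).1, rfl⟩, hq⟩
      · obtain ⟨a, -, ha⟩ := h.heads x hx
        exact ⟨a, ha⟩
      · intro a l c hq hl hc
        exact h.code a (List.mem_toFinset.2 (List.mem_map.2 ⟨_, hq, rfl⟩)) l
          (mem_blockLengths.2 ⟨hq, hl⟩) c hc
  · rintro ⟨a, l⟩ s τ hs hf ⟨⟨qs, h⟩, hmax⟩ hj
    have hp : τ.reg Rp = σ.reg Rp := by simpa using hf.reg Rp rfl
    have ha : Code ps a (τ.row Abl (τ.reg Rp) (τ.reg Rj)) := by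
      rw [hp, hf.row_eq rfl, hj]
      exact (hB (a, l) s hs).1
    set c := τ.row Abl (τ.reg Rp) (τ.reg Rj) with hc
    set S := (s.map Prod.fst).toFinset with hS
    have hS' : (((a, l) :: s).map Prod.fst).toFinset = insert a S := by simp [hS]
    rw [hS']
    have hmc := hmax a c ha
    set τ₁ := (Ra ≔ Expr.row Abl ♯Rj).eval τ with hτ₁
    have e₁ : τ₁.row Amax (τ₁.reg Rp) (τ₁.reg Ra) = τ.row Amax (σ.reg Rp) c := by
      simp [hτ₁, hp, hc]
    by_cases hz : τ.row Amax (σ.reg Rp) c = 0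
    · refine ⟨0, ?_, Spec.init rfl (Spec.mono (n := 0 + 0) (Spec.seq (Spec.ite
        (fun hv => absurd ?_ hv) fun _ => Spec.eval (Q := fun ρ => ρ = τ₁) rfl rfl) ?_)
        le_rfl fun _ h => h)⟩
      · have := Finset.sum_le_sum_of_subset (f := fun a => 5 * T.count a) (Finset.subset_insert a S)
        simp only [List.length_cons]
        omega
      · rw [← hz, ← e₁]; rfl
      · rintro _ rfl
        refine Spec.eval rfl ⟨⟨⟨qs, ?_, ?_, ?_, ?_⟩, ?_⟩, by simp [hτ₁, hj]⟩
        · exact h.out.congr (by simp [hτ₁]) (by simp [hτ₁]) (by simp [hτ₁]) (by simp [hτ₁])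
        · rw [h.prods]
          by_cases has : a ∈ S
          · rw [Finset.insert_eq_of_mem has]
          · rw [if_neg has, hz] at hmc
            rw [Finset.biUnion_insert, hempty a c ha hmc.symm, blockProds_nil, Finset.empty_union]
        · intro x hx
          obtain ⟨b, hb, hb'⟩ := h.heads x hx
          exact ⟨b, Finset.mem_insert_of_mem hb, hb'⟩
        · intro b hb l hl d hd
          have hbs : b ∈ S := by
            rcases Finset.mem_insert.1 hb with rfl | hb
            · by_contra has
              rw [if_neg has, hz] at hmc
              rw [hempty b c ha hmc.symm] at hl
              simp at hl
            · exact hb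
          simpa [hτ₁] using h.code b hbs l hl d hd
        · intro b d hd
          have := hmax b d hd
          simp only [Finset.mem_insert]
          by_cases hbs : b ∈ S
          · simpa [hτ₁, hbs] using this
          · by_cases hba : b = a
            · subst hba
              obtain rfl := (ha.inj hd).2 rfl
              simpa [hτ₁] using hz
            · simpa [hτ₁, hbs, hba] using this
    · have has : a ∉ S := fun h => hz (by rw [hmc, if_pos h])
      rw [if_neg has] at hmc
      have hMa := hM a c ha
      rw [← hmc] at hMa
      obtain ⟨hM₁, hM₂, hM₃⟩ := hMa
      obtain ⟨hM₃, hM₄⟩ := hM₃.resolve_left hz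
      have hcount := le_count_of_mem_maximalBlocks hM₄
      set M := τ.row Amax (σ.reg Rp) c with hMdef
      have hfresh : ∀ x, IsBlockLetter k a x → x ∉ Recompression.heads (ps ++ qs) := by
        intro x hx
        rw [heads_append, List.mem_append]
        rintro (h' | h')
        · exact hx.not_old (hold x h')
        · obtain ⟨b, hb, hb'⟩ := h.heads x h'
          exact has (hx.inj hb' ▸ hb)
      have hq := sortedLT_blockLengths T a
      rw [List.sortedLT_iff_pairwise, List.pairwise_cons, ← List.sortedLT_iff_pairwise] at hq
      have hrc : τ₁.reg Ra = c := by simp [hτ₁, hc]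
      have sp := spec_processLetter (σ := τ₁) (ps := ps ++ qs) (k := k) (M := M) (a := a)
        (ls := blockLengths T a)
        (h.out.congr (by simp [hτ₁]) (by simp [hτ₁]) (by simp [hτ₁]) (by simp [hτ₁]))
        (by rw [hrc]; exact ha.append _) hq.2
        (fun l hl => ⟨(mem_blockLengths.1 hl).2,
          hM₂ l (mem_blockLengths.1 hl).1 (mem_blockLengths.1 hl).2⟩) e₁ ?_
        (fun i => hfresh _ (.inl ⟨_, rfl⟩)) (fun i j => hfresh _ (.inr (.inl ⟨_, _, rfl⟩)))
        (fun l => hfresh _ (.inr (.inr ⟨_, rfl⟩)))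
      · refine ⟨5 * M + 0, ?_, Spec.init rfl (Spec.seq (Spec.ite (fun _ => sp) fun hv => absurd ?_ hz)
          ?_)⟩
        · rw [Finset.sum_insert has, List.length_cons]
          simp only at hcount
          omega
        · rw [← e₁]; exact hv
        · rintro τ₂ ⟨⟨h₁, h₂, h₃, h₄⟩, hf₂⟩
          have hp₁ : τ₁.reg Rp = σ.reg Rp := by simpa [hτ₁] using hp
          have hp₂ : τ₂.reg Rp = σ.reg Rp := (hf₂.reg Rp rfl).trans hp₁
          rw [hp₁, hrc] at h₂ h₃ h₄
          have hr₁ : ∀ A, τ₁.row A (σ.reg Rp) = τ.row A (σ.reg Rp) := fun A => by simp [hτ₁]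
          rw [hr₁] at h₃ h₄
          have hcd : ∀ {b d}, b ≠ a → Code ps b d → d ≠ c := fun hba hd h => hba ((hd.inj ha).1 h)
          refine Spec.eval rfl ⟨⟨⟨qs ++ letterProds k a (blockLengths T a), ?_, ?_, ?_, ?_⟩, ?_⟩, ?_⟩
          · rw [← List.append_assoc]
            exact h₁.congr (by simp) (by simp) (by simp) (by simp)
          · rw [List.toFinset_append, h.prods, toFinset_letterProds, Finset.biUnion_insert,
              Finset.union_comm]
          · intro x hx
            rw [heads_append, List.mem_append] at hx
            rcases hx with hx | hx
            · obtain ⟨b, hb, hb'⟩ := h.heads x hx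
              exact ⟨b, Finset.mem_insert_of_mem hb, hb'⟩
            · exact ⟨a, Finset.mem_insert_self _ _, isBlockLetter_of_mem_heads hx⟩
          · intro b hb l hl d hd
            rw [← List.append_assoc]
            simp only [Prog.eval, Store.row_setReg, Store.reg_setReg, hp₂]
            by_cases hba : b = a
            · subst hba
              obtain rfl := (ha.inj hd).2 rfl
              simpa using h₂ l hl
            · have := h.code b (Finset.mem_of_mem_insert_of_ne hb hba) l hl d hd
              rw [hp] at this
              have e := h₃ d l (hcd hba hd)
              simpa [hp₂, e] using this.append (letterProds k a (blockLengths T a))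
          · intro b d hd
            have e := h₄ d
            by_cases hba : b = a
            · subst hba
              obtain rfl := (ha.inj hd).2 rfl
              simpa using e
            · rw [if_neg (hcd hba hd)] at e
              simpa [e, hba] using hmax b d hd
          · rw [Prog.eval, Store.reg_setReg, if_pos rfl]
            have : τ₂.reg Rj = τ₁.reg Rj := hf₂.reg Rj rfl
            simp [this, hτ₁, hj]
      · intro l
        rw [hrc, show τ₁.reg Rp = σ.reg Rp by simpa [hτ₁] using hp, mem_blockLengths]
        have : τ₁.row Apres (σ.reg Rp) = σ.row Apres (σ.reg Rp) := by
          have : τ.row Apres (σ.reg Rp) = σ.row Apres (σ.reg Rp) := by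
            rw [hf.row_eq rfl]; simp
          simpa [hτ₁] using this
        rw [this, hM₁ l]
        simp [hBT]
  · refine ⟨⟨[], ⟨?_, by simp, by simp [Recompression.heads], by simp⟩⟩, by simp⟩
    simpa using hO.congr (by simp) (by simp) (by simp) (by simp)

end Recompression

namespace Recompression

open WordRAM

/-! ### The program: the text after block compression, and its pairs -/

def writeMidBody : Prog :=
  .ite (.less 1 (.row Abn ♯Rj)) (.put Amid ♯Rj (.row Ablock (.key (.row Abl ♯Rj) (.row Abn ♯Rj))))
    (.put Amid ♯Rj (.row Abl ♯Rj)) ⨾ Rj ≔ ♯Rj + 1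

/-- Write the text after block compression. -/
def writeMid : Prog :=
  Rj ≔ 0 ⨾ .loop (.op .lt ♯Rj ♯Rm) writeMidBody

theorem spec_writeMid {ps qs : List (Letter ℕ × List (Letter ℕ))} {k : ℕ} {T : List (Letter ℕ)}
    {σ : Store} (hB : BlockStk ps (maximalBlocks T) σ) (hm : σ.reg Rm = (maximalBlocks T).length)
    (hq : ∀ a l c, (a, l) ∈ maximalBlocks T → 1 < l → Code ps a c →
      Code (ps ++ qs) (.block k a l) (σ.row Ablock (σ.reg Rp) (key c l))) :
    Spec writeMid σ T.length fun τ =>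
      Stk (τ.row Amid (τ.reg Rp)) (Code (ps ++ qs)) (compressBlocks k T) := by
  have hle : (maximalBlocks T).length ≤ T.length := by
    simpa [compressBlocks] using length_compressBlocks_le k T
  refine Spec.init rfl (Spec.mono (Spec.scan (T := maximalBlocks T) (fun s τ =>
    Stk (τ.row Amid (τ.reg Rp)) (Code (ps ++ qs))
      (s.map fun q : Letter ℕ × ℕ => if 1 < q.2 then .block k q.1 q.2 else q.1)) List.length rfl ?_ (by simpa)
    (by simp) (by simp [Stk.nil])) hle fun _ h => h)
  rintro ⟨a, l⟩ s τ hs hf hI hj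
  refine ⟨0, by simp; omega, Spec.eval rfl ⟨?_, by simp [writeMidBody, hj]⟩⟩
  have hp : τ.reg Rp = σ.reg Rp := by simpa using hf.reg Rp rfl
  have hr : ∀ A, writeMidBody.setsCell A = false → τ.row A (τ.reg Rp) = σ.row A (σ.reg Rp) := by
    intro A hA
    rw [hp, hf.row_eq hA]; simp
  obtain ⟨h₁, h₂⟩ := hB (a, l) s hs
  simp only at h₁ h₂
  have h₃ := hq a l (σ.row Abl (σ.reg Rp) s.length) (hs.subset (by simp))
  rw [List.map_cons]
  refine (hI.congr fun i hi => ?_).cons ?_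
  · rw [List.length_map] at hi
    simp [writeMidBody, hj, hi.ne]
  · by_cases hl : 1 < l
    · simpa [writeMidBody, hj, hr, Prog.setsCell, Prog.put, h₂, hl] using h₃ hl h₁
    · simpa [writeMidBody, hj, hr, Prog.setsCell, Prog.put, h₂, hl] using h₁.append qs

/-- The other letters in the pairs that contain `c`. -/
def partners (P : List (Letter ℕ × Letter ℕ)) (c : Letter ℕ) : List (Letter ℕ) :=
  P.flatMap fun q => if q.1 = c then [q.2] else if q.2 = c then [q.1] else []

theorem sum_count_le (S : Finset (Letter ℕ)) (l : List (Letter ℕ)) :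
    ∑ a ∈ S, l.count a ≤ l.length := by
  induction l with
  | nil => simp
  | cons b l ih =>
    simp only [List.count_cons, Finset.sum_add_distrib, List.length_cons, beq_iff_eq,
      Finset.sum_ite_eq]
    split_ifs <;> omega

theorem sum_partners_le (S : Finset (Letter ℕ)) (P : List (Letter ℕ × Letter ℕ)) :
    ∑ a ∈ S, (partners P a).length ≤ 2 * P.length := by
  have h : ∀ a, (partners P a).length ≤ (P.map Prod.fst).count a + (P.map Prod.snd).count a := by
    intro a
    induction P with
    | nil => simp [partners]
    | cons q P ih =>
      simp only [partners, List.flatMap_cons, List.length_append, List.map_cons, List.count_cons,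
        beq_iff_eq] at ih ⊢
      split_ifs <;> simp only [List.length_cons, List.length_nil] <;> omega
  have h₁ := sum_count_le S (P.map Prod.fst)
  have h₂ := sum_count_le S (P.map Prod.snd)
  have h₃ := Finset.sum_le_sum fun a (_ : a ∈ S) => h a
  rw [Finset.sum_add_distrib] at h₃
  simp only [List.length_map] at h₁ h₂
  omega

theorem countP_partners {T : List (Letter ℕ)} (hT : ∀ q ∈ pairs T, q.1 ≠ q.2)
    (S : Finset (Letter ℕ)) (a : Letter ℕ) :
    (partners (pairs T) a).countP (· ∈ S) = count T S a := by
  unfold count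
  generalize pairs T = P at hT ⊢
  induction P with
  | nil => simp [partners]
  | cons q P ih =>
    have hq := hT q (by simp)
    rw [List.countP_cons, ← ih fun r hr => hT r (by simp [hr])]
    simp only [partners, List.flatMap_cons, List.countP_append]
    by_cases h₁ : q.1 = a
    · have h₂ : q.2 ≠ a := fun h => hq (h₁.trans h.symm)
      by_cases h₃ : q.2 ∈ S <;> simp [h₁, h₂, h₃, Nat.add_comm]
    · by_cases h₂ : q.2 = a
      · by_cases h₃ : q.1 ∈ S <;> simp [h₁, h₂, h₃, Nat.add_comm]
      · simp [h₁, h₂]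

theorem partners_ne_nil {P : List (Letter ℕ × Letter ℕ)} {a : Letter ℕ} :
    partners P a ≠ [] ↔ ∃ q ∈ P, a = q.1 ∨ a = q.2 := by
  simp only [partners, ne_eq, List.flatMap_eq_nil_iff, not_forall]
  constructor
  · rintro ⟨q, hq, h⟩
    refine ⟨q, hq, ?_⟩
    by_contra h'
    push Not at h'
    exact h (by rw [if_neg h'.1.symm, if_neg h'.2.symm])
  · rintro ⟨q, hq, h⟩
    refine ⟨q, hq, ?_⟩
    rcases h with rfl | rfl
    · simp
    · by_cases h : q.1 = q.2 <;> simp [h]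

/-- For each letter the other letters in pairs with it are listed. -/
def Listed (ps : List (Letter ℕ × List (Letter ℕ))) (P : List (Letter ℕ × Letter ℕ)) (σ : Store) :
    Prop :=
  ∀ a c, Code ps a c → σ.row Adeg (σ.reg Rp) c = (partners P a).length ∧
    Stk (fun i => σ.row Aadj (σ.reg Rp) (key c i)) (Code ps) (partners P a)

def listPairsBody : Prog :=
  .ite ♯Rj (Ra ≔ .row Amid ♯Rj ⨾ Rb ≔ .row Amid (♯Rj - 1) ⨾
    .put Aadj (.key ♯Ra (.row Adeg ♯Ra)) ♯Rb ⨾ .put Adeg ♯Ra (.row Adeg ♯Ra + 1) ⨾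
    .put Aadj (.key ♯Rb (.row Adeg ♯Rb)) ♯Ra ⨾ .put Adeg ♯Rb (.row Adeg ♯Rb + 1)) .skip ⨾
  Rj ≔ ♯Rj + 1

/-- List the pairs of the text. -/
def listPairs : Prog :=
  Rj ≔ 0 ⨾ .loop (.op .lt ♯Rj ♯Rm) listPairsBody

theorem pairs_cons_cons (a b : Letter ℕ) (t : List (Letter ℕ)) :
    pairs (a :: b :: t) = (a, b) :: pairs (b :: t) := rfl

theorem spec_listPairs {ps : List (Letter ℕ × List (Letter ℕ))} {T : List (Letter ℕ)} {σ : Store}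
    (hT : Stk (σ.row Amid (σ.reg Rp)) (Code ps) T) (hm : σ.reg Rm = T.length)
    (hne : ∀ q ∈ pairs T, q.1 ≠ q.2) (h₀ : ∀ z, σ.row Adeg (σ.reg Rp) z = 0) :
    Spec listPairs σ T.length (Listed ps (pairs T)) := by
  refine Spec.init rfl (Spec.scan (T := T) (fun s τ => Listed ps (pairs s) τ) List.length rfl ?_
    (by simpa) (by simp) ?_)
  · intro a s τ hs hf hI hj
    refine ⟨0, by simp; omega, Spec.eval rfl ⟨?_, by simp [listPairsBody, hj]⟩⟩
    have hp : τ.reg Rp = σ.reg Rp := by simpa using hf.reg Rp rfl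
    have hr : τ.row Amid (τ.reg Rp) = σ.row Amid (σ.reg Rp) := by
      rw [hp, hf.row_eq rfl]; simp
    have ha := hT a s hs
    cases s with
    | nil =>
      intro x c hx
      have := hI x c hx
      simp only [pairs, List.tail_nil, List.tail_cons, List.zip_nil_right] at this ⊢
      simpa [listPairsBody, hj] using this
    | cons b t =>
      have hb := hT b t ((List.suffix_cons a _).trans hs)
      have hab : a ≠ b := by
        obtain ⟨u, rfl⟩ := hs
        refine hne (a, b) ?_
        have : (a, b) ∈ pairs (a :: b :: t) := by simp [pairs_cons_cons]
        clear * - this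
        induction u with
        | nil => exact this
        | cons x u ih =>
          cases u with
          | nil => exact List.mem_cons_of_mem _ ih
          | cons y u => exact List.mem_cons_of_mem _ ih
      rw [← hr] at ha hb
      simp only [List.length_cons] at hj ha
      set ca := τ.row Amid (τ.reg Rp) (t.length + 1) with hca
      set cb := τ.row Amid (τ.reg Rp) t.length with hcb
      -- The two insertions go to different lists, since neighbouring letters differ.
      have hcab : ca ≠ cb := fun h => hab ((ha.inj hb).1 h)
      have h₁ : ∀ z, (listPairsBody.eval τ).row Adeg (τ.reg Rp) z = if z = cb ∨ z = ca then
          τ.row Adeg (τ.reg Rp) z + 1 else τ.row Adeg (τ.reg Rp) z := by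
        intro z
        by_cases hzb : z = cb
        · subst hzb
          simp [listPairsBody, hj, ← hca, ← hcb, hcab.symm]
        · by_cases hza : z = ca
          · subst hza
            simp [listPairsBody, hj, ← hca, ← hcb, hcab]
          · simp [listPairsBody, hj, ← hca, ← hcb, hza, hzb]
      have h₂ : ∀ c i, (listPairsBody.eval τ).row Aadj (τ.reg Rp) (key c i) =
          if c = cb ∧ i = τ.row Adeg (τ.reg Rp) cb then ca else
          if c = ca ∧ i = τ.row Adeg (τ.reg Rp) ca then cb else
          τ.row Aadj (τ.reg Rp) (key c i) := by
        intro c i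
        simp [listPairsBody, hj, ← hca, ← hcb, hcab.symm]
      have h₃ : (listPairsBody.eval τ).reg Rp = τ.reg Rp := by
        simp [listPairsBody, hj]
      intro x c hx
      obtain ⟨i₁, i₂⟩ := hI x c hx
      rw [h₃, h₁ c]
      simp only [h₂]
      have e : partners (pairs (a :: b :: t)) x = (if a = x then [b] else if b = x then [a] else [])
          ++ partners (pairs (b :: t)) x := by simp [partners, pairs_cons_cons]
      rw [e]
      have hxa := hx.inj ha
      have hxb := hx.inj hb
      by_cases h₄ : a = x
      · have h₅ := hxa.2 h₄.symm
        have h₆ : c ≠ cb := h₅ ▸ hcab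
        rw [if_pos h₄, if_pos (.inr h₅), List.singleton_append]
        refine ⟨by simp [i₁], Stk.cons (i₂.congr fun i hi => ?_) ?_⟩
        · rw [if_neg (by simp [h₆]), if_neg (by rw [← h₅, i₁]; omega)]
        · rw [if_neg (by simp [h₆]), if_pos ⟨h₅, by rw [← h₅, i₁]⟩]
          exact hb
      · by_cases h₅ : b = x
        · have h₆ := hxb.2 h₅.symm
          have h₇ : c ≠ ca := h₆ ▸ hcab.symm
          rw [if_neg h₄, if_pos h₅, if_pos (.inl h₆), List.singleton_append]
          refine ⟨by simp [i₁], Stk.cons (i₂.congr fun i hi => ?_) ?_⟩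
          · rw [if_neg (by rw [← h₆, i₁]; omega), if_neg (by simp [h₇])]
          · rw [if_pos ⟨h₆, by rw [← h₆, i₁]⟩]
            exact ha
        · have h₆ : c ≠ ca := fun h => h₄ (hxa.1 h).symm
          have h₇ : c ≠ cb := fun h => h₅ (hxb.1 h).symm
          rw [if_neg h₄, if_neg h₅, if_neg (by simp [h₆, h₇])]
          simpa [h₆, h₇] using ⟨i₁, i₂⟩
  · intro x c _
    simpa [partners, pairs, Stk.nil] using h₀ c

end Recompression

namespace Recompression

open WordRAM

/-! ### The program: the greedy partition -/

theorem greedyLoop_append_singleton (T L : List (Letter ℕ)) (a : Letter ℕ)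
    (S : Finset (Letter ℕ) × Finset (Letter ℕ)) :
    greedyLoop T (L ++ [a]) S =
      if count T (greedyLoop T L S).1 a ≤ count T (greedyLoop T L S).2 a then
        (insert a (greedyLoop T L S).1, (greedyLoop T L S).2)
      else ((greedyLoop T L S).1, insert a (greedyLoop T L S).2) := by
  induction L generalizing S with
  | nil => rfl
  | cons b L ih =>
    obtain ⟨Sl, Sr⟩ := S
    simp only [List.cons_append, greedyLoop]
    by_cases h : count T Sl b ≤ count T Sr b
    · simp only [if_pos h, ih]
    · simp only [if_neg h, ih]

/-- The parts of the letters are stored. -/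
def Sided (ps : List (Letter ℕ × List (Letter ℕ))) (S : Finset (Letter ℕ) × Finset (Letter ℕ))
    (σ : Store) : Prop :=
  ∀ a c, Code ps a c →
    σ.row Aside (σ.reg Rp) c = if a ∈ S.1 then 1 else if a ∈ S.2 then 2 else 0

def countBody : Prog :=
  Rb ≔ .row Aadj (.key ♯Ra ♯Ri) ⨾ Rl ≔ .row Aside ♯Rb ⨾
  .ite (.same ♯Rl 1) (Rx ≔ ♯Rx + 1) (.ite (.same ♯Rl 2) (Ry ≔ ♯Ry + 1) .skip) ⨾ Ri ≔ ♯Ri + 1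

/-- Choose the part of one letter. -/
def chooseSide : Prog :=
  (Rd ≔ .row Adeg ♯Ra ⨾ Rx ≔ 0 ⨾ Ry ≔ 0 ⨾ Ri ≔ 0) ⨾ .loop (.op .lt ♯Ri ♯Rd) countBody ⨾
  .ite (.less ♯Ry ♯Rx) (.put Aside ♯Ra 2) (.put Aside ♯Ra 1)

theorem spec_chooseSide {ps : List (Letter ℕ × List (Letter ℕ))} {T : List (Letter ℕ)}
    {a : Letter ℕ} {S : Finset (Letter ℕ) × Finset (Letter ℕ)} {σ : Store}
    (hT : ∀ q ∈ pairs T, q.1 ≠ q.2) (hL : Listed ps (pairs T) σ) (hS : Sided ps S σ)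
    (hd : Disjoint S.1 S.2) (ha : Code ps a (σ.reg Ra)) (h₁ : a ∉ S.1) (h₂ : a ∉ S.2) :
    Spec chooseSide σ (partners (pairs T) a).length fun τ =>
      Sided ps (if count T S.1 a ≤ count T S.2 a then (insert a S.1, S.2)
        else (S.1, insert a S.2)) τ ∧ Frame chooseSide σ τ := by
  refine Spec.frame (Spec.init rfl ?_)
  obtain ⟨hdeg, hadj⟩ := hL a _ ha
  set σ₁ := (Rd ≔ Expr.row Adeg ♯Ra ⨾ Rx ≔ 0 ⨾ Ry ≔ 0 ⨾ Ri ≔ 0).eval σ with hσ₁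
  have main := Spec.scan (T := partners (pairs T) a) (i := Ri) (n := Rd) (P := countBody) (σ₀ := σ₁)
    (fun s τ => τ.reg Rx = s.countP (· ∈ S.1) ∧ τ.reg Ry = s.countP (· ∈ S.2))
    List.length rfl ?_ (by simpa [hσ₁] using hdeg) (by simp [hσ₁]) (by simp [hσ₁])
  · refine Spec.mono (n := (partners (pairs T) a).length + 0) (main.frame.seq ?_) (by omega)
      fun _ h => h
    rintro τ ⟨⟨hx, hy⟩, hf⟩
    rw [countP_partners hT] at hx hy
    have hp : τ.reg Rp = σ.reg Rp := by rw [hf.reg Rp rfl]; simp [hσ₁]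
    have hra : τ.reg Ra = σ.reg Ra := by rw [hf.reg Ra rfl]; simp [hσ₁]
    have hr : τ.row Aside (σ.reg Rp) = σ.row Aside (σ.reg Rp) := by rw [hf.row_eq rfl]; simp [hσ₁]
    refine Spec.eval rfl fun b c hc => ?_
    have hSb := hS b c hc
    have hab := hc.inj ha
    by_cases hle : count T S.1 a ≤ count T S.2 a
    · simp only [if_pos hle, Finset.mem_insert]
      by_cases hba : b = a
      · subst hba
        simp [hx, hy, hp, hra, hle, hab.2 rfl]
      · have := mt hab.1 hba
        simpa [hx, hy, hp, hra, hr, hle, this, hba] using hSb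
    · simp only [if_neg hle, Finset.mem_insert]
      by_cases hba : b = a
      · subst hba
        simp [hx, hy, hp, hra, hle, hab.2 rfl, h₁]
      · have := mt hab.1 hba
        simpa [hx, hy, hp, hra, hr, hle, this, hba] using hSb
  · rintro b s τ hs hf ⟨hx, hy⟩ hi
    refine ⟨0, by simp; omega, Spec.eval rfl ?_⟩
    have hp : τ.reg Rp = σ.reg Rp := by rw [hf.reg Rp rfl]; simp [hσ₁]
    have hra : τ.reg Ra = σ.reg Ra := by rw [hf.reg Ra rfl]; simp [hσ₁]
    have hr : τ.row Aside (σ.reg Rp) = σ.row Aside (σ.reg Rp) := by rw [hf.row_eq rfl]; simp [hσ₁]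
    have hr' : τ.row Aadj (σ.reg Rp) = σ.row Aadj (σ.reg Rp) := by rw [hf.row_eq rfl]; simp [hσ₁]
    have hb := hadj b s hs
    have hSb := hS b _ hb
    rw [List.countP_cons, List.countP_cons]
    by_cases hb₁ : b ∈ S.1
    · have hb₂ := Finset.disjoint_left.1 hd hb₁
      rw [if_pos hb₁] at hSb
      simp [countBody, hp, hra, hr, hr', hi, hx, hy, hSb, hb₁, hb₂]
    · rw [if_neg hb₁] at hSb
      by_cases hb₂ : b ∈ S.2
      · rw [if_pos hb₂] at hSb
        simp [countBody, hp, hra, hr, hr', hi, hx, hy, hSb, hb₁, hb₂]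
      · rw [if_neg hb₂] at hSb
        simp [countBody, hp, hra, hr, hr', hi, hx, hy, hSb, hb₁, hb₂]

def greedyBody : Prog :=
  Ra ≔ .row Amid ♯Rj ⨾
  .ite ((Expr.same (.row Aside ♯Ra) 0).both (.row Adeg ♯Ra)) chooseSide .skip ⨾ Rj ≔ ♯Rj + 1

/-- Choose the parts of all letters in pairs, in the order of the text. -/
def greedy : Prog :=
  Rj ≔ 0 ⨾ .loop (.op .lt ♯Rj ♯Rm) greedyBody

/-- The order is that of first occurrence in the scan. A letter costs its number of pairs and only
once, as a letter with a side is skipped; the degrees sum to at most twice the number of pairs. -/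
theorem spec_greedy {ps : List (Letter ℕ × List (Letter ℕ))} {T : List (Letter ℕ)} {σ : Store}
    (hT : Stk (σ.row Amid (σ.reg Rp)) (Code ps) T) (hm : σ.reg Rm = T.length)
    (hne : ∀ q ∈ pairs T, q.1 ≠ q.2) (hL : Listed ps (pairs T) σ)
    (h₀ : ∀ z, σ.row Aside (σ.reg Rp) z = 0) :
    Spec greedy σ (3 * T.length) fun τ => ∃ L, IsLetterList T L ∧
      Sided ps (greedyLoop T L (∅, ∅)) τ := by
  have main := Spec.scan (T := T) (i := Rj) (n := Rm) (P := greedyBody) (σ₀ := (Rj ≔ 0).eval σ)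
    (fun s τ => ∃ L : List (Letter ℕ), L.Nodup ∧
      (∀ a, a ∈ L ↔ a ∈ s ∧ partners (pairs T) a ≠ []) ∧ Sided ps (greedyLoop T L (∅, ∅)) τ)
    (fun s => s.length + ∑ a ∈ s.toFinset, (partners (pairs T) a).length) rfl ?_ (by simpa)
    (by simp) ⟨[], by simp, by simp, fun a c hc => by simpa [greedyLoop] using h₀ c⟩
  · refine Spec.init rfl (main.mono ?_ ?_)
    · have := sum_partners_le T.toFinset (pairs T)
      rw [length_pairs] at this
      omega
    · rintro τ ⟨L, hL, hmem, h⟩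
      refine ⟨L, ⟨hL, fun a => ?_⟩, h⟩
      rw [hmem, partners_ne_nil, and_iff_right_iff_imp]
      rintro ⟨q, hq, rfl | rfl⟩
      · exact (mem_of_mem_pairs hq).1
      · exact (mem_of_mem_pairs hq).2
  · rintro a s τ hs hf ⟨L, hnd, hmem, hS⟩ hj
    have hp : τ.reg Rp = σ.reg Rp := by rw [hf.reg Rp rfl]; simp
    have hr : ∀ A, greedyBody.setsCell A = false → τ.row A (σ.reg Rp) = σ.row A (σ.reg Rp) :=
      fun A hA => by rw [hf.row_eq hA]; simp
    have ha := hT a s hs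
    set c := σ.row Amid (σ.reg Rp) s.length with hc
    have hdeg := (hL a c ha).1
    have hsd := hS a c ha
    have hin := mem_greedyLoop T L (∅, ∅) a
    simp only [Finset.notMem_empty, false_or] at hin
    set τ₁ := (Ra ≔ Expr.row Amid ♯Rj).eval τ with hτ₁
    have hra : τ₁.reg Ra = c := by simp [hτ₁, hp, hj, hr Amid rfl, hc]
    have e₁ : ((Expr.same (.row Aside ♯Ra) 0).both (.row Adeg ♯Ra)).val τ₁ ≠ 0 ↔
        a ∉ L ∧ partners (pairs T) a ≠ [] := by
      have h₁ : τ.row Aside (σ.reg Rp) c = 0 ↔ a ∉ L := by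
        rw [← hp, hsd, ← hin]
        split_ifs <;> simp_all
      have h₂ : τ.row Adeg (σ.reg Rp) c ≠ 0 ↔ partners (pairs T) a ≠ [] := by
        rw [hr Adeg rfl, hdeg]; simp
      simp only [Expr.val_both, Expr.val_same, Expr.val_row, Expr.val, hra]
      rw [show τ₁.reg Rp = σ.reg Rp by simpa [hτ₁] using hp,
        show τ₁.row Aside (σ.reg Rp) = τ.row Aside (σ.reg Rp) by simp [hτ₁],
        show τ₁.row Adeg (σ.reg Rp) = τ.row Adeg (σ.reg Rp) by simp [hτ₁], ← h₁, ← h₂]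
      simp
    rw [List.toFinset_cons]
    by_cases hv : a ∉ L ∧ partners (pairs T) a ≠ []
    · have has : a ∉ s.toFinset := fun h => hv.1 ((hmem a).2 ⟨List.mem_toFinset.1 h, hv.2⟩)
      have hin' : ¬ (a ∈ (greedyLoop T L (∅, ∅)).1 ∨ a ∈ (greedyLoop T L (∅, ∅)).2) :=
        fun h => hv.1 (hin.1 h)
      rw [not_or] at hin'
      have sp := spec_chooseSide (σ := τ₁) (a := a) hne (fun b d hb => ?_) (fun b d hb => ?_)
        (disjoint_greedyLoop T L (∅, ∅) hnd (by simp) (by simp)) (by rwa [hra]) hin'.1 hin'.2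
      · refine ⟨(partners (pairs T) a).length + 0, ?_, Spec.init rfl (Spec.seq (Spec.ite (fun _ => sp)
          fun h => absurd h (e₁.2 hv)) ?_)⟩
        · rw [Finset.sum_insert has, List.length_cons]
          omega
        · rintro τ₂ ⟨h, hf₂⟩
          refine Spec.eval rfl ⟨⟨L ++ [a], ?_, fun b => ?_, ?_⟩, ?_⟩
          · exact List.nodup_append.2 ⟨hnd, by simp, fun x hx y hy => by
              rw [List.mem_singleton] at hy; subst hy; rintro rfl; exact hv.1 hx⟩
          · rw [List.mem_append, hmem, List.mem_singleton, List.mem_cons]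
            constructor
            · rintro (h | rfl)
              · exact ⟨.inr h.1, h.2⟩
              · exact ⟨.inl rfl, hv.2⟩
            · rintro ⟨rfl | h, h'⟩
              · exact .inr rfl
              · exact .inl ⟨h, h'⟩
          · rw [greedyLoop_append_singleton]
            intro b d hb
            simpa using h b d hb
          · have := hf₂.reg Rj rfl
            simp [this, hτ₁, hj]
      · have := hL b d hb
        rw [← hp] at this
        simpa [hτ₁, hp, hr Adeg rfl, hr Aadj rfl] using this
      · simpa [hτ₁] using hS b d hb
    · refine ⟨0, ?_, Spec.init rfl (Spec.mono (n := 0 + 0) (Spec.seq (Spec.ite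
        (fun h => absurd (e₁.1 h) hv) fun _ => Spec.eval (Q := fun ρ => ρ = τ₁) rfl rfl) ?_)
        le_rfl fun _ h => h)⟩
      · have := Finset.sum_le_sum_of_subset (f := fun a => (partners (pairs T) a).length)
          (Finset.subset_insert a s.toFinset)
        simp only [List.length_cons]
        omega
      · rintro _ rfl
        refine Spec.eval rfl ⟨⟨L, hnd, fun b => ?_, fun b d hb => ?_⟩, by simp [hτ₁, hj]⟩
        · rw [hmem, List.mem_cons]
          constructor
          · exact fun h => ⟨.inr h.1, h.2⟩
          · rintro ⟨rfl | h, h'⟩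
            · by_contra hc
              exact hv ⟨fun h => hc ((hmem b).1 h), h'⟩
            · exact ⟨h, h'⟩
        · simpa [hτ₁] using hS b d hb

end Recompression

namespace Recompression

open WordRAM

/-! ### The program: pair compression -/

/-- The recursion that defines the compression passes over two letters, whereas a scan adds one. By
disjointness `b` cannot begin a replaced pair, so the compressed rest starts with `b` itself, which
is exchanged for the new letter. -/
theorem compressPairs_cons_cons (k : ℕ) {A B : Finset (Letter ℕ)} (h : Disjoint A B)
    (a b : Letter ℕ) (t : List (Letter ℕ)) :
    compressPairs k A B (a :: b :: t) = if a ∈ A ∧ b ∈ B then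
      .pair k a b :: (compressPairs k A B (b :: t)).tail else a :: compressPairs k A B (b :: t) := by
  rw [compressPairs]
  split_ifs with hab
  · have hb : b ∉ A := Finset.disjoint_right.1 h hab.2
    cases t with
    | nil => rfl
    | cons c t => rw [compressPairs, if_neg fun h => hb h.1, List.tail_cons]
  · rfl

theorem cover_cons_cons (A B : Finset (Letter ℕ)) (a b : Letter ℕ) (t : List (Letter ℕ)) :
    cover (a :: b :: t) A B = cover (b :: t) A B + if a ∈ A ∧ b ∈ B then 1 else 0 := by
  rw [cover, pairs_cons_cons, List.countP_cons, cover]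
  simp

def switchBody : Prog :=
  .ite ♯Rj (Rx ≔ .row Aside (.row Amid ♯Rj) ⨾ Ry ≔ .row Aside (.row Amid (♯Rj - 1)) ⨾
    .ite ((Expr.same ♯Rx 1).both (.same ♯Ry 2)) (Rs ≔ ♯Rs + 1)
      (.ite ((Expr.same ♯Rx 2).both (.same ♯Ry 1)) (Rt ≔ ♯Rt + 1) .skip)) .skip ⨾ Rj ≔ ♯Rj + 1

/-- Decide whether the parts are switched. -/
def switch : Prog :=
  (Rs ≔ 0 ⨾ Rt ≔ 0 ⨾ Rj ≔ 0) ⨾ .loop (.op .lt ♯Rj ♯Rm) switchBody ⨾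
  .ite (.less ♯Rs ♯Rt) (Rs ≔ 2 ⨾ Rt ≔ 1) (Rs ≔ 1 ⨾ Rt ≔ 2)

/-- The numbers in two registers tell the parts. -/
def Switched (ps : List (Letter ℕ × List (Letter ℕ))) (A B : Finset (Letter ℕ)) (σ : Store) : Prop :=
  ∀ a c, Code ps a c → (σ.row Aside (σ.reg Rp) c = σ.reg Rs ↔ a ∈ A) ∧
    (σ.row Aside (σ.reg Rp) c = σ.reg Rt ↔ a ∈ B)

theorem spec_switch {ps : List (Letter ℕ × List (Letter ℕ))} {T : List (Letter ℕ)} {σ : Store}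
    {S : Finset (Letter ℕ) × Finset (Letter ℕ)}
    (hT : Stk (σ.row Amid (σ.reg Rp)) (Code ps) T) (hm : σ.reg Rm = T.length)
    (hS : Sided ps S σ) (hd : Disjoint S.1 S.2) :
    Spec switch σ T.length fun τ =>
      Switched ps (if cover T S.1 S.2 < cover T S.2 S.1 then (S.2, S.1) else S).1
        (if cover T S.1 S.2 < cover T S.2 S.1 then (S.2, S.1) else S).2 τ := by
  refine Spec.init rfl ?_
  have main := Spec.scan (T := T) (i := Rj) (n := Rm) (P := switchBody)
    (σ₀ := (Rs ≔ 0 ⨾ Rt ≔ 0 ⨾ Rj ≔ 0).eval σ)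
    (fun s τ => τ.reg Rs = cover s S.1 S.2 ∧ τ.reg Rt = cover s S.2 S.1)
    List.length rfl ?_ (by simpa) (by simp) (by simp [cover, pairs])
  · refine Spec.mono (n := T.length + 0) (main.frame.seq ?_) (by omega) fun _ h => h
    rintro τ ⟨⟨h₁, h₂⟩, hf⟩
    have hp : τ.reg Rp = σ.reg Rp := by rw [hf.reg Rp rfl]; simp
    have hr : τ.row Aside (σ.reg Rp) = σ.row Aside (σ.reg Rp) := by rw [hf.row_eq rfl]; simp
    refine Spec.eval rfl fun a c hc => ?_
    have h := hS a c hc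
    have hda : a ∈ S.1 → a ∉ S.2 := fun h => Finset.disjoint_left.1 hd h
    set E := Prog.ite (.less ♯Rs ♯Rt) (Rs ≔ 2 ⨾ Rt ≔ 1) (Rs ≔ 1 ⨾ Rt ≔ 2) with hE
    have e₁ : (E.eval τ).row Aside ((E.eval τ).reg Rp) c = σ.row Aside (σ.reg Rp) c := by
      by_cases hlt : cover T S.1 S.2 < cover T S.2 S.1 <;> simp [hE, h₁, h₂, hlt, hp, hr]
    have e₂ : (E.eval τ).reg Rs = if cover T S.1 S.2 < cover T S.2 S.1 then 2 else 1 := by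
      simp [hE, h₁, h₂]
    have e₃ : (E.eval τ).reg Rt = if cover T S.1 S.2 < cover T S.2 S.1 then 1 else 2 := by
      simp [hE, h₁, h₂]
    rw [e₁, e₂, e₃, h]
    clear * - hda
    split_ifs <;> simp_all
  · rintro a s τ hs hf ⟨h₁, h₂⟩ hj
    refine ⟨0, by simp; omega, Spec.eval rfl ?_⟩
    have hp : τ.reg Rp = σ.reg Rp := by rw [hf.reg Rp rfl]; simp
    have hr : ∀ A, switchBody.setsCell A = false → τ.row A (σ.reg Rp) = σ.row A (σ.reg Rp) :=
      fun A hA => by rw [hf.row_eq hA]; simp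
    have ha := hS a _ (hT a s hs)
    cases s with
    | nil =>
      simp only [cover, pairs, List.tail_nil, List.tail_cons, List.zip_nil_right] at h₁ h₂ ⊢
      simp [switchBody, hj, h₁, h₂]
    | cons b t =>
      have hb := hS b _ (hT b t ((List.suffix_cons a _).trans hs))
      simp only [List.length_cons] at hj ha
      rw [cover_cons_cons, cover_cons_cons, ← h₁, ← h₂]
      have hda : a ∈ S.1 → a ∉ S.2 := fun h => Finset.disjoint_left.1 hd h
      have hdb : b ∈ S.1 → b ∉ S.2 := fun h => Finset.disjoint_left.1 hd h
      have e₁ : (switchBody.eval τ).reg Rj = t.length + 2 := by simp [switchBody, hj]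
      have e₂ : (switchBody.eval τ).reg Rs = τ.reg Rs +
          if σ.row Aside (σ.reg Rp) (σ.row Amid (σ.reg Rp) (t.length + 1)) = 1 ∧
            σ.row Aside (σ.reg Rp) (σ.row Amid (σ.reg Rp) t.length) = 2 then 1 else 0 := by
        simp [switchBody, hj, hp, hr Amid rfl, hr Aside rfl]
        clear * -
        split_ifs <;> simp_all
      have e₃ : (switchBody.eval τ).reg Rt = τ.reg Rt +
          if σ.row Aside (σ.reg Rp) (σ.row Amid (σ.reg Rp) (t.length + 1)) = 2 ∧
            σ.row Aside (σ.reg Rp) (σ.row Amid (σ.reg Rp) t.length) = 1 then 1 else 0 := by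
        simp [switchBody, hj, hp, hr Amid rfl, hr Aside rfl]
        clear * -
        split_ifs <;> simp_all
      rw [e₁, e₂, e₃, ha, hb]
      clear * - hda hdb
      refine ⟨⟨?_, ?_⟩, rfl⟩ <;> split_ifs <;> simp_all

/-- Find or introduce the letter for a pair. -/
def lookup : Prog :=
  Rc ≔ .row Apair (.key ♯Rx ♯Ry) ⨾ .ite ♯Rc .skip (emitTwo ⨾ .put Apair (.key ♯Rx ♯Ry) ♯Rc)

/-- The letters for pairs in the list `rs` are found in the table. -/
structure PairTable (ps : List (Letter ℕ × List (Letter ℕ))) (k : ℕ)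
    (rs : List (Letter ℕ × List (Letter ℕ))) (σ : Store) : Prop where
  out : Out (ps ++ rs) σ
  prods : ∀ q ∈ rs, ∃ a b, q = (.pair k a b, [a, b])
  table : ∀ a b c d, Code ps a c → Code ps b d →
    if (.pair k a b, [a, b]) ∈ rs then
      Code (ps ++ rs) (.pair k a b) (σ.row Apair (σ.reg Rp) (key c d))
    else σ.row Apair (σ.reg Rp) (key c d) = 0

theorem PairTable.congr {ps rs : List (Letter ℕ × List (Letter ℕ))} {k : ℕ} {σ τ : Store}
    (h : PairTable ps k rs σ) (h₁ : τ.cell 1 = σ.cell 1) (h₂ : τ.reg Rid = σ.reg Rid)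
    (h₃ : τ.reg Rout = σ.reg Rout) (h₄ : τ.reg Rcost = σ.reg Rcost) (h₅ : τ.reg Rp = σ.reg Rp)
    (h₆ : τ.row Apair (σ.reg Rp) = σ.row Apair (σ.reg Rp)) : PairTable ps k rs τ where
  out := h.out.congr h₁ h₂ h₃ h₄
  prods := h.prods
  table := by rw [h₅, h₆]; exact h.table

/-- The table is indexed by the numbers of both letters; a zero entry means that the pair has no
production yet. -/
theorem spec_lookup {ps rs : List (Letter ℕ × List (Letter ℕ))} {k : ℕ} {σ : Store}
    (hps : ∀ a b, .pair k a b ∉ heads ps) (h : PairTable ps k rs σ) {a b : Letter ℕ}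
    (ha : Code ps a (σ.reg Rx)) (hb : Code ps b (σ.reg Ry)) :
    Spec lookup σ 0 fun τ => (∃ rs', rs <+: rs' ∧
      rs'.toFinset = insert (.pair k a b, [a, b]) rs.toFinset ∧ PairTable ps k rs' τ ∧
      Code (ps ++ rs') (.pair k a b) (τ.reg Rc)) ∧ Frame lookup σ τ := by
  refine Spec.frame (Spec.init rfl ?_)
  have ht := h.table a b _ _ ha hb
  set n := σ.row Apair (σ.reg Rp) (key (σ.reg Rx) (σ.reg Ry)) with hn
  set σ₁ := (Rc ≔ Expr.row Apair (.key ♯Rx ♯Ry)).eval σ with hσ₁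
  have e₁ : σ₁.reg Rc = n := by simp [hσ₁, hn]
  have h' : PairTable ps k rs σ₁ := h.congr (by simp [hσ₁]) (by simp [hσ₁]) (by simp [hσ₁])
    (by simp [hσ₁]) (by simp [hσ₁]) (by funext z; simp [hσ₁])
  by_cases hmem : (Letter.pair k a b, [a, b]) ∈ rs
  · rw [if_pos hmem] at ht
    refine Spec.ite (fun _ => Spec.eval rfl ⟨rs, List.prefix_rfl, ?_, h', ?_⟩) fun hv => ?_
    · rw [Finset.insert_eq_of_mem (List.mem_toFinset.2 hmem)]
    · simpa [e₁] using ht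
    · have := ht.pos (by simp)
      simp [e₁] at hv
      omega
  · rw [if_neg hmem] at ht
    refine Spec.ite (fun hv => absurd (e₁.trans ht) hv) fun _ => ?_
    have hfresh : Letter.pair k a b ∉ heads (ps ++ rs) := by
      rw [heads_append, List.mem_append]
      rintro (hx | hx)
      · exact hps a b hx
      · obtain ⟨q, hq, hq'⟩ := List.mem_map.1 hx
        obtain ⟨a', b', rfl⟩ := h.prods q hq
        simp only [Letter.pair.injEq, true_and] at hq'
        obtain ⟨rfl, rfl⟩ := hq'
        exact hmem hq
    refine (spec_emitTwo h'.out hfresh (by simp) (y := a) (z := b)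
      (by simpa [hσ₁] using ha.append rs) (by simpa [hσ₁] using hb.append rs)).seq
      fun τ ⟨⟨h₁, h₂⟩, hf⟩ => Spec.eval rfl
        ⟨rs ++ [(.pair k a b, [a, b])], List.prefix_append _ _, by ext; simp [or_comm],
          ⟨?_, ?_, ?_⟩, ?_⟩
    · rw [← List.append_assoc]
      exact h₁.congr (by simp) (by simp) (by simp) (by simp)
    · intro q hq
      rcases List.mem_append.1 hq with hq | hq
      · exact h.prods q hq
      · exact ⟨a, b, by simpa using hq⟩
    · intro a' b' c d hc hd
      have hp : τ.reg Rp = σ.reg Rp := by rw [hf.reg Rp rfl]; simp [hσ₁]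
      have hx : τ.reg Rx = σ.reg Rx := by rw [hf.reg Rx rfl]; simp [hσ₁]
      have hy : τ.reg Ry = σ.reg Ry := by rw [hf.reg Ry rfl]; simp [hσ₁]
      have hr : τ.row Apair (σ.reg Rp) = σ.row Apair (σ.reg Rp) := by
        rw [hf.row_eq rfl]; funext z; simp [hσ₁]
      have := h.table a' b' c d hc hd
      have hca := hc.inj ha
      have hdb := hd.inj hb
      rw [← List.append_assoc]
      simp only [List.mem_append, List.mem_singleton, Prod.mk.injEq, Letter.pair.injEq, true_and,
        List.cons.injEq, and_true]
      by_cases hab : a' = a ∧ b' = b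
      · obtain ⟨rfl, rfl⟩ := hab
        simpa [hp, hx, hy, hca.2 rfl, hdb.2 rfl] using h₂
      · have hcd : ¬ (c = σ.reg Rx ∧ d = σ.reg Ry) := fun h => hab ⟨hca.1 h.1, hdb.1 h.2⟩
        simp only [hab, and_self, or_false]
        split_ifs at this ⊢ with hm
        · simpa [hp, hx, hy, hcd, hr] using this.append _
        · simpa [hp, hx, hy, hcd, hr] using this
    · rw [← List.append_assoc]
      simpa using h₂

def pairBody : Prog :=
  Ra ≔ .row Amid ♯Rj ⨾
  .ite ((♯Rj).both ((Expr.same (.row Aside ♯Ra) ♯Rs).both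
      (.same (.row Aside (.row Amid (♯Rj - 1))) ♯Rt)))
    ((Rx ≔ ♯Ra ⨾ Ry ≔ .row Amid (♯Rj - 1)) ⨾ lookup ⨾ .put Atext (♯Rk - 1) ♯Rc)
    (.put Atext ♯Rk ♯Ra ⨾ Rk ≔ ♯Rk + 1) ⨾
  Rj ≔ ♯Rj + 1

/-- Replace the pairs. -/
def replacePairs : Prog :=
  (Rj ≔ 0 ⨾ Rk ≔ 0) ⨾ .loop (.op .lt ♯Rj ♯Rm) pairBody

theorem pairProds_cons_cons (k : ℕ) (A B : Finset (Letter ℕ)) (a b : Letter ℕ)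
    (t : List (Letter ℕ)) : pairProds k A B (a :: b :: t) = if a ∈ A ∧ b ∈ B then
      insert (.pair k a b, [a, b]) (pairProds k A B (b :: t)) else pairProds k A B (b :: t) := by
  rw [pairProds, pairs_cons_cons, List.toFinset_cons, Finset.filter_insert]
  split_ifs
  · rw [Finset.image_insert, pairProds]
  · rw [pairProds]

theorem compressPairs_ne_nil (k : ℕ) (A B : Finset (Letter ℕ)) (a : Letter ℕ) (t : List (Letter ℕ)) :
    compressPairs k A B (a :: t) ≠ [] := by
  cases t with
  | nil => simp [compressPairs]
  | cons b t =>
    rw [compressPairs]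
    split_ifs <;> simp

theorem spec_replacePairs {ps : List (Letter ℕ × List (Letter ℕ))} {T : List (Letter ℕ)} {σ : Store}
    {k : ℕ} {A B : Finset (Letter ℕ)} (hO : Out ps σ) (hps : ∀ a b, .pair k a b ∉ heads ps)
    (hT : Stk (σ.row Amid (σ.reg Rp)) (Code ps) T) (hm : σ.reg Rm = T.length)
    (hd : Disjoint A B) (hS : Switched ps A B σ) (h₀ : ∀ z, σ.row Apair (σ.reg Rp) z = 0) :
    Spec replacePairs σ T.length fun τ => ∃ rs, Out (ps ++ rs) τ ∧
      rs.toFinset = pairProds k A B T ∧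
      Stk (τ.row Atext (τ.reg Rp)) (Code (ps ++ rs)) (compressPairs k A B T) ∧
      τ.reg Rk = (compressPairs k A B T).length := by
  refine Spec.init rfl ((Spec.scan (T := T) (i := Rj) (n := Rm) (P := pairBody)
    (fun s τ => ∃ rs, PairTable ps k rs τ ∧ rs.toFinset = pairProds k A B s ∧
      Stk (τ.row Atext (τ.reg Rp)) (Code (ps ++ rs)) (compressPairs k A B s) ∧
      τ.reg Rk = (compressPairs k A B s).length)
    List.length rfl ?_ (by simpa) (by simp) ?_).mono le_rfl
    fun τ ⟨rs, h₁, h₂, h₃, h₄⟩ => ⟨rs, h₁.out, h₂, h₃, h₄⟩)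
  · rintro a s τ hs hf ⟨rs, h, hrs, hst, hk⟩ hj
    refine ⟨0, by simp; omega, ?_⟩
    have hp : τ.reg Rp = σ.reg Rp := by rw [hf.reg Rp rfl]; simp
    have hr : ∀ A, pairBody.setsCell A = false → τ.row A (σ.reg Rp) = σ.row A (σ.reg Rp) :=
      fun A hA => by rw [hf.row_eq hA]; simp
    have hrs' : τ.reg Rs = σ.reg Rs := by rw [hf.reg Rs rfl]; simp
    have hrt : τ.reg Rt = σ.reg Rt := by rw [hf.reg Rt rfl]; simp
    have ha := hT a s hs
    have keep : (∀ b t, s = b :: t → ¬ (a ∈ A ∧ b ∈ B)) → Spec (.put Atext ♯Rk ♯Ra ⨾ Rk ≔ ♯Rk + 1)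
        ((Ra ≔ Expr.row Amid ♯Rj).eval τ) 0 fun ρ =>
        (∃ rs, PairTable ps k rs ρ ∧ rs.toFinset = pairProds k A B (a :: s) ∧
          Stk (ρ.row Atext (ρ.reg Rp)) (Code (ps ++ rs)) (compressPairs k A B (a :: s)) ∧
          ρ.reg Rk = (compressPairs k A B (a :: s)).length) ∧ ρ.reg Rj = s.length := by
      intro hn
      have e₁ : pairProds k A B (a :: s) = pairProds k A B s := by
        cases s with
        | nil => simp [pairProds, pairs]
        | cons b t => rw [pairProds_cons_cons, if_neg (hn b t rfl)]
      have e₂ : compressPairs k A B (a :: s) = a :: compressPairs k A B s := by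
        cases s with
        | nil => rfl
        | cons b t => rw [compressPairs_cons_cons k hd, if_neg (hn b t rfl)]
      rw [e₁, e₂]
      refine Spec.eval rfl ⟨⟨rs, h.congr (by simp) (by simp) (by simp) (by simp) (by simp)
        (by funext z; simp), hrs, (hst.congr fun i hi => ?_).cons ?_, by simp [hk]⟩, by simp [hj]⟩
      · simp [hk, hi.ne]
      · simpa [hk, hp, hj, hr Amid rfl] using ha.append rs
    refine Spec.init rfl ?_
    refine Spec.mono (n := 0 + 0) (Spec.seq (Q := fun ρ =>
      (∃ rs, PairTable ps k rs ρ ∧ rs.toFinset = pairProds k A B (a :: s) ∧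
        Stk (ρ.row Atext (ρ.reg Rp)) (Code (ps ++ rs)) (compressPairs k A B (a :: s)) ∧
        ρ.reg Rk = (compressPairs k A B (a :: s)).length) ∧ ρ.reg Rj = s.length)
      (Spec.ite (fun hv => ?_) fun hv => keep ?_) ?_) le_rfl fun _ h => h
    · cases s with
      | nil => simp [hj] at hv
      | cons b t =>
        have hb := hT b t ((List.suffix_cons a _).trans hs)
        have hSa := (hS a _ ha).1
        have hSb := (hS b _ hb).2
        simp only [List.length_cons] at hj ha hSa
        have hab : a ∈ A ∧ b ∈ B := by
          simpa [hj, hp, hr Amid rfl, hr Aside rfl, hrs', hrt, hSa, hSb, and_comm] using hv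
        rw [compressPairs_cons_cons k hd, if_pos hab, pairProds_cons_cons, if_pos hab]
        -- The compressed rest is not empty, and the letter written last is overwritten by the
        -- letter for the pair.
        obtain ⟨y, u, hu⟩ := List.exists_cons_of_ne_nil (compressPairs_ne_nil k A B b t)
        rw [hu] at hst hk ⊢
        refine Spec.init rfl ?_
        set τ₁ := (Rx ≔ ♯Ra ⨾ Ry ≔ Expr.row Amid (♯Rj - 1)).eval ((Ra ≔ Expr.row Amid ♯Rj).eval τ)
          with hτ₁
        have sp := spec_lookup (σ := τ₁) hps (h.congr (by simp [hτ₁]) (by simp [hτ₁])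
          (by simp [hτ₁]) (by simp [hτ₁]) (by simp [hτ₁]) (by funext z; simp [hτ₁]))
          (a := a) (b := b) (by simpa [hτ₁, hj, hp, hr Amid rfl] using ha)
          (by simpa [hτ₁, hj, hp, hr Amid rfl] using hb)
        refine Spec.mono (n := 0 + 0) (sp.seq ?_) le_rfl fun _ h => h
        rintro ρ ⟨⟨rs', ⟨v, rfl⟩, hfin, htab, hcode⟩, hf'⟩
        have hp' : ρ.reg Rp = τ.reg Rp := by rw [hf'.reg Rp rfl]; simp [hτ₁]
        have hk' : ρ.reg Rk = u.length + 1 := by rw [hf'.reg Rk rfl]; simp [hτ₁, hk]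
        have hj' : ρ.reg Rj = t.length + 1 := by rw [hf'.reg Rj rfl]; simp [hτ₁, hj]
        have hr' : ρ.row Atext (τ.reg Rp) = τ.row Atext (τ.reg Rp) := by
          rw [hf'.row_eq rfl]; simp [hτ₁]
        refine Spec.eval rfl ⟨⟨rs ++ v, htab.congr (by simp) (by simp) (by simp) (by simp) (by simp)
          (by funext z; simp), by rw [hfin, hrs], ((hst.tail.imp
            fun x _ n hn => ?_).congr fun i hi => ?_).cons ?_, by simp [hk']⟩, by simp [hj']⟩
        · rw [← List.append_assoc]
          exact hn.append v
        · simp [hp', hk', hr', hi.ne]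
        · simpa [hp', hk'] using hcode
    · rintro b t rfl hab
      have hb := hT b t ((List.suffix_cons a _).trans hs)
      have hSa := (hS a _ ha).1.2 hab.1
      have hSb := (hS b _ hb).2.2 hab.2
      simp only [List.length_cons] at hj hSa
      simp [hj, hp, hr Amid rfl, hr Aside rfl, hrs', hrt, hSa, hSb] at hv
    · rintro ρ ⟨⟨rs', g₁, g₂, g₃, g₄⟩, g₅⟩
      refine Spec.eval rfl ⟨⟨rs', g₁.congr (by simp) (by simp) (by simp) (by simp) (by simp)
        (by funext z; simp), g₂, by simpa using g₃, by simpa using g₄⟩, by simp [g₅]⟩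
  · refine ⟨[], ⟨by simpa using hO.congr (by simp) (by simp) (by simp) (by simp), by simp,
      fun a b c d _ _ => by simpa using h₀ _⟩, by simp [pairProds, pairs], ?_, ?_⟩
    · simp [compressPairs, Stk.nil]
    · simp [compressPairs]

end Recompression

namespace Recompression

open WordRAM

/-! ### The program: one phase -/

def onePhase : Prog :=
  findBlocks ⨾ markBlocks ⨾ defineBlocks ⨾ writeMid ⨾ listPairs ⨾ greedy ⨾ switch ⨾ replacePairs

/-- Guarantees that a phase preserves the stored texts of earlier phases and the zeros in the rows
of later ones. -/
theorem rowed_onePhase : onePhase.Rowed Rp := by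
  simp [onePhase, findBlocks, findBlocksBody, markBlocks, markBlocksBody, defineBlocks,
    defineBlocksBody, processLetter, eachGap, maxGapBody, powers, powersBody, defineBody, emitDiff,
    bitsBody, emitTwo, emitOne, writeMid, writeMidBody, listPairs, listPairsBody, greedy, greedyBody,
    chooseSide, countBody, switch, switchBody, replacePairs, pairBody, lookup, Prog.Rowed, Prog.put]

/-- The factor is `1 + 1 + 6 + 1 + 1 + 3 + 1 + 1` for the eight passes. Zero rows are required only
of the tables in which `0` has a meaning before anything is written. -/
theorem spec_onePhase {ps : List (Letter ℕ × List (Letter ℕ))} {k : ℕ} {s : State ℕ} {σ : Store}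
    (hO : Out ps σ) (hold : ∀ x ∈ heads ps, x.Old k) (hprods : ps.toFinset = s.prods)
    (hT : Stk (σ.row Atext (σ.reg Rq)) (Code ps) s.text) (hTold : ∀ x ∈ s.text, x.Old k)
    (hn : σ.reg Rn = s.text.length)
    (h₀ : ∀ A ∈ [Apres, Amax, Adeg, Aside, Apair], ∀ z, σ.row A (σ.reg Rp) z = 0) :
    Spec onePhase σ (15 * s.text.length) fun τ => (∃ L,
      IsLetterList (compressBlocks k s.text) L ∧ ∃ qs, Out (ps ++ qs) τ ∧
      (∀ x ∈ heads (ps ++ qs), x.Old (k + 1)) ∧ (ps ++ qs).toFinset = (phase k L s).prods ∧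
      Stk (τ.row Atext (τ.reg Rp)) (Code (ps ++ qs)) (phase k L s).text ∧
      τ.reg Rk = (phase k L s).text.length) ∧ Frame onePhase σ τ := by
  refine Spec.frame ?_
  set T := s.text with hTs
  set T₁ := compressBlocks k T with hT₁
  have hlen : T₁.length ≤ T.length := length_compressBlocks_le k T
  have hlen' : (maximalBlocks T).length = T₁.length := by simp [hT₁, compressBlocks]
  have hne := ne_of_mem_pairs_compressBlocks hTold
  refine Spec.mono (n := T.length + (T.length + (6 * T.length + (T.length + (T.length +
    (3 * T.length + (T.length + T.length))))))) ?_ (by omega) fun _ h => h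
  refine (spec_findBlocks hT hn).frame.seq fun σ₁ ⟨⟨hm, hB⟩, f₁⟩ => ?_
  have p₁ : σ₁.reg Rp = σ.reg Rp := f₁.reg Rp rfl
  refine ((spec_markBlocks hB hm (fun z => ?_) (fun z => ?_)).frame.mono (by omega)
    fun _ h => h).seq fun σ₂ ⟨hM, f₂⟩ => ?_
  · rw [p₁, f₁.row_eq rfl]; exact h₀ _ (by simp) z
  · rw [p₁, f₁.row_eq rfl]; exact h₀ _ (by simp) z
  have p₂ : σ₂.reg Rp = σ.reg Rp := (f₂.reg Rp rfl).trans p₁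
  have hO₂ : Out ps σ₂ := (hO.frame f₁ rfl rfl rfl rfl).frame f₂ rfl rfl rfl rfl
  have hB₂ : BlockStk ps (maximalBlocks T) σ₂ := by
    unfold BlockStk at hB ⊢
    rwa [p₂, ← p₁, f₂.row_eq rfl, f₂.row_eq rfl]
  have m₂ : σ₂.reg Rm = (maximalBlocks T).length := (f₂.reg Rm rfl).trans hm
  refine (spec_defineBlocks hO₂ hold hB₂ m₂ hM).frame.seq
    fun σ₃ ⟨⟨qs, hO₃, hq₁, hq₂, hq₃⟩, f₃⟩ => ?_
  have p₃ : σ₃.reg Rp = σ.reg Rp := (f₃.reg Rp rfl).trans p₂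
  have hB₃ : BlockStk ps (maximalBlocks T) σ₃ := by
    unfold BlockStk at hB₂ ⊢
    rwa [p₃, ← p₂, f₃.row_eq rfl, f₃.row_eq rfl]
  have m₃ : σ₃.reg Rm = (maximalBlocks T).length := (f₃.reg Rm rfl).trans m₂
  refine (spec_writeMid hB₃ m₃ hq₃).frame.seq fun σ₄ ⟨hT₄, f₄⟩ => ?_
  have p₄ : σ₄.reg Rp = σ.reg Rp := (f₄.reg Rp rfl).trans p₃
  have m₄ : σ₄.reg Rm = T₁.length := ((f₄.reg Rm rfl).trans m₃).trans hlen'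
  refine ((spec_listPairs hT₄ m₄ hne fun z => ?_).frame.mono hlen fun _ h => h).seq
    fun σ₅ ⟨hL, f₅⟩ => ?_
  · rw [p₄, f₄.row_eq rfl, f₃.row_eq rfl, f₂.row_eq rfl, f₁.row_eq rfl]; exact h₀ _ (by simp) z
  have p₅ : σ₅.reg Rp = σ.reg Rp := (f₅.reg Rp rfl).trans p₄
  have m₅ : σ₅.reg Rm = T₁.length := (f₅.reg Rm rfl).trans m₄
  have hT₅ : Stk (σ₅.row Amid (σ₅.reg Rp)) (Code (ps ++ qs)) T₁ := by
    rwa [p₅, ← p₄, f₅.row_eq rfl]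
  refine ((spec_greedy hT₅ m₅ hne hL fun z => ?_).frame.mono (by omega) fun _ h => h).seq
    fun σ₆ ⟨⟨L, hLL, hS⟩, f₆⟩ => ?_
  · rw [p₅, f₅.row_eq rfl, f₄.row_eq rfl, f₃.row_eq rfl, f₂.row_eq rfl, f₁.row_eq rfl]
    exact h₀ _ (by simp) z
  have p₆ : σ₆.reg Rp = σ.reg Rp := (f₆.reg Rp rfl).trans p₅
  have m₆ : σ₆.reg Rm = T₁.length := (f₆.reg Rm rfl).trans m₅
  have hT₆ : Stk (σ₆.row Amid (σ₆.reg Rp)) (Code (ps ++ qs)) T₁ := by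
    rwa [p₆, ← p₅, f₆.row_eq rfl]
  refine ((spec_switch hT₆ m₆ hS (disjoint_greedyLoop _ _ _ hLL.1 (by simp) (by simp))).frame.mono
    hlen fun _ h => h).seq fun σ₇ ⟨hW, f₇⟩ => ?_
  have p₇ : σ₇.reg Rp = σ.reg Rp := (f₇.reg Rp rfl).trans p₆
  have m₇ : σ₇.reg Rm = T₁.length := (f₇.reg Rm rfl).trans m₆
  have hT₇ : Stk (σ₇.row Amid (σ₇.reg Rp)) (Code (ps ++ qs)) T₁ := by
    rwa [p₇, ← p₆, f₇.row_eq rfl]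
  have hO₇ : Out (ps ++ qs) σ₇ := (((hO₃.frame f₄ rfl rfl rfl rfl).frame f₅ rfl rfl rfl rfl).frame f₆
    rfl rfl rfl rfl).frame f₇ rfl rfl rfl rfl
  refine (spec_replacePairs (k := k) (A := (greedyPairs T₁ L).1) (B := (greedyPairs T₁ L).2) hO₇ ?_
    hT₇ m₇ (disjoint_greedyPairs hLL.1) hW fun z => ?_).mono hlen fun τ ⟨rs, g₁, g₂, g₃, g₄⟩ => ?_
  · intro a b hab
    rw [heads_append, List.mem_append] at hab
    rcases hab with h | h
    · have := hold _ h
      simp [Letter.Old] at this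
    · obtain ⟨a', ⟨i, h⟩ | ⟨i, j, h⟩ | ⟨l, h⟩⟩ := hq₂ _ h <;> simp at h
  · rw [p₇, f₇.row_eq rfl, f₆.row_eq rfl, f₅.row_eq rfl, f₄.row_eq rfl, f₃.row_eq rfl,
      f₂.row_eq rfl, f₁.row_eq rfl]
    exact h₀ _ (by simp) z
  refine ⟨L, hLL, qs ++ rs, ?_, ?_, ?_, ?_, g₄⟩
  · rwa [← List.append_assoc]
  · intro x hx
    rw [heads_append, heads_append, List.mem_append, List.mem_append] at hx
    rcases hx with h | h | h
    · exact (hold x h).succ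
    · obtain ⟨a, ⟨i, h⟩ | ⟨i, j, h⟩ | ⟨l, h⟩⟩ := hq₂ _ h <;> simp [h, Letter.Old]
    · obtain ⟨q, hq, rfl⟩ := List.mem_map.1 h
      rw [← List.mem_toFinset, g₂, pairProds, Finset.mem_image] at hq
      obtain ⟨r, -, rfl⟩ := hq
      simp [Letter.Old]
  · rw [List.toFinset_append, List.toFinset_append, g₂, hq₁, hprods, ← Finset.union_assoc]
    rfl
  · rw [← List.append_assoc]
    exact g₃

end Recompression

namespace Recompression

open WordRAM

/-! ### The program: all phases -/

/-- The first `k` phases of a run. -/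
def IsPartialRun (w : List ℕ) (k : ℕ) (s : ℕ → State ℕ) : Prop :=
  s 0 = ⟨w.map .input, ∅⟩ ∧ ∀ i < k, 1 < (s i).text.length ∧
    ∃ L, IsLetterList (compressBlocks i (s i).text) L ∧ s (i + 1) = phase i L (s i)

/-- The input is stored from its last letter on. Letters are doubled because odd numbers are
reserved for nonterminals. -/
def startBody : Prog :=
  .put Atext ♯Rj (.op .mul 2 (.cell 0 (♯0 - (♯Rj + 1)))) ⨾ Rj ≔ ♯Rj + 1

/-- Store the input in row `0` of the texts. -/
def start : Prog :=
  .loop (.op .lt ♯Rj ♯0) startBody ⨾ Rn ≔ ♯0 ⨾ Rid ≔ 3 ⨾ Rout ≔ 2 ⨾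
  RbestLen ≔ ♯0 ⨾ RbestOut ≔ 2 ⨾ RbestId ≔ 3

def phases : Prog :=
  .loop (.less 1 ♯Rn) ((Rq ≔ ♯Rp ⨾ Rp ≔ ♯Rp + 1) ⨾ onePhase ⨾ Rn ≔ ♯Rk ⨾
    .ite (.less (♯Rcost + ♯Rn) (♯RbestCost + ♯RbestLen))
      (Rbest ≔ ♯Rp ⨾ RbestLen ≔ ♯Rn ⨾ RbestOut ≔ ♯Rout ⨾ RbestId ≔ ♯Rid ⨾ RbestCost ≔ ♯Rcost) .skip)

/-- The situation after `k` phases. -/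
structure Reached (w : List ℕ) (k : ℕ) (s : ℕ → State ℕ) (ps : List (Letter ℕ × List (Letter ℕ)))
    (σ : Store) : Prop where
  run : IsPartialRun w k s
  prods : ps.toFinset = (s k).prods
  out : Out ps σ
  old : ∀ x ∈ heads ps, x.Old k
  oldText : ∀ x ∈ (s k).text, x.Old k
  text : Stk (σ.row Atext k) (Code ps) (s k).text
  phase : σ.reg Rp = k
  length : σ.reg Rn = (s k).text.length
  fresh : ∀ A ∈ [Apres, Amax, Adeg, Aside, Apair], ∀ q, k < q → ∀ z, σ.row A q z = 0

/-- The situation that is recorded as the best one. -/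
structure Recorded (k : ℕ) (s : ℕ → State ℕ) (ps : List (Letter ℕ × List (Letter ℕ))) (b : ℕ)
    (qs : List (Letter ℕ × List (Letter ℕ))) (σ : Store) : Prop where
  le : b ≤ k
  min : ∀ j ≤ k, (s b).size ≤ (s j).size
  isPrefix : qs <+: ps
  prods : qs.toFinset = (s b).prods
  closed : ∀ q ∈ qs, ∀ x ∈ q.2, Known qs x
  text : Stk (σ.row Atext b) (Code qs) (s b).text
  best : σ.reg Rbest = b
  length : σ.reg RbestLen = (s b).text.length
  out : σ.reg RbestOut = 2 + (flat qs).length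
  id : σ.reg RbestId = 2 * qs.length + 3
  cost : σ.reg RbestCost + σ.reg RbestLen = (s b).size

theorem Out.size {ps : List (Letter ℕ × List (Letter ℕ))} {σ : Store} (h : Out ps σ) {s : State ℕ}
    (hs : ps.toFinset = s.prods) : s.size = σ.reg Rcost + s.text.length := by
  rw [State.size, ← hs, List.sum_toFinset _ (List.Nodup.of_map _ h.nodup), h.cost, Nat.add_comm]

theorem spec_start (w : List ℕ) :
    Spec start (Store.init w) w.length fun τ =>
      Reached w 0 (fun _ => ⟨w.map .input, ∅⟩) [] τ ∧
      Recorded 0 (fun _ => ⟨w.map .input, ∅⟩) [] 0 [] τ := by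
  have main := Spec.scan (T := w.map Letter.input) (i := Rj) (n := 0) (P := startBody)
    (σ₀ := Store.init w) (fun s τ => τ.reg Rp = 0 ∧ Stk (τ.row Atext 0) (Code []) s)
    List.length rfl ?_ (by simp [Store.init]) (by simp [Store.init])
    ⟨by simp [Store.init], Stk.nil⟩
  · refine Spec.mono (n := (w.map Letter.input).length + 0) (main.frame.seq ?_) (by simp)
      fun _ h => h
    rintro τ ⟨⟨hp, hT⟩, hf⟩
    have hr : ∀ x, Prog.setsReg (.loop (.op .lt ♯Rj ♯0) startBody) x = false →
        τ.reg x = if x = 0 then w.length else 0 := fun x hx => by rw [hf.reg x hx]; rfl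
    refine Spec.eval rfl ⟨⟨⟨rfl, by simp⟩, rfl, ⟨by simp [heads], by simp [heads], by simp,
      by simp [flat, Holds.nil], by simp, by simp [flat], by simp [hr Rcost rfl]⟩, by simp [heads],
      by simp [Letter.Old], by simpa using hT, by simp [hp], by simp [hr 0 rfl], ?_⟩,
      ⟨le_rfl, by simp, List.prefix_rfl, rfl, by simp, by simpa using hT, by simp [hr Rbest rfl],
      by simp [hr 0 rfl], by simp [flat], by simp, by simp [State.size, hr RbestCost rfl, hr 0 rfl]⟩⟩
    intro A hA q _ z
    have hA' : τ.cell A = (Store.init w).cell A := hf.cell A (by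
      simp only [List.mem_cons, List.not_mem_nil, or_false] at hA
      rcases hA with rfl | rfl | rfl | rfl | rfl <;> rfl)
    have h0 : A ≠ 0 := by rintro rfl; simp at hA
    simp [Store.row, hA', Store.init, h0]
  · rintro a s τ hs hf ⟨hp, hT⟩ hj
    have h0 : τ.reg 0 = w.length := by rw [hf.reg 0 rfl]; rfl
    have hc : τ.cell 0 = (Store.init w).cell 0 := hf.cell 0 rfl
    obtain ⟨u, hu⟩ := hs
    obtain ⟨v, b, t, rfl, hv, rfl, rfl⟩ : ∃ v b t, w = v ++ b :: t ∧ v.map .input = u ∧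
        Letter.input b = a ∧ t.map .input = s := by
      obtain ⟨v, r, rfl, h₁, h₂⟩ := List.map_eq_append_iff.1 hu.symm
      obtain ⟨b, t, rfl, h₃, h₄⟩ := List.map_eq_cons_iff.1 h₂
      exact ⟨v, b, t, rfl, h₁, h₃, h₄⟩
    refine ⟨0, by simp; omega, Spec.eval rfl ⟨⟨by simp [startBody, hp],
      (hT.congr fun i hi => ?_).cons ?_⟩, by simp [startBody, hj]⟩⟩
    · rw [List.length_map] at hi
      simp [startBody, hp, hj, hi.ne]
    · simp only [List.length_map] at hj
      have : v.length + (t.length + 1) - (t.length + 1) = v.length := by omega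
      simp [startBody, hp, hj, h0, hc, Store.init, this]
      exact ⟨.inl ⟨_, rfl⟩, rfl⟩

/-- A phase reduces length minus one by at least a quarter, so the potential drops by at least `31 *
(n - 1)`, which is at least `15 * n + 1` for `n ≥ 2`, with equality at `n = 2`. -/
theorem spec_phases {w : List ℕ} {s₀ : ℕ → State ℕ} {ps₀ : List (Letter ℕ × List (Letter ℕ))}
    {σ : Store} {b₀ : ℕ} {qs₀ : List (Letter ℕ × List (Letter ℕ))} (h₀ : Reached w 0 s₀ ps₀ σ)
    (h₁ : Recorded 0 s₀ ps₀ b₀ qs₀ σ) :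
    Spec phases σ (124 * (σ.reg Rn - 1)) fun τ => ∃ k s ps b qs, Reached w k s ps τ ∧
      Recorded k s ps b qs τ ∧ (s k).text.length ≤ 1 := by
  refine (Spec.loop (γ := ℕ) (fun n τ => n = τ.reg Rn ∧ ∃ k s ps b qs, Reached w k s ps τ ∧
      Recorded k s ps b qs τ) (fun n => 124 * (n - 1)) ?_ ⟨rfl, 0, s₀, ps₀, b₀, qs₀, h₀, h₁⟩).mono
      le_rfl ?_
  · rintro _ τ - ⟨rfl, k, s, ps, b, qs, h, hb⟩ hv
    have hlen : 1 < (s k).text.length := by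
      by_contra hc
      simp [h.length] at hv
      omega
    set τ₁ := (Rq ≔ ♯Rp ⨾ Rp ≔ ♯Rp + 1).eval τ with hτ₁
    have p₁ : τ₁.reg Rp = k + 1 := by simp [hτ₁, h.phase]
    have sp := spec_onePhase (σ := τ₁) (k := k) (s := s k)
      (h.out.congr (by simp [hτ₁]) (by simp [hτ₁]) (by simp [hτ₁]) (by simp [hτ₁])) h.old h.prods
      (by simpa [hτ₁, h.phase] using h.text) h.oldText (by simpa [hτ₁] using h.length)
      (fun A hA z => by rw [p₁]; simpa [hτ₁] using h.fresh A hA (k + 1) (by omega) z)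
    refine ⟨15 * (s k).text.length + 0, Spec.init rfl (sp.seq ?_)⟩
    rintro τ₂ ⟨⟨L, hL, rs, hO, hold, hprods, htext, hk⟩, hf⟩
    have p₂ : τ₂.reg Rp = k + 1 := (hf.reg Rp rfl).trans p₁
    have hrow : ∀ A ≠ 1, ∀ q ≠ k + 1, τ₂.row A q = τ.row A q := by
      intro A hA q hq
      funext z
      have := (hf.row Rp rowed_onePhase).2 A hA q (by rwa [p₁]) z
      simpa [Store.row, hτ₁] using this
    have hreg : ∀ x, onePhase.setsReg x = false → x ≠ Rp → x ≠ Rq → τ₂.reg x = τ.reg x := by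
      intro x hx h₁ h₂
      rw [hf.reg x hx]; simp [hτ₁, h₁, h₂]
    rw [p₂] at htext
    -- The loop invariant keeps the run so far as a function of the index, and each iteration
    -- defines one more value of it.
    set s' := Function.update s (k + 1) (Recompression.phase k L (s k)) with hs'
    have e₁ : s' (k + 1) = Recompression.phase k L (s k) := by simp [hs']
    have e₂ : ∀ j ≤ k, s' j = s j := fun j hj => by simp [hs', show j ≠ k + 1 by omega]
    have hrun : IsPartialRun w (k + 1) s' := by
      refine ⟨(e₂ 0 (by omega)).trans h.run.1, fun i hi => ?_⟩
      rcases Nat.lt_succ_iff_lt_or_eq.1 hi with hi | rfl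
      · rw [e₂ i (by omega), e₂ (i + 1) (by omega)]
        exact h.run.2 i hi
      · rw [e₂ i le_rfl, e₁]
        exact ⟨hlen, L, hL, rfl⟩
    have hl' := length_phase h.oldText hL
    set U := Prog.ite (.less (♯Rcost + ♯Rn) (♯RbestCost + ♯RbestLen))
      (Rbest ≔ ♯Rp ⨾ RbestLen ≔ ♯Rn ⨾ RbestOut ≔ ♯Rout ⨾ RbestId ≔ ♯Rid ⨾ RbestCost ≔ ♯Rcost) .skip
      with hU
    set τ₃ := (Rn ≔ ♯Rk).eval τ₂ with hτ₃
    have hReached : Reached w (k + 1) s' (ps ++ rs) τ₃ := by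
      refine ⟨hrun, by rw [e₁, hprods], hO.congr (by simp [hτ₃]) (by simp [hτ₃]) (by simp [hτ₃])
        (by simp [hτ₃]), hold, ?_, by rw [e₁]; simpa [hτ₃] using htext, by simp [hτ₃, p₂],
        by rw [e₁]; simp [hτ₃, hk], fun A hA q hq z => ?_⟩
      · rw [e₁]
        exact old_phase L h.oldText
      · have hA1 : A ≠ 1 := by rintro rfl; simp at hA
        simpa [hτ₃, hrow A hA1 q (by omega)] using h.fresh A hA q (by omega) z
    have hsize := hReached.out.size hReached.prods
    have hbsize : τ₃.reg RbestCost + τ₃.reg RbestLen = (s' b).size := by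
      rw [e₂ b hb.le, ← hb.cost]
      simp [hτ₃, hreg RbestCost rfl, hreg RbestLen rfl]
    rw [← hReached.length] at hsize
    refine Spec.init rfl (Spec.eval rfl ⟨(Recompression.phase k L (s k)).text.length, ⟨?_, k + 1, s',
      ps ++ rs, ?_⟩, ?_⟩)
    · rw [← hk]
      simp [hU]
    · by_cases hc : (s' (k + 1)).size < (s' b).size
      · have hval : (Expr.less (♯Rcost + ♯Rn) (♯RbestCost + ♯RbestLen)).val τ₃ ≠ 0 := by
          rw [hsize, ← hbsize] at hc
          simp [hc]
        have hev : U.eval τ₃ = (Rbest ≔ ♯Rp ⨾ RbestLen ≔ ♯Rn ⨾ RbestOut ≔ ♯Rout ⨾ RbestId ≔ ♯Rid ⨾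
            RbestCost ≔ ♯Rcost).eval τ₃ := if_pos hval
        rw [hev]
        refine ⟨k + 1, ps ++ rs, ⟨hReached.run, hReached.prods, hReached.out.congr (by simp) (by simp)
          (by simp) (by simp), hReached.old, hReached.oldText, by simpa using hReached.text,
          by simpa using hReached.phase, by simpa using hReached.length,
          fun A hA q hq z => by simpa using hReached.fresh A hA q hq z⟩,
          ⟨le_rfl, fun j hj => ?_, List.prefix_rfl, hReached.prods, hReached.out.closed,
          by simpa using hReached.text, by simpa using hReached.phase, by simpa using hReached.length,
          by simpa using hReached.out.out, by simpa using hReached.out.id, ?_⟩⟩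
        · rcases Nat.le_succ_iff.1 hj with hj | rfl
          · have := hb.min j hj
            rw [e₂ b hb.le] at hc
            rw [e₂ j hj]
            omega
          · exact le_rfl
        · rw [hsize]; simp
      · have hval : (Expr.less (♯Rcost + ♯Rn) (♯RbestCost + ♯RbestLen)).val τ₃ = 0 := by
          rw [hsize, ← hbsize] at hc
          simp [hc]
        have hev : U.eval τ₃ = τ₃ := if_neg (by simp [hval])
        rw [hev]
        refine ⟨b, qs, hReached, ⟨hb.le.trans (by omega), fun j hj => ?_,
          hb.isPrefix.trans (List.prefix_append _ _), by rw [e₂ b hb.le, hb.prods], hb.closed, ?_,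
          ?_, ?_, ?_, ?_, hbsize⟩⟩
        · rcases Nat.le_succ_iff.1 hj with hj | rfl
          · rw [e₂ b hb.le, e₂ j hj]
            exact hb.min j hj
          · exact not_lt.1 hc
        · rw [e₂ b hb.le]
          have := hb.le
          simpa [hτ₃, hrow Atext (by simp) b (by omega)] using hb.text
        · simpa [hτ₃, hreg Rbest rfl] using hb.best
        · rw [e₂ b hb.le]
          simpa [hτ₃, hreg RbestLen rfl] using hb.length
        · simpa [hτ₃, hreg RbestOut rfl] using hb.out
        · simpa [hτ₃, hreg RbestId rfl] using hb.id
    · rw [h.length]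
      omega
  · rintro τ ⟨_, ⟨-, k, s, ps, b, qs, h, hb⟩, hv⟩
    refine ⟨k, s, ps, b, qs, h, hb, ?_⟩
    simp [h.length] at hv
    exact hv

end Recompression

namespace Recompression

open WordRAM

/-! ### The program: the output -/

theorem flat_append {qs : List (Letter ℕ × List (Letter ℕ))}
    (h : ∀ q ∈ qs, ∀ x ∈ q.2, Known qs x) (v : List (Letter ℕ × List (Letter ℕ))) :
    ∃ r, flat (qs ++ v) = flat qs ++ r := by
  refine ⟨_, (List.flatMap_append ..).trans (congrArg (· ++ _) (List.flatMap_congr fun q hq => ?_))⟩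
  have h₁ : q.1 ∈ heads qs := List.mem_map.2 ⟨q, hq, rfl⟩
  have h₂ : q.2.map (enc (heads (qs ++ v))) = q.2.map (enc (heads qs)) :=
    List.map_congr_left fun x hx => enc_append (h q hq x hx)
  rw [h₂, heads_append, List.idxOf_append_of_mem h₁]

/-- The listing of the grammar of a state. -/
def listing (qs : List (Letter ℕ × List (Letter ℕ))) (T : List (Letter ℕ)) : List ℕ :=
  0 :: (qs.length + 1) :: (flat qs ++ 0 :: T.length :: T.map (enc (heads qs)))

theorem encodes_listing {qs : List (Letter ℕ × List (Letter ℕ))} {s : State ℕ}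
    (hs : qs.toFinset = s.prods) (hnd : (heads qs).Nodup)
    (hni : ∀ x ∈ heads qs, ∀ a, x ≠ .input a) (hcl : ∀ q ∈ qs, ∀ x ∈ q.2, Known qs x)
    (hT : ∀ x ∈ s.text, Known qs x) : Encodes (listing qs s.text) s.grammar := by
  set ν : Option (Letter ℕ) → ℕ := fun X => X.elim 0 fun x => (heads qs).idxOf x + 1 with hν
  have henc : ∀ T : List (Letter ℕ), (T.map Letter.toSymbol).map (encodeSymbol ν) =
      T.map (enc (heads qs)) := by
    intro T
    rw [List.map_map]
    exact List.map_congr_left fun x _ => by cases x <;> rfl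
  have hmem : ∀ T : List (Letter ℕ), (∀ x ∈ T, Known qs x) → ∀ X,
      Symbol.nonterminal X ∈ T.map Letter.toSymbol → ∃ x ∈ heads qs, X = some x := by
    intro T hT X hX
    obtain ⟨x, hx, hx'⟩ := List.mem_map.1 hX
    rcases hT x hx with ⟨a, rfl⟩ | h
    · simp [Letter.toSymbol] at hx'
    · refine ⟨x, h, ?_⟩
      cases x with
      | input a => exact absurd rfl (hni _ h a)
      | _ => exact (Symbol.nonterminal.inj hx').symm
  set rs : List (ContextFreeRule ℕ (Option (Letter ℕ))) :=
    qs.map (fun q => ⟨some q.1, q.2.map Letter.toSymbol⟩) ++ [⟨none, s.text.map Letter.toSymbol⟩]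
    with hrs
  have hrules : ∀ r : ContextFreeRule ℕ (Option (Letter ℕ)), r ∈ rs ↔
      r ∈ (s.grammar.rules : Finset (ContextFreeRule ℕ (Option (Letter ℕ)))) := by
    intro r
    rw [mem_rules_grammar, hrs, List.mem_append, List.mem_map, List.mem_singleton, ← hs, or_comm]
    simp only [List.mem_toFinset, eq_comm]
  have key : ∀ X : Option (Letter ℕ), (X = none ∨
      ∃ r ∈ rs, X = r.input ∨ .nonterminal X ∈ r.output) → X = none ∨ ∃ x ∈ heads qs, X = some x := by
    rintro X (rfl | ⟨r, hr, hX⟩)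
    · exact .inl rfl
    · rw [hrs, List.mem_append, List.mem_map, List.mem_singleton] at hr
      rcases hr with ⟨q, hq, rfl⟩ | rfl
      · rcases hX with rfl | hX
        · exact .inr ⟨q.1, List.mem_map.2 ⟨q, hq, rfl⟩, rfl⟩
        · exact .inr (hmem _ (hcl q hq) X hX)
      · rcases hX with rfl | hX
        · exact .inl rfl
        · exact .inr (hmem _ hT X hX)
  have hnodup : rs.Nodup := by
    refine List.Nodup.of_map ContextFreeRule.input ?_
    rw [hrs, List.map_append, List.map_map]
    refine List.nodup_append.2 ⟨?_, by simp, by rintro _ h _ h' rfl; simp_all⟩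
    have := hnd.map (Option.some_injective _)
    rwa [heads, List.map_map] at this
  have hlist : listing qs s.text = 0 :: rs.length :: rs.flatMap (encodeRule ν) := by
    rw [listing, hrs, List.length_append, List.length_map, List.flatMap_append]
    refine congrArg (0 :: _ :: ·) (congrArg₂ _ ?_ ?_)
    · rw [flat, List.flatMap_map]
      refine List.flatMap_congr fun q _ => ?_
      rw [encodeRule, henc, List.length_map]
      rfl
    · rw [List.flatMap_singleton, encodeRule, henc, List.length_map]
      rfl
  refine ⟨ν, rs, fun X hX Y hY hXY => ?_, hnodup, hrules, hlist⟩
  rcases key X (hX.imp id fun ⟨r, hr, h⟩ => ⟨r, (hrules r).2 hr, h⟩) with rfl | ⟨x, hx, rfl⟩ <;>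
    rcases key Y (hY.imp id fun ⟨r, hr, h⟩ => ⟨r, (hrules r).2 hr, h⟩) with rfl | ⟨y, hy, rfl⟩
  · rfl
  · simp [hν] at hXY
  · simp [hν] at hXY
  · simp only [hν, Option.elim_some, Nat.add_right_cancel_iff] at hXY
    rw [(List.idxOf_inj hx).1 hXY]

/-- The text is stored from right to left, hence the falling address. -/
def finishBody : Prog :=
  .write 1 (♯RbestOut + (1 + (♯RbestLen - ♯Rj))) (.cell Atext (.key ♯Rbest ♯Rj)) ⨾ Rj ≔ ♯Rj + 1

/-- Write the production of the start symbol and the beginning of the output. -/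
def finish : Prog :=
  (.write 1 ♯RbestOut 0 ⨾ .write 1 (♯RbestOut + 1) ♯RbestLen ⨾ Rj ≔ 0) ⨾
  .loop (.op .lt ♯Rj ♯RbestLen) finishBody ⨾ .write 1 0 0 ⨾ .write 1 1 (♯RbestId / 2)

/-- The productions of the best state are a prefix of the list, and numbers do not change, so their
listing is a prefix of the output array. The start production is written directly behind it, over
any later productions. -/
theorem spec_finish {k b : ℕ} {s : ℕ → State ℕ} {ps qs : List (Letter ℕ × List (Letter ℕ))}
    {σ : Store} (h : Out ps σ) (hb : Recorded k s ps b qs σ) :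
    Spec finish σ (s b).text.length fun τ => τ.Outputs (listing qs (s b).text) := by
  obtain ⟨v, rfl⟩ := hb.isPrefix
  obtain ⟨r, hr⟩ := flat_append hb.closed v
  have hq : Holds (σ.cell 1) 2 (flat qs) := (hr ▸ h.holds).left
  set o := σ.reg RbestOut with ho
  have hout : o = 2 + (flat qs).length := hb.out
  set l := (s b).text.length with hl
  have hlen : σ.reg RbestLen = l := hb.length
  refine Spec.init rfl ?_
  set σ₁ := (Prog.write 1 ♯RbestOut 0 ⨾ .write 1 (♯RbestOut + 1) ♯RbestLen ⨾ Rj ≔ 0).eval σ with hσ₁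
  have main := Spec.scan (T := (s b).text) (i := Rj) (n := RbestLen) (P := finishBody) (σ₀ := σ₁)
    (fun t τ => t.length ≤ l ∧ (∀ i < o + 2, τ.cell 1 i = σ₁.cell 1 i) ∧
      Holds (τ.cell 1) (o + 2 + (l - t.length)) (t.map (enc (heads qs))))
    List.length rfl ?_ (by simpa [hσ₁] using hlen) (by simp [hσ₁]) ⟨by simp, by simp, Holds.nil⟩
  · refine Spec.mono (n := l + 0) (main.frame.seq ?_) le_rfl fun _ h => h
    rintro τ ⟨⟨-, h₁, h₂⟩, hf⟩
    rw [← hl, Nat.sub_self, Nat.add_zero] at h₂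
    have hid : τ.reg RbestId / 2 = qs.length + 1 := by
      rw [hf.reg RbestId rfl, show σ₁.reg RbestId = σ.reg RbestId by simp [hσ₁], hb.id]
      omega
    refine Spec.eval rfl ?_
    set τ₁ := (Prog.write 1 0 0 ⨾ .write 1 1 (♯RbestId / 2)).eval τ with hτ₁
    have hge : ∀ i, 2 ≤ i → τ₁.cell 1 i = τ.cell 1 i := fun i hi => by
      simp [hτ₁, show i ≠ 0 by omega, show i ≠ 1 by omega]
    have : Holds (τ₁.cell 1) 0 (listing qs (s b).text) := by
      refine .cons (by simp [hτ₁]) (.cons (by simp [hτ₁, hid]) (.append ?_ ?_))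
      · refine hq.congr fun i h₃ h₄ => ?_
        rw [hge i h₃, h₁ i (by omega)]
        simp [hσ₁, ← ho, show i ≠ o by omega, show i ≠ o + 1 by omega]
      · rw [show 0 + 1 + 1 + (flat qs).length = o by omega]
        refine .cons ?_ (.cons ?_ (h₂.congr fun i h₃ _ => hge i (by omega)))
        · rw [hge _ (by omega), h₁ _ (by omega)]
          simp [hσ₁, ← ho]
        · rw [hge _ (by omega), h₁ _ (by omega)]
          simp [hσ₁, ← ho, hlen, hl]
    intro i hi
    simpa using this i hi
  · rintro a t τ ht hf ⟨-, h₁, h₂⟩ hj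
    have htl : t.length + 1 ≤ l := by simpa using ht.length_le
    refine ⟨0, by simp; omega, Spec.eval rfl ⟨⟨by simpa using htl, fun i hi => ?_, ?_⟩,
      by simp [finishBody, hj]⟩⟩
    all_goals
      have e₁ : τ.reg RbestOut = o := by rw [hf.reg RbestOut rfl]; simp [hσ₁, ho]
      have e₂ : τ.reg RbestLen = l := by rw [hf.reg RbestLen rfl]; simpa [hσ₁] using hlen
      have e₃ : τ.reg Rbest = b := by rw [hf.reg Rbest rfl]; simpa [hσ₁] using hb.best
      have e₄ : τ.cell Atext = σ.cell Atext := by rw [hf.cell Atext rfl]; simp [hσ₁]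
      have e₅ : o + (1 + (l - t.length)) = o + 2 + (l - (t.length + 1)) := by omega
    · have : i ≠ o + 2 + (l - (t.length + 1)) := by omega
      simp [finishBody, e₁, e₂, hj, e₅, this, h₁ i hi]
    · have ha := (hb.text a t ht).2
      rw [List.map_cons, List.length_cons]
      refine .cons ?_ ?_
      · rw [ha]
        simp [finishBody, e₁, e₂, hj, e₅, e₃, e₄, Store.row]
      · rw [show o + 2 + (l - (t.length + 1)) + 1 = o + 2 + (l - t.length) by omega]
        refine h₂.congr fun i hi _ => ?_
        have : i ≠ o + 2 + (l - (t.length + 1)) := by omega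
        simp [finishBody, e₁, e₂, hj, e₅, this]

/-- The program. -/
def recompress : Prog := start ⨾ phases ⨾ finish

theorem spec_recompress (w : List ℕ) :
    Spec recompress (Store.init w) (126 * w.length) fun τ => ∃ (out : List ℕ)
      (G : ContextFreeGrammar ℕ), τ.Outputs out ∧ Encodes out G ∧ IsOutput w G := by
  refine Spec.mono (n := w.length + (124 * w.length + w.length)) ((spec_start w).seq fun σ h => ?_)
    (by omega) fun _ h => h
  obtain ⟨h₁, h₂⟩ := h
  have hn : σ.reg Rn = w.length := by rw [h₁.length]; simp
  refine ((spec_phases h₁ h₂).mono (by rw [hn]; omega) fun _ h => h).seq ?_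
  rintro τ ⟨k, s, ps, b, qs, hr, hb, hk⟩
  have hle : ∀ j ≤ k, (s j).text.length ≤ w.length := by
    intro j hj
    induction j with
    | zero => simp [hr.run.1]
    | succ j ih =>
      have := IsRun.length_succ ⟨hr.run.1, hr.run.2, hk⟩ (i := j) (by omega)
      have := (hr.run.2 j (by omega)).1
      have := ih (by omega)
      omega
  refine (spec_finish hr.out hb).mono (hle b hb.le) fun ρ h => ⟨_, _, h, encodes_listing hb.prods ?_ ?_
    hb.closed ?_, k, s, ⟨hr.run.1, hr.run.2, hk⟩, b, hb.le, rfl, hb.min⟩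
  · exact hr.out.nodup.sublist (hb.isPrefix.sublist.map _)
  · exact fun x hx => hr.out.ne_input x ((hb.isPrefix.sublist.map _).subset hx)
  · intro x hx
    obtain ⟨u, t, hut⟩ := List.append_of_mem hx
    exact (hb.text x t ⟨u, hut.symm⟩).1

theorem tame_recompress : recompress.tame = true := rfl

theorem exists_program : ∃ P : Prog, ∀ c : ℕ, ∃ K : ℕ, ∀ w : List ℕ, w ≠ [] →
    (∀ a ∈ w, 1 ≤ a ∧ a ≤ w.length ^ c) →
    ∃ (t : ℕ) (σ : Store) (out : List ℕ) (G : ContextFreeGrammar ℕ),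
      Exec (K * w.length ^ K) P (Store.init w) t σ ∧ t ≤ K * w.length ∧ σ.Outputs out ∧
      Encodes out G ∧ IsOutput w G := by
  refine ⟨recompress, fun c => ?_⟩
  set E := recompress.weight with hE
  set d := recompress.exprTime with hd
  set A := recompress.maxConst + 3 with hA
  -- With `b = A * N ^ c` as a bound for constants and input letters, all stored values stay below
  -- `N ^ c + N + t * b ^ d ≤ D * N ^ e`, and all computed ones below the `d`-th power of this.
  set D := 2 + 127 * E * A ^ d + A with hD
  set e := c + 1 + c * d with he
  -- One constant serves as factor and exponent of the word bound and as factor of the time; each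
  -- summand is needed in one of these roles.
  refine ⟨D ^ d + 1 + e * d + 127 * E, fun w hw hwc => ?_⟩
  obtain ⟨n, hn, τ, hrun, out, G, h₁, h₂, h₃⟩ := spec_recompress w
  set N := w.length with hN
  have hN1 : 1 ≤ N := List.length_pos_iff.2 hw
  have hNc : 1 ≤ N ^ c := Nat.one_le_pow _ _ hN1
  have hANc : A * 1 ≤ A * N ^ c := Nat.mul_le_mul_left A hNc
  obtain ⟨t, ht, hexec⟩ := hrun.exec (b := A * N ^ c) (d := d) (m := N ^ c)
    (W := (D ^ d + 1 + e * d + 127 * E) * N ^ (D ^ d + 1 + e * d + 127 * E)) (by omega)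
    (Nat.le_mul_of_pos_left _ (by omega)) (by omega) tame_recompress le_rfl
  have ht' : t ≤ 127 * E * N := by
    calc t ≤ E * (n + 1) := ht
      _ ≤ E * (127 * N) := Nat.mul_le_mul_left _ (by omega)
      _ = 127 * E * N := by ring
  have hcell : ∀ i, w.getD i 0 ≤ N ^ c := by
    intro i
    rw [List.getD_eq_getElem?_getD]
    rcases lt_or_ge i w.length with hi | hi
    · rw [List.getElem?_eq_getElem hi]
      exact (hwc _ (List.getElem_mem hi)).2
    · simp [List.getElem?_eq_none hi]
  have hpow : ∀ {i}, i ≤ e → N ^ i ≤ N ^ e := fun h => Nat.pow_le_pow_right hN1 h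
  have hbound : (Store.init w).Bounded (N ^ c) (N ^ c + N) := by
    refine ⟨fun x => ?_, fun B i => ?_, fun i => ?_⟩
    · simp only [Store.init]
      split_ifs <;> omega
    · simp only [Store.init]
      have := hcell i
      split_ifs <;> omega
    · simpa [Store.init] using hcell i
  have h₄ : N ^ c + N + t * (A * N ^ c) ^ d ≤ D * N ^ e := by
    have e₁ : t * (A * N ^ c) ^ d ≤ 127 * E * A ^ d * N ^ e := by
      calc t * (A * N ^ c) ^ d ≤ 127 * E * N * (A * N ^ c) ^ d := Nat.mul_le_mul_right _ ht'
        _ = 127 * E * A ^ d * N ^ (1 + c * d) := by rw [mul_pow, pow_add, pow_mul]; ring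
        _ ≤ 127 * E * A ^ d * N ^ e := Nat.mul_le_mul_left _ (hpow (by omega))
    have e₂ := hpow (i := c) (by omega)
    have e₃ := hpow (i := 1) (by omega)
    rw [pow_one] at e₃
    have e₄ : D * N ^ e = 2 * N ^ e + 127 * E * A ^ d * N ^ e + A * N ^ e := by rw [hD]; ring
    omega
  have h₅ : A * N ^ c ≤ D * N ^ e := Nat.mul_le_mul (by omega) (hpow (by omega))
  have h₆ : (D * N ^ e) ^ d <
      (D ^ d + 1 + e * d + 127 * E) * N ^ (D ^ d + 1 + e * d + 127 * E) := by
    rw [mul_pow, ← pow_mul]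
    have e₁ : N ^ (e * d) ≤ N ^ (D ^ d + 1 + e * d + 127 * E) :=
      Nat.pow_le_pow_right hN1 (by omega)
    have e₂ : 1 ≤ N ^ (e * d) := Nat.one_le_pow _ _ hN1
    calc D ^ d * N ^ (e * d) < (D ^ d + 1) * N ^ (e * d) := Nat.mul_lt_mul_of_pos_right (by omega) e₂
      _ ≤ _ := Nat.mul_le_mul (by omega) e₁
  exact ⟨t, τ, out, G, (hexec _ _ hbound h₅ h₄ h₆).1,
    ht'.trans (Nat.mul_le_mul_right _ (by omega)), h₁, h₂, h₃⟩

end Recompression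

theorem mainTheorem1 :
    (∃ C : ℝ, ∀ (α : Type) [DecidableEq α] (w : List α), w ≠ [] →
      (∃ G, Recompression.IsOutput w G) ∧
      ∀ G, Recompression.IsOutput w G →
        G.language = {w} ∧
        (G.size : ℝ) ≤ C * ((smallestGrammarSize w : ℝ) + (smallestGrammarSize w : ℝ) *
          Real.logb 2 ((w.length : ℝ) / (smallestGrammarSize w : ℝ)))) ∧
    (∃ P : WordRAM.Prog, ∀ c : ℕ, ∃ K : ℕ, ∀ w : List ℕ, w ≠ [] →
      (∀ a ∈ w, 1 ≤ a ∧ a ≤ w.length ^ c) →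
      ∃ (t : ℕ) (σ : WordRAM.Store) (out : List ℕ) (G : ContextFreeGrammar ℕ),
        WordRAM.Exec (K * w.length ^ K) P (WordRAM.Store.init w) t σ ∧
        t ≤ K * w.length ∧
        σ.Outputs out ∧
        WordRAM.Encodes out G ∧
        Recompression.IsOutput w G) := by
  exact ⟨⟨4000, fun α _ w hw => ⟨Recompression.exists_isOutput w, fun G hG =>
    ⟨hG.language_eq, hG.size_le hw⟩⟩⟩, Recompression.exists_program⟩
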